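/- Let $d\ge 0$ and let $V_0$ be a finite-dimensional $\mathbb Z$-graded complex vector space with a nondegenerate, graded skew-symmetric pairing $(-,-)$ such that $(v,w)\neq 0$ only if $|v|+|w|=1-d$. Consider on $\mathbb C^d$ the fields $\mathcal E_V=\Omega^{0,*}(\mathbb C^d)\otimes V_0$ with differential $\bar\partial$ (that is, $Q^{hol}=0$) and the $(-1)$-shifted symplectic pairing $\int d^dz\,(-\wedge -)$. Let $\mathcal O_{loc}(\mathcal E_V)$ be the space of local functionals: Lagrangian densities with smooth coefficients that are formal power series without constant term in the jets of the fields (polydifferential in each polynomial degree), modulo total derivatives, with its BV bracket $\{-,-\}$. Let the abelian dg Lie algebra $\mathbb C^{2d|d}$ be spanned by the translations $\partial_{z_i},\partial_{\bar z_i}$ and by the contractions $\bar\eta_i=\iota_{\partial_{\bar z_i}}$ in degree $-1$, with $\bar\eta_i\mapsto\partial_{\bar z_i}$. Let $I\in\mathcal O_{loc}(\mathcal E_V)$ be a holomorphically translation invariant interaction: it has degree $0$, is at least cubic, is annihilated by $\partial_{z_i},\partial_{\bar z_i},\bar\eta_i$ for all $i$, and satisfies $\bar\partial I+\tfrac12\{I,I\}=0$.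 Let $\mathrm{Def}=(\mathcal O_{loc}(\mathcal E_V),\bar\partial+\{I,-\})$ be the deformation complex and $\mathrm{Def}^{\mathbb C^{2d|d}}$ its subcomplex of elements annihilated by $\mathbb C^{2d|d}$. Let $\mathcal O_{red}(V_0[[z]])=\prod_{n\ge1}\mathrm{Sym}^n(V_0[[z_1,\dots,z_d]]^\vee)$ (continuous dual), with the action of $\mathbb C[\partial_{z_1},\dots,\partial_{z_d}]$ induced from $V_0[[z]]$, and let $\mathbb C\cdot d^dz$ be the trivial module. Then $I$ has a holomorphic part $I^{hol}\in\mathbb C\cdot d^dz\otimes_{\mathbb C[\partial_z]}\mathcal O_{red}(V_0[[z]])$, which depends on holomorphic derivatives only. It is at least cubic, has degree $d$ and satisfies $\{I^{hol},I^{hol}\}^{hol}=0$ for the bracket defined by $(-,-)$. If $I=\int J^{\Omega^{0,*}}$ is the extension of a translation invariant holomorphic Lagrangian $J$ to Dolbeault forms, then $I^{hol}$ is the class of $J$. The operator $\{I^{hol},-\}$ is a square-zero derivation of $\mathcal O_{red}(V_0[[z]])$ of degree $1$ which commutes with the $\partial_{z_i}$, and there is a quasi-isomorphism $$\mathrm{Def}^{\mathbb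 C^{2d|d}}\;\simeq\;\Big(\mathbb C\cdot d^dz\otimes^{\mathbb L}_{\mathbb C[\partial_{z_1},\dots,\partial_{z_d}]}\mathcal O_{red}(V_0[[z_1,\dots,z_d]])[d],\ \{I^{hol},-\}\Big).$$ More precisely, taking the holomorphic part induces a quasi-isomorphism from $\mathrm{Def}^{\mathbb C^{2d|d}}$ to the underived tensor product shifted by $d$, and the natural map from the derived tensor product (computed by the Koszul resolution of $\mathbb C\cdot d^dz$) to the underived one is a quasi-isomorphism. Equivalently, $\{I^{hol},-\}$ is the Chevalley–Eilenberg differential of an $L_\infty$-structure on $V_0[[z]][-1]$ in $\mathbb C[\partial_z]$-modules, and $$\mathrm{Def}^{\mathbb C^{2d|d}}\simeq \mathbb C\cdot d^dz\otimes^{\mathbb L}_{\mathbb C[\partial_z]}C^*_{red}\big(V_0[[z]][-1]\big)[d].$$ -/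

import Mathlib

open scoped ContDiff
open CategoryTheory

noncomputable section

namespace HolBV

/-! ### Subquotient cochain complexes

A graded subspace `C k` of a vector space `M`, a subspace `N` of relations and an endomorphism
`D` of degree one present the cochain complex `k ↦ C k / (C k ∩ N)`. -/

/-- `D` induces a square-zero differential of degree one on `k ↦ C k / (C k ∩ N)`. -/
structure IsSubqComplex {M : Type} [AddCommGroup M] [Module ℂ M]
    (C : ℤ → Submodule ℂ M) (N : Submodule ℂ M) (D : M →ₗ[ℂ] M) : Prop where
  map_deg : ∀ k, ∀ x ∈ C k, D x ∈ C (k + 1)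
  map_rel : ∀ k, ∀ x ∈ C k, x ∈ N → D x ∈ N
  sq : ∀ k, ∀ x ∈ C k, D (D x) ∈ N

/-- The degree `k` part `C k / (C k ∩ N)`. -/
abbrev Subq {M : Type} [AddCommGroup M] [Module ℂ M]
    (C : ℤ → Submodule ℂ M) (N : Submodule ℂ M) (k : ℤ) : Type :=
  C k ⧸ N.submoduleOf (C k)

/-- The map induced on subquotients by a linear map. -/
def subqMap {M M' : Type} [AddCommGroup M] [Module ℂ M] [AddCommGroup M'] [Module ℂ M']
    {C : ℤ → Submodule ℂ M} {N : Submodule ℂ M} {C' : ℤ → Submodule ℂ M'} {N' : Submodule ℂ M'}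
    (φ : M →ₗ[ℂ] M') (i j : ℤ) (hC : ∀ x ∈ C i, φ x ∈ C' j)
    (hN : ∀ x ∈ C i, x ∈ N → φ x ∈ N') : Subq C N i →ₗ[ℂ] Subq C' N' j :=
  Submodule.mapQ _ _ (φ.restrict hC) (fun x hx => hN x.1 x.2 hx)

/-- The cochain complex presented by `(C, N, D)`. -/
def subqComplex {M : Type} [AddCommGroup M] [Module ℂ M]
    {C : ℤ → Submodule ℂ M} {N : Submodule ℂ M} {D : M →ₗ[ℂ] M}
    (h : IsSubqComplex C N D) : CochainComplex (ModuleCat.{0} ℂ) ℤ where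
  X k := ModuleCat.of ℂ (Subq C N k)
  d i j := if hij : i + 1 = j then
      ModuleCat.ofHom (subqMap D i j (fun x hx => hij ▸ h.map_deg i x hx) (h.map_rel i))
    else 0
  shape i j hij := dif_neg hij
  d_comp_d' i j k hij hjk := by
    change i + 1 = j at hij
    change j + 1 = k at hjk
    rw [dif_pos hij, dif_pos hjk]
    ext x
    exact (Submodule.Quotient.mk_eq_zero _).2 (h.sq i x.1 x.2)

/-- `φ` induces a cochain map of degree zero from the complex `(C, N, D)` to the `n`-fold shift
of the complex `(C', N', D')`, whose differential is `(-1)^n D'`. -/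
structure IsSubqMap {M M' : Type} [AddCommGroup M] [Module ℂ M] [AddCommGroup M'] [Module ℂ M']
    (C : ℤ → Submodule ℂ M) (N : Submodule ℂ M) (D : M →ₗ[ℂ] M)
    (C' : ℤ → Submodule ℂ M') (N' : Submodule ℂ M') (D' : M' →ₗ[ℂ] M')
    (n : ℤ) (φ : M →ₗ[ℂ] M') : Prop where
  map_deg : ∀ k, ∀ x ∈ C k, φ x ∈ C' (k + n)
  map_rel : ∀ k, ∀ x ∈ C k, x ∈ N → φ x ∈ N'
  comm : ∀ k, ∀ x ∈ C k, φ (D x) - n.negOnePow • D' (φ x) ∈ N'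

/-- The cochain map induced by `φ`, with values in the shifted complex. -/
def subqHom {M M' : Type} [AddCommGroup M] [Module ℂ M] [AddCommGroup M'] [Module ℂ M']
    {C : ℤ → Submodule ℂ M} {N : Submodule ℂ M} {D : M →ₗ[ℂ] M}
    {C' : ℤ → Submodule ℂ M'} {N' : Submodule ℂ M'} {D' : M' →ₗ[ℂ] M'}
    {n : ℤ} {φ : M →ₗ[ℂ] M'}
    (h : IsSubqComplex C N D) (h' : IsSubqComplex C' N' D')
    (hφ : IsSubqMap C N D C' N' D' n φ) :
    subqComplex h ⟶ (subqComplex h')⟦n⟧ where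
  f k := ModuleCat.ofHom (Y := Subq C' N' (k + n))
    (subqMap φ k (k + n) (hφ.map_deg k) (hφ.map_rel k))
  comm' i j hij := by
    change i + 1 = j at hij
    subst hij
    have hij' : i + n + 1 = i + 1 + n := by ring
    have e1 : (subqComplex h).d i (i + 1) = ModuleCat.ofHom (subqMap D i (i + 1)
        (fun x hx => h.map_deg i x hx) (h.map_rel i)) := dif_pos rfl
    have e2 : ((subqComplex h')⟦n⟧).d i (i + 1) = n.negOnePow • ModuleCat.ofHom
        (subqMap D' (i + n) (i + 1 + n) (fun x hx => hij' ▸ h'.map_deg (i + n) x hx)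
          (h'.map_rel (i + n))) := by
      rw [CochainComplex.shiftFunctor_obj_d']
      congr 1
      exact dif_pos hij'
    rw [e1, e2]
    ext x
    obtain ⟨x, rfl⟩ := Submodule.Quotient.mk_surjective (N.submoduleOf (C i)) x
    exact ((Submodule.Quotient.eq (N'.submoduleOf (C' (i + 1 + n)))
      (x := ⟨φ (D x.1), hφ.map_deg (i + 1) _ (h.map_deg i x.1 x.2)⟩)
      (y := n.negOnePow • ⟨D' (φ x.1), hij' ▸ h'.map_deg (i + n) _ (hφ.map_deg i x.1 x.2)⟩)).2
      (hφ.comm i x.1 x.2)).symm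

/-- The cochain map induced by `φ` in the case of no shift. -/
def subqHomZero {M M' : Type} [AddCommGroup M] [Module ℂ M] [AddCommGroup M'] [Module ℂ M']
    {C : ℤ → Submodule ℂ M} {N : Submodule ℂ M} {D : M →ₗ[ℂ] M}
    {C' : ℤ → Submodule ℂ M'} {N' : Submodule ℂ M'} {D' : M' →ₗ[ℂ] M'} {φ : M →ₗ[ℂ] M'}
    (h : IsSubqComplex C N D) (h' : IsSubqComplex C' N' D')
    (hφ : IsSubqMap C N D C' N' D' 0 φ) : subqComplex h ⟶ subqComplex h' :=
  subqHom h h' hφ ≫ (shiftFunctorZero (CochainComplex (ModuleCat.{0} ℂ) ℤ) ℤ).hom.app _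

/-! ### Polynomial Lagrangians in jet variables

`ι` indexes the directions of differentiation (with commuting derivations `δ i` on the ring `R` of
coefficients) and `A` the components of the fields; `deg a` is the cohomological degree of the
component `a`. The pair `(a, K)` stands for the jet coordinate
`u^a_K : φ ↦ ∂^K φ^a`, a linear functional of degree `-deg a`, and a list of such pairs for the
product of the corresponding functionals. -/

/-- Polynomials in (not yet commuting) jet coordinates with coefficients in `R`; the part of word
length `n` consists of the multilinear `n`-ary polydifferential operators with values in `R`. -/
abbrev JetPoly (R ι A : Type) [CommRing R] : Type := List (A × (ι →₀ ℕ)) →₀ R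

/-- Formal series: the `n`-th entry is the part of polynomial degree `n`. -/
abbrev JetSeries (R ι A : Type) [CommRing R] : Type := ℕ → JetPoly R ι A

/-- Sum of the degrees of the field components in a word: the product of the jet coordinates in
the word has cohomological degree `-wordDeg`. -/
def wordDeg {ι A : Type} (deg : A → ℤ) (w : List (A × (ι →₀ ℕ))) : ℤ :=
  (w.map fun j => deg j.1).sum

/-- Reduced Lagrangians of cohomological degree `k`: no constant term, and the `n`-th entry is a
polynomial of degree `n` in the jet coordinates. -/
def lagrangians (R : Type) {ι A : Type} [CommRing R] [Algebra ℂ R] (deg : A → ℤ) (k : ℤ) :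
    Submodule ℂ (JetSeries R ι A) where
  carrier := {F | F 0 = 0 ∧ ∀ n w, F n w ≠ 0 → w.length = n ∧ wordDeg deg w = -k}
  zero_mem' := ⟨rfl, fun n w h => absurd rfl h⟩
  add_mem' := by
    rintro F G ⟨hF, hF'⟩ ⟨hG, hG'⟩
    refine ⟨by simp [hF, hG], fun n w h => ?_⟩
    by_cases h1 : F n w = 0
    · by_cases h2 : G n w = 0
      · exact absurd (by simp [h1, h2]) h
      · exact hG' n w h2
    · exact hF' n w h1
  smul_mem' := by
    rintro c F ⟨hF, hF'⟩
    refine ⟨by simp [hF], fun n w h => hF' n w fun h1 => h (by simp [h1])⟩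

/-- The Koszul relations `u x y v = (-1)^{|x||y|} u y x v`; dividing by them is taking
coinvariants for the symmetric groups. -/
def koszulRel (R : Type) {ι A : Type} [CommRing R] [Algebra ℂ R] (deg : A → ℤ) :
    Submodule ℂ (JetPoly R ι A) :=
  Submodule.span ℂ {X | ∃ (u v : List (A × (ι →₀ ℕ))) (x y : A × (ι →₀ ℕ)) (r : R),
    X = Finsupp.single (u ++ x :: y :: v) r
      - ((-1 : ℂ) ^ (deg x.1 * deg y.1)) • Finsupp.single (u ++ y :: x :: v) r}

/-- The derivation `r u^{a₁}_{K₁} ⋯ u^{aₙ}_{Kₙ} ↦ ∑ₖ r ⋯ u^{aₖ}_{Kₖ + eᵢ} ⋯`: the action on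
functionals induced by the operator `φ ↦ ∂ᵢ φ` on fields. -/
def fieldD (R : Type) {ι A : Type} [CommRing R] [Algebra ℂ R] (i : ι) :
    JetPoly R ι A →ₗ[ℂ] JetPoly R ι A :=
  Finsupp.lsum ℂ fun w => ∑ k : Fin w.length,
    Finsupp.lsingle (w.set k ((w.get k).1, (w.get k).2 + Finsupp.single i 1))

/-- The total derivative `Dᵢ`, i.e. the action of `∂ᵢ` on Lagrangians. -/
def totalD {R ι A : Type} [CommRing R] [Algebra ℂ R] (δ : ι → R →ₗ[ℂ] R) (i : ι) :
    JetPoly R ι A →ₗ[ℂ] JetPoly R ι A :=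
  Finsupp.mapRange.linearMap (δ i) + fieldD R i

/-- The iterated total derivative `D^K` (the `Dᵢ` commute). -/
def totalDPow {R ι A : Type} [CommRing R] [Algebra ℂ R] [Fintype ι] (δ : ι → R →ₗ[ℂ] R)
    (K : ι →₀ ℕ) : Module.End ℂ (JetPoly R ι A) :=
  ((Finset.univ : Finset ι).toList.map fun i => (totalD δ i : Module.End ℂ _) ^ K i).prod

/-- Koszul relations in each polynomial degree: `JetSeries` modulo these (without constant term)
is the space `O_red` of functions on jets. -/
def symRel (R ι : Type) {A : Type} [CommRing R] [Algebra ℂ R] (deg : A → ℤ) :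
    Submodule ℂ (JetSeries R ι A) :=
  Submodule.pi Set.univ fun _ => koszulRel R deg

/-- Koszul relations and total derivatives: Lagrangians modulo these are local functionals. -/
def locRel {R ι A : Type} [CommRing R] [Algebra ℂ R] (δ : ι → R →ₗ[ℂ] R) (deg : A → ℤ) :
    Submodule ℂ (JetSeries R ι A) :=
  Submodule.pi Set.univ fun _ => koszulRel R deg ⊔ ⨆ i, LinearMap.range (totalD δ i)

/-- The (left) variational derivative `∑_K (-1)^{|K|} D^K ∂/∂u^a_K`. -/
def euler {R ι A : Type} [CommRing R] [Algebra ℂ R] [Fintype ι] [DecidableEq A]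
    (δ : ι → R →ₗ[ℂ] R) (deg : A → ℤ) (a : A) : JetPoly R ι A →ₗ[ℂ] JetPoly R ι A :=
  Finsupp.lsum ℂ fun w => ∑ k : Fin w.length,
    if (w.get k).1 = a then
      ((-1 : ℂ) ^ (deg a * wordDeg deg (w.take k)) * (-1) ^ ((w.get k).2.sum fun _ e => e)) •
        (totalDPow δ (w.get k).2 ∘ₗ Finsupp.lsingle (w.eraseIdx k))
    else 0

/-- The `R`-linear odd graded derivation which takes the jet coordinate `j` to `q j`. -/
def oddDer {R ι A : Type} [CommRing R] [Algebra ℂ R] (deg : A → ℤ)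
    (q : A × (ι →₀ ℕ) → JetPoly R ι A) : JetPoly R ι A →ₗ[ℂ] JetPoly R ι A :=
  Finsupp.lsum ℂ fun w => ∑ k : Fin w.length,
    ((-1 : ℂ) ^ wordDeg deg (w.take k)) •
      (LinearMap.toSpanSingleton R (JetPoly R ι A)
        ((q (w.get k)).mapDomain fun v => w.take k ++ v ++ w.drop (k + 1))).restrictScalars ℂ

/-- The reduced Chevalley–Eilenberg differential with dual brackets `q`: the odd derivation of
the completed symmetric algebra which takes a generator `j` to `∑ₘ q m j`, where `q m` is dual to
the `m`-ary bracket. -/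
def ceDiff {R ι A : Type} [CommRing R] [Algebra ℂ R] (deg : A → ℤ)
    (q : ℕ → A × (ι →₀ ℕ) → JetPoly R ι A) : JetSeries R ι A →ₗ[ℂ] JetSeries R ι A :=
  LinearMap.pi fun n => ∑ p ∈ Finset.HasAntidiagonal.antidiagonal (n + 1),
    oddDer deg (q p.1) ∘ₗ LinearMap.proj p.2

/-- The continuous brackets dual to `q` form an `L_∞`-structure on the space `L = J[-1]`, where
`J` is the pro-finite-dimensional space of jets with coordinates `u^a_K`: `q m` has polynomial
degree `m ≥ 1`, raises the cohomological degree by one, and the resulting derivation of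
`O_red(L[1])` squares to zero. -/
structure IsLInfinity {ι A : Type} (deg : A → ℤ) (q : ℕ → A × (ι →₀ ℕ) → JetPoly ℂ ι A) :
    Prop where
  zero : q 0 = 0
  homogeneous : ∀ m j w, q m j w ≠ 0 → w.length = m ∧ wordDeg deg w = deg j.1 - 1
  sq : ∀ k, ∀ F ∈ lagrangians ℂ deg k, ceDiff deg q (ceDiff deg q F) ∈ symRel ℂ ι deg

/-- Components of the Hamiltonian vector field `{I, -}` of a Lagrangian `I`:
`{I, u^a_K} = D^K ((-1)^{|a|} ∑_b π^{ab} δI/δu^b)`, where `π` is the inverse of the matrix of the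
pairing. The part `I (m + 1)` contributes the terms of polynomial degree `m`. -/
def hamiltonian {R ι A : Type} [CommRing R] [Algebra ℂ R] [Fintype ι] [Fintype A] [DecidableEq A]
    (δ : ι → R →ₗ[ℂ] R) (deg : A → ℤ) (π : Matrix A A ℂ) (I : JetSeries R ι A) (m : ℕ)
    (j : A × (ι →₀ ℕ)) : JetPoly R ι A :=
  totalDPow δ j.2 (∑ b, ((-1 : ℂ) ^ deg j.1 * π j.1 b) • euler δ deg b (I (m + 1)))

/-- The operator `{I, -}` on Lagrangians (for `I` such that it is odd): the derivation commuting
with total derivatives with components `hamiltonian`. -/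
def bracket {R ι A : Type} [CommRing R] [Algebra ℂ R] [Fintype ι] [Fintype A] [DecidableEq A]
    (δ : ι → R →ₗ[ℂ] R) (deg : A → ℤ) (π : Matrix A A ℂ) (I : JetSeries R ι A) :
    JetSeries R ι A →ₗ[ℂ] JetSeries R ι A :=
  ceDiff deg (hamiltonian δ deg π I)

/-! ### Smooth functions on `ℂ^d` -/

/-- The algebra of smooth complex-valued functions on `ℂ^d = ℝ^{2d}`. -/
def smoothFun (d : ℕ) : Subalgebra ℂ ((Fin d → ℂ) → ℂ) where
  carrier := {f | ContDiff ℝ ∞ f}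
  mul_mem' {f g} (hf : ContDiff ℝ ∞ f) (hg : ContDiff ℝ ∞ g) := ContDiff.mul hf hg
  add_mem' {f g} (hf : ContDiff ℝ ∞ f) (hg : ContDiff ℝ ∞ g) := ContDiff.add hf hg
  algebraMap_mem' c := (contDiff_const : ContDiff ℝ ∞ fun _ : Fin d → ℂ => c)

theorem smoothFun_contDiff {d : ℕ} (f : smoothFun d) : ContDiff ℝ ∞ f.1 := f.2

/-- `½ (∂/∂xᵢ + c ∂/∂yᵢ)` on smooth functions. -/
def wirtinger {d : ℕ} (c : ℂ) (i : Fin d) : smoothFun d →ₗ[ℂ] smoothFun d where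
  toFun f := ⟨fun x => (1 / 2) * (fderiv ℝ f.1 x (Pi.single i 1)
      + c * fderiv ℝ f.1 x (Pi.single i Complex.I)), by
    have h (v : Fin d → ℂ) : ContDiff ℝ ∞ fun x => fderiv ℝ f.1 x v :=
      ((smoothFun_contDiff f).fderiv_right (m := ∞) (by simp)).clm_apply contDiff_const
    exact contDiff_const.mul ((h _).add (contDiff_const.mul (h _)))⟩
  map_add' f g := by
    have hf (x) : DifferentiableAt ℝ f.1 x := (smoothFun_contDiff f).differentiable (by simp) x
    have hg (x) : DifferentiableAt ℝ g.1 x := (smoothFun_contDiff g).differentiable (by simp) x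
    refine Subtype.ext (funext fun x => ?_)
    have : fderiv ℝ (f.1 + g.1) x = fderiv ℝ f.1 x + fderiv ℝ g.1 x := fderiv_add (hf x) (hg x)
    simp [this]
    ring
  map_smul' a f := by
    have hf (x) : DifferentiableAt ℝ f.1 x := (smoothFun_contDiff f).differentiable (by simp) x
    refine Subtype.ext (funext fun x => ?_)
    have : fderiv ℝ (a • f.1) x = a • fderiv ℝ f.1 x := fderiv_const_smul (hf x) a
    simp [this]
    ring

/-- `∂/∂zᵢ` (left summand) and `∂/∂z̄ᵢ` (right summand) on smooth functions. -/
def coefD (d : ℕ) : Fin d ⊕ Fin d → smoothFun d →ₗ[ℂ] smoothFun d :=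
  Sum.elim (wirtinger (-Complex.I)) (wirtinger Complex.I)

/-! ### Free theories with `Q^hol = 0` -/

/-- The data of a translation-invariant pairing `V ⊗ V → K[d - 1]` on the graded bundle
`V = ℂ^d × V₀`: a graded vector space `V₀` with homogeneous basis `e`, where `e b` has degree
`deg b`, and a pairing `(v, w)_V = pairing v w · d^d z` of degree `d - 1`, graded
skew-symmetric and nondegenerate. -/
structure FreeTheory (d : ℕ) (V₀ : Type*) [AddCommGroup V₀] [Module ℂ V₀] (B : Type) where
  e : Module.Basis B ℂ V₀
  deg : B → ℤ
  pairing : LinearMap.BilinForm ℂ V₀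
  pairing_deg : ∀ b c, pairing (e b) (e c) ≠ 0 → deg b + deg c = 1 - d
  pairing_skew : ∀ b c, pairing (e b) (e c) = -((-1) ^ (deg b * deg c) * pairing (e c) (e b))
  nondegenerate : pairing.Nondegenerate

/-- Koszul sign: `d z̄_S ∧ d z̄_T = wedgeSign S T • d z̄_{S ∪ T}` for disjoint `S`, `T`, where
`d z̄_S` is the wedge product in increasing order. -/
def wedgeSign {d : ℕ} (S T : Finset (Fin d)) : ℂ :=
  (-1) ^ ((S ×ˢ T).filter fun p => p.2 < p.1).card

section Theory

variable {d : ℕ} {V₀ : Type*} [AddCommGroup V₀] [Module ℂ V₀] {B : Type}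
  (𝓥 : FreeTheory d V₀ B)

/-- Lagrangians on the fields `Ω^{0,*}(ℂ^d) ⊗ V₀`: the component `(S, b)` of a field is the
coefficient of `d z̄_S ⊗ e b`, the directions are `∂/∂zᵢ`, `∂/∂z̄ᵢ`, the coefficients are smooth,
and densities are written as multiples of `d^d z d^d z̄`. -/
abbrev BVLag (d : ℕ) (B : Type) : Type :=
  JetSeries (smoothFun d) (Fin d ⊕ Fin d) (Finset (Fin d) × B)

/-- Functions on `V₀[[z₁, …, z_d]]`: the variable `(b, K)` is the linear functional
`∑_b f_b e_b ↦ (∂^K f_b)(0)`. -/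
abbrev HolLag (d : ℕ) (B : Type) : Type := JetSeries ℂ (Fin d) B

namespace FreeTheory

/-- Degree of `d z̄_S ⊗ e b`. -/
def fieldDeg (a : Finset (Fin d) × B) : ℤ := a.1.card + 𝓥.deg a.2

/-- Matrix of the pairing on `Λ(d z̄) ⊗ V₀` which takes
`(d z̄_S ⊗ e b, d z̄_T ⊗ e c)` to the coefficient of `d z̄₁ ⋯ d z̄_d` in
`(-1)^{|b||T|} d z̄_S ∧ d z̄_T (e b, e c)`: the integrand of the symplectic pairing on fields. -/
def fieldPairing : Matrix (Finset (Fin d) × B) (Finset (Fin d) × B) ℂ := fun a c =>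
  if c.1 = a.1ᶜ then
    (-1) ^ (𝓥.deg a.2 * c.1.card) * wedgeSign a.1 c.1 * 𝓥.pairing (𝓥.e a.2) (𝓥.e c.2)
  else 0

/-- Matrix of the pairing on `V₀`. -/
def fibrePairing : Matrix B B ℂ := fun b c => 𝓥.pairing (𝓥.e b) (𝓥.e c)

/-- Translations acting on functionals, through `φ ↦ ∂φ/∂zᵢ` and `φ ↦ ∂φ/∂z̄ᵢ`. -/
def transl (d : ℕ) (B : Type) (i : Fin d ⊕ Fin d) : BVLag d B →ₗ[ℂ] BVLag d B :=
  (fieldD (smoothFun d) i).compLeft ℕ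

/-- The derivation induced by the contraction `η̄ᵢ` with `∂/∂z̄ᵢ` on fields. -/
def contract (i : Fin d) : BVLag d B →ₗ[ℂ] BVLag d B :=
  (oddDer 𝓥.fieldDeg fun j => if i ∈ j.1.1 then 0 else
    Finsupp.single [((insert i j.1.1, j.1.2), j.2)] (algebraMap ℂ (smoothFun d)
      (wedgeSign {i} j.1.1))).compLeft ℕ

/-- The derivation induced by the Dolbeault operator `∂̄` on fields. -/
def dbar : BVLag d B →ₗ[ℂ] BVLag d B :=
  (oddDer 𝓥.fieldDeg fun j => ∑ i ∈ j.1.1,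
    Finsupp.single [((j.1.1.erase i, j.1.2), j.2 + Finsupp.single (Sum.inr i) 1)]
      (algebraMap ℂ (smoothFun d) (wedgeSign {i} (j.1.1.erase i)))).compLeft ℕ

/-- Relations of local functionals `O_loc(E_V)` on `ℂ^d`: local functionals of degree `k` are
`lagrangians k` modulo these. -/
def bvRel : Submodule ℂ (BVLag d B) := locRel (coefD d) 𝓥.fieldDeg

/-- Lagrangians of degree `k` whose class in `O_loc(E_V)` is invariant under `ℂ^{2d|d}`, i.e.
annihilated by all translations and all contractions `η̄ᵢ`. -/
def invariants (k : ℤ) : Submodule ℂ (BVLag d B) :=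
  lagrangians (smoothFun d) 𝓥.fieldDeg k ⊓
    ((⨅ i, 𝓥.bvRel.comap (transl d B i)) ⊓ ⨅ i, 𝓥.bvRel.comap (𝓥.contract i))

/-- Relations of `ℂ·d^d z ⊗_{ℂ[∂]} O_red(V₀[[z]])`: Koszul relations and the images of the
`∂/∂zᵢ`. -/
def holRel : Submodule ℂ (HolLag d B) := locRel (fun _ => 0) 𝓥.deg

/-- Action of `∂/∂zᵢ` on functions on `V₀[[z]]`. -/
def holD (d : ℕ) (B : Type) (i : Fin d) : HolLag d B →ₗ[ℂ] HolLag d B :=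
  (totalD (fun _ => 0) i).compLeft ℕ

/-- The functional `φ ↦ ∫ d^d z G^{Ω^{0,*}}(φ)` of a holomorphic Lagrangian `G` with constant
coefficients, on words: the value at `T` is the coefficient of `d z̄_T` in the extension to
Dolbeault forms. -/
def dolbeaultExt : List (B × (Fin d →₀ ℕ)) → Finset (Fin d) →
    JetPoly (smoothFun d) (Fin d ⊕ Fin d) (Finset (Fin d) × B)
  | [], T => if T = ∅ then Finsupp.single [] 1 else 0
  | j :: w, T => ∑ S ∈ T.powerset,
      (wedgeSign S (T \ S) * (-1) ^ (𝓥.deg j.1 * (T \ S).card)) •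
        (dolbeaultExt w (T \ S)).mapDomain
          (List.cons ((S, j.1), j.2.mapDomain Sum.inl))

/-- The inclusion `G ↦ ∫ d^d z G^{Ω^{0,*}}`. -/
def inclusion : HolLag d B →ₗ[ℂ] BVLag d B :=
  (Finsupp.lsum ℂ fun w => LinearMap.toSpanSingleton ℂ _
    (𝓥.dolbeaultExt w Finset.univ)).compLeft ℕ

end FreeTheory

/-- Restriction of a jet coordinate to holomorphic jets without `d z̄`-components; `none` if it
vanishes there. -/
def holLetter (j : (Finset (Fin d) × B) × (Fin d ⊕ Fin d →₀ ℕ)) : Option (B × (Fin d →₀ ℕ)) :=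
  if j.1.1 = ∅ ∧ ∀ i, j.2 (Sum.inr i) = 0 then
    some (j.1.2, j.2.comapDomain Sum.inl Sum.inl_injective.injOn)
  else none

/-- Restriction of a polynomial at the origin to the holomorphic jets `V₀[[z]]`. -/
def restrictHol (d : ℕ) (B : Type) :
    JetPoly (smoothFun d) (Fin d ⊕ Fin d) (Finset (Fin d) × B) →ₗ[ℂ] JetPoly ℂ (Fin d) B :=
  Finsupp.lsum ℂ fun w => (w.mapM holLetter).elim 0 fun v =>
    Finsupp.lsingle v ∘ₗ LinearMap.proj (0 : Fin d → ℂ) ∘ₗ (smoothFun d).val.toLinearMap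

namespace FreeTheory

variable [Fintype B] [DecidableEq B]

/-- The holomorphic part of a local functional: in polynomial degree `n` it is
`(1/n) ∑_b u^b · δF/δu^{(top, b)}` restricted to holomorphic jets, `u^{(top, b)}` being the
coefficient of `d z̄₁ ⋯ d z̄_d ⊗ e b`. -/
def holPart : BVLag d B →ₗ[ℂ] HolLag d B :=
  LinearMap.pi fun n => ((n : ℂ)⁻¹ • ∑ b, Finsupp.lmapDomain ℂ ℂ (List.cons (b, 0)) ∘ₗ
    restrictHol d B ∘ₗ euler (coefD d) 𝓥.fieldDeg (Finset.univ, b)) ∘ₗ LinearMap.proj n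

/-- The operator `{I, -}` on Lagrangians of the fields. -/
def bvBracket (I : BVLag d B) : BVLag d B →ₗ[ℂ] BVLag d B :=
  bracket (coefD d) 𝓥.fieldDeg 𝓥.fieldPairing⁻¹ I

/-- The dual brackets on `V₀[[z]][-1]` defined by a holomorphic interaction. -/
def holBrackets (J : HolLag d B) : ℕ → B × (Fin d →₀ ℕ) → JetPoly ℂ (Fin d) B :=
  hamiltonian (fun _ => 0) 𝓥.deg 𝓥.fibrePairing⁻¹ J

/-- The operator `{J, -}` on `O_red(V₀[[z]])`; this is the Chevalley–Eilenberg differential of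
the brackets on `V₀[[z]][-1]`. -/
def holBracket (J : HolLag d B) : HolLag d B →ₗ[ℂ] HolLag d B :=
  ceDiff 𝓥.deg (𝓥.holBrackets J)

/-- Holomorphically translation-invariant interactions: Lagrangians for local functionals of
degree zero, at least cubic, invariant under `ℂ^{2d|d}`, which satisfy the classical master
equation `∂̄I + ½{I, I} = 0` in `O_loc(E_V)`. -/
structure Interaction where
  I : BVLag d B
  invariant : I ∈ 𝓥.invariants 0
  cubic : ∀ n < 3, I n = 0
  master : 𝓥.dbar I + (1 / 2 : ℂ) • 𝓥.bvBracket I I ∈ 𝓥.bvRel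

/-- The differential `∂̄ + {I, -}` of the deformation complex. -/
def defDiff (I : BVLag d B) : BVLag d B →ₗ[ℂ] BVLag d B := 𝓥.dbar + 𝓥.bvBracket I

/-! ### The derived tensor product

`ℂ·d^d z ⊗^L_{ℂ[∂]} O_red(V₀[[z]])` is computed with the Koszul resolution of the trivial module
`ℂ·d^d z` over `ℂ[∂₁, …, ∂_d]`: an element is a family `G` with `G T` the coefficient of
`ε_T = ε_{i₁} ⋯ ε_{iₚ}`, of degree `-p`. -/

/-- Elements of total degree `k`. -/
def koszulDeg (k : ℤ) : Submodule ℂ (Finset (Fin d) → HolLag d B) :=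
  Submodule.pi Set.univ fun T => lagrangians ℂ 𝓥.deg (k + T.card)

/-- The relations of `O_red(V₀[[z]])` in each coefficient. -/
def koszulComplexRel : Submodule ℂ (Finset (Fin d) → HolLag d B) :=
  Submodule.pi Set.univ fun _ => symRel ℂ (Fin d) 𝓥.deg

/-- The total differential
`ε_T G ↦ ∑_{i ∈ T} ± ε_{T \ i} ∂ᵢ G + (-1)^{|T|} ε_T {J, G}`. -/
def koszulDiff (J : HolLag d B) :
    (Finset (Fin d) → HolLag d B) →ₗ[ℂ] (Finset (Fin d) → HolLag d B) :=
  LinearMap.pi fun T =>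
    (∑ i ∈ Tᶜ, wedgeSign {i} T • (holD d B i ∘ₗ LinearMap.proj (insert i T)))
      + (-1 : ℂ) ^ T.card • (𝓥.holBracket J ∘ₗ LinearMap.proj T)

/-- The augmentation to the underived tensor product. -/
def augmentation (d : ℕ) (B : Type) : (Finset (Fin d) → HolLag d B) →ₗ[ℂ] HolLag d B :=
  LinearMap.proj ∅

end FreeTheory

end Theory

end HolBV

end

/-! All three differentials are perturbations of simple ones. As `I` is at least cubic, `{I, -}` and
`{I^hol, -}` strictly raise the polynomial degree; modulo higher degree the differentials become
`∂̄`, zero and the Koszul differential. A solution for the leading terms is corrected degree by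
degree, and the corrections converge in the product over all degrees (`exists_of_leading`). So it
suffices to work in a single degree `n > 0`, where `n` is invertible.

Variational calculus: polynomials are words in jet coordinates modulo Koszul relations. The first
variation formula (`der_congr_euler`) gives Euler's identity `n x ≡ ∑ u^b δx/δu^b`, so an element
with vanishing variational derivatives is a total derivative (`mem_locSub_of_euler`). Translation
invariance makes the variational derivatives constant in the coefficients, and Euler's identity then
yields a representative with constant coefficients (`exists_cMap_of_fieldD`). The variational
derivative of `{I, I}` (`euler_hamiltonian`) shows that half the commutator of `{I, -}` with itself
is, up to signs, the Hamiltonian derivation of `½{I, I}`; the master equation therefore gives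
square-zero differentials.

Dolbeault part: contraction `η_i` and multiplication by `d z̄_i` anticommute to `n`, so a functional
annihilated by all `η_i` equals `η_1 ⋯ η_d y` modulo total derivatives (`exists_eq_etaL`).
Contraction with the antiholomorphic Euler field is a homotopy for `∂̄` whose anticommutator is a
weight. It commutes with `∂/∂z̄_i` only up to `η_i`, and this defect dies under `η_1 ⋯ η_d`; hence,
up to a `∂̄`-exact term, `y` may be replaced by its restriction to holomorphic jets
(`exists_etaL_eq`). Conversely, the variational derivative of `η_1 ⋯ η_d y` in the top component
restricts to that of the restriction of `y`, up to sign (`projHol_euler_etaL`). So the holomorphic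
part recovers the restriction of `y` (`holPartC_etaL`), kills `∂̄`, and intertwines the brackets
with the sign `(-1)^d` of the shift (`holSeries_ceDiff_defQ`).

Koszul part: the operator `L_i` on functions dual to multiplication by `z_i` satisfies `[L_i, ∂_i] =
n` in degree `n` and is locally nilpotent. An alternating series in `∂_i^k L_i^(k+1)` is then a left
inverse of `∂_i` commuting with the other `∂_j`, which makes the Koszul complex a resolution of the
underived tensor product (`koszulD_exact`). -/

noncomputable section

namespace HolBV

/-! ### Signs -/

/-- The sign `(-1)^k`. -/
def sgn (k : ℤ) : ℂ := (-1 : ℂ) ^ k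

theorem sgn_add (a b : ℤ) : sgn (a + b) = sgn a * sgn b :=
  zpow_add₀ (by norm_num) a b

theorem sgn_mul_self (a : ℤ) : sgn a * sgn a = 1 := by
  rw [← sgn_add, sgn, Even.neg_one_zpow ⟨a, rfl⟩]

theorem sgn_eq_of_even {a b : ℤ} (h : Even (a - b)) : sgn a = sgn b := by
  have : a = (a - b) + b := by ring
  rw [this, sgn_add, sgn, h.neg_one_zpow, one_mul]

theorem sgn_eq_neg_of_odd {a b : ℤ} (h : Odd (a - b)) : sgn a = -sgn b := by
  have : a = (a - b) + b := by ring
  rw [this, sgn_add, sgn, h.neg_one_zpow, neg_one_mul]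

@[simp] theorem sgn_zero : sgn 0 = 1 := by simp [sgn]

@[simp] theorem sgn_one : sgn 1 = -1 := by simp [sgn]

theorem sgn_ne_zero (a : ℤ) : sgn a ≠ 0 := fun h => by
  simpa [h] using sgn_mul_self a

/-! ### Words -/

section Words

variable {R ι A : Type} [CommRing R] [Algebra ℂ R]

/-- Multiplication by a jet coordinate from the left. -/
def consL (j : A × (ι →₀ ℕ)) : JetPoly R ι A →ₗ[ℂ] JetPoly R ι A :=
  Finsupp.lmapDomain R ℂ (List.cons j)

@[simp] theorem consL_single (j : A × (ι →₀ ℕ)) (w : List (A × (ι →₀ ℕ))) (r : R) :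
    consL j (Finsupp.single w r) = Finsupp.single (j :: w) r := by
  simp [consL, Finsupp.lmapDomain_apply]

theorem consL_smul (j : A × (ι →₀ ℕ)) (r : R) (x : JetPoly R ι A) :
    consL j (r • x) = r • consL j x := by
  simp [consL, Finsupp.lmapDomain_apply, Finsupp.mapDomain_smul]

/-- Every operator below is described by its value on the empty word and by its behaviour when a
letter is put in front. Identities of operators are then proved by this induction, without indices
of positions in a word. -/
theorem word_induction {P : JetPoly R ι A → Prop} (hnil : ∀ r, P (Finsupp.single [] r))
    (hcons : ∀ j x, P x → P (consL j x)) (hadd : ∀ x y, P x → P y → P (x + y))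
    (x : JetPoly R ι A) : P x := by
  induction x using Finsupp.induction_linear with
  | zero => simpa using hnil 0
  | add x y hx hy => exact hadd x y hx hy
  | single w r =>
    induction w with
    | nil => exact hnil r
    | cons j w ih => simpa using hcons j _ ih

theorem linearMap_word_ext {M : Type*} [AddCommGroup M] [Module ℂ M]
    {f g : JetPoly R ι A →ₗ[ℂ] M} (hnil : ∀ r, f (Finsupp.single [] r) = g (Finsupp.single [] r))
    (hcons : ∀ j x, f x = g x → f (consL j x) = g (consL j x)) : f = g := by
  refine LinearMap.ext fun x => ?_
  refine word_induction (P := fun x => f x = g x) hnil hcons (fun x y hx hy => ?_) x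
  rw [map_add, map_add, hx, hy]

/-- Concatenation product. -/
def mulL : JetPoly R ι A →ₗ[ℂ] JetPoly R ι A →ₗ[ℂ] JetPoly R ι A :=
  Finsupp.lsum ℂ fun w =>
    { toFun := fun r => r • (Finsupp.lmapDomain R ℂ (w ++ ·))
      map_add' := fun r s => add_smul r s _
      map_smul' := fun c r => by ext1; simp [smul_assoc] }

notation:70 x:70 " ⋆ " y:71 => mulL x y

theorem single_mul (w : List (A × (ι →₀ ℕ))) (r : R) (y : JetPoly R ι A) :
    Finsupp.single w r ⋆ y = r • y.mapDomain (w ++ ·) := by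
  simp [mulL, Finsupp.lmapDomain_apply]

@[simp] theorem nil_mul (r : R) (y : JetPoly R ι A) :
    Finsupp.single [] r ⋆ y = r • y := by
  rw [single_mul]
  exact congrArg _ Finsupp.mapDomain_id

@[simp] theorem consL_mul (j : A × (ι →₀ ℕ)) (x y : JetPoly R ι A) :
    consL j x ⋆ y = consL j (x ⋆ y) := by
  induction x using Finsupp.induction_linear with
  | zero => simp
  | add x x' hx hx' => simp only [map_add, LinearMap.add_apply] at *; rw [hx, hx']
  | single w r =>
    rw [consL_single, single_mul, single_mul, consL_smul, consL, Finsupp.lmapDomain_apply,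
      ← Finsupp.mapDomain_comp]
    rfl

theorem smul_mul (r : R) (x y : JetPoly R ι A) : (r • x) ⋆ y = r • (x ⋆ y) := by
  induction x using word_induction with
  | hnil s => rw [Finsupp.smul_single, smul_eq_mul, nil_mul, nil_mul, mul_smul]
  | hcons j x ih => rw [← consL_smul, consL_mul, consL_mul, ih, consL_smul]
  | hadd x x' hx hx' =>
    simp only [map_add, LinearMap.add_apply, smul_add] at *; rw [hx, hx']

theorem mul_smul' (r : R) (x y : JetPoly R ι A) : x ⋆ (r • y) = r • (x ⋆ y) := by
  induction x using word_induction with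
  | hnil s => rw [nil_mul, nil_mul, smul_comm]
  | hcons j x ih => rw [consL_mul, consL_mul, ih, consL_smul]
  | hadd x x' hx hx' =>
    simp only [map_add, LinearMap.add_apply, smul_add] at *; rw [hx, hx']

theorem mulL_assoc (x y z : JetPoly R ι A) : x ⋆ y ⋆ z = x ⋆ (y ⋆ z) := by
  induction x using word_induction with
  | hnil s => simp [smul_mul]
  | hcons j x ih => simp only [consL_mul, ih]
  | hadd x x' hx hx' =>
    simp only [map_add, LinearMap.add_apply] at *; rw [hx, hx']

/-- The jet coordinate `j` as a polynomial. -/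
def letter (R : Type) {ι A : Type} [CommRing R] [Algebra ℂ R] (j : A × (ι →₀ ℕ)) : JetPoly R ι A :=
  Finsupp.single [j] 1

@[simp] theorem letter_mul (j : A × (ι →₀ ℕ)) (x : JetPoly R ι A) :
    letter R j ⋆ x = consL j x := by
  simp only [letter, ← consL_single, consL_mul, nil_mul, one_smul]

theorem mul_one' (x : JetPoly R ι A) : x ⋆ Finsupp.single [] 1 = x := by
  induction x using word_induction with
  | hnil r => simp
  | hcons j x ih => rw [consL_mul, ih]
  | hadd x x' hx hx' =>
    simp only [map_add, LinearMap.add_apply] at *; rw [hx, hx']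

/-! ### Homogeneous elements -/

/-- Polynomials of degree `n` in the jet coordinates, with components adding up to degree `k`. -/
def homog (R : Type) {ι A : Type} [CommRing R] [Algebra ℂ R] (deg : A → ℤ) (n : ℕ) (k : ℤ) :
    Submodule ℂ (JetPoly R ι A) :=
  Finsupp.supported R ℂ {w | w.length = n ∧ wordDeg deg w = k}

theorem mem_homog {deg : A → ℤ} {n : ℕ} {k : ℤ} {x : JetPoly R ι A} :
    x ∈ homog R deg n k ↔ ∀ w, x w ≠ 0 → w.length = n ∧ wordDeg deg w = k := by
  simp [homog, Finsupp.mem_supported, Set.subset_def]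

theorem mem_lagrangians {deg : A → ℤ} {k : ℤ} {F : JetSeries R ι A} :
    F ∈ lagrangians R deg k ↔ F 0 = 0 ∧ ∀ n, F n ∈ homog R deg n (-k) := by
  simp only [mem_homog]; rfl

theorem homog_induction {deg : A → ℤ} {n : ℕ} {k : ℤ} {P : JetPoly R ι A → Prop}
    (hzero : P 0) (hadd : ∀ x y, P x → P y → P (x + y))
    (hsingle : ∀ w r, w.length = n → wordDeg deg w = k → P (Finsupp.single w r))
    {x : JetPoly R ι A} (hx : x ∈ homog R deg n k) : P x := by
  rw [← x.sum_single]
  refine Finset.sum_induction _ P hadd hzero fun w hw => ?_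
  have := mem_homog.1 hx w (Finsupp.mem_support_iff.1 hw)
  exact hsingle w _ this.1 this.2

theorem single_mem_homog {deg : A → ℤ} {n : ℕ} {k : ℤ} {w : List (A × (ι →₀ ℕ))} {r : R}
    (h : w.length = n) (h' : wordDeg deg w = k) : Finsupp.single w r ∈ homog R deg n k :=
  Finsupp.single_mem_supported ℂ r ⟨h, h'⟩

/-- To map homogeneous elements into a submodule it suffices to consider words. -/
theorem homog_le_comap {M : Type*} [AddCommGroup M] [Module ℂ M] {deg : A → ℤ} {n : ℕ} {k : ℤ}
    (T : JetPoly R ι A →ₗ[ℂ] M) {N : Submodule ℂ M}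
    (h : ∀ w r, w.length = n → wordDeg deg w = k → T (Finsupp.single w r) ∈ N)
    {x : JetPoly R ι A} (hx : x ∈ homog R deg n k) : T x ∈ N :=
  homog_induction (P := fun x => T x ∈ N) (by simp) (fun x y hx hy => by simpa using N.add_mem hx hy)
    h hx

@[simp] theorem wordDeg_nil (deg : A → ℤ) : wordDeg (ι := ι) deg [] = 0 := rfl

@[simp] theorem wordDeg_cons (deg : A → ℤ) (j : A × (ι →₀ ℕ)) (w : List (A × (ι →₀ ℕ))) :
    wordDeg deg (j :: w) = deg j.1 + wordDeg deg w := by simp [wordDeg]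

theorem consL_mem_homog {deg : A → ℤ} {n : ℕ} {k : ℤ} (j : A × (ι →₀ ℕ)) {x : JetPoly R ι A}
    (hx : x ∈ homog R deg n k) : consL j x ∈ homog R deg (n + 1) (deg j.1 + k) :=
  homog_le_comap (consL j) (fun w r h h' => by
    rw [consL_single]; exact single_mem_homog (by simp [h]) (by simp [h'])) hx

theorem smul_mem_homog {deg : A → ℤ} {n : ℕ} {k : ℤ} (r : R) {x : JetPoly R ι A}
    (hx : x ∈ homog R deg n k) : r • x ∈ homog R deg n k :=
  mem_homog.2 fun w h => mem_homog.1 hx w fun h0 => h (by simp [h0])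

theorem mul_mem_homog {deg : A → ℤ} {m n : ℕ} {k l : ℤ} {x y : JetPoly R ι A}
    (hx : x ∈ homog R deg m k) (hy : y ∈ homog R deg n l) :
    x ⋆ y ∈ homog R deg (m + n) (k + l) := by
  refine homog_le_comap (mulL.flip y) (fun w r h h' => ?_) hx
  subst h h'
  simp only [LinearMap.flip_apply]
  clear hx
  induction w with
  | nil => simpa using smul_mem_homog r hy
  | cons j w ih =>
    rw [← consL_single]
    have := consL_mem_homog j ih
    rw [← consL_mul] at this
    convert this using 2
    · simp; ring
    · simp; ring

/-! ### Derivations -/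

/-- Auxiliary recursion for `der`. -/
def derWord (deg : A → ℤ) (p : ℤ) (q : A × (ι →₀ ℕ) → JetPoly R ι A) :
    List (A × (ι →₀ ℕ)) → JetPoly R ι A
  | [] => 0
  | j :: w => q j ⋆ Finsupp.single w 1 + sgn (p * deg j.1) • consL j (derWord deg p q w)

/-- The graded derivation of parity `p` with values `q` on the jet coordinates. -/
def der (deg : A → ℤ) (p : ℤ) (q : A × (ι →₀ ℕ) → JetPoly R ι A) :
    JetPoly R ι A →ₗ[ℂ] JetPoly R ι A :=
  Finsupp.lsum ℂ fun w =>
    (LinearMap.toSpanSingleton R (JetPoly R ι A) (derWord deg p q w)).restrictScalars ℂ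

variable {deg : A → ℤ} {p : ℤ} {q : A × (ι →₀ ℕ) → JetPoly R ι A}

@[simp] theorem der_nil (r : R) : der deg p q (Finsupp.single [] r) = 0 := by
  simp [der, derWord]

theorem der_single (w : List (A × (ι →₀ ℕ))) (r : R) :
    der deg p q (Finsupp.single w r) = r • derWord deg p q w := by
  simp [der]

theorem der_consL (j : A × (ι →₀ ℕ)) (x : JetPoly R ι A) :
    der deg p q (consL j x) = q j ⋆ x + sgn (p * deg j.1) • consL j (der deg p q x) := by
  induction x using Finsupp.induction_linear with
  | zero => simp
  | add x y hx hy => simp only [map_add, smul_add] at *; rw [hx, hy]; abel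
  | single w r =>
    rw [consL_single, der_single, derWord, der_single, consL_smul, smul_add, ← mul_smul',
      Finsupp.smul_single, smul_eq_mul, mul_one, smul_comm]

theorem der_smul (r : R) (x : JetPoly R ι A) : der deg p q (r • x) = r • der deg p q x := by
  induction x using word_induction with
  | hnil s => rw [Finsupp.smul_single, der_nil, der_nil, smul_zero]
  | hcons j x ih => rw [← consL_smul, der_consL, der_consL, ih, consL_smul, mul_smul', smul_add,
      smul_comm r]
  | hadd x y hx hy => simp only [map_add, smul_add] at *; rw [hx, hy]

theorem mulL_append (u v : List (A × (ι →₀ ℕ))) (x : JetPoly R ι A) :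
    (Finsupp.mapDomain (fun v' => u ++ v' ++ v) x : JetPoly R ι A) =
      Finsupp.single u 1 ⋆ x ⋆ Finsupp.single v 1 := by
  induction x using Finsupp.induction_linear with
  | zero => simp
  | add x y hx hy =>
    simp only [map_add, LinearMap.add_apply, Finsupp.mapDomain_add] at *; rw [hx, hy]
  | single w r => simp [single_mul]

/-- Trades a sum over positions in the word for the recursion `der_consL`, on which all later
inductions run. -/
theorem oddDer_eq_der (deg : A → ℤ) (q : A × (ι →₀ ℕ) → JetPoly R ι A) :
    oddDer deg q = der deg 1 q := by
  refine Finsupp.lhom_ext' fun w => ?_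
  ext1 r
  simp only [LinearMap.comp_apply, Finsupp.lsingle_apply, der_single]
  simp only [oddDer, Finsupp.lsum_single, LinearMap.sum_apply, LinearMap.smul_apply,
    LinearMap.coe_restrictScalars, LinearMap.toSpanSingleton_apply]
  have key : ∀ w, ∑ k : Fin w.length, ((-1 : ℂ) ^ wordDeg deg (w.take k)) •
      (r • (Finsupp.mapDomain (fun v => w.take k ++ v ++ w.drop (k + 1)) (q (w.get k)) :
        JetPoly R ι A)) = r • derWord deg 1 q w := by
    intro w
    induction w with
    | nil => simp [derWord]
    | cons j w ih =>
      rw [derWord, smul_add, smul_comm r, ← consL_smul, ← ih, map_sum, Finset.smul_sum]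
      simp only [List.length_cons, Fin.sum_univ_succ]
      congr 1
      · simp only [Fin.val_zero, List.take_zero, wordDeg_nil, zpow_zero, one_smul,
          zero_add, mulL_append]
        simp
      · refine Finset.sum_congr rfl fun k _ => ?_
        simp only [Fin.val_succ, List.take_succ_cons, wordDeg_cons, one_mul,
          List.get_cons_succ', List.drop_succ_cons, LinearMap.map_smul, consL_smul, smul_smul]
        rw [sgn, ← zpow_add₀ (by norm_num)]
        congr 2
        simp only [mulL_append, ← consL_single, consL_mul]
  exact key w

theorem fieldD_eq_der (deg : A → ℤ) (i : ι) :
    fieldD R i = der deg 0 fun j => letter R (j.1, j.2 + Finsupp.single i 1) := by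
  refine Finsupp.lhom_ext' fun w => ?_
  ext1 r
  simp only [LinearMap.comp_apply, Finsupp.lsingle_apply, der_single]
  simp only [fieldD, Finsupp.lsum_single, LinearMap.sum_apply, Finsupp.lsingle_apply]
  induction w with
  | nil => simp [derWord]
  | cons j w ih =>
    rw [derWord, smul_add, smul_comm r, ← consL_smul, ← ih, map_sum, Finset.smul_sum]
    simp only [List.length_cons, Fin.sum_univ_succ]
    congr 1
    · simp [letter, single_mul]
    · refine Finset.sum_congr rfl fun k _ => ?_
      simp

theorem fieldD_consL (i : ι) (j : A × (ι →₀ ℕ)) (x : JetPoly R ι A) :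
    fieldD R i (consL j x) = consL (j.1, j.2 + Finsupp.single i 1) x + consL j (fieldD R i x) := by
  rw [fieldD_eq_der (fun _ => 0), der_consL]; simp

@[simp] theorem fieldD_nil (i : ι) (r : R) :
    fieldD R i (Finsupp.single ([] : List (A × (ι →₀ ℕ))) r) = 0 := by
  rw [fieldD_eq_der (fun _ => 0), der_nil]

/-- The sign twist `x ↦ (-1)^{p |x|} x`. -/
def twist (deg : A → ℤ) (p : ℤ) : JetPoly R ι A →ₗ[ℂ] JetPoly R ι A :=
  Finsupp.lsum ℂ fun w => sgn (p * wordDeg deg w) • Finsupp.lsingle w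

@[simp] theorem twist_nil (r : R) : twist (ι := ι) deg p (Finsupp.single [] r)
    = Finsupp.single [] r := by
  simp [twist]

theorem twist_consL (j : A × (ι →₀ ℕ)) (x : JetPoly R ι A) :
    twist deg p (consL j x) = sgn (p * deg j.1) • consL j (twist deg p x) := by
  induction x using Finsupp.induction_linear with
  | zero => simp
  | add x y hx hy => simp only [map_add, smul_add] at *; rw [hx, hy]
  | single w r =>
    rw [consL_single]
    simp only [twist, Finsupp.lsum_single, LinearMap.smul_apply,
      Finsupp.lsingle_apply, wordDeg_cons, mul_add, sgn_add, map_smul, smul_smul, consL_single]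

theorem twist_of_mem {n : ℕ} {k : ℤ} {x : JetPoly R ι A} (hx : x ∈ homog R deg n k) :
    twist deg p x = sgn (p * k) • x := by
  refine homog_induction (P := fun x => twist deg p x = sgn (p * k) • x) (by simp)
    (fun x y hx hy => by simp [hx, hy]) (fun w r _ h => ?_) hx
  simp [twist, h]

/-- Graded Leibniz rule. `x` need not be homogeneous, so the sign of passing the derivation across
`x` is carried by `twist`. -/
theorem der_mul (x y : JetPoly R ι A) :
    der deg p q (x ⋆ y) = der deg p q x ⋆ y + twist deg p x ⋆ der deg p q y := by
  induction x using word_induction with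
  | hnil r => simp [der_smul]
  | hcons j x ih =>
    rw [consL_mul, der_consL, ih, der_consL, twist_consL]
    simp only [map_add, LinearMap.add_apply, map_smul, LinearMap.smul_apply, consL_mul, smul_add,
      mulL_assoc]
    abel
  | hadd x x' hx hx' =>
    simp only [map_add, LinearMap.add_apply] at *; rw [hx, hx']; abel

/-- A family of values of homogeneous elements of length `m` which lower the degree by `p`. -/
def IsHomogFamily (deg : A → ℤ) (p : ℤ) (m : ℕ) (q : A × (ι →₀ ℕ) → JetPoly R ι A) : Prop :=
  ∀ j, q j ∈ homog R deg m (deg j.1 - p)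

theorem der_mem_homog {m n : ℕ} {k : ℤ} (hq : IsHomogFamily deg p m q) {x : JetPoly R ι A}
    (hx : x ∈ homog R deg (n + 1) k) : der deg p q x ∈ homog R deg (n + m) (k - p) := by
  have key : ∀ (r : R) (w : List (A × (ι →₀ ℕ))), w.length = n + 1 → der deg p q (Finsupp.single w r) ∈
      homog R deg (n + m) (wordDeg deg w - p) := by
    clear hx
    intro r w hw
    induction w generalizing n with
    | nil => simp
    | cons j w ih =>
      rw [← consL_single, der_consL]
      obtain rfl : w.length = n := by simpa using hw
      refine add_mem ?_ (Submodule.smul_mem _ _ ?_)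
      · have := mul_mem_homog (hq j) (single_mem_homog (r := r) (w := w) (deg := deg) rfl rfl)
        convert this using 2
        · ring
        · simp; ring
      · cases w with
        | nil => simp
        | cons j' w =>
          have := consL_mem_homog j (ih (n := w.length) rfl)
          convert this using 2
          · simp; ring
          · simp; ring
  exact homog_le_comap _ (fun w r h h' => h' ▸ key r w h) hx

theorem der_zero_len {k : ℤ} {x : JetPoly R ι A}
    (hx : x ∈ homog R deg 0 k) : der deg p q x = 0 := by
  refine homog_induction (P := fun x => der deg p q x = 0) (by simp)
    (fun x y hx hy => by simp [hx, hy]) (fun w r h _ => ?_) hx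
  obtain rfl := List.length_eq_zero_iff.1 h
  simp

theorem der_add_left (q q' : A × (ι →₀ ℕ) → JetPoly R ι A) :
    der deg p (q + q') = der deg p q + der deg p q' := by
  refine linearMap_word_ext (fun r => by simp) fun j x h => ?_
  simp only [LinearMap.add_apply] at h ⊢
  simp only [der_consL, h, map_add, LinearMap.add_apply, Pi.add_apply, smul_add]
  abel

theorem der_smul_left (c : ℂ) (q : A × (ι →₀ ℕ) → JetPoly R ι A) :
    der deg p (c • q) = c • der deg p q := by
  refine linearMap_word_ext (fun r => by simp) fun j x h => ?_
  simp only [LinearMap.smul_apply] at h ⊢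
  simp only [der_consL, h, map_smul, LinearMap.smul_apply, Pi.smul_apply, smul_add]
  rw [smul_comm]

@[simp] theorem der_zero_left : der (R := R) (ι := ι) deg p 0 = 0 := by
  simpa using der_smul_left (R := R) (ι := ι) (deg := deg) (p := p) 0 0

theorem der_sum_left {κ : Type*} (s : Finset κ) (q : κ → A × (ι →₀ ℕ) → JetPoly R ι A) :
    der deg p (∑ i ∈ s, q i) = ∑ i ∈ s, der deg p (q i) := by
  classical
  induction s using Finset.induction with
  | empty => simp
  | insert i s hi ih => rw [Finset.sum_insert hi, Finset.sum_insert hi, der_add_left, ih]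

@[simp] theorem der_letter (j : A × (ι →₀ ℕ)) : der deg p q (letter R j) = q j := by
  rw [letter, ← consL_single, der_consL, der_nil, map_zero, smul_zero, add_zero, mul_one']

/-- The graded commutator of two derivations is a derivation. -/
theorem der_comm {p' : ℤ} {m m' : ℕ} {q' : A × (ι →₀ ℕ) → JetPoly R ι A}
    (hq : IsHomogFamily deg p m q) (hq' : IsHomogFamily deg p' m' q') (x : JetPoly R ι A) :
    der deg p q (der deg p' q' x) - sgn (p * p') • der deg p' q' (der deg p q x) =
      der deg (p + p') (fun j => der deg p q (q' j) - sgn (p * p') • der deg p' q' (q j)) x := by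
  induction x using word_induction with
  | hnil r => simp
  | hcons j x ih =>
    rw [der_consL, der_consL (q := q), der_consL]
    simp only [map_add, map_smul, der_consL, der_mul, twist_of_mem (hq' j), twist_of_mem (hq j),
      ← ih, smul_add, smul_sub, map_sub, LinearMap.sub_apply, LinearMap.smul_apply, smul_smul]
    -- The value `q' j` has degree `deg j.1 - p'`, so passing `p` across it costs an extra `sgn (p *
    -- p')`. This is what cancels the cross terms `q' j ⋆ der q x` and `q j ⋆ der q' x` of the
    -- commutator.
    have e1 : sgn (p * (deg j.1 - p')) = sgn (p * deg j.1) * sgn (p * p') := by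
      rw [← sgn_add]; exact sgn_eq_of_even ⟨-(p * p'), by ring⟩
    have e2 : sgn (p' * (deg j.1 - p)) = sgn (p' * deg j.1) * sgn (p * p') := by
      rw [← sgn_add]; exact sgn_eq_of_even ⟨-(p * p'), by ring⟩
    have e3 : sgn ((p + p') * deg j.1) = sgn (p * deg j.1) * sgn (p' * deg j.1) := by
      rw [← sgn_add]; ring_nf
    have e4 := sgn_mul_self (p * p')
    rw [e1, e2, e3]
    match_scalars <;> first | ring1 | linear_combination (-sgn (p' * deg j.1)) * e4
  | hadd x y hx hy =>
    simp only [map_add, ← hx, ← hy, smul_add]; abel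

end Words

/-! ### Calculus modulo the Koszul relations. -/

section Koszul

variable {R ι A : Type} [CommRing R] [Algebra ℂ R] {deg : A → ℤ}

theorem _root_.SModEq.neg' {M : Type*} [AddCommGroup M] [Module ℂ M] {U : Submodule ℂ M} {x y : M}
    (h : x ≡ y [SMOD U]) : -x ≡ -y [SMOD U] := by
  rw [SModEq.sub_mem] at h ⊢; convert U.neg_mem h using 1; abel

theorem _root_.SModEq.of_eq {M : Type*} [AddCommGroup M] [Module ℂ M] {U : Submodule ℂ M} {x y : M}
    (h : x = y) : x ≡ y [SMOD U] := by
  rw [h]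

/-- A linear map between spaces with relations respects congruences. -/
theorem _root_.SModEq.map_of_le {M M' : Type*} [AddCommGroup M] [Module ℂ M] [AddCommGroup M']
    [Module ℂ M'] {U : Submodule ℂ M} {U' : Submodule ℂ M'} (f : M →ₗ[ℂ] M')
    (hf : ∀ x ∈ U, f x ∈ U') {x y : M} (h : x ≡ y [SMOD U]) : f x ≡ f y [SMOD U'] := by
  rw [SModEq.sub_mem] at h ⊢; rw [← map_sub]; exact hf _ h

theorem _root_.SModEq.sum' {M : Type*} [AddCommGroup M] [Module ℂ M] {U : Submodule ℂ M} {κ : Type*}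
    {s : Finset κ} {f g : κ → M} (h : ∀ i ∈ s, f i ≡ g i [SMOD U]) :
    ∑ i ∈ s, f i ≡ ∑ i ∈ s, g i [SMOD U] := by
  rw [SModEq.sub_mem, ← Finset.sum_sub_distrib]
  exact Submodule.sum_mem _ fun i hi => SModEq.sub_mem.1 (h i hi)

theorem _root_.SModEq.of_le {M : Type*} [AddCommGroup M] [Module ℂ M] {U V : Submodule ℂ M} (hUV : U ≤ V)
    {x y : M} (h : x ≡ y [SMOD U]) : x ≡ y [SMOD V] :=
  SModEq.sub_mem.2 (hUV (SModEq.sub_mem.1 h))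

theorem _root_.SModEq.mem_iff {M : Type*} [AddCommGroup M] [Module ℂ M] {U : Submodule ℂ M}
    {x y : M} (h : x ≡ y [SMOD U]) : x ∈ U ↔ y ∈ U := by
  rw [← SModEq.zero, ← SModEq.zero]; exact ⟨fun h' => h.symm.trans h', fun h' => h.trans h'⟩

theorem consL_mem_koszul (j : A × (ι →₀ ℕ)) {x : JetPoly R ι A} (hx : x ∈ koszulRel R deg) :
    consL j x ∈ koszulRel R deg := by
  revert x
  change koszulRel R deg ≤ (koszulRel R deg).comap (consL j)
  refine Submodule.span_le.2 ?_
  rintro _ ⟨u, v, x, y, r, rfl⟩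
  refine Submodule.subset_span ⟨j :: u, v, x, y, r, ?_⟩
  simp

theorem consL_consL_mem_koszul (x y : A × (ι →₀ ℕ)) (z : JetPoly R ι A) :
    consL x (consL y z) - sgn (deg x.1 * deg y.1) • consL y (consL x z) ∈ koszulRel R deg := by
  induction z using Finsupp.induction_linear with
  | zero => simp
  | add z z' hz hz' =>
    convert add_mem hz hz' using 1
    simp only [map_add, smul_add]; abel
  | single w r => exact Submodule.subset_span ⟨[], w, x, y, r, by simp [sgn]⟩

/-- A generating relation swaps two letters behind a prefix `u`. Peeling off `u` letter by letter
leaves a swap at the front, which fits operators known through their behaviour under `consL`. -/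
theorem koszul_induction {M : Type*} [AddCommGroup M] [Module ℂ M] (T : JetPoly R ι A →ₗ[ℂ] M)
    {N : Submodule ℂ M}
    (h1 : ∀ x y z, T (consL x (consL y z) - sgn (deg x.1 * deg y.1) • consL y (consL x z)) ∈ N)
    (h2 : ∀ j z, z ∈ koszulRel R deg → T z ∈ N → T (consL j z) ∈ N) {z : JetPoly R ι A}
    (hz : z ∈ koszulRel R deg) : T z ∈ N := by
  revert z
  change koszulRel R deg ≤ N.comap T
  refine Submodule.span_le.2 ?_
  rintro _ ⟨u, v, x, y, r, rfl⟩
  change T _ ∈ N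
  suffices h : ∀ u : List (A × (ι →₀ ℕ)), T (Finsupp.single (u ++ x :: y :: v) r -
      (-1 : ℂ) ^ (deg x.1 * deg y.1) • Finsupp.single (u ++ y :: x :: v) r) ∈ N from h u
  intro u
  induction u with
  | nil => simpa [sgn] using h1 x y (Finsupp.single v r)
  | cons j u ih =>
    have := h2 j _ (Submodule.subset_span ⟨u, v, x, y, r, rfl⟩) ih
    simpa using this

theorem smul_mem_koszul (r : R) {x : JetPoly R ι A} (hx : x ∈ koszulRel R deg) :
    r • x ∈ koszulRel R deg := by
  refine koszul_induction (LinearMap.lsmul R (JetPoly R ι A) r |>.restrictScalars ℂ)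
    (fun x y z => ?_) (fun j z _ h => ?_) hx
  · have := consL_consL_mem_koszul (deg := deg) x y (r • z)
    simpa [consL_smul, smul_sub, smul_comm r] using this
  · simpa [consL_smul] using consL_mem_koszul j h

theorem mul_mem_koszul_left {x : JetPoly R ι A} (hx : x ∈ koszulRel R deg) (y : JetPoly R ι A) :
    x ⋆ y ∈ koszulRel R deg := by
  refine koszul_induction (mulL.flip y) (fun x x' z => ?_) (fun j z _ h => ?_) hx
  · simpa using consL_consL_mem_koszul x x' (z ⋆ y)
  · simpa using consL_mem_koszul j h

theorem mul_mem_koszul_right (x : JetPoly R ι A) {y : JetPoly R ι A} (hy : y ∈ koszulRel R deg) :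
    x ⋆ y ∈ koszulRel R deg := by
  induction x using word_induction with
  | hnil r => simpa using smul_mem_koszul r hy
  | hcons j x ih => simpa using consL_mem_koszul j ih
  | hadd x x' hx hx' => simpa using add_mem hx hx'

theorem consL_congr (j : A × (ι →₀ ℕ)) {x y : JetPoly R ι A} (h : x ≡ y [SMOD koszulRel R deg]) :
    consL j x ≡ consL j y [SMOD koszulRel R deg] :=
  SModEq.map_of_le (consL j) (fun _ => consL_mem_koszul j) h

theorem mulL_congr {x x' y y' : JetPoly R ι A} (h : x ≡ x' [SMOD koszulRel R deg])
    (h' : y ≡ y' [SMOD koszulRel R deg]) : x ⋆ y ≡ x' ⋆ y' [SMOD koszulRel R deg] :=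
  (SModEq.map_of_le (mulL.flip y) (fun _ hx => mul_mem_koszul_left hx y) h).trans
    (SModEq.map_of_le (mulL x') (fun _ hx => mul_mem_koszul_right x' hx) h')

theorem mul_consL_swap {m : ℕ} {k : ℤ} {x : JetPoly R ι A} (hx : x ∈ homog R deg m k)
    (j : A × (ι →₀ ℕ)) (z : JetPoly R ι A) :
    x ⋆ consL j z ≡ sgn (k * deg j.1) • consL j (x ⋆ z) [SMOD koszulRel R deg] := by
  have key : ∀ r (w : List (A × (ι →₀ ℕ))), Finsupp.single w r ⋆ consL j z ≡
      sgn (wordDeg deg w * deg j.1) • consL j (Finsupp.single w r ⋆ z) [SMOD koszulRel R deg] := by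
    intro r w
    induction w with
    | nil => simp [consL_smul]
    | cons j' w ih =>
      rw [← consL_single, consL_mul, consL_mul]
      refine (consL_congr j' ih).trans ?_
      have := (SModEq.sub_mem.2 (consL_consL_mem_koszul (deg := deg) j' j
        (Finsupp.single w r ⋆ z))).smul (sgn (wordDeg deg w * deg j.1))
      rw [map_smul]
      refine this.trans ?_
      rw [smul_smul, wordDeg_cons, add_mul, sgn_add, mul_comm]
  refine homog_induction (P := fun x => x ⋆ consL j z ≡ sgn (k * deg j.1) • consL j (x ⋆ z)
    [SMOD koszulRel R deg]) ?_ ?_ ?_ hx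
  · simp
  · intro x y hx hy
    simpa using hx.add hy
  · rintro w r _ rfl
    exact key r w

/-- Graded commutativity modulo the Koszul relations. -/
theorem mul_swap {m n : ℕ} {k l : ℤ} {x y : JetPoly R ι A} (hx : x ∈ homog R deg m k)
    (hy : y ∈ homog R deg n l) :
    x ⋆ y ≡ sgn (k * l) • (y ⋆ x) [SMOD koszulRel R deg] := by
  have key : ∀ r (w : List (A × (ι →₀ ℕ))), x ⋆ Finsupp.single w r ≡
      sgn (k * wordDeg deg w) • (Finsupp.single w r ⋆ x) [SMOD koszulRel R deg] := by
    intro r w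
    induction w with
    | nil =>
      have : x ⋆ Finsupp.single [] r = r • x := by
        rw [← mul_one r, ← smul_eq_mul, ← Finsupp.smul_single, mul_smul', mul_one', smul_eq_mul,
          mul_one]
      simp [this]
    | cons j w ih =>
      rw [← consL_single, consL_mul]
      refine (mul_consL_swap hx j _).trans ?_
      refine ((consL_congr j ih).smul _).trans ?_
      rw [map_smul, smul_smul, wordDeg_cons, mul_add, sgn_add]
  refine homog_induction (P := fun y => x ⋆ y ≡ sgn (k * l) • (y ⋆ x) [SMOD koszulRel R deg])
    ?_ ?_ ?_ hy
  · simp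
  · intro y y' hx hy
    simpa using hx.add hy
  · rintro w r _ rfl
    exact key r w

/-- For a swap at the front, the term where the derivation hits one letter is matched with the same
term of the swapped word by moving `q x` or `q y` past the other letter. Homogeneity of `q` is what
makes the sign of that move well defined. -/
theorem der_mem_koszul {p : ℤ} {m : ℕ} {q : A × (ι →₀ ℕ) → JetPoly R ι A}
    (hq : IsHomogFamily deg p m q) {z : JetPoly R ι A} (hz : z ∈ koszulRel R deg) :
    der deg p q z ∈ koszulRel R deg := by
  refine koszul_induction (der deg p q) (fun x y z => ?_) (fun j z hz h => ?_) hz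
  · rw [map_sub, ← SModEq.sub_mem, map_smul]
    simp only [der_consL, map_add, map_smul, smul_add, smul_smul]
    have h1 := mul_consL_swap (hq x) y z
    have h2 := mul_consL_swap (hq y) x z
    have h3 := SModEq.sub_mem.2 (consL_consL_mem_koszul (deg := deg) x y (der deg p q z))
    have e0 := sgn_mul_self (deg x.1 * deg y.1)
    have e1 : sgn ((deg x.1 - p) * deg y.1) = sgn (deg x.1 * deg y.1) * sgn (p * deg y.1) := by
      rw [← sgn_add]; exact sgn_eq_of_even ⟨-(p * deg y.1), by ring⟩
    have e2 : sgn ((deg y.1 - p) * deg x.1) = sgn (deg x.1 * deg y.1) * sgn (p * deg x.1) := by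
      rw [← sgn_add]; exact sgn_eq_of_even ⟨-(p * deg x.1), by ring⟩
    rw [e1] at h1
    rw [e2] at h2
    have h4 := (h1.add ((h2.smul (sgn (deg x.1 * deg y.1))).symm)).add
      (h3.smul (sgn (p * deg x.1) * sgn (p * deg y.1)))
    rw [SModEq.sub_mem] at h4 ⊢
    convert h4 using 1
    match_scalars
    · ring
    · linear_combination (-sgn (p * deg x.1)) * e0
    · ring
    · ring
    · ring
    · ring
  · rw [der_consL]
    exact add_mem (mul_mem_koszul_right _ hz) (Submodule.smul_mem _ _ (consL_mem_koszul j h))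

theorem der_congr_left {p : ℤ} {q q' : A × (ι →₀ ℕ) → JetPoly R ι A}
    (h : ∀ j, q j ≡ q' j [SMOD koszulRel R deg]) (x : JetPoly R ι A) :
    der deg p q x ≡ der deg p q' x [SMOD koszulRel R deg] := by
  induction x using word_induction with
  | hnil r => simp
  | hcons j x ih =>
    rw [der_consL, der_consL]
    exact (mulL_congr (h j) SModEq.rfl).add ((consL_congr j ih).smul _)
  | hadd x y hx hy => simpa using hx.add hy

/-! ### Total derivatives -/

/-- Commuting derivations of the coefficient ring. -/
structure CommDer (δ : ι → R →ₗ[ℂ] R) : Prop where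
  leibniz : ∀ i r s, δ i (r * s) = δ i r * s + r * δ i s
  comm : ∀ i i' r, δ i (δ i' r) = δ i' (δ i r)

theorem commDer_zero : CommDer (fun _ : ι => (0 : R →ₗ[ℂ] R)) :=
  ⟨by simp, by simp⟩

variable {δ : ι → R →ₗ[ℂ] R}

@[simp] theorem totalD_nil (i : ι) (r : R) :
    totalD δ i (Finsupp.single ([] : List (A × (ι →₀ ℕ))) r) = Finsupp.single [] (δ i r) := by
  simp [totalD]

/-- Action of a linear map on the coefficients. -/
def coefMap (f : R →ₗ[ℂ] R) : JetPoly R ι A →ₗ[ℂ] JetPoly R ι A := Finsupp.mapRange.linearMap f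

@[simp] theorem coefMap_single (f : R →ₗ[ℂ] R) (w : List (A × (ι →₀ ℕ))) (r : R) :
    coefMap f (Finsupp.single w r) = Finsupp.single w (f r) := by
  simp [coefMap]

theorem coefMap_consL (f : R →ₗ[ℂ] R) (j : A × (ι →₀ ℕ)) (x : JetPoly R ι A) :
    coefMap f (consL j x) = consL j (coefMap f x) := by
  induction x using Finsupp.induction_linear with
  | zero => simp
  | add x y hx hy => simp only [map_add] at *; rw [hx, hy]
  | single w r => simp

theorem totalD_eq (i : ι) (x : JetPoly R ι A) :
    totalD δ i x = coefMap (δ i) x + fieldD R i x := rfl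

theorem totalD_consL (i : ι) (j : A × (ι →₀ ℕ)) (x : JetPoly R ι A) :
    totalD δ i (consL j x) = consL (j.1, j.2 + Finsupp.single i 1) x + consL j (totalD δ i x) := by
  rw [totalD_eq, totalD_eq, fieldD_consL, coefMap_consL, map_add]; abel

theorem totalD_smul (hδ : CommDer δ) (i : ι) (r : R) (x : JetPoly R ι A) :
    totalD δ i (r • x) = δ i r • x + r • totalD δ i x := by
  induction x using word_induction with
  | hnil s =>
    rw [Finsupp.smul_single, totalD_nil, totalD_nil, Finsupp.smul_single, Finsupp.smul_single,
      ← Finsupp.single_add, smul_eq_mul, hδ.leibniz]; rfl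
  | hcons j x ih =>
    rw [← consL_smul, totalD_consL, ih, totalD_consL, smul_add, map_add, consL_smul, consL_smul,
      consL_smul]
    abel
  | hadd x y hx hy => simp only [smul_add, map_add] at *; rw [hx, hy]; abel

theorem totalD_mul (hδ : CommDer δ) (i : ι) (x y : JetPoly R ι A) :
    totalD δ i (x ⋆ y) = totalD δ i x ⋆ y + x ⋆ totalD δ i y := by
  induction x using word_induction with
  | hnil r => simp [totalD_smul hδ]
  | hcons j x ih =>
    rw [consL_mul, totalD_consL, ih, totalD_consL]
    simp only [map_add, LinearMap.add_apply, consL_mul]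
    abel
  | hadd x x' hx hx' =>
    simp only [map_add, LinearMap.add_apply] at *; rw [hx, hx']; abel

theorem totalD_comm (hδ : CommDer δ) (i i' : ι) (x : JetPoly R ι A) :
    totalD δ i (totalD δ i' x) = totalD δ i' (totalD δ i x) := by
  induction x using word_induction with
  | hnil r => simp [hδ.comm i i']
  | hcons j x ih =>
    rw [totalD_consL, totalD_consL, map_add, map_add, totalD_consL, totalD_consL, totalD_consL,
      totalD_consL, ih, add_right_comm j.2]
    abel
  | hadd x y hx hy => simp only [map_add] at *; rw [hx, hy]

theorem coefMap_comm_totalD (hδ : CommDer δ) (i i' : ι) (x : JetPoly R ι A) :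
    coefMap (δ i) (totalD δ i' x) = totalD δ i' (coefMap (δ i) x) := by
  induction x using word_induction with
  | hnil r => simp [hδ.comm i i']
  | hcons j x ih =>
    rw [totalD_consL, map_add, coefMap_consL, coefMap_consL, ih, coefMap_consL, totalD_consL]
  | hadd x y hx hy => simp only [map_add] at *; rw [hx, hy]

theorem coefMap_mem_koszul (f : R →ₗ[ℂ] R) {x : JetPoly R ι A} (hx : x ∈ koszulRel R deg) :
    coefMap f x ∈ koszulRel R deg := by
  refine koszul_induction (coefMap f) (fun x y z => ?_) (fun j z _ h => ?_) hx
  · simpa [coefMap_consL] using consL_consL_mem_koszul x y (coefMap f z)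
  · simpa [coefMap_consL] using consL_mem_koszul j h

theorem fieldD_mem_koszul (i : ι) {x : JetPoly R ι A} (hx : x ∈ koszulRel R deg) :
    fieldD R i x ∈ koszulRel R deg := by
  rw [fieldD_eq_der deg]
  exact der_mem_koszul (m := 1) (fun j => single_mem_homog rfl (by simp)) hx

theorem totalD_mem_koszul (i : ι) {x : JetPoly R ι A} (hx : x ∈ koszulRel R deg) :
    totalD δ i x ∈ koszulRel R deg :=
  add_mem (coefMap_mem_koszul _ hx) (fieldD_mem_koszul i hx)

theorem coefMap_mem_homog (f : R →ₗ[ℂ] R) {n : ℕ} {k : ℤ} {x : JetPoly R ι A}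
    (hx : x ∈ homog R deg n k) : coefMap f x ∈ homog R deg n k :=
  homog_le_comap (coefMap f) (fun w r h h' => by
    rw [coefMap_single]; exact single_mem_homog h h') hx

theorem fieldD_mem_homog (i : ι) {n : ℕ} {k : ℤ} {x : JetPoly R ι A}
    (hx : x ∈ homog R deg n k) : fieldD R i x ∈ homog R deg n k := by
  rw [fieldD_eq_der deg]
  cases n with
  | zero => rw [der_zero_len hx]; exact zero_mem _
  | succ n =>
    have := der_mem_homog (m := 1) (p := 0) (q := fun j : A × (ι →₀ ℕ) =>
      letter R (j.1, j.2 + Finsupp.single i 1)) (fun j => single_mem_homog rfl (by simp)) hx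
    simpa using this

theorem totalD_mem_homog (i : ι) {n : ℕ} {k : ℤ} {x : JetPoly R ι A}
    (hx : x ∈ homog R deg n k) : totalD δ i x ∈ homog R deg n k :=
  add_mem (coefMap_mem_homog _ hx) (fieldD_mem_homog i hx)

/-- Induction on multi-indices. -/
theorem multiindex_induction {P : (ι →₀ ℕ) → Prop} (h0 : P 0)
    (h1 : ∀ K i, P K → P (K + Finsupp.single i 1)) (K : ι →₀ ℕ) : P K := by
  classical
  induction K using Finsupp.induction with
  | zero => exact h0
  | single_add i n K _ _ ih =>
    clear * - h1 ih
    induction n with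
    | zero => simpa using ih
    | succ n ihn =>
      have := h1 _ i ihn
      rwa [add_right_comm, ← Finsupp.single_add] at this

section Pow

variable [Fintype ι]

@[simp] theorem totalDPow_zero : totalDPow (A := A) δ 0 = 1 := by
  simp [totalDPow]

/-- The product defining `totalDPow` follows an arbitrary enumeration of `ι`; commutativity lets the
new factor travel to the front from wherever `i` is listed. -/
theorem totalDPow_add_single (hδ : CommDer δ) (K : ι →₀ ℕ) (i : ι) :
    totalDPow (A := A) δ (K + Finsupp.single i 1) = totalD δ i * totalDPow δ K := by
  classical
  have hcomm : ∀ i' : ι, ∀ n : ℕ, Commute (totalD (A := A) δ i : Module.End ℂ (JetPoly R ι A))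
      ((totalD δ i' : Module.End ℂ (JetPoly R ι A)) ^ n) := fun i' n =>
    Commute.pow_right (LinearMap.ext fun x => totalD_comm hδ i i' x) n
  have key : ∀ l : List ι, l.Nodup →
      (l.map fun k => (totalD (A := A) δ k : Module.End ℂ _) ^ (K + Finsupp.single i 1 : ι →₀ ℕ) k).prod =
      if i ∈ l then totalD δ i * (l.map fun k => (totalD δ k : Module.End ℂ _) ^ K k).prod
      else (l.map fun k => (totalD δ k : Module.End ℂ _) ^ K k).prod := by
    intro l hl
    induction l with
    | nil => simp
    | cons k l ih =>
      obtain ⟨hk, hl⟩ := List.nodup_cons.1 hl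
      rw [List.map_cons, List.prod_cons, ih hl, List.map_cons, List.prod_cons]
      by_cases hik : i = k
      · subst hik
        simp [hk, pow_succ', mul_assoc]
      · have h0 : (Finsupp.single i 1 : ι →₀ ℕ) k = 0 := by simp [hik]
        by_cases hil : i ∈ l
        · simp only [hil, List.mem_cons, hik, Finsupp.add_apply, h0, add_zero, if_true, or_true]
          rw [← mul_assoc, ← mul_assoc, (hcomm k (K k)).eq]
        · simp [hil, hik, h0]
  rw [totalDPow, key _ (Finset.nodup_toList _), if_pos (by simp)]
  rfl

theorem totalDPow_map {P : JetPoly R ι A → Prop} (hδ : CommDer δ) (K : ι →₀ ℕ)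
    (h : ∀ i x, P x → P (totalD δ i x)) {x : JetPoly R ι A} (hx : P x) : P (totalDPow δ K x) := by
  induction K using multiindex_induction with
  | h0 => simpa using hx
  | h1 K i ih => rw [totalDPow_add_single hδ]; exact h i _ ih

theorem totalDPow_mem_koszul (hδ : CommDer δ) (K : ι →₀ ℕ) {x : JetPoly R ι A}
    (hx : x ∈ koszulRel R deg) : totalDPow δ K x ∈ koszulRel R deg :=
  totalDPow_map hδ K (P := fun x => x ∈ koszulRel R deg) (fun i _ h => totalD_mem_koszul i h) hx

theorem totalDPow_mem_homog (hδ : CommDer δ) (K : ι →₀ ℕ) {n : ℕ} {k : ℤ} {x : JetPoly R ι A}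
    (hx : x ∈ homog R deg n k) : totalDPow δ K x ∈ homog R deg n k :=
  totalDPow_map hδ K (P := fun x => x ∈ homog R deg n k) (fun i _ h => totalD_mem_homog i h) hx

/-- An operator which commutes with the total derivatives commutes with their products. -/
theorem comm_totalDPow {R' ι' A' : Type} [CommRing R'] [Algebra ℂ R'] [Fintype ι']
    {δ' : ι' → R' →ₗ[ℂ] R'} (hδ : CommDer δ) (hδ' : CommDer δ')
    (T : JetPoly R ι A →ₗ[ℂ] JetPoly R' ι' A') (f : ι → ι')
    (h : ∀ i x, T (totalD δ i x) = totalD δ' (f i) (T x)) (K : ι →₀ ℕ) (x : JetPoly R ι A) :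
    T (totalDPow δ K x) = totalDPow δ' (K.mapDomain f) (T x) := by
  induction K using multiindex_induction with
  | h0 => simp
  | h1 K i ih =>
    rw [totalDPow_add_single hδ, Finsupp.mapDomain_add, Finsupp.mapDomain_single,
      totalDPow_add_single hδ', Module.End.mul_apply, h, ih]; rfl

theorem comm_totalDPow' (hδ : CommDer δ) (T : JetPoly R ι A →ₗ[ℂ] JetPoly R ι A)
    (h : ∀ i x, T (totalD δ i x) = totalD δ i (T x)) (K : ι →₀ ℕ) (x : JetPoly R ι A) :
    T (totalDPow δ K x) = totalDPow δ K (T x) := by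
  have := comm_totalDPow hδ hδ T id h K x
  rwa [Finsupp.mapDomain_id] at this

end Pow

/-! ### Evolutionary derivations -/

/-- The values of a derivation which commutes with the total derivatives. -/
def IsEvolutionary (δ : ι → R →ₗ[ℂ] R) (q : A × (ι →₀ ℕ) → JetPoly R ι A) : Prop :=
  ∀ j i, q (j.1, j.2 + Finsupp.single i 1) = totalD δ i (q j)

/-- `IsEvolutionary` is commutation on single letters; the Leibniz rules of the two operators
propagate it to words. -/
theorem der_totalD {p : ℤ} {q : A × (ι →₀ ℕ) → JetPoly R ι A} (hδ : CommDer δ)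
    (hq : IsEvolutionary δ q) (i : ι) (x : JetPoly R ι A) :
    der deg p q (totalD δ i x) = totalD δ i (der deg p q x) := by
  induction x using word_induction with
  | hnil r => simp
  | hcons j x ih =>
    rw [totalD_consL, map_add, der_consL, der_consL, der_consL, map_add, totalD_mul hδ, ih,
      map_smul, totalD_consL, hq]
    module
  | hadd x y hx hy => simp only [map_add] at *; rw [hx, hy]

/-- Koszul relations and total derivatives in one polynomial degree. -/
def locSub (δ : ι → R →ₗ[ℂ] R) (deg : A → ℤ) : Submodule ℂ (JetPoly R ι A) :=
  koszulRel R deg ⊔ ⨆ i, LinearMap.range (totalD δ i)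

theorem mem_locRel {F : JetSeries R ι A} : F ∈ locRel δ deg ↔ ∀ n, F n ∈ locSub δ deg := by
  simp [locRel, locSub, Submodule.mem_pi]

theorem mem_symRel {F : JetSeries R ι A} : F ∈ symRel R ι deg ↔ ∀ n, F n ∈ koszulRel R deg := by
  simp [symRel, Submodule.mem_pi]

theorem koszul_le_locSub : koszulRel R deg ≤ locSub δ deg := le_sup_left

theorem totalD_mem_locSub (i : ι) (x : JetPoly R ι A) : totalD δ i x ∈ locSub δ deg :=
  le_sup_right (a := koszulRel R deg) (le_iSup (fun i => LinearMap.range (totalD δ i)) i ⟨x, rfl⟩)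

theorem locSub_induction {M : Type*} [AddCommGroup M] [Module ℂ M] (T : JetPoly R ι A →ₗ[ℂ] M)
    {N : Submodule ℂ M} (h1 : ∀ x ∈ koszulRel R deg, T x ∈ N) (h2 : ∀ i x, T (totalD δ i x) ∈ N)
    {x : JetPoly R ι A} (hx : x ∈ locSub δ deg) : T x ∈ N := by
  revert x
  change locSub δ deg ≤ N.comap T
  refine sup_le h1 (iSup_le fun i => ?_)
  rintro _ ⟨x, rfl⟩
  exact h2 i x

theorem der_mem_locSub {p : ℤ} {m : ℕ} {q : A × (ι →₀ ℕ) → JetPoly R ι A} (hδ : CommDer δ)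
    (hq : IsHomogFamily deg p m q) (hq' : IsEvolutionary δ q)
    {z : JetPoly R ι A} (hz : z ∈ locSub δ deg) : der deg p q z ∈ locSub δ deg :=
  locSub_induction _ (fun _ hx => koszul_le_locSub (der_mem_koszul hq hx))
    (fun i x => by rw [der_totalD hδ hq']; exact totalD_mem_locSub i _) hz

end Koszul

section Euler

variable {R ι A : Type} [CommRing R] [Algebra ℂ R] {deg : A → ℤ}
  {δ : ι → R →ₗ[ℂ] R}

/-! ### Symbols of variational derivatives -/

/-- Finitely supported families of polynomials indexed by multi-indices. -/
abbrev EPoly (R ι A : Type) [CommRing R] : Type := (ι →₀ ℕ) →₀ JetPoly R ι A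

/-- Action of a linear map on the members of a family. -/
def mapE (T : JetPoly R ι A →ₗ[ℂ] JetPoly R ι A) : EPoly R ι A →ₗ[ℂ] EPoly R ι A :=
  Finsupp.mapRange.linearMap T

@[simp] theorem mapE_single (T : JetPoly R ι A →ₗ[ℂ] JetPoly R ι A) (K : ι →₀ ℕ)
    (x : JetPoly R ι A) : mapE T (Finsupp.single K x) = Finsupp.single K (T x) := by
  simp [mapE]

theorem mapE_apply (T : JetPoly R ι A →ₗ[ℂ] JetPoly R ι A) (e : EPoly R ι A) (K : ι →₀ ℕ) :
    mapE T e K = T (e K) := by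
  simp [mapE]

/-- Right multiplication of the members of a family. -/
def mulE : EPoly R ι A →ₗ[ℂ] JetPoly R ι A →ₗ[ℂ] EPoly R ι A :=
  Finsupp.lsum ℂ fun K => mulL.compr₂ (Finsupp.lsingle K)

@[simp] theorem mulE_single (K : ι →₀ ℕ) (x y : JetPoly R ι A) :
    mulE (Finsupp.single K x) y = Finsupp.single K (x ⋆ y) := by
  simp [mulE]

/-- Families with members in a given subspace. -/
def EAll (P : Submodule ℂ (JetPoly R ι A)) : Submodule ℂ (EPoly R ι A) where
  carrier := {e | ∀ K, e K ∈ P}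
  zero_mem' _ := zero_mem P
  add_mem' h h' K := add_mem (h K) (h' K)
  smul_mem' c _ h K := P.smul_mem c (h K)

theorem EAll_induction {P : Submodule ℂ (JetPoly R ι A)} {Q : EPoly R ι A → Prop} (h0 : Q 0)
    (hadd : ∀ e e', Q e → Q e' → Q (e + e')) (h : ∀ K, ∀ x ∈ P, Q (Finsupp.single K x))
    {e : EPoly R ι A} (he : e ∈ EAll P) : Q e := by
  rw [← e.sum_single]
  exact Finset.sum_induction _ Q hadd h0 fun K _ => h K _ (he K)

theorem single_mem_EAll {P : Submodule ℂ (JetPoly R ι A)} (K : ι →₀ ℕ) {x : JetPoly R ι A}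
    (hx : x ∈ P) : Finsupp.single K x ∈ EAll P := fun K' => by
  classical
  rw [Finsupp.single_apply]
  split_ifs
  exacts [hx, zero_mem P]

theorem mapE_mem {P P' : Submodule ℂ (JetPoly R ι A)} {T : JetPoly R ι A →ₗ[ℂ] JetPoly R ι A}
    (hT : ∀ x ∈ P, T x ∈ P') {e : EPoly R ι A} (he : e ∈ EAll P) : mapE T e ∈ EAll P' :=
  fun K => by rw [mapE_apply]; exact hT _ (he K)

/-- Shift of the multi-index. -/
def shiftE (i : ι) : EPoly R ι A →ₗ[ℂ] EPoly R ι A :=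
  Finsupp.lmapDomain _ ℂ (· + Finsupp.single i 1)

@[simp] theorem shiftE_single (i : ι) (K : ι →₀ ℕ) (x : JetPoly R ι A) :
    shiftE i (Finsupp.single K x) = Finsupp.single (K + Finsupp.single i 1) x := by
  simp [shiftE]

theorem mapE_consL_smul (j : A × (ι →₀ ℕ)) (r : R) (e : EPoly R ι A) :
    mapE (consL j) (r • e) = r • mapE (consL j) e := by
  ext1 K
  rw [mapE_apply, Finsupp.smul_apply, Finsupp.smul_apply, mapE_apply, consL_smul]

/-- The total degree of a multi-index, as an exponent of a sign. -/
def signK (K : ι →₀ ℕ) : ℂ := (-1) ^ (K.sum fun _ e => e)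

@[simp] theorem signK_zero : signK (0 : ι →₀ ℕ) = 1 := by simp [signK]

theorem signK_add_single (K : ι →₀ ℕ) (i : ι) : signK (K + Finsupp.single i 1) = -signK K := by
  classical
  rw [signK, Finsupp.sum_add_index' (by simp) (by simp), pow_add]
  simp [signK]

section PD

variable [DecidableEq A]

/-- Auxiliary recursion for `pdAll`. -/
def pdWord (deg : A → ℤ) (a : A) : List (A × (ι →₀ ℕ)) → EPoly R ι A
  | [] => 0
  | j :: w => (if j.1 = a then Finsupp.single j.2 (Finsupp.single w 1) else 0)
      + sgn (deg a * deg j.1) • mapE (consL j) (pdWord deg a w)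

/-- The family of left partial derivatives `∂/∂u^a_K`. -/
def pdAll (deg : A → ℤ) (a : A) : JetPoly R ι A →ₗ[ℂ] EPoly R ι A :=
  Finsupp.lsum ℂ fun w =>
    (LinearMap.toSpanSingleton R (EPoly R ι A) (pdWord deg a w)).restrictScalars ℂ

@[simp] theorem pdAll_nil (a : A) (r : R) :
    pdAll (ι := ι) deg a (Finsupp.single [] r) = 0 := by
  simp [pdAll, pdWord]

theorem pdAll_consL (a : A) (j : A × (ι →₀ ℕ)) (x : JetPoly R ι A) :
    pdAll deg a (consL j x) = (if j.1 = a then Finsupp.single j.2 x else 0)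
      + sgn (deg a * deg j.1) • mapE (consL j) (pdAll deg a x) := by
  induction x using Finsupp.induction_linear with
  | zero => simp
  | add x y hx hy =>
    simp only [map_add, smul_add, Finsupp.single_add] at *; rw [hx, hy]; split_ifs <;> abel
  | single w r =>
    simp only [consL_single, pdAll, Finsupp.lsum_single, LinearMap.coe_restrictScalars,
      LinearMap.toSpanSingleton_apply, pdWord, smul_add, mapE_consL_smul]
    congr 1
    · split_ifs <;> simp
    · rw [smul_comm]

theorem pdAll_single (a : A) (w : List (A × (ι →₀ ℕ))) (r : R) :
    pdAll deg a (Finsupp.single w r) = ∑ k : Fin w.length, if (w.get k).1 = a then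
      Finsupp.single (w.get k).2
        (sgn (deg a * wordDeg deg (w.take k)) • Finsupp.single (w.eraseIdx k) r) else 0 := by
  induction w with
  | nil => simp
  | cons j w ih =>
    rw [← consL_single, pdAll_consL, ih, map_sum, Finset.smul_sum]
    simp only [List.length_cons, Fin.sum_univ_succ]
    congr 1
    · simp
    · refine Finset.sum_congr rfl fun k _ => ?_
      simp only [List.get_cons_succ', Fin.val_succ, List.take_succ_cons, wordDeg_cons,
        List.eraseIdx_cons_succ, mul_add, sgn_add]
      split_ifs
      · rw [mapE_single, map_smul, consL_single, Finsupp.smul_single, smul_smul]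
      · simp

/-- The commutation rule `[∂/∂u_K, D_i] = ∂/∂u_{K - e_i}`. For the whole family the lowered index
becomes a shift, so no case distinction on `K i = 0` is needed. -/
theorem pdAll_totalD (a : A) (i : ι) (x : JetPoly R ι A) :
    pdAll deg a (totalD δ i x) = mapE (totalD δ i) (pdAll deg a x) + shiftE i (pdAll deg a x) := by
  induction x using word_induction with
  | hnil r => simp
  | hcons j x ih =>
    have h : mapE (totalD δ i) (mapE (consL j) (pdAll deg a x)) =
        mapE (consL (j.1, j.2 + Finsupp.single i 1)) (pdAll deg a x) +
          mapE (consL j) (mapE (totalD δ i) (pdAll deg a x)) := by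
      ext1 K
      simp [mapE_apply, totalD_consL]
    have h' : shiftE i (mapE (consL j) (pdAll deg a x)) =
        mapE (consL j) (shiftE i (pdAll deg a x)) := by
      induction pdAll deg a x using Finsupp.induction_linear with
      | zero => simp
      | add x y hx hy => simp only [map_add] at *; rw [hx, hy]
      | single K x => simp
    rw [totalD_consL, map_add, pdAll_consL, pdAll_consL, pdAll_consL, ih]
    simp only [map_add, map_smul, h, h', smul_add]
    split_ifs <;> simp <;> abel
  | hadd x y hx hy => simp only [map_add] at *; rw [hx, hy]; abel

theorem pdAll_mem_koszul (a : A) {x : JetPoly R ι A} (hx : x ∈ koszulRel R deg) :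
    pdAll deg a x ∈ EAll (koszulRel R deg) := by
  refine koszul_induction (M := EPoly R ι A) (pdAll deg a) (fun x y z => ?_) (fun j z hz h => ?_) hx
  · have h : pdAll deg a (consL x (consL y z) - sgn (deg x.1 * deg y.1) • consL y (consL x z)) =
        (sgn (deg a * deg x.1) * sgn (deg a * deg y.1)) • (mapE (consL x) (mapE (consL y)
          (pdAll deg a z)) - sgn (deg x.1 * deg y.1) • mapE (consL y) (mapE (consL x)
          (pdAll deg a z))) := by
      rw [map_sub, map_smul]
      simp only [pdAll_consL, map_add, map_smul, smul_add]
      -- The terms in which one of the two swapped letters is differentiated cancel exactly, in each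
      -- of the four cases. Only the terms keeping both letters remain, and those are again swaps.
      by_cases hx : x.1 = a <;> by_cases hy : y.1 = a
      · subst hx
        have e := sgn_mul_self (deg x.1 * deg x.1)
        simp only [hy, if_true, mapE_single]
        match_scalars <;> first | ring1 | linear_combination e | linear_combination (-1) * e
      · subst hx
        have e := sgn_mul_self (deg x.1 * deg y.1)
        simp only [hy, if_true, if_false, mapE_single, map_zero]
        match_scalars
        · linear_combination (-1) * e
        · ring
        · ring
      · subst hy
        have e : sgn (deg y.1 * deg x.1) = sgn (deg x.1 * deg y.1) := by rw [mul_comm]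
        simp only [hx, if_true, if_false, mapE_single, map_zero]
        match_scalars
        · linear_combination e
        · ring
        · ring
      · simp only [hx, hy, if_false, map_zero]
        match_scalars
        · ring
        · ring
    rw [h]
    refine Submodule.smul_mem _ _ fun K => ?_
    simpa [mapE_apply] using consL_consL_mem_koszul x y (pdAll deg a z K)
  · rw [pdAll_consL]
    refine add_mem ?_ (Submodule.smul_mem _ _ (mapE_mem (fun _ => consL_mem_koszul j) h))
    split_ifs
    exacts [single_mem_EAll _ hz, zero_mem _]

/-- The subtraction `n - 1` is truncated at `n = 0`, harmlessly: the empty word has no partial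
derivatives. -/
theorem pdAll_mem_homog (a : A) {n : ℕ} {k : ℤ} {x : JetPoly R ι A} (hx : x ∈ homog R deg n k) :
    pdAll deg a x ∈ EAll (homog R deg (n - 1) (k - deg a)) := by
  refine homog_le_comap (M := EPoly R ι A) (pdAll deg a) (fun w r h h' => ?_) hx
  rw [pdAll_single]
  refine Submodule.sum_mem _ fun l _ => ?_
  split_ifs with hl
  · refine single_mem_EAll _ (Submodule.smul_mem _ _ (single_mem_homog ?_ ?_))
    · rw [List.length_eraseIdx_of_lt l.2, h]
    · subst hl h'
      have := (List.getElem_cons_eraseIdx_perm (l := w) l.2).map (fun j => deg j.1)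
      have := this.sum_eq
      simp only [List.map_cons, List.sum_cons] at this
      simp only [wordDeg, ← this]
      simp
  · exact zero_mem _

end PD

/-! ### The variational derivative -/

section Sig

variable [Fintype ι]

/-- The operator `∑_K (-1)^{|K|} D^K`. -/
def Sig (δ : ι → R →ₗ[ℂ] R) : EPoly R ι A →ₗ[ℂ] JetPoly R ι A :=
  Finsupp.lsum ℂ fun K => signK K • totalDPow δ K

@[simp] theorem Sig_single (K : ι →₀ ℕ) (x : JetPoly R ι A) :
    Sig δ (Finsupp.single K x) = signK K • totalDPow δ K x := by
  simp [Sig]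

theorem Sig_mapE (hδ : CommDer δ) {T : JetPoly R ι A →ₗ[ℂ] JetPoly R ι A}
    (h : ∀ i x, T (totalD δ i x) = totalD δ i (T x)) (e : EPoly R ι A) :
    Sig δ (mapE T e) = T (Sig δ e) := by
  induction e using Finsupp.induction_linear with
  | zero => simp
  | add x y hx hy => simp only [map_add] at *; rw [hx, hy]
  | single K x => rw [mapE_single, Sig_single, Sig_single, map_smul, comm_totalDPow' hδ T h]

theorem Sig_shiftE (hδ : CommDer δ) (i : ι) (e : EPoly R ι A) :
    Sig δ (shiftE i e) = -totalD δ i (Sig δ e) := by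
  induction e using Finsupp.induction_linear with
  | zero => simp
  | add x y hx hy => simp only [map_add] at *; rw [hx, hy]; abel
  | single K x =>
    rw [shiftE_single, Sig_single, Sig_single, map_smul, totalDPow_add_single hδ, signK_add_single,
      neg_smul]; rfl

theorem Sig_mem {P : Submodule ℂ (JetPoly R ι A)} (hδ : CommDer δ)
    (hP : ∀ i, ∀ x ∈ P, totalD δ i x ∈ P) {e : EPoly R ι A} (he : e ∈ EAll P) : Sig δ e ∈ P :=
  EAll_induction (Q := fun e => Sig δ e ∈ P) (by simp)
    (fun e e' h h' => by rw [map_add]; exact add_mem h h')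
    (fun K x hx => by
      rw [Sig_single]
      exact P.smul_mem _ (totalDPow_map hδ K (P := fun x => x ∈ P) hP hx)) he

theorem Sig_mem_koszul (hδ : CommDer δ) {e : EPoly R ι A} (he : e ∈ EAll (koszulRel R deg)) :
    Sig δ e ∈ koszulRel R deg :=
  Sig_mem hδ (fun i _ hx => totalD_mem_koszul i hx) he

variable [DecidableEq A]

/-- Separates the partial derivatives from the integration by parts: identities are first proved for
the family `pdAll` and then transported through `Sig`. -/
theorem euler_eq (a : A) (x : JetPoly R ι A) : euler δ deg a x = Sig δ (pdAll deg a x) := by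
  change euler δ deg a x = (Sig δ ∘ₗ pdAll deg a) x
  congr 1
  refine Finsupp.lhom_ext' fun w => ?_
  ext1 r
  simp only [LinearMap.comp_apply, Finsupp.lsingle_apply, pdAll_single, map_sum]
  simp only [euler, Finsupp.lsum_single, LinearMap.sum_apply]
  refine Finset.sum_congr rfl fun k _ => ?_
  split_ifs
  · rw [Sig_single, map_smul, smul_smul, mul_comm]; rfl
  · simp

/-- `Sig` turns the index shift in `pdAll_totalD` into `-D_i`, which cancels the other summand. -/
theorem euler_totalD (hδ : CommDer δ) (a : A) (i : ι) (x : JetPoly R ι A) :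
    euler δ deg a (totalD δ i x) = 0 := by
  rw [euler_eq, pdAll_totalD, map_add, Sig_shiftE hδ, Sig_mapE hδ (fun i' x => totalD_comm hδ i i' x),
    add_neg_cancel]

theorem euler_mem_koszul (hδ : CommDer δ) (a : A) {x : JetPoly R ι A} (hx : x ∈ koszulRel R deg) :
    euler δ deg a x ∈ koszulRel R deg := by
  rw [euler_eq]; exact Sig_mem_koszul hδ (pdAll_mem_koszul a hx)

theorem euler_mem_koszul_of_locSub (hδ : CommDer δ) (a : A) {x : JetPoly R ι A}
    (hx : x ∈ locSub δ deg) : euler δ deg a x ∈ koszulRel R deg :=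
  locSub_induction _ (fun _ => euler_mem_koszul hδ a) (fun i x => by
    rw [euler_totalD hδ]; exact zero_mem _) hx

theorem euler_mem_homog (hδ : CommDer δ) (a : A) {n : ℕ} {k : ℤ} {x : JetPoly R ι A}
    (hx : x ∈ homog R deg n k) : euler δ deg a x ∈ homog R deg (n - 1) (k - deg a) := by
  rw [euler_eq]
  exact Sig_mem hδ (fun i _ hx => totalD_mem_homog i hx) (pdAll_mem_homog a hx)

end Sig

end Euler

/-! ### The first variation formula, Euler's identity and variational derivatives of derivations. -/

section EulerFormulas

variable {R ι A : Type} [CommRing R] [Algebra ℂ R] {deg : A → ℤ}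
  {δ : ι → R →ₗ[ℂ] R}

theorem EAll_congr_iff {e e' : EPoly R ι A} :
    e ≡ e' [SMOD EAll (koszulRel R deg)] ↔ ∀ K, e K ≡ e' K [SMOD koszulRel R deg] := by
  simp only [SModEq.sub_mem]; rfl

theorem mulE_apply (e : EPoly R ι A) (y : JetPoly R ι A) (K : ι →₀ ℕ) :
    mulE e y K = e K ⋆ y := by
  classical
  induction e using Finsupp.induction_linear with
  | zero => simp
  | add e e' h h' => simp only [map_add, LinearMap.add_apply, Finsupp.add_apply] at *; rw [h, h']
  | single K' x =>
    rw [mulE_single, Finsupp.single_apply, Finsupp.single_apply]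
    split_ifs <;> simp

theorem mulE_consL {m : ℕ} {k : ℤ} {e : EPoly R ι A} (he : e ∈ EAll (homog R deg m k))
    (j : A × (ι →₀ ℕ)) (x : JetPoly R ι A) :
    mulE e (consL j x) ≡ sgn (k * deg j.1) • mapE (consL j) (mulE e x)
      [SMOD EAll (koszulRel R deg)] := by
  rw [EAll_congr_iff]
  intro K
  rw [mulE_apply, Finsupp.smul_apply, mapE_apply, mulE_apply]
  exact mul_consL_swap (he K) j x

theorem mapE_mulL_congr {m n : ℕ} {k l : ℤ} {x : JetPoly R ι A} (hx : x ∈ homog R deg m k)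
    {e : EPoly R ι A} (he : e ∈ EAll (homog R deg n l)) :
    mapE (mulL x) e ≡ sgn (k * l) • mulE e x [SMOD EAll (koszulRel R deg)] := by
  rw [EAll_congr_iff]
  intro K
  rw [Finsupp.smul_apply, mapE_apply, mulE_apply]
  exact mul_swap hx (he K)

theorem IsEvolutionary.eq_totalDPow [Fintype ι] (hδ : CommDer δ)
    {q : A × (ι →₀ ℕ) → JetPoly R ι A} (hq : IsEvolutionary δ q) (a : A) (K : ι →₀ ℕ) :
    q (a, K) = totalDPow δ K (q (a, 0)) := by
  induction K using multiindex_induction with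
  | h0 => simp
  | h1 K i ih =>
    have := hq (a, K) i
    simp only at this
    rw [this, ih, totalDPow_add_single hδ]; rfl

/-- The even derivation fixing every letter counts letters. It is the source of the factor `n` in
Euler's identity and in the homotopy formulas below. -/
theorem der_letter_eq {n : ℕ} {k : ℤ} {x : JetPoly R ι A} (hx : x ∈ homog R deg n k) :
    der deg 0 (letter R) x = (n : ℂ) • x := by
  have key : ∀ (r : R) (w : List (A × (ι →₀ ℕ))), der deg 0 (letter R) (Finsupp.single w r) =
      (w.length : ℂ) • Finsupp.single w r := fun r w => by
    induction w with
    | nil => simp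
    | cons j w ih =>
      rw [← consL_single, der_consL, ih]
      simp [add_smul, add_comm]
  exact homog_induction (P := fun x => der deg 0 (letter R) x = (n : ℂ) • x) (by simp)
    (fun x y hx hy => by simp [hx, hy]) (fun w r h _ => h ▸ key r w) hx

/-- Integration by parts, one total derivative at a time. -/
theorem totalDPow_mul_congr [Fintype ι] (hδ : CommDer δ) (K : ι →₀ ℕ) (x y : JetPoly R ι A) :
    totalDPow δ K x ⋆ y ≡ signK K • (x ⋆ totalDPow δ K y) [SMOD locSub δ deg] := by
  induction K using multiindex_induction generalizing y with
  | h0 => simp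
  | h1 K i ih =>
    rw [totalDPow_add_single hδ, Module.End.mul_apply, signK_add_single, Module.End.mul_apply,
      neg_smul, comm_totalDPow' hδ (totalD δ i) (fun i' x => totalD_comm hδ i i' x) K y]
    refine SModEq.trans ?_ (SModEq.neg' (ih (totalD δ i y)))
    rw [SModEq.sub_mem, sub_neg_eq_add, ← totalD_mul hδ]
    exact totalD_mem_locSub i _

section

variable [DecidableEq A] [Fintype A]

variable {p : ℤ} {m : ℕ} {q : A × (ι →₀ ℕ) → JetPoly R ι A}

/-- The operator `∑_L q(b, L) · ∂/∂u^b_L` on symbols. -/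
def pairE (q : A × (ι →₀ ℕ) → JetPoly R ι A) (b : A) : EPoly R ι A →ₗ[ℂ] JetPoly R ι A :=
  Finsupp.lsum ℂ fun L => mulL (q (b, L))

/-- The chain rule. It holds only modulo Koszul relations, because `pairE` writes the value
replacing a letter at the front of the word instead of in its place. -/
theorem der_congr_pairE (hq : IsHomogFamily deg p m q) (x : JetPoly R ι A) :
    der deg p q x ≡ ∑ b, pairE q b (pdAll deg b x) [SMOD koszulRel R deg] := by
  have key : ∀ (b : A) (j : A × (ι →₀ ℕ)) (e : EPoly R ι A), pairE q b (mapE (consL j) e) ≡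
      sgn ((deg b - p) * deg j.1) • consL j (pairE q b e) [SMOD koszulRel R deg] := by
    intro b j e
    induction e using Finsupp.induction_linear with
    | zero => simp
    | add e e' h h' => simpa using h.add h'
    | single L x =>
      rw [mapE_single]
      simpa [pairE] using mul_consL_swap (hq (b, L)) j x
  induction x using word_induction with
  | hnil r => simp
  | hcons j x ih =>
    simp only [der_consL, pdAll_consL, map_add, Finset.sum_add_distrib, map_smul]
    refine SModEq.add ?_ (((consL_congr j ih).smul _).trans ?_)
    · rw [Finset.sum_eq_single j.1]
      · simp [pairE]
      · intro b _ hb; simp [Ne.symm hb]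
      · simp
    · rw [map_sum, Finset.smul_sum]
      refine SModEq.sum' fun b _ => ?_
      refine SModEq.symm (((key b j _).smul _).trans ?_)
      rw [smul_smul, ← sgn_add, sgn_eq_of_even (b := p * deg j.1)]
      exact ⟨deg b * deg j.1 - p * deg j.1, by ring⟩
  | hadd x y hx hy => simpa [Finset.sum_add_distrib] using hx.add hy

end

variable [Fintype ι] [DecidableEq A]

/-- The operator `(F, H) ↦ ∑_K (-1)^{|K|} D^K (∂F/∂u^a_K · H)`, which is adjoint to the
linearization of `F`. -/
def linAdj (δ : ι → R →ₗ[ℂ] R) (deg : A → ℤ) (a : A) (x y : JetPoly R ι A) : JetPoly R ι A :=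
  Sig δ (mulE (pdAll deg a x) y)

/-- The linearization of `D_i x` is `D_i` after the linearization of `x`; taking adjoints puts
`-D_i` on the argument `y`. -/
theorem linAdj_totalD (hδ : CommDer δ) (a : A) (i : ι) (x y : JetPoly R ι A) :
    linAdj δ deg a (totalD δ i x) y = -linAdj δ deg a x (totalD δ i y) := by
  have h1 : ∀ e : EPoly R ι A, mulE (shiftE i e) y = shiftE i (mulE e y) := fun e => by
    induction e using Finsupp.induction_linear with
    | zero => simp
    | add e e' h h' => simp only [map_add, LinearMap.add_apply] at *; rw [h, h']
    | single K x => simp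
  have h2 : mapE (totalD δ i) (mulE (pdAll deg a x) y) =
      mulE (mapE (totalD δ i) (pdAll deg a x)) y + mulE (pdAll deg a x) (totalD δ i y) := by
    ext1 K
    rw [Finsupp.add_apply, mulE_apply, mapE_apply, mapE_apply, mulE_apply, mulE_apply,
      totalD_mul hδ]
  have h3 := congrArg (Sig δ) h2
  rw [map_add, Sig_mapE hδ (fun i' x => totalD_comm hδ i i' x)] at h3
  rw [linAdj, pdAll_totalD, map_add, LinearMap.add_apply, h1, map_add, Sig_shiftE hδ, h3, linAdj]
  abel

theorem linAdj_totalDPow (hδ : CommDer δ) (a : A) (K : ι →₀ ℕ) (x y : JetPoly R ι A) :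
    linAdj δ deg a (totalDPow δ K x) y = signK K • linAdj δ deg a x (totalDPow δ K y) := by
  induction K using multiindex_induction generalizing y with
  | h0 => simp
  | h1 K i ih =>
    rw [totalDPow_add_single hδ, Module.End.mul_apply, linAdj_totalD hδ, ih, signK_add_single,
      neg_smul, Module.End.mul_apply,
      comm_totalDPow' hδ (totalD δ i) (fun i' x => totalD_comm hδ i i' x)]

theorem linAdj_smul_right (a : A) (c : ℂ) (x y : JetPoly R ι A) :
    linAdj δ deg a x (c • y) = c • linAdj δ deg a x y := by simp [linAdj]

theorem linAdj_add_right (a : A) (x y z : JetPoly R ι A) :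
    linAdj δ deg a x (y + z) = linAdj δ deg a x y + linAdj δ deg a x z := by simp [linAdj]

theorem linAdj_sum_left {κ : Type*} (s : Finset κ) (a : A) (x : κ → JetPoly R ι A)
    (y : JetPoly R ι A) :
    linAdj δ deg a (∑ i ∈ s, x i) y = ∑ i ∈ s, linAdj δ deg a (x i) y := by
  simp [linAdj, LinearMap.sum_apply]

theorem linAdj_smul_left (a : A) (c : ℂ) (x y : JetPoly R ι A) :
    linAdj δ deg a (c • x) y = c • linAdj δ deg a x y := by simp [linAdj]

theorem linAdj_sum_right {κ : Type*} (s : Finset κ) (a : A) (x : JetPoly R ι A)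
    (y : κ → JetPoly R ι A) :
    linAdj δ deg a x (∑ i ∈ s, y i) = ∑ i ∈ s, linAdj δ deg a x (y i) := by
  simp [linAdj]

theorem pdAll_mul (a : A) (x y : JetPoly R ι A) :
    pdAll deg a (x ⋆ y) = mulE (pdAll deg a x) y +
      mapE (mulL (twist deg (deg a) x)) (pdAll deg a y) := by
  induction x using word_induction with
  | hnil r =>
    have : ∀ (r : R) (y : JetPoly R ι A), pdAll deg a (r • y) =
        mapE (mulL (Finsupp.single [] r)) (pdAll deg a y) := fun r y => by
      induction y using word_induction with
      | hnil s => rw [Finsupp.smul_single, pdAll_nil, pdAll_nil, map_zero]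
      | hcons j y ih =>
        rw [← consL_smul, pdAll_consL, pdAll_consL, ih, map_add, map_smul]
        congr 1
        · split_ifs <;> simp
        · congr 1; ext1 K; simp [mapE_apply, consL_smul]
      | hadd y y' hy hy' => simp only [smul_add, map_add] at *; rw [hy, hy']
    simp [this]
  | hcons j x ih =>
    rw [consL_mul, pdAll_consL, pdAll_consL, ih, twist_consL]
    ext1 K
    simp only [Finsupp.add_apply, Finsupp.smul_apply, mapE_apply, mulE_apply, map_add, map_smul,
      LinearMap.add_apply, LinearMap.smul_apply, consL_mul, smul_add]
    rw [← add_assoc]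
    congr 2
    split_ifs
    · rw [← mulE_apply, mulE_single]
    · simp
  | hadd x x' hx hx' =>
    have : mapE (mulL (twist deg (deg a) (x + x'))) (pdAll deg a y) =
      mapE (mulL (twist deg (deg a) x)) (pdAll deg a y) +
      mapE (mulL (twist deg (deg a) x')) (pdAll deg a y) := by ext1 K; simp [mapE_apply]
    rw [this]
    simp only [map_add, LinearMap.add_apply]; rw [hx, hx']; abel

/-- The variational derivative of a product. -/
theorem euler_mul (hδ : CommDer δ) (a : A) {m n : ℕ} {k l : ℤ} {x y : JetPoly R ι A}
    (hx : x ∈ homog R deg m k) (hy : y ∈ homog R deg n l) :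
    euler δ deg a (x ⋆ y) ≡ linAdj δ deg a x y + sgn (k * l) • linAdj δ deg a y x
      [SMOD koszulRel R deg] := by
  rw [euler_eq, pdAll_mul, map_add, linAdj, linAdj, ← map_smul]
  refine SModEq.rfl.add (SModEq.map_of_le (M := EPoly R ι A) (Sig δ) (fun _ => Sig_mem_koszul hδ) ?_)
  rw [twist_of_mem hx]
  have h2 : mapE (mulL (sgn (deg a * k) • x)) (pdAll deg a y) =
      sgn (deg a * k) • mapE (mulL x) (pdAll deg a y) := by
    ext1 K; simp [mapE_apply]
  rw [h2]
  refine ((mapE_mulL_congr hx (pdAll_mem_homog a hy)).smul _).trans ?_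
  rw [smul_smul, ← sgn_add]
  rw [sgn_eq_of_even (b := k * l) ⟨0, by ring⟩]

variable {p : ℤ} {m : ℕ} {q : A × (ι →₀ ℕ) → JetPoly R ι A}

theorem pairE_congr (hδ : CommDer δ) (hq : IsEvolutionary δ q) (b : A) (e : EPoly R ι A) :
    pairE q b e ≡ q (b, 0) ⋆ Sig δ e [SMOD locSub δ deg] := by
  induction e using Finsupp.induction_linear with
  | zero => simp
  | add e e' h h' => simpa using h.add h'
  | single L x =>
    simp only [pairE, Finsupp.lsum_single]
    rw [hq.eq_totalDPow hδ, Sig_single, map_smul]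
    exact totalDPow_mul_congr hδ L _ x

/-- The first variation formula. -/
theorem der_congr_euler [Fintype A] (hδ : CommDer δ) (hq : IsHomogFamily deg p m q)
    (hq' : IsEvolutionary δ q) (x : JetPoly R ι A) :
    der deg p q x ≡ ∑ b, q (b, 0) ⋆ euler δ deg b x [SMOD locSub δ deg] := by
  refine ((der_congr_pairE hq x).of_le koszul_le_locSub).trans (SModEq.sum' fun b _ => ?_)
  rw [euler_eq]
  exact pairE_congr hδ hq' b _

/-- Euler's identity for homogeneous functionals. -/
theorem sum_consL_euler [Fintype A] (hδ : CommDer δ) {n : ℕ} {k : ℤ} {x : JetPoly R ι A}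
    (hx : x ∈ homog R deg n k) :
    (n : ℂ) • x ≡ ∑ b, consL (b, 0) (euler δ deg b x) [SMOD locSub δ deg] := by
  rw [← der_letter_eq hx]
  have h1 : IsHomogFamily (R := R) (ι := ι) deg 0 1 (letter R) := fun j =>
    single_mem_homog rfl (by simp)
  have h2 : IsEvolutionary (A := A) δ (letter R) := fun j i => by
    have e : letter R j = consL j (Finsupp.single [] 1) := by simp [letter]
    rw [e, totalD_consL]
    simp only [totalD_nil, letter, consL_single]
    -- The coefficient `1` of a letter could contribute its derivative; the Leibniz rule for `1 * 1`
    -- excludes this.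
    suffices h : δ i 1 = 0 by simp [h]
    have := hδ.leibniz i 1 1
    simpa using this
  simpa using der_congr_euler hδ h1 h2 x

/-- An element of positive degree is a total derivative modulo the Koszul relations if its
variational derivatives vanish. -/
theorem mem_locSub_of_euler [Fintype A] (hδ : CommDer δ) {n : ℕ} {k : ℤ} {x : JetPoly R ι A}
    (hn : n ≠ 0) (hx : x ∈ homog R deg n k) (h : ∀ b, euler δ deg b x ∈ koszulRel R deg) :
    x ∈ locSub δ deg := by
  have h1 := ((sum_consL_euler hδ hx).mem_iff).2 (Submodule.sum_mem _ fun b _ =>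
    koszul_le_locSub (consL_mem_koszul _ (h b)))
  have := Submodule.smul_mem _ (n : ℂ)⁻¹ h1
  rwa [smul_smul, inv_mul_cancel₀ (by exact_mod_cast hn), one_smul] at this

/-- The variational derivative of the derivative along an evolutionary derivation. -/
theorem euler_der [Fintype A] (hδ : CommDer δ) (hq : IsHomogFamily deg p m q)
    (hq' : IsEvolutionary δ q) (a : A) (x : JetPoly R ι A) :
    euler δ deg a (der deg p q x) ≡ sgn (p * deg a) • der deg p q (euler δ deg a x) +
      ∑ b, linAdj δ deg a (q (b, 0)) (euler δ deg b x) [SMOD koszulRel R deg] := by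
  -- The second-order part of the chain rule: the coefficient of `∂/∂u^b_L` is multiplied from the
  -- left by the partial derivatives of the value `q (b, L)`.
  let RR : A → EPoly R ι A →ₗ[ℂ] EPoly R ι A := fun b =>
    Finsupp.lsum ℂ fun L => mulE (pdAll deg a (q (b, L)))
  have hRR : ∀ b L x, RR b (Finsupp.single L x) = mulE (pdAll deg a (q (b, L))) x := fun b L x => by
    simp [RR]
  have key : ∀ (b : A) (j : A × (ι →₀ ℕ)) (e : EPoly R ι A), RR b (mapE (consL j) e) ≡
      sgn ((deg b - p - deg a) * deg j.1) • mapE (consL j) (RR b e)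
        [SMOD EAll (koszulRel R deg)] := by
    intro b j e
    induction e using Finsupp.induction_linear with
    | zero => simp
    | add e e' h h' => simpa using h.add h'
    | single L x =>
      rw [mapE_single, hRR, hRR]
      exact mulE_consL (pdAll_mem_homog a (hq (b, L))) j x
  -- The formula before integration by parts: a partial derivative of `der q x` either meets an
  -- untouched letter of `x` or falls on an inserted value of `q`.
  have main : pdAll deg a (der deg p q x) ≡ sgn (p * deg a) • mapE (der deg p q) (pdAll deg a x) +
      ∑ b, RR b (pdAll deg b x) [SMOD EAll (koszulRel R deg)] := by
    induction x using word_induction with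
    | hnil r => simp
    | hcons j x ih =>
      have e1 : sgn (deg a * (deg j.1 - p)) = sgn (p * deg a) * sgn (deg a * deg j.1) := by
        rw [← sgn_add]; exact sgn_eq_of_even ⟨-(p * deg a), by ring⟩
      have h1 : mapE (mulL (twist deg (deg a) (q j))) (pdAll deg a x) =
          (sgn (p * deg a) * sgn (deg a * deg j.1)) • mapE (mulL (q j)) (pdAll deg a x) := by
        ext1 K; simp [mapE_apply, twist_of_mem (hq j), e1]
      have h2 : mapE (der deg p q) (mapE (consL j) (pdAll deg a x)) =
          mapE (mulL (q j)) (pdAll deg a x) + sgn (p * deg j.1) •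
            mapE (consL j) (mapE (der deg p q) (pdAll deg a x)) := by
        ext1 K; simp [mapE_apply, der_consL]
      have h3 : sgn (p * deg j.1) • (if j.1 = a then
            (Finsupp.single j.2 (der deg p q x) : EPoly R ι A) else 0) =
          sgn (p * deg a) • mapE (der deg p q) (if j.1 = a then Finsupp.single j.2 x else 0) := by
        split_ifs with h
        · rw [mapE_single, h]
        · simp
      have h4 : ∑ b, RR b (pdAll deg b (consL j x)) ≡ mulE (pdAll deg a (q j)) x +
          (sgn (p * deg j.1) * sgn (deg a * deg j.1)) •
            ∑ b, mapE (consL j) (RR b (pdAll deg b x)) [SMOD EAll (koszulRel R deg)] := by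
        simp only [pdAll_consL, map_add, Finset.sum_add_distrib, map_smul]
        refine SModEq.add ?_ ?_
        · rw [Finset.sum_eq_single j.1]
          · rw [if_pos rfl, hRR]
          · intro b _ hb; simp [Ne.symm hb]
          · simp
        · rw [Finset.smul_sum]
          refine SModEq.sum' fun b _ => ((key b j _).smul _).trans ?_
          rw [smul_smul, ← sgn_add, ← sgn_add, sgn_eq_of_even (b := p * deg j.1 + deg a * deg j.1)]
          exact ⟨deg b * deg j.1 - p * deg j.1 - deg a * deg j.1, by ring⟩
      have h5 := SModEq.map_of_le (M := EPoly R ι A) (M' := EPoly R ι A) (mapE (consL j))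
        (fun _ => mapE_mem (fun _ => consL_mem_koszul j)) ih
      refine SModEq.trans ?_ (SModEq.rfl.add h4.symm)
      rw [der_consL, map_add, pdAll_mul, map_smul, pdAll_consL, h1, smul_add, h3, pdAll_consL,
        map_add, map_smul, h2]
      refine (SModEq.rfl.add (SModEq.rfl.add ((h5.smul _).smul _))).trans ?_
      rw [map_add, map_smul, map_sum]
      refine SModEq.of_eq ?_
      module
    | hadd x y hx hy => simpa [Finset.sum_add_distrib, smul_add, add_add_add_comm] using hx.add hy
  -- As `q (b, L) = D^L q (b, 0)`, the adjoint moves `D^L` to the other factor with sign `(-1)^|L|`;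
  -- summing over `L` rebuilds `Sig δ e`.
  have hSig : ∀ b e, Sig δ (RR b e) = linAdj δ deg a (q (b, 0)) (Sig δ e) := by
    intro b e
    induction e using Finsupp.induction_linear with
    | zero => simp [linAdj]
    | add e e' h h' => rw [map_add, map_add, h, h', map_add, linAdj_add_right]
    | single L x =>
      rw [hRR, Sig_single, linAdj_smul_right, ← linAdj_totalDPow hδ, ← hq'.eq_totalDPow hδ]; rfl
  have := SModEq.map_of_le (M := EPoly R ι A) (Sig δ) (fun _ => Sig_mem_koszul hδ) main
  rw [← euler_eq] at this
  refine this.trans ?_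
  rw [map_add, map_smul, Sig_mapE hδ (fun i x => der_totalD hδ hq' i x), map_sum]
  simp only [hSig, euler_eq]
  rfl

end EulerFormulas

section Hamiltonian

variable {R ι A : Type} [CommRing R] [Algebra ℂ R] {deg : A → ℤ} {δ : ι → R →ₗ[ℂ] R}

/-! ### Chevalley–Eilenberg differentials -/

theorem ceDiff_apply (q : ℕ → A × (ι →₀ ℕ) → JetPoly R ι A) (F : JetSeries R ι A) (n : ℕ) :
    ceDiff deg q F n =
      ∑ p ∈ Finset.HasAntidiagonal.antidiagonal (n + 1), der deg 1 (q p.1) (F p.2) := by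
  simp [ceDiff, LinearMap.sum_apply, oddDer_eq_der]

variable {q q' : ℕ → A × (ι →₀ ℕ) → JetPoly R ι A}

theorem ceDiff_mem_lagrangians (hq0 : q 0 = 0) (hq : ∀ m, IsHomogFamily deg 1 m (q m)) {k : ℤ}
    {F : JetSeries R ι A} (hF : F ∈ lagrangians R deg k) :
    ceDiff deg q F ∈ lagrangians R deg (k + 1) := by
  rw [mem_lagrangians] at *
  refine ⟨?_, fun n => ?_⟩
  · rw [ceDiff_apply, Finset.Nat.sum_antidiagonal_succ]
    simp [hq0, hF.1]
  · rw [ceDiff_apply]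
    refine Submodule.sum_mem _ fun p hp => ?_
    rw [Finset.HasAntidiagonal.mem_antidiagonal] at hp
    obtain ⟨m, l⟩ := p
    simp only at hp ⊢
    cases l with
    | zero => simp [hF.1]
    | succ l =>
      have := der_mem_homog (hq m) (hF.2 (l + 1))
      convert this using 2
      · omega
      · ring

theorem ceDiff_mem_symRel (hq : ∀ m, IsHomogFamily deg 1 m (q m)) {F : JetSeries R ι A}
    (hF : F ∈ symRel R ι deg) : ceDiff deg q F ∈ symRel R ι deg := by
  rw [mem_symRel] at *
  intro n
  rw [ceDiff_apply]
  exact Submodule.sum_mem _ fun p _ => der_mem_koszul (hq p.1) (hF p.2)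

theorem ceDiff_mem_locRel (hδ : CommDer δ) (hq : ∀ m, IsHomogFamily deg 1 m (q m))
    (hq' : ∀ m, IsEvolutionary δ (q m)) {F : JetSeries R ι A}
    (hF : F ∈ locRel δ deg) : ceDiff deg q F ∈ locRel δ deg := by
  rw [mem_locRel] at *
  intro n
  rw [ceDiff_apply]
  exact Submodule.sum_mem _ fun p _ => der_mem_locSub hδ (hq p.1) (hq' p.1) (hF p.2)

theorem symRel_le_locRel : symRel R ι deg ≤ locRel δ deg := fun F hF => by
  rw [mem_symRel] at hF
  rw [mem_locRel]
  exact fun n => koszul_le_locSub (hF n)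

theorem smodEq_symRel {F G : JetSeries R ι A} :
    F ≡ G [SMOD symRel R ι deg] ↔ ∀ n, F n ≡ G n [SMOD koszulRel R deg] := by
  simp only [SModEq.sub_mem, mem_symRel, Pi.sub_apply]

theorem smodEq_locRel {F G : JetSeries R ι A} :
    F ≡ G [SMOD locRel δ deg] ↔ ∀ n, F n ≡ G n [SMOD locSub δ deg] := by
  simp only [SModEq.sub_mem, mem_locRel, Pi.sub_apply]

theorem ceDiff_congr (h : ∀ m j, q m j ≡ q' m j [SMOD koszulRel R deg]) (F : JetSeries R ι A) :
    ceDiff deg q F ≡ ceDiff deg q' F [SMOD symRel R ι deg] := by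
  rw [smodEq_symRel]
  intro n
  rw [ceDiff_apply, ceDiff_apply]
  exact SModEq.sum' fun p _ => der_congr_left (h p.1) _

theorem ceDiff_totalD (hδ : CommDer δ) (hq' : ∀ m, IsEvolutionary δ (q m)) (i : ι)
    (F : JetSeries R ι A) :
    ceDiff deg q (fun n => totalD δ i (F n)) = fun n => totalD δ i (ceDiff deg q F n) := by
  funext n
  simp only [ceDiff_apply, map_sum]
  exact Finset.sum_congr rfl fun p _ => der_totalD hδ (hq' p.1) i _

/-- The differential squares to zero if the brackets satisfy the `L_∞`-relations on generators. -/
theorem ceDiff_sq (hq0 : q 0 = 0) (hq : ∀ m, IsHomogFamily deg 1 m (q m))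
    (h : ∀ M j, ∑ p ∈ Finset.HasAntidiagonal.antidiagonal M, der deg 1 (q p.1) (q p.2 j) ∈
      koszulRel R deg) (F : JetSeries R ι A) :
    ceDiff deg q (ceDiff deg q F) ∈ symRel R ι deg := by
  -- The square of an odd derivation is half its commutator with itself, hence an even derivation,
  -- so it is determined modulo relations by its values on letters.
  have key : ∀ M x, ∑ p ∈ Finset.HasAntidiagonal.antidiagonal M,
      der deg 1 (q p.1) (der deg 1 (q p.2) x) ∈ koszulRel R deg := by
    intro M x
    have h1 : ∑ p ∈ Finset.HasAntidiagonal.antidiagonal M,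
        der deg 1 (q p.1) (der deg 1 (q p.2) x) = (1 / 2 : ℂ) •
        der deg (1 + 1) (fun j => (2 : ℂ) • ∑ p ∈ Finset.HasAntidiagonal.antidiagonal M,
          der deg 1 (q p.1) (q p.2 j)) x := by
      -- A single product of two derivations is not a derivation. Symmetrizing the sum over arities
      -- pairs the products into graded commutators, to which `der_comm` applies.
      have hswap : ∀ f : ℕ → ℕ → JetPoly R ι A,
          ∑ p ∈ Finset.HasAntidiagonal.antidiagonal M, f p.1 p.2 = (1 / 2 : ℂ) •
            ∑ p ∈ Finset.HasAntidiagonal.antidiagonal M, (f p.1 p.2 + f p.2 p.1) := by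
        intro f
        rw [Finset.sum_add_distrib]
        have := Finset.Nat.sum_antidiagonal_swap (n := M) (f := fun p : ℕ × ℕ => f p.1 p.2)
        simp only [Prod.fst_swap, Prod.snd_swap] at this
        rw [this, ← two_smul ℂ, smul_smul]
        norm_num
      rw [hswap fun m m' => der deg 1 (q m) (der deg 1 (q m') x)]
      congr 1
      have h2 : (fun j => (2 : ℂ) • ∑ p ∈ Finset.HasAntidiagonal.antidiagonal M,
          der deg 1 (q p.1) (q p.2 j)) = ∑ p ∈ Finset.HasAntidiagonal.antidiagonal M, fun j =>
            der deg 1 (q p.1) (q p.2 j) - sgn (1 * 1) • der deg 1 (q p.2) (q p.1 j) := by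
        funext j
        rw [hswap fun m m' => der deg 1 (q m) (q m' j), smul_smul, Finset.sum_apply]
        norm_num
      rw [h2, der_sum_left, LinearMap.sum_apply]
      refine Finset.sum_congr rfl fun p _ => ?_
      rw [← der_comm (hq p.1) (hq p.2)]
      norm_num
    rw [h1]
    refine Submodule.smul_mem _ _ ?_
    rw [← SModEq.zero]
    refine (der_congr_left (q' := 0) (fun j => ?_) x).trans (by rw [der_zero_left]; rfl)
    exact SModEq.zero.2 (Submodule.smul_mem _ _ (h M j))
  rw [mem_symRel]
  intro n
  -- Two applications replace two letters by `m + m'` new ones, so arities and initial length add up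
  -- to `n + 2`. Extending the outer sum to all of that antidiagonal adds one term, which vanishes
  -- because `q 0 = 0`.
  have h3 : ceDiff deg q (ceDiff deg q F) n = ∑ p ∈ Finset.HasAntidiagonal.antidiagonal (n + 2),
      ∑ p' ∈ Finset.HasAntidiagonal.antidiagonal p.2,
        der deg 1 (q p.1) (der deg 1 (q p'.1) (F p'.2)) := by
    rw [Finset.Nat.sum_antidiagonal_succ', ceDiff_apply]
    simp only [ceDiff_apply, map_sum]
    simp [hq0]
  -- The same triple sum, grouped so that the two derivations form the inner sum, as `key` requires.
  have h4 : ceDiff deg q (ceDiff deg q F) n = ∑ p ∈ Finset.HasAntidiagonal.antidiagonal (n + 2),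
      ∑ p' ∈ Finset.HasAntidiagonal.antidiagonal p.2,
        der deg 1 (q p'.1) (der deg 1 (q p'.2) (F p.1)) := by
    rw [h3, Finset.sum_sigma', Finset.sum_sigma']
    refine Finset.sum_bij' (fun x _ => ⟨(x.2.2, x.1.1 + x.2.1), (x.1.1, x.2.1)⟩)
      (fun x _ => ⟨(x.2.1, x.2.2 + x.1.1), (x.2.2, x.1.1)⟩) ?_ ?_ ?_ ?_ ?_
    · rintro ⟨⟨a, b⟩, ⟨c, e⟩⟩ h
      simp only [Finset.mem_sigma, Finset.HasAntidiagonal.mem_antidiagonal] at h ⊢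
      exact ⟨by omega, trivial⟩
    · rintro ⟨⟨a, b⟩, ⟨c, e⟩⟩ h
      simp only [Finset.mem_sigma, Finset.HasAntidiagonal.mem_antidiagonal] at h ⊢
      exact ⟨by omega, trivial⟩
    · rintro ⟨⟨a, b⟩, ⟨c, e⟩⟩ h
      simp only [Finset.mem_sigma, Finset.HasAntidiagonal.mem_antidiagonal] at h ⊢
      obtain ⟨h, rfl⟩ := h
      rfl
    · rintro ⟨⟨a, b⟩, ⟨c, e⟩⟩ h
      simp only [Finset.mem_sigma, Finset.HasAntidiagonal.mem_antidiagonal] at h ⊢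
      obtain ⟨h, rfl⟩ := h
      rfl
    · rintro ⟨⟨a, b⟩, ⟨c, e⟩⟩ _
      rfl
  rw [h4]
  exact Submodule.sum_mem _ fun p _ => key _ _

/-! ### Hamiltonian derivations -/

variable [Fintype ι] [Fintype A] [DecidableEq A]

/-- The inverse matrix of a pairing for which functionals of degree `g` generate odd Hamiltonian
derivations. -/
structure IsPairing (deg : A → ℤ) (g : ℤ) (π : Matrix A A ℂ) : Prop where
  deg_add : ∀ a b, π a b ≠ 0 → deg a + deg b = 1 - g
  symm : ∀ a b, sgn (deg b) * π b a = sgn ((deg a - 1) * (g + deg a) + deg a) * π a b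

variable {g : ℤ} {π : Matrix A A ℂ} {I : JetSeries R ι A}

theorem hamiltonian_zero (m : ℕ) (a : A) : hamiltonian δ deg π I m (a, 0) =
    ∑ b, (sgn (deg a) * π a b) • euler δ deg b (I (m + 1)) := by
  simp [hamiltonian, sgn]

theorem hamiltonian_eq (m : ℕ) (j : A × (ι →₀ ℕ)) : hamiltonian δ deg π I m j =
    totalDPow δ j.2 (∑ b, (sgn (deg j.1) * π j.1 b) • euler δ deg b (I (m + 1))) := rfl

theorem hamiltonian_eq_zero {m : ℕ} (h : I (m + 1) = 0) : hamiltonian δ deg π I m = 0 := by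
  funext j
  simp [hamiltonian, h]

theorem isEvolutionary_hamiltonian (hδ : CommDer δ) (m : ℕ) :
    IsEvolutionary δ (hamiltonian δ deg π I m) := fun j i => by
  rw [hamiltonian_eq, totalDPow_add_single hδ]; rfl

theorem isHomogFamily_hamiltonian (hδ : CommDer δ) (hπ : IsPairing deg g π)
    (hI : I ∈ lagrangians R deg g) (m : ℕ) :
    IsHomogFamily deg 1 m (hamiltonian δ deg π I m) := fun j => by
  rw [hamiltonian_eq]
  refine totalDPow_mem_homog hδ _ (Submodule.sum_mem _ fun b _ => ?_)
  by_cases h : π j.1 b = 0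
  · simp [h]
  · refine Submodule.smul_mem _ _ ?_
    have := euler_mem_homog hδ b ((mem_lagrangians.1 hI).2 (m + 1))
    have e : deg j.1 - 1 = -g - deg b := by have := hπ.deg_add _ _ h; omega
    rwa [e]

theorem hamiltonian_congr (hδ : CommDer δ) {I' : JetSeries R ι A}
    (h : I ≡ I' [SMOD locRel δ deg]) (m : ℕ) (j : A × (ι →₀ ℕ)) :
    hamiltonian δ deg π I m j ≡ hamiltonian δ deg π I' m j [SMOD koszulRel R deg] := by
  rw [hamiltonian_eq, hamiltonian_eq]
  refine SModEq.map_of_le _ (fun _ => totalDPow_mem_koszul hδ _) (SModEq.sum' fun b _ => ?_)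
  exact (SModEq.map_of_le _ (fun _ => euler_mem_koszul_of_locSub hδ b)
    (smodEq_locRel.1 h (m + 1))).smul _

/-- The polarized derivation property of the variational derivative of the bracket. -/
theorem euler_hamiltonian (hδ : CommDer δ) (hπ : IsPairing deg g π)
    (hI : I ∈ lagrangians R deg g) (m₁ m₂ : ℕ) (c : A) :
    euler δ deg c (der deg 1 (hamiltonian δ deg π I m₂) (I (m₁ + 1))) ≡
      sgn (deg c) • (der deg 1 (hamiltonian δ deg π I m₁) (euler δ deg c (I (m₂ + 1))) +
        der deg 1 (hamiltonian δ deg π I m₂) (euler δ deg c (I (m₁ + 1))))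
      [SMOD koszulRel R deg] := by
  have hI' := (mem_lagrangians.1 hI).2
  have hh := isHomogFamily_hamiltonian hδ hπ hI
  have he := isEvolutionary_hamiltonian (deg := deg) (π := π) (I := I) hδ
  -- The variational derivative of the bracket of `I (m₁ + 1)` with `I (m₂ + 1)` is computed twice:
  -- in `ha` by differentiating along the evolutionary derivation, in `hb` after rewriting the
  -- bracket as a sum of products by the first variation formula.
  have ha := euler_der hδ (hh m₁) (he m₁) c (I (m₂ + 1))
  have hd := euler_der hδ (hh m₂) (he m₂) c (I (m₁ + 1))
  have hb : euler δ deg c (der deg 1 (hamiltonian δ deg π I m₁) (I (m₂ + 1))) ≡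
      ∑ b, (linAdj δ deg c (hamiltonian δ deg π I m₁ (b, 0)) (euler δ deg b (I (m₂ + 1))) +
        sgn ((deg b - 1) * (g + deg b)) • linAdj δ deg c (euler δ deg b (I (m₂ + 1)))
          (hamiltonian δ deg π I m₁ (b, 0))) [SMOD koszulRel R deg] := by
    refine (SModEq.map_of_le _ (fun _ => euler_mem_koszul_of_locSub hδ c)
      (der_congr_euler hδ (hh m₁) (he m₁) _)).trans ?_
    rw [map_sum]
    refine SModEq.sum' fun b _ => ?_
    refine (euler_mul hδ c (hh m₁ (b, 0)) (euler_mem_homog hδ b (hI' (m₂ + 1)))).trans ?_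
    rw [sgn_eq_of_even (b := (deg b - 1) * (g + deg b)) ⟨-((deg b - 1) * (g + deg b)), by ring⟩]
  -- `IsPairing.symm` is calibrated for this identity: the sign from exchanging the factors of a
  -- product is the one from transposing `π`, so the roles of `m₁` and `m₂` are interchanged.
  have hc : ∑ b, sgn ((deg b - 1) * (g + deg b)) • linAdj δ deg c (euler δ deg b (I (m₂ + 1)))
      (hamiltonian δ deg π I m₁ (b, 0)) =
      ∑ b, linAdj δ deg c (hamiltonian δ deg π I m₂ (b, 0)) (euler δ deg b (I (m₁ + 1))) := by
    simp only [hamiltonian_zero, linAdj_sum_left, linAdj_sum_right, Finset.smul_sum]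
    rw [Finset.sum_comm]
    refine Finset.sum_congr rfl fun e _ => Finset.sum_congr rfl fun b _ => ?_
    rw [linAdj_smul_left, linAdj_smul_right, smul_smul, hπ.symm b e, sgn_add, mul_assoc]
  rw [Finset.sum_add_distrib, hc] at hb
  rw [one_mul] at ha hd
  -- Comparing `ha` with `hb` leaves `sgn (deg c) • der h_{m₁} (δI_{m₂}/δu^c)` equal to the `linAdj`
  -- sum occurring in `hd`. Eliminating that sum gives the symmetric formula.
  have hab := ha.symm.trans hb
  rw [SModEq.sub_mem] at hab hd ⊢
  convert Submodule.sub_mem _ hd hab using 1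
  module

variable (δ deg π) in
/-- The bracket of a Lagrangian with itself, in one polynomial degree. -/
theorem bracket_self_apply (hI0 : I 0 = 0) (M : ℕ) :
    bracket δ deg π I I M = ∑ p ∈ Finset.HasAntidiagonal.antidiagonal M,
      der deg 1 (hamiltonian δ deg π I p.1) (I (p.2 + 1)) := by
  rw [bracket, ceDiff_apply, Finset.Nat.sum_antidiagonal_succ']
  simp [hI0]

/-- The right side of `euler_hamiltonian` is symmetric in the two indices, so summing over the
antidiagonal counts each term twice. This is the factor `½` of the master equation. -/
theorem sum_der_euler (hδ : CommDer δ) (hπ : IsPairing deg g π)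
    (hI : I ∈ lagrangians R deg g) (M : ℕ) (c : A) :
    ∑ p ∈ Finset.HasAntidiagonal.antidiagonal M,
      der deg 1 (hamiltonian δ deg π I p.1) (euler δ deg c (I (p.2 + 1))) ≡
      sgn (deg c) • euler δ deg c (((1 / 2 : ℂ) • bracket δ deg π I I) M)
      [SMOD koszulRel R deg] := by
  rw [Pi.smul_apply, bracket_self_apply deg δ π (mem_lagrangians.1 hI).1, map_smul, map_sum]
  have h := SModEq.sum' (s := Finset.HasAntidiagonal.antidiagonal M)
    fun p _ => euler_hamiltonian hδ hπ hI p.2 p.1 c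
  rw [← Finset.smul_sum, Finset.sum_add_distrib] at h
  have hs := Finset.Nat.sum_antidiagonal_swap (n := M) (f := fun p : ℕ × ℕ =>
    der deg 1 (hamiltonian δ deg π I p.1) (euler δ deg c (I (p.2 + 1))))
  simp only [Prod.fst_swap, Prod.snd_swap] at hs
  rw [hs, ← two_smul ℂ] at h
  have := (h.smul (1 / 2 : ℂ)).smul (sgn (deg c))
  refine SModEq.symm (this.trans (SModEq.of_eq ?_))
  have e := sgn_mul_self (deg c)
  match_scalars
  linear_combination e

/-- Computes the square of `{I, -}` on letters: up to signs it is the Hamiltonian field of `½{I,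
I}`, depending on that bracket only through its variational derivatives. Total derivatives in the
master equation are therefore invisible. -/
theorem sum_der_hamiltonian (hδ : CommDer δ) (hπ : IsPairing deg g π)
    (hI : I ∈ lagrangians R deg g) (M : ℕ) (j : A × (ι →₀ ℕ)) :
    ∑ p ∈ Finset.HasAntidiagonal.antidiagonal M,
      der deg 1 (hamiltonian δ deg π I p.1) (hamiltonian δ deg π I p.2 j) ≡
      totalDPow δ j.2 (∑ b, (sgn (deg j.1) * π j.1 b * sgn (deg b)) •
        euler δ deg b (((1 / 2 : ℂ) • bracket δ deg π I I) M)) [SMOD koszulRel R deg] := by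
  have h1 : ∑ p ∈ Finset.HasAntidiagonal.antidiagonal M,
      der deg 1 (hamiltonian δ deg π I p.1) (hamiltonian δ deg π I p.2 j) =
      totalDPow δ j.2 (∑ b, (sgn (deg j.1) * π j.1 b) •
        ∑ p ∈ Finset.HasAntidiagonal.antidiagonal M,
          der deg 1 (hamiltonian δ deg π I p.1) (euler δ deg b (I (p.2 + 1)))) := by
    have h2 : ∀ m₁ m₂, der deg 1 (hamiltonian δ deg π I m₁) (hamiltonian δ deg π I m₂ j) =
        totalDPow δ j.2 (∑ b, (sgn (deg j.1) * π j.1 b) •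
          der deg 1 (hamiltonian δ deg π I m₁) (euler δ deg b (I (m₂ + 1)))) := fun m₁ m₂ => by
      rw [hamiltonian_eq m₂ j, comm_totalDPow' hδ (der deg 1 (hamiltonian δ deg π I m₁))
        (fun i x => der_totalD hδ (isEvolutionary_hamiltonian hδ m₁) i x) j.2 _, map_sum]
      simp only [map_smul]
    rw [Finset.sum_congr rfl fun p _ => h2 p.1 p.2, ← map_sum, Finset.sum_comm]
    simp only [Finset.smul_sum]
  rw [h1]
  refine SModEq.map_of_le _ (fun _ => totalDPow_mem_koszul hδ _) (SModEq.sum' fun b _ => ?_)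
  refine ((sum_der_euler hδ hπ hI M b).smul _).trans ?_
  rw [smul_smul]

end Hamiltonian

/-! ### Wedge signs -/

section Wedge

variable {d : ℕ}

@[simp] theorem wedgeSign_empty_left (T : Finset (Fin d)) : wedgeSign ∅ T = 1 := by
  simp [wedgeSign]

@[simp] theorem wedgeSign_empty_right (T : Finset (Fin d)) : wedgeSign T ∅ = 1 := by
  simp [wedgeSign]

theorem wedgeSign_union_left {S S' : Finset (Fin d)} (h : Disjoint S S') (T : Finset (Fin d)) :
    wedgeSign (S ∪ S') T = wedgeSign S T * wedgeSign S' T := by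
  rw [wedgeSign, wedgeSign, wedgeSign, ← pow_add, Finset.union_product, Finset.filter_union,
    Finset.card_union_of_disjoint]
  refine Finset.disjoint_filter_filter (Finset.disjoint_left.2 ?_)
  rintro ⟨a, b⟩ h1 h2
  exact Finset.disjoint_left.1 h (Finset.mem_product.1 h1).1 (Finset.mem_product.1 h2).1

theorem wedgeSign_union_right {T T' : Finset (Fin d)} (h : Disjoint T T') (S : Finset (Fin d)) :
    wedgeSign S (T ∪ T') = wedgeSign S T * wedgeSign S T' := by
  rw [wedgeSign, wedgeSign, wedgeSign, ← pow_add, Finset.product_union, Finset.filter_union,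
    Finset.card_union_of_disjoint]
  refine Finset.disjoint_filter_filter (Finset.disjoint_left.2 ?_)
  rintro ⟨a, b⟩ h1 h2
  exact Finset.disjoint_left.1 h (Finset.mem_product.1 h1).2 (Finset.mem_product.1 h2).2

theorem wedgeSign_insert_left {i : Fin d} {S : Finset (Fin d)} (h : i ∉ S) (T : Finset (Fin d)) :
    wedgeSign (insert i S) T = wedgeSign {i} T * wedgeSign S T := by
  rw [Finset.insert_eq, wedgeSign_union_left (Finset.disjoint_singleton_left.2 h)]

theorem wedgeSign_insert_right {i : Fin d} {T : Finset (Fin d)} (h : i ∉ T) (S : Finset (Fin d)) :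
    wedgeSign S (insert i T) = wedgeSign S {i} * wedgeSign S T := by
  rw [Finset.insert_eq, wedgeSign_union_right (Finset.disjoint_singleton_left.2 h)]

theorem wedgeSign_mul_self (S T : Finset (Fin d)) : wedgeSign S T * wedgeSign S T = 1 := by
  rw [wedgeSign, ← pow_add, Even.neg_one_pow ⟨_, rfl⟩]

theorem wedgeSign_singleton (i j : Fin d) : wedgeSign {i} {j} = if j < i then -1 else 1 := by
  simp only [wedgeSign, Finset.singleton_product_singleton, Finset.filter_singleton]
  split_ifs <;> simp

theorem wedgeSign_swap_singleton {i j : Fin d} (h : i ≠ j) :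
    wedgeSign {j} {i} = -wedgeSign {i} {j} := by
  rw [wedgeSign_singleton, wedgeSign_singleton]
  rcases lt_or_gt_of_ne h with h' | h'
  · simp [h', not_lt_of_gt h']
  · simp [h', not_lt_of_gt h']

theorem wedgeSign_swap_left {i : Fin d} {S : Finset (Fin d)} (h : i ∉ S) :
    wedgeSign S {i} = sgn S.card * wedgeSign {i} S := by
  induction S using Finset.induction with
  | empty => simp
  | insert j S hj ih =>
    obtain ⟨hij, hS⟩ : i ≠ j ∧ i ∉ S := by simpa using h
    rw [wedgeSign_insert_left hj, wedgeSign_insert_right hj, ih hS, wedgeSign_swap_singleton hij,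
      Finset.card_insert_of_notMem hj]
    push_cast
    rw [sgn_add, sgn_one]
    ring

/-- Anticommutation of two one-forms `d z̄_i`, `d z̄_j`, or of two Koszul generators: it is behind
`∂² = 0` and the anticommutation of contractions. -/
theorem wedgeSign_comm_insert {i j : Fin d} {T : Finset (Fin d)} (hij : i ≠ j) (hi : i ∉ T)
    (hj : j ∉ T) : wedgeSign {i} T * wedgeSign {j} (insert i T) =
      -(wedgeSign {j} T * wedgeSign {i} (insert j T)) := by
  rw [wedgeSign_insert_right hi, wedgeSign_insert_right hj, wedgeSign_swap_singleton hij]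
  ring

end Wedge

/-! ### Projection to homogeneous elements -/

section Projection

variable {R ι A : Type} [CommRing R] [Algebra ℂ R]

open Classical in
/-- The projection to a homogeneous component. -/
def projHomog (deg : A → ℤ) (n : ℕ) (k : ℤ) : JetPoly R ι A →ₗ[ℂ] JetPoly R ι A :=
  Finsupp.lsum ℂ fun w => if w.length = n ∧ wordDeg deg w = k then Finsupp.lsingle w else 0

variable {deg : A → ℤ} {n : ℕ} {k : ℤ}

open Classical in
theorem projHomog_single (w : List (A × (ι →₀ ℕ))) (r : R) :
    projHomog deg n k (Finsupp.single w r) =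
      if w.length = n ∧ wordDeg deg w = k then Finsupp.single w r else 0 := by
  simp only [projHomog, Finsupp.lsum_single]
  split_ifs <;> rfl

theorem projHomog_mem (x : JetPoly R ι A) : projHomog deg n k x ∈ homog R deg n k := by
  classical
  induction x using Finsupp.induction_linear with
  | zero => simp
  | add x y hx hy => rw [map_add]; exact add_mem hx hy
  | single w r =>
    rw [projHomog_single]
    split_ifs with h
    · exact single_mem_homog h.1 h.2
    · exact zero_mem _

theorem projHomog_of_mem {x : JetPoly R ι A} (hx : x ∈ homog R deg n k) :
    projHomog deg n k x = x :=
  homog_induction (P := fun x => projHomog deg n k x = x) (by simp)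
    (fun x y hx hy => by simp [hx, hy])
    (fun w r h h' => by classical rw [projHomog_single, if_pos ⟨h, h'⟩]) hx

theorem projHomog_of_mem_of_ne {n' : ℕ} {k' : ℤ} {x : JetPoly R ι A} (hx : x ∈ homog R deg n' k')
    (h : ¬(n' = n ∧ k' = k)) : projHomog deg n k x = 0 :=
  homog_induction (P := fun x => projHomog deg n k x = 0) (by simp)
    (fun x y hx hy => by simp [hx, hy])
    (fun w r h1 h2 => by classical rw [projHomog_single, if_neg (by rwa [h1, h2])]) hx

/-- An operator which preserves the homogeneous components commutes with the projections. -/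
theorem projHomog_comm {T : JetPoly R ι A →ₗ[ℂ] JetPoly R ι A}
    (hT : ∀ n k (x : JetPoly R ι A), x ∈ homog R deg n k → T x ∈ homog R deg n k) (x : JetPoly R ι A) :
    projHomog deg n k (T x) = T (projHomog deg n k x) := by
  classical
  induction x using Finsupp.induction_linear with
  | zero => simp
  | add x y hx hy => simp only [map_add, hx, hy]
  | single w r =>
    have h1 := hT _ _ _ (single_mem_homog (R := R) (deg := deg) (w := w) (r := r) rfl rfl)
    rw [projHomog_single]
    split_ifs with h
    · rw [h.1, h.2] at h1
      exact projHomog_of_mem h1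
    · rw [map_zero]
      exact projHomog_of_mem_of_ne h1 h

theorem projHomog_mem_koszul {x : JetPoly R ι A} (hx : x ∈ koszulRel R deg) :
    projHomog deg n k x ∈ koszulRel R deg := by
  classical
  revert x
  change koszulRel R deg ≤ (koszulRel R deg).comap (projHomog deg n k)
  refine Submodule.span_le.2 ?_
  rintro _ ⟨u, v, x, y, r, rfl⟩
  change projHomog deg n k _ ∈ koszulRel R deg
  have h : (u ++ y :: x :: v).length = (u ++ x :: y :: v).length := by simp
  have h' : wordDeg deg (u ++ y :: x :: v) = wordDeg deg (u ++ x :: y :: v) := by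
    simp [wordDeg]; ring
  rw [map_sub, map_smul, projHomog_single, projHomog_single, h, h']
  split_ifs
  · exact Submodule.subset_span ⟨u, v, x, y, r, rfl⟩
  · simp

/-- Homogeneous relations of local functionals come from homogeneous elements. -/
theorem exists_homog_of_mem_locSub [Fintype ι] {δ : ι → R →ₗ[ℂ] R} {x : JetPoly R ι A}
    (hx : x ∈ homog R deg n k) (h : x ∈ locSub δ deg) :
    ∃ H : ι → JetPoly R ι A, (∀ i, H i ∈ homog R deg n k) ∧
      x ≡ ∑ i, totalD δ i (H i) [SMOD koszulRel R deg] := by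
  classical
  obtain ⟨y, hy, z, hz, rfl⟩ := Submodule.mem_sup.1 h
  obtain ⟨f, hf⟩ := (Submodule.mem_iSup_iff_exists_finsupp _ _).1 hz
  choose H hH using fun i => hf.1 i
  -- The given primitives may have parts in other degrees. Projection fixes `x`, commutes with `D_i`
  -- and preserves the relations, so those parts can be dropped.
  refine ⟨fun i => projHomog deg n k (H i), fun i => projHomog_mem _, ?_⟩
  have e : z = ∑ i, totalD δ i (H i) := by
    rw [← hf.2, Finsupp.sum_fintype _ _ (by simp)]
    exact Finset.sum_congr rfl fun i _ => (hH i).symm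
  have h1 := projHomog_of_mem hx
  rw [map_add, e, map_sum] at h1
  rw [SModEq.sub_mem, e]
  have h2 : y + ∑ i, totalD δ i (H i) - ∑ i, totalD δ i (projHomog deg n k (H i)) =
      projHomog deg n k y := by
    rw [← h1, sub_eq_iff_eq_add]
    congr 1
    exact Finset.sum_congr rfl fun i _ =>
      projHomog_comm (fun n k x hx => totalD_mem_homog i hx) _
  rw [h2]
  exact projHomog_mem_koszul hy

end Projection

/-! ### Acyclicity of the Koszul complex of `O_red` -/

section Acyclic

variable {ι A : Type} {deg : A → ℤ}

/-- Total derivatives for constant coefficients. -/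
abbrev constD (i : ι) : JetPoly ℂ ι A →ₗ[ℂ] JetPoly ℂ ι A := totalD (fun _ => 0) i

theorem constD_eq_fieldD (i : ι) (x : JetPoly ℂ ι A) : constD i x = fieldD ℂ i x := by
  rw [totalD_eq]
  have : coefMap (0 : ℂ →ₗ[ℂ] ℂ) x = 0 := by
    induction x using Finsupp.induction_linear with
    | zero => simp
    | add x y hx hy => rw [map_add, hx, hy, add_zero]
    | single w r => simp
  rw [this, zero_add]

/-- The derivation `u_K ↦ K_i u_{K - e_i}`, dual to multiplication by a coordinate. -/
def lowerD (deg : A → ℤ) (i : ι) : JetPoly ℂ ι A →ₗ[ℂ] JetPoly ℂ ι A :=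
  der deg 0 fun j => (j.2 i : ℂ) • letter ℂ (j.1, j.2 - Finsupp.single i 1)

theorem lowerD_consL (i : ι) (j : A × (ι →₀ ℕ)) (x : JetPoly ℂ ι A) :
    lowerD deg i (consL j x) = (j.2 i : ℂ) • consL (j.1, j.2 - Finsupp.single i 1) x +
      consL j (lowerD deg i x) := by
  simp [lowerD, der_consL]

theorem isHomogFamily_lowerD (i : ι) : IsHomogFamily (ι := ι) deg 0 1
    (fun j => (j.2 i : ℂ) • letter ℂ (j.1, j.2 - Finsupp.single i 1)) := fun j =>
  Submodule.smul_mem _ _ (single_mem_homog rfl (by simp))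

theorem der_mem_homog_of_one {R : Type} [CommRing R] [Algebra ℂ R] {p : ℤ}
    {q : A × (ι →₀ ℕ) → JetPoly R ι A} (hq : IsHomogFamily deg p 1 q) {n : ℕ} {k : ℤ}
    {x : JetPoly R ι A} (hx : x ∈ homog R deg n k) : der deg p q x ∈ homog R deg n (k - p) := by
  cases n with
  | zero => rw [der_zero_len hx]; exact zero_mem _
  | succ n => exact der_mem_homog hq hx

theorem lowerD_mem_homog (i : ι) {n : ℕ} {k : ℤ} {x : JetPoly ℂ ι A}
    (hx : x ∈ homog ℂ deg n k) : lowerD deg i x ∈ homog ℂ deg n k := by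
  have := der_mem_homog_of_one (isHomogFamily_lowerD i) hx
  rwa [sub_zero] at this

theorem lowerD_mem_koszul (i : ι) {x : JetPoly ℂ ι A}
    (hx : x ∈ koszulRel ℂ deg) : lowerD deg i x ∈ koszulRel ℂ deg :=
  der_mem_koszul (isHomogFamily_lowerD i) hx

theorem lowerD_constD_of_ne {i i' : ι} (h : i ≠ i') (x : JetPoly ℂ ι A) :
    lowerD deg i (constD i' x) = constD i' (lowerD deg i x) := by
  classical
  induction x using word_induction with
  | hnil r => simp [lowerD]
  | hcons j x ih =>
    rw [totalD_consL, map_add, lowerD_consL, lowerD_consL, lowerD_consL, map_add, ih, totalD_consL,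
      map_smul, totalD_consL]
    have h0 : (Finsupp.single i' 1 : ι →₀ ℕ) i = 0 := by simp [Ne.symm h]
    have e : j.2 + Finsupp.single i' 1 - Finsupp.single i 1 =
        j.2 - Finsupp.single i 1 + Finsupp.single i' 1 := by
      ext l
      simp only [Finsupp.add_apply, Finsupp.tsub_apply, Finsupp.single_apply]
      split_ifs with h1 h2
      · exact absurd (h2.trans h1.symm) h
      all_goals omega
    simp only [Finsupp.add_apply, h0, add_zero, e]
    module
  | hadd x y hx hy => simp only [map_add, hx, hy]

/-- On one letter the two operators satisfy the Weyl relation `[L, ∂] = 1`; as both are even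
derivations, on words their commutator counts letters. -/
theorem lowerD_constD_self {i : ι} {n : ℕ} {k : ℤ} {x : JetPoly ℂ ι A} (hx : x ∈ homog ℂ deg n k) :
    lowerD deg i (constD i x) = constD i (lowerD deg i x) + (n : ℂ) • x := by
  classical
  rw [← der_letter_eq hx]
  clear hx
  induction x using word_induction with
  | hnil r => simp [lowerD]
  | hcons j x ih =>
    rw [totalD_consL, map_add, lowerD_consL, lowerD_consL, lowerD_consL, map_add, ih, totalD_consL,
      map_smul, totalD_consL, der_consL]
    have e : j.2 + Finsupp.single i 1 - Finsupp.single i 1 = j.2 := by simp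
    -- The truncated subtraction is undone unless `j.2 i = 0`, and then the coefficient vanishes.
    have e' : (j.2 i : ℂ) • consL (j.1, j.2 - Finsupp.single i 1 + Finsupp.single i 1) x =
        (j.2 i : ℂ) • consL j x := by
      by_cases h : j.2 i = 0
      · simp [h]
      · rw [tsub_add_cancel_of_le]
        exact Finsupp.single_le_iff.2 (Nat.one_le_iff_ne_zero.2 h)
    simp only [Finsupp.add_apply, Finsupp.single_eq_same, e, smul_add, e', letter_mul, zero_mul,
      sgn_zero, one_smul, map_add]
    push_cast
    module
  | hadd x y hx hy => simp only [map_add, hx, hy]; abel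

/-- Each application removes one `i`-derivative from some letter, and a polynomial carries only
finitely many. This makes the series for the left inverse of `∂_i` finite. -/
theorem exists_lowerD_pow_eq_zero (i : ι) (x : JetPoly ℂ ι A) :
    ∃ N, ∀ M ≥ N, ((lowerD deg i) ^ M : Module.End ℂ _) x = 0 := by
  have mono : ∀ {N : ℕ} {x : JetPoly ℂ ι A}, ((lowerD deg i) ^ N : Module.End ℂ _) x = 0 →
      ∀ M ≥ N, ((lowerD deg i) ^ M : Module.End ℂ _) x = 0 := by
    intro N x h M hM
    obtain ⟨m, rfl⟩ := Nat.exists_eq_add_of_le' hM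
    rw [pow_add, Module.End.mul_apply, h, map_zero]
  -- At most `m` of the `s` applications can hit the letter `j`; at least `N` then fall on `x` and
  -- annihilate it.
  have step : ∀ (s m N : ℕ), m + N = s → ∀ (j : A × (ι →₀ ℕ)) (x : JetPoly ℂ ι A), j.2 i ≤ m →
      ((lowerD deg i) ^ N : Module.End ℂ _) x = 0 →
      ((lowerD deg i) ^ s : Module.End ℂ _) (consL j x) = 0 := by
    intro s
    induction s with
    | zero =>
      intro m N h j x _ hx
      obtain rfl : N = 0 := by omega
      simp only [pow_zero, Module.End.one_apply] at hx
      simp [hx]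
    | succ s ih =>
      intro m N h j x hj hx
      rw [pow_succ, Module.End.mul_apply, lowerD_consL, map_add, map_smul]
      have h1 : (j.2 i : ℂ) • ((lowerD deg i) ^ s : Module.End ℂ _)
          (consL (j.1, j.2 - Finsupp.single i 1) x) = 0 := by
        by_cases h0 : j.2 i = 0
        · simp [h0]
        · rw [ih (m - 1) N (by omega) _ _ ?_ hx, smul_zero]
          simp only [Finsupp.tsub_apply, Finsupp.single_eq_same]
          omega
      have h2 : ((lowerD deg i) ^ s : Module.End ℂ _) (consL j (lowerD deg i x)) = 0 := by
        cases N with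
        | zero =>
          simp only [pow_zero, Module.End.one_apply] at hx
          simp [hx]
        | succ N =>
          refine ih m N (by omega) j _ hj ?_
          rwa [pow_succ, Module.End.mul_apply] at hx
      rw [h1, h2, add_zero]
  suffices h : ∃ N, ((lowerD deg i) ^ N : Module.End ℂ _) x = 0 by
    obtain ⟨N, hN⟩ := h
    exact ⟨N, mono hN⟩
  induction x using word_induction with
  | hnil r => exact ⟨1, by simp [lowerD]⟩
  | hcons j x ih =>
    obtain ⟨N, hN⟩ := ih
    exact ⟨_, step _ (j.2 i) N rfl j x le_rfl hN⟩
  | hadd x y hx hy =>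
    obtain ⟨N, hN⟩ := hx
    obtain ⟨N', hN'⟩ := hy
    exact ⟨max N N', by rw [map_add, mono hN _ (le_max_left _ _), mono hN' _ (le_max_right _ _),
      add_zero]⟩

/-- A left inverse of `∂_i` on elements of degree `n` annihilated by the `N`-th power of
`lowerD i`. -/
def invD (deg : A → ℤ) (i : ι) (n N : ℕ) : JetPoly ℂ ι A →ₗ[ℂ] JetPoly ℂ ι A :=
  ∑ k ∈ Finset.range N, ((-1 : ℂ) ^ k / (n ^ (k + 1) * (k + 1).factorial)) •
    ((constD i : Module.End ℂ (JetPoly ℂ ι A)) ^ k * (lowerD deg i) ^ (k + 1))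

theorem pow_map_mem {M : Type*} [AddCommGroup M] [Module ℂ M] {P : Submodule ℂ M}
    {T : Module.End ℂ M} (hT : ∀ x ∈ P, T x ∈ P) (k : ℕ) {x : M} (hx : x ∈ P) : (T ^ k) x ∈ P := by
  induction k with
  | zero => simpa using hx
  | succ k ih => rw [pow_succ', Module.End.mul_apply]; exact hT _ ih

theorem invD_mem {P : Submodule ℂ (JetPoly ℂ ι A)} {i : ι} (h1 : ∀ x ∈ P, constD i x ∈ P)
    (h2 : ∀ x ∈ P, lowerD deg i x ∈ P) (n N : ℕ) {x : JetPoly ℂ ι A} (hx : x ∈ P) :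
    invD deg i n N x ∈ P := by
  rw [invD, LinearMap.sum_apply]
  exact Submodule.sum_mem _ fun k _ => P.smul_mem _ (pow_map_mem h1 k (pow_map_mem h2 _ hx))

theorem invD_constD_of_ne {i i' : ι} (h : i ≠ i') (n N : ℕ) (x : JetPoly ℂ ι A) :
    invD deg i n N (constD i' x) = constD i' (invD deg i n N x) := by
  have h1 : Commute (lowerD deg i : Module.End ℂ (JetPoly ℂ ι A)) (constD i') :=
    LinearMap.ext fun x => lowerD_constD_of_ne h x
  have h2 : Commute (constD i : Module.End ℂ (JetPoly ℂ ι A)) (constD i') :=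
    LinearMap.ext fun x => totalD_comm commDer_zero i i' x
  have h3 : Commute (invD deg i n N : Module.End ℂ (JetPoly ℂ ι A)) (constD i') :=
    Commute.sum_left _ _ _ fun k _ => (((h2.pow_left k).mul_left (h1.pow_left _)).smul_left _)
  exact LinearMap.congr_fun h3 x

theorem invD_constD_self {i : ι} {n : ℕ} (hn : n ≠ 0) {k : ℤ} {N : ℕ} {x : JetPoly ℂ ι A}
    (hx : x ∈ homog ℂ deg n k) (hN : ((lowerD deg i) ^ N : Module.End ℂ _) x = 0) :
    invD deg i n N (constD i x) = x := by
  have hT : ∀ m, ((lowerD deg i) ^ m : Module.End ℂ _) x ∈ homog ℂ deg n k := fun m =>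
    pow_map_mem (fun _ => lowerD_mem_homog i) m hx
  -- The Weyl relation iterated: `L^m ∂ = ∂ L^m + m n L^(m-1)`. At `m = 0` the truncated exponent
  -- carries the coefficient zero.
  have h1 : ∀ m : ℕ, ((lowerD deg i) ^ m : Module.End ℂ _) (constD i x) =
      constD i (((lowerD deg i) ^ m : Module.End ℂ _) x) +
        ((m * n : ℕ) : ℂ) • ((lowerD deg i) ^ (m - 1) : Module.End ℂ _) x := by
    intro m
    induction m with
    | zero => simp
    | succ m ih =>
      rw [pow_succ', Module.End.mul_apply, ih, map_add, lowerD_constD_self (hT m), map_smul,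
        Module.End.mul_apply]
      cases m with
      | zero => simp
      | succ m =>
        rw [← Module.End.mul_apply, ← Module.End.mul_apply, ← Module.End.mul_apply, Nat.add_sub_cancel,
          ← pow_succ', Nat.add_sub_cancel]
        push_cast
        module
  -- The coefficients of `invD` are chosen so that the partial sums telescope, leaving a multiple of
  -- `∂^M L^M x`, which vanishes once `L^M x = 0`.
  have h2 : ∀ M : ℕ, invD deg i n M (constD i x) = x - ((-1 : ℂ) ^ M / (n ^ M * M.factorial)) •
      ((constD i : Module.End ℂ (JetPoly ℂ ι A)) ^ M * (lowerD deg i) ^ M) x := by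
    intro M
    induction M with
    | zero => simp [invD]
    | succ M ih =>
      have e : invD deg i n (M + 1) (constD i x) = invD deg i n M (constD i x) +
          ((-1 : ℂ) ^ M / (n ^ (M + 1) * (M + 1).factorial)) •
          ((constD i : Module.End ℂ (JetPoly ℂ ι A)) ^ M * (lowerD deg i) ^ (M + 1))
            (constD i x) := by
        rw [invD, Finset.sum_range_succ]; rfl
      have h3 : ((constD i : Module.End ℂ (JetPoly ℂ ι A)) ^ M * (lowerD deg i) ^ (M + 1))
          (constD i x) =
          ((constD i : Module.End ℂ (JetPoly ℂ ι A)) ^ (M + 1) * (lowerD deg i) ^ (M + 1)) x +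
          (((M + 1) * n : ℕ) : ℂ) •
            ((constD i : Module.End ℂ (JetPoly ℂ ι A)) ^ M * (lowerD deg i) ^ M) x := by
        rw [Module.End.mul_apply, h1, map_add, map_smul, pow_succ (constD i)]; rfl
      rw [e, ih, h3, smul_add, smul_smul]
      have hn' : (n : ℂ) ≠ 0 := by exact_mod_cast hn
      have hf : ((M.factorial : ℕ) : ℂ) ≠ 0 := by exact_mod_cast M.factorial_ne_zero
      have hM : ((M : ℂ) + 1) ≠ 0 := by exact_mod_cast M.succ_ne_zero
      rw [Nat.factorial_succ]
      push_cast
      match_scalars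
      · ring
      · field_simp
        ring
      · field_simp
        ring
  rw [h2, Module.End.mul_apply, hN, map_zero, smul_zero, sub_zero]

variable {d : ℕ} {B : Type} {degB : B → ℤ}

/-- The Koszul differential. -/
def koszulD (d : ℕ) (B : Type) :
    (Finset (Fin d) → JetPoly ℂ (Fin d) B) →ₗ[ℂ] (Finset (Fin d) → JetPoly ℂ (Fin d) B) :=
  LinearMap.pi fun T => ∑ i ∈ Tᶜ, wedgeSign {i} T • (constD i ∘ₗ LinearMap.proj (insert i T))

theorem koszulD_apply (G : Finset (Fin d) → JetPoly ℂ (Fin d) B) (T : Finset (Fin d)) :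
    koszulD d B G T = ∑ i ∈ Tᶜ, wedgeSign {i} T • constD i (G (insert i T)) := by
  simp [koszulD, LinearMap.sum_apply]

theorem koszulD_sq (G : Finset (Fin d) → JetPoly ℂ (Fin d) B) : koszulD d B (koszulD d B G) = 0 := by
  funext T
  simp only [koszulD_apply, map_sum, Finset.smul_sum, map_smul]
  rw [Finset.sum_sigma']
  refine Finset.sum_involution (fun x _ => ⟨x.2, x.1⟩) ?_ ?_ ?_ ?_
  · rintro ⟨i, j⟩ h
    simp only [Finset.mem_sigma, Finset.mem_compl, Finset.mem_insert, not_or] at h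
    simp only
    rw [totalD_comm commDer_zero j i, Finset.insert_comm j i, smul_smul, smul_smul, ← add_smul,
      wedgeSign_comm_insert (Ne.symm h.2.1) h.1 h.2.2, neg_add_cancel, zero_smul]
  · rintro ⟨i, j⟩ h _
    simp only [Finset.mem_sigma, Finset.mem_compl, Finset.mem_insert, not_or] at h
    intro e
    simp only [Sigma.mk.injEq] at e
    exact h.2.1 e.1
  · rintro ⟨i, j⟩ h
    simp only [Finset.mem_sigma, Finset.mem_compl, Finset.mem_insert, not_or] at h ⊢
    exact ⟨h.2.2, Ne.symm h.2.1, h.1⟩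
  · rintro ⟨i, j⟩ _
    rfl

/-- A Koszul cycle whose augmentation is a total derivative is a boundary. -/
theorem koszulD_exact {n : ℕ} (hn : n ≠ 0) {k : ℤ} (G : Finset (Fin d) → JetPoly ℂ (Fin d) B)
    (hG : ∀ T, G T ∈ homog ℂ degB n (k - T.card)) (hd : ∀ T, koszulD d B G T ∈ koszulRel ℂ degB)
    (h0 : G ∅ ∈ locSub (fun _ => 0) degB) :
    ∃ H : Finset (Fin d) → JetPoly ℂ (Fin d) B, (∀ T, H T ∈ homog ℂ degB n (k + 1 - T.card)) ∧
      ∀ T, G T - koszulD d B H T ∈ koszulRel ℂ degB := by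
  -- The Koszul directions are treated one at a time: `l` holds the indices already processed, and
  -- every component whose `T` meets `l` has been removed modulo relations.
  have step : ∀ l : Finset (Fin d), ∃ H : Finset (Fin d) → JetPoly ℂ (Fin d) B,
      (∀ T, H T ∈ homog ℂ degB n (k + 1 - T.card)) ∧
      (∀ T, (∃ i ∈ T, i ∈ l) → (G - koszulD d B H) T ∈ koszulRel ℂ degB) := by
    intro l
    induction l using Finset.induction with
    | empty => exact ⟨0, fun T => zero_mem _, by simp⟩
    | insert i l hi ih =>
      obtain ⟨H, hH, hl⟩ := ih
      set G₁ := G - koszulD d B H with hG₁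
      have hG₁h : ∀ T, G₁ T ∈ homog ℂ degB n (k - T.card) := fun T => by
        rw [hG₁, Pi.sub_apply, koszulD_apply]
        refine sub_mem (hG T) (Submodule.sum_mem _ fun j hj => Submodule.smul_mem _ _
          (totalD_mem_homog j ?_))
        have := hH (insert j T)
        rw [Finset.card_insert_of_notMem (Finset.mem_compl.1 hj)] at this
        convert this using 2
        push_cast; ring
      have hG₁d : ∀ T, koszulD d B G₁ T ∈ koszulRel ℂ degB := fun T => by
        rw [hG₁, map_sub, koszulD_sq, sub_zero]; exact hd T
      choose N hN using fun T => exists_lowerD_pow_eq_zero (deg := degB) i (G₁ T)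
      -- One exponent that works for all the finitely many components.
      let N' := ∑ T, N T
      have hN' : ∀ T, ((lowerD degB i) ^ N' : Module.End ℂ _) (G₁ T) = 0 := fun T =>
        hN T _ (Finset.single_le_sum (fun _ _ => Nat.zero_le _) (Finset.mem_univ T))
      let S := invD degB i n N'
      have hSK : ∀ x ∈ koszulRel ℂ degB, S x ∈ koszulRel ℂ degB := fun x hx =>
        invD_mem (fun _ => totalD_mem_koszul i) (fun _ => lowerD_mem_koszul i) _ _ hx
      -- The homotopy in direction `i`: multiplication by `ε_i` combined with the left inverse `S`
      -- of `∂_i`.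
      let H' : Finset (Fin d) → JetPoly ℂ (Fin d) B := fun T =>
        if i ∈ T then wedgeSign {i} (T.erase i) • S (G₁ (T.erase i)) else 0
      have hH'1 : ∀ T, i ∉ T → H' T = 0 := fun T hT => if_neg hT
      have hH'2 : ∀ T, i ∉ T → H' (insert i T) = wedgeSign {i} T • S (G₁ T) := fun T hT => by
        simp only [H', Finset.mem_insert_self, if_true, Finset.erase_insert hT]
      have hnot : ∀ T, i ∉ T → koszulD d B H' T = constD i (S (G₁ T)) := fun T hT => by
        rw [koszulD_apply, Finset.sum_eq_single i]
        · rw [hH'2 T hT, map_smul, smul_smul, wedgeSign_mul_self, one_smul]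
        · intro j _ hj
          rw [hH'1 _ (by simp [Ne.symm hj, hT]), map_zero, smul_zero]
        · intro h; exact absurd (Finset.mem_compl.2 hT) h
      -- `S ∂_i = 1` produces `G₁ (insert i T)`, and since `S` commutes with the other `∂_j` the
      -- remaining terms assemble to `S` applied to the Koszul differential of `G₁` at `T`, which is
      -- a relation.
      have hin : ∀ T, i ∉ T → G₁ (insert i T) - koszulD d B H' (insert i T) ∈ koszulRel ℂ degB := by
        intro T hT
        have h1 : koszulD d B H' (insert i T) = G₁ (insert i T) -
            wedgeSign {i} T • S (koszulD d B G₁ T) := by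
          have e : (Tᶜ : Finset (Fin d)) = insert i (insert i T)ᶜ := by
            ext j; by_cases hj : j = i
            · subst hj; simp [hT]
            · simp [hj]
          rw [koszulD_apply, koszulD_apply, e, Finset.sum_insert (by simp), map_add, map_smul,
            invD_constD_self hn (hG₁h _) (hN' _), smul_add, smul_smul, wedgeSign_mul_self, one_smul,
            sub_add_cancel_left, map_sum, Finset.smul_sum, ← Finset.sum_neg_distrib]
          refine Finset.sum_congr rfl fun j hj => ?_
          obtain ⟨hji, hjT⟩ : j ≠ i ∧ j ∉ T := by simpa using hj
          rw [Finset.insert_comm, hH'2 _ (by simp [Ne.symm hji, hT]), map_smul, map_smul,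
            invD_constD_of_ne (Ne.symm hji), smul_smul, smul_smul, ← neg_smul]
          congr 1
          have e1 := wedgeSign_comm_insert (Ne.symm hji) hT hjT
          have e2 := wedgeSign_mul_self {i} T
          have e3 := wedgeSign_mul_self {i} (insert j T)
          linear_combination (-wedgeSign {j} (insert i T) * wedgeSign {i} (insert j T)) * e2 +
            wedgeSign {i} T * wedgeSign {i} (insert j T) * e1 -
            wedgeSign {i} T * wedgeSign {j} T * e3
        rw [h1, sub_sub_cancel]
        exact Submodule.smul_mem _ _ (hSK _ (hG₁d T))
      refine ⟨H + H', fun T => add_mem (hH T) ?_, ?_⟩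
      · simp only [H']
        split_ifs with hT
        · refine Submodule.smul_mem _ _ (invD_mem (fun _ => totalD_mem_homog i)
            (fun _ => lowerD_mem_homog i) _ _ ?_)
          have := hG₁h (T.erase i)
          rw [Finset.card_erase_of_mem hT, Nat.cast_sub (Finset.card_pos.2 ⟨i, hT⟩)] at this
          convert this using 2
          push_cast; ring
        · exact zero_mem _
      · have e : G - koszulD d B (H + H') = G₁ - koszulD d B H' := by
          rw [map_add, hG₁]; abel
        rw [e]
        rintro T ⟨j, hjT, hj⟩
        by_cases hT : i ∈ T
        · have := hin (T.erase i) (by simp)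
          rwa [Finset.insert_erase hT] at this
        · rw [Finset.mem_insert] at hj
          rcases hj with rfl | hj
          · exact absurd hjT hT
          -- Components removed before stay removed: on them the new correction is `∂_i S` of
          -- something already in the relations.
          · have h1 := hl T ⟨j, hjT, hj⟩
            rw [Pi.sub_apply, hnot T hT]
            exact sub_mem h1 (totalD_mem_koszul i (hSK _ h1))
  obtain ⟨H, hH, hl⟩ := step Finset.univ
  set G₁ := G - koszulD d B H with hG₁
  have hG₁0 : G₁ ∅ ∈ homog ℂ degB n k := by
    rw [hG₁, Pi.sub_apply, koszulD_apply]
    refine sub_mem (by simpa using hG ∅) (Submodule.sum_mem _ fun j _ => Submodule.smul_mem _ _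
      (totalD_mem_homog j ?_))
    simpa using hH (insert j ∅)
  have hG₁l : G₁ ∅ ∈ locSub (fun _ => 0) degB := by
    rw [hG₁, Pi.sub_apply, koszulD_apply]
    exact sub_mem h0 (Submodule.sum_mem _ fun j _ => Submodule.smul_mem _ _ (totalD_mem_locSub j _))
  obtain ⟨x, hx, hx'⟩ := exists_homog_of_mem_locSub hG₁0 hG₁l
  -- Only the component `∅` is left, and it is a sum of total derivatives. Primitives supported on
  -- singletons correct it without touching any other component.
  let H' : Finset (Fin d) → JetPoly ℂ (Fin d) B := fun T => ∑ i, if T = {i} then x i else 0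
  have hH' : ∀ i, H' {i} = x i := fun i => by
    simp [H']
  have hH'0 : ∀ T : Finset (Fin d), T.card ≠ 1 → H' T = 0 := fun T hT => by
    refine Finset.sum_eq_zero fun i _ => if_neg ?_
    rintro rfl
    simp at hT
  refine ⟨H + H', fun T => add_mem (hH T) ?_, fun T => ?_⟩
  · by_cases hT : T.card = 1
    · obtain ⟨i, rfl⟩ := Finset.card_eq_one.1 hT
      rw [hH']; simpa using hx i
    · rw [hH'0 T hT]; exact zero_mem _
  · have e : G T - koszulD d B (H + H') T = G₁ T - koszulD d B H' T := by
      rw [map_add, hG₁, Pi.add_apply, Pi.sub_apply]; abel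
    rw [e]
    by_cases hT : T = ∅
    · subst hT
      rw [SModEq.sub_mem] at hx'
      convert hx' using 2
      rw [koszulD_apply]
      simp [hH']
    · have h1 : koszulD d B H' T = 0 := by
        rw [koszulD_apply]
        refine Finset.sum_eq_zero fun i hi => ?_
        rw [hH'0, map_zero, smul_zero]
        rw [Finset.card_insert_of_notMem (Finset.mem_compl.1 hi)]
        have := Finset.card_pos.2 (Finset.nonempty_iff_ne_empty.2 hT)
        omega
      rw [h1, sub_zero]
      obtain ⟨i, hi⟩ := Finset.nonempty_iff_ne_empty.2 hT
      exact hl T ⟨i, hi, Finset.mem_univ i⟩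

end Acyclic

/-! ### A criterion for quasi-isomorphisms -/

section QuasiIsoCriterion

/-- A cochain map with acyclic cone, in terms of elements. -/
theorem quasiIso_of_forall_exists {K L : CochainComplex (ModuleCat.{0} ℂ) ℤ} (φ : K ⟶ L)
    (h : ∀ k, ∀ (x : K.X (k + 1)) (y : L.X k), (K.d (k + 1) (k + 2)).hom x = 0 →
      (φ.f (k + 1)).hom x = (L.d k (k + 1)).hom y →
      ∃ (x' : K.X k), (K.d k (k + 1)).hom x' = x ∧ ∃ (y' : L.X (k - 1)),
        y = (φ.f k).hom x' + (L.d (k - 1) k).hom y') :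
    QuasiIso φ := by
  rw [quasiIso_iff]
  intro k
  rw [quasiIsoAt_iff_isIso_homologyMap]
  have hmono : Mono (HomologicalComplex.homologyMap φ k) := by
    obtain ⟨k, rfl⟩ : ∃ k', k = k' + 1 := ⟨k - 1, by ring⟩
    rw [HomologicalComplex.mono_homologyMap_iff_up_to_refinements φ k (k + 1) (k + 2) (by simp)
      (by rw [CochainComplex.next]; ring)]
    intro A x₂ hx₂ y₁ hy
    -- The primitives given by `h` need not depend linearly on the element. The pullback `P` of all
    -- admissible choices supplies linear maps, and `h` says exactly that `P` covers `A`.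
    let P : Submodule ℂ (A × K.X k) := LinearMap.ker
      (x₂.hom ∘ₗ LinearMap.fst ℂ _ _ - (K.d k (k + 1)).hom ∘ₗ LinearMap.snd ℂ _ _)
    refine ⟨ModuleCat.of ℂ P, ModuleCat.ofHom (LinearMap.fst ℂ _ _ ∘ₗ P.subtype), ?_,
      ModuleCat.ofHom (LinearMap.snd ℂ _ _ ∘ₗ P.subtype), ?_⟩
    · rw [ModuleCat.epi_iff_surjective]
      intro a
      obtain ⟨x', hx', -⟩ := h k (x₂.hom a) (y₁.hom a)
        (congrArg (fun f => f.hom a) hx₂) (congrArg (fun f => f.hom a) hy)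
      exact ⟨⟨(a, x'), by simp [P, LinearMap.mem_ker, hx']⟩, rfl⟩
    · ext ⟨⟨a, x⟩, hp⟩
      exact sub_eq_zero.1 hp
  have hepi : Epi (HomologicalComplex.homologyMap φ k) := by
    rw [HomologicalComplex.epi_homologyMap_iff_up_to_refinements φ (k - 1) k (k + 1) (by simp)
      (by simp)]
    intro A y₂ hy₂
    let P : Submodule ℂ (A × K.X k × L.X (k - 1)) := LinearMap.ker
      ((K.d k (k + 1)).hom ∘ₗ LinearMap.fst ℂ _ _ ∘ₗ LinearMap.snd ℂ _ _) ⊓ LinearMap.ker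
      (y₂.hom ∘ₗ LinearMap.fst ℂ _ _ - ((φ.f k).hom ∘ₗ LinearMap.fst ℂ _ _ +
        (L.d (k - 1) k).hom ∘ₗ LinearMap.snd ℂ _ _) ∘ₗ LinearMap.snd ℂ _ _)
    refine ⟨ModuleCat.of ℂ P, ModuleCat.ofHom (LinearMap.fst ℂ _ _ ∘ₗ P.subtype), ?_,
      ModuleCat.ofHom (LinearMap.fst ℂ _ _ ∘ₗ LinearMap.snd ℂ _ _ ∘ₗ P.subtype), ?_,
      ModuleCat.ofHom (LinearMap.snd ℂ _ _ ∘ₗ LinearMap.snd ℂ _ _ ∘ₗ P.subtype), ?_⟩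
    · rw [ModuleCat.epi_iff_surjective]
      intro a
      -- Surjectivity on cohomology is the case `x = 0`.
      obtain ⟨x', hx', y', hy'⟩ := h k 0 (y₂.hom a) (map_zero _)
        ((map_zero _).trans (congrArg (fun f => f.hom a) hy₂).symm)
      exact ⟨⟨(a, x', y'), hx', sub_eq_zero.2 hy'⟩, rfl⟩
    · ext ⟨⟨a, x, y⟩, hp⟩
      exact hp.1
    · ext ⟨⟨a, x, y⟩, hp⟩
      exact sub_eq_zero.1 hp.2
  exact isIso_of_mono_of_epi _

variable {M M' : Type} [AddCommGroup M] [Module ℂ M] [AddCommGroup M'] [Module ℂ M']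
  {C : ℤ → Submodule ℂ M} {N : Submodule ℂ M} {D : M →ₗ[ℂ] M}
  {C' : ℤ → Submodule ℂ M'} {N' : Submodule ℂ M'} {D' : M' →ₗ[ℂ] M'}
  {n : ℤ} {φ : M →ₗ[ℂ] M'}

/-- The hypothesis asks for `y = φ x'` modulo relations, without an extra boundary: the lifting
property of a surjection with acyclic kernel. In this form solutions can be corrected degree by
degree in `exists_of_leading`. -/
theorem quasiIso_subqHom (h : IsSubqComplex C N D) (h' : IsSubqComplex C' N' D')
    (hφ : IsSubqMap C N D C' N' D' n φ)
    (H : ∀ k, ∀ x ∈ C (k + 1), ∀ y ∈ C' (k + n), D x ∈ N → φ x - n.negOnePow • D' y ∈ N' →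
      ∃ x' ∈ C k, x - D x' ∈ N ∧ y - φ x' ∈ N') : QuasiIso (subqHom h h' hφ) := by
  refine quasiIso_of_forall_exists _ fun k x y hx hxy => ?_
  obtain ⟨x, rfl⟩ := Submodule.Quotient.mk_surjective (N.submoduleOf (C (k + 1))) x
  obtain ⟨y, rfl⟩ := Submodule.Quotient.mk_surjective (N'.submoduleOf (C' (k + n))) y
  have e1 (i j : ℤ) (hij : i + 1 = j) : (subqComplex h).d i j = ModuleCat.ofHom (subqMap D i j
      (fun x hx => hij ▸ h.map_deg i x hx) (h.map_rel i)) := dif_pos hij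
  have hkn : k + n + 1 = k + 1 + n := by ring
  have e2 : ((subqComplex h')⟦n⟧).d k (k + 1) = n.negOnePow • ModuleCat.ofHom
      (subqMap D' (k + n) (k + 1 + n) (fun x hx => hkn ▸ h'.map_deg (k + n) x hx)
        (h'.map_rel (k + n))) := by
    rw [CochainComplex.shiftFunctor_obj_d']
    congr 1
    exact dif_pos hkn
  rw [e1 _ _ (by ring)] at hx
  rw [e2] at hxy
  have hx0 : D x.1 ∈ N := by
    have hk2 : k + 1 + 1 = k + 2 := by ring
    have hx1 : (Submodule.Quotient.mk ⟨D x.1, hk2 ▸ h.map_deg _ _ x.2⟩ : Subq C N (k + 2)) = 0 := hx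
    exact (Submodule.Quotient.mk_eq_zero (N.submoduleOf (C (k + 2)))).1 hx1
  have hxy0 : φ x.1 - n.negOnePow • D' y.1 ∈ N' := by
    have hxy1 : (Submodule.Quotient.mk ⟨φ x.1, hφ.map_deg (k + 1) _ x.2⟩ : Subq C' N' (k + 1 + n)) =
      Submodule.Quotient.mk (n.negOnePow • ⟨D' y.1, hkn ▸ h'.map_deg (k + n) _ y.2⟩) := hxy
    exact (Submodule.Quotient.eq (N'.submoduleOf (C' (k + 1 + n)))).1 hxy1
  obtain ⟨x', hx', h1, h2⟩ := H k x.1 x.2 y.1 y.2 hx0 hxy0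
  refine ⟨Submodule.Quotient.mk (p := N.submoduleOf (C k)) ⟨x', hx'⟩, ?_, 0, ?_⟩
  · rw [e1 _ _ rfl]
    exact ((Submodule.Quotient.eq (N.submoduleOf (C (k + 1))) (x := x)
      (y := ⟨D x', h.map_deg k _ hx'⟩)).2 h1).symm
  · rw [map_zero, add_zero]
    exact (Submodule.Quotient.eq (N'.submoduleOf (C' (k + n))) (x := y)
      (y := ⟨φ x', hφ.map_deg k _ hx'⟩)).2 h2

theorem quasiIso_subqHomZero (h : IsSubqComplex C N D) (h' : IsSubqComplex C' N' D')
    (hφ : IsSubqMap C N D C' N' D' 0 φ)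
    (H : ∀ k, ∀ x ∈ C (k + 1), ∀ y ∈ C' (k + 0), D x ∈ N →
      φ x - (0 : ℤ).negOnePow • D' y ∈ N' → ∃ x' ∈ C k, x - D x' ∈ N ∧ y - φ x' ∈ N') :
    QuasiIso (subqHomZero h h' hφ) := by
  have := quasiIso_subqHom h h' hφ H
  rw [subqHomZero]
  infer_instance

/-- A degreewise map between complexes of formal series whose differentials are perturbed by terms
of higher polynomial degree: it suffices to consider the leading terms. -/
theorem exists_of_leading {M₀ M₀' : Type} [AddCommGroup M₀] [Module ℂ M₀] [AddCommGroup M₀']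
    [Module ℂ M₀'] (e : M ≃ₗ[ℂ] (ℕ → M₀)) (e' : M' ≃ₗ[ℂ] (ℕ → M₀'))
    {Cc : ℕ → ℤ → Submodule ℂ M₀} {Nc : ℕ → Submodule ℂ M₀}
    {Cc' : ℕ → ℤ → Submodule ℂ M₀'} {Nc' : ℕ → Submodule ℂ M₀'}
    (hC : ∀ k x, x ∈ C k ↔ ∀ m, e x m ∈ Cc m k) (hN : ∀ x, x ∈ N ↔ ∀ m, e x m ∈ Nc m)
    (hC' : ∀ k x, x ∈ C' k ↔ ∀ m, e' x m ∈ Cc' m k) (hN' : ∀ x, x ∈ N' ↔ ∀ m, e' x m ∈ Nc' m)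
    (D₀ : ℕ → M₀ →ₗ[ℂ] M₀) (φ₀ : ℕ → M₀ →ₗ[ℂ] M₀')
    (hD : ∀ k m, ∀ x ∈ C k, (∀ l < m, e x l ∈ Nc l) → e (D x) m - D₀ m (e x m) ∈ Nc m)
    (hD' : ∀ k m, ∀ y ∈ C' k, (∀ l < m, e' y l ∈ Nc' l) → e' (D' y) m ∈ Nc' m)
    (hφ₀ : ∀ x m, e' (φ x) m = φ₀ m (e x m))
    (h : IsSubqComplex C N D) (hφ : IsSubqMap C N D C' N' D' n φ)
    (lead : ∀ m k, ∀ a ∈ Cc m (k + 1), ∀ b ∈ Cc' m (k + n), D₀ m a ∈ Nc m → φ₀ m a ∈ Nc' m →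
      ∃ c ∈ Cc m k, a - D₀ m c ∈ Nc m ∧ b - φ₀ m c ∈ Nc' m)
    (k : ℤ) (x : M) (hx : x ∈ C (k + 1)) (y : M') (hy : y ∈ C' (k + n)) (hDx : D x ∈ N)
    (hxy : φ x - n.negOnePow • D' y ∈ N') : ∃ x' ∈ C k, x - D x' ∈ N ∧ y - φ x' ∈ N' := by
  classical
  -- An approximate solution, correct in polynomial degrees below `m`.
  let Good (m : ℕ) (X : M) : Prop := X ∈ C k ∧ (∀ l < m, e (x - D X) l ∈ Nc l) ∧
    ∀ l < m, e' (y - φ X) l ∈ Nc' l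
  have hsingle : ∀ m c, c ∈ Cc m k → e.symm (Pi.single m c) ∈ C k := fun m c hc => by
    refine (hC _ _).2 fun l => ?_
    rw [LinearEquiv.apply_symm_apply]
    by_cases hl : l = m
    · subst hl; simpa using hc
    · simp [hl]
  have hlow : ∀ m, ∀ z ∈ C k, (∀ l < m, e z l = 0) →
      (∀ l < m, e (D z) l ∈ Nc l) ∧ (∀ l < m, e' (φ z) l = 0) := by
    refine fun m z hz h0 => ⟨fun l hl => ?_, fun l hl => by rw [hφ₀, h0 l hl, map_zero]⟩
    have := hD k l z hz fun l' hl' => by rw [h0 l' (hl'.trans hl)]; exact zero_mem _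
    rwa [h0 l hl, map_zero, sub_zero] at this
  have hstep : ∀ m (X : {X // Good m X}), ∃ Y : {Y // Good (m + 1) Y},
      ∀ l < m, e Y.1 l = e X.1 l := by
    rintro m ⟨X, hX, h1, h2⟩
    have ha : x - D X ∈ C (k + 1) := sub_mem hx (h.map_deg k X hX)
    have hb : y - φ X ∈ C' (k + n) := sub_mem hy (hφ.map_deg k X hX)
    have ha1 : D₀ m (e (x - D X) m) ∈ Nc m := by
      have h3 := hD (k + 1) m _ ha h1
      have h4 : D (x - D X) ∈ N := by rw [map_sub]; exact sub_mem hDx (h.sq k X hX)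
      have := sub_mem ((hN _).1 h4 m) h3
      rwa [sub_sub_cancel] at this
    -- The error `y - φ X` vanishes below degree `m` modulo relations, so `D'` contributes nothing
    -- in degree `m`: the leading error is a cocycle in the kernel of the leading map.
    have ha2 : φ₀ m (e (x - D X) m) ∈ Nc' m := by
      rw [← hφ₀]
      have h3 := hD' _ m _ hb h2
      have h4 : φ (x - D X) - n.negOnePow • D' (y - φ X) ∈ N' := by
        have := sub_mem hxy (hφ.comm k X hX)
        convert this using 1
        rw [map_sub, map_sub, smul_sub]; abel
      have h5 := (hN' _).1 h4 m
      rw [map_sub, Pi.sub_apply] at h5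
      have h6 : e' (n.negOnePow • D' (y - φ X)) m ∈ Nc' m := by
        rcases Int.units_eq_one_or n.negOnePow with hu | hu <;> rw [hu]
        · rwa [one_smul]
        · rw [Units.neg_smul, one_smul, map_neg]
          exact neg_mem h3
      have h7 := add_mem h5 h6
      rwa [sub_add_cancel] at h7
    obtain ⟨c, hc, hc1, hc2⟩ := lead m k _ ((hC _ _).1 ha m) _ ((hC' _ _).1 hb m) ha1 ha2
    -- The correction is concentrated in degree `m`. It leaves lower entries of `X` untouched and
    -- changes the error below degree `m` only by relations.
    have hz := hsingle m c hc
    set z := e.symm (Pi.single m c) with hzd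
    have hez : e z = Pi.single m c := LinearEquiv.apply_symm_apply _ _
    have hz0 : ∀ l < m, e z l = 0 := fun l hl => by rw [hez, Pi.single_eq_of_ne hl.ne]
    obtain ⟨hz1, hz2⟩ := hlow m z hz hz0
    have hzm : e (D z) m - D₀ m c ∈ Nc m := by
      have := hD k m z hz fun l hl => by rw [hz0 l hl]; exact zero_mem _
      rwa [hez, Pi.single_eq_same] at this
    refine ⟨⟨X + z, add_mem hX hz, fun l hl => ?_, fun l hl => ?_⟩, fun l hl => ?_⟩
    · rw [map_add, ← sub_sub, map_sub, Pi.sub_apply]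
      rcases Nat.lt_succ_iff_lt_or_eq.1 hl with hl | rfl
      · exact sub_mem (h1 l hl) (hz1 l hl)
      · convert sub_mem hc1 hzm using 1
        abel
    · rw [map_add, ← sub_sub, map_sub, Pi.sub_apply]
      rcases Nat.lt_succ_iff_lt_or_eq.1 hl with hl | rfl
      · rw [hz2 l hl, sub_zero]; exact h2 l hl
      · rwa [hφ₀ z, hez, Pi.single_eq_same]
    · simp [hz0 l hl]
  choose next hnext using hstep
  let X : (m : ℕ) → {X // Good m X} := fun m =>
    Nat.rec ⟨0, zero_mem _, by simp, by simp⟩ (fun m X => next m X) m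
  have hX : ∀ m, ∀ l < m, ∀ m' ≥ m, e (X m').1 l = e (X m).1 l := fun m l hl m' hm' => by
    induction m', hm' using Nat.le_induction with
    | base => rfl
    | succ m' hm' ih => exact (hnext m' (X m') l (hl.trans_le hm')).trans ih
  -- Entry `l` no longer changes after stage `l + 1`, so the limit exists in the product over all
  -- degrees.
  let Z : M := e.symm fun l => e (X (l + 1)).1 l
  have hZ : ∀ l, e Z l = e (X (l + 1)).1 l := fun l => by simp [Z]
  have hZC : Z ∈ C k := (hC _ _).2 fun l => by
    rw [hZ]; exact (hC _ _).1 (X (l + 1)).2.1 l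
  have hdiff : ∀ m, ∀ l < m, e (Z - (X m).1) l = 0 := fun m l hl => by
    rw [map_sub, Pi.sub_apply, hZ, hX (l + 1) l (Nat.lt_succ_self l) m hl, sub_self]
  refine ⟨Z, hZC, (hN _).2 fun m => ?_, (hN' _).2 fun m => ?_⟩
  · have h1 := (hlow (m + 1) _ (sub_mem hZC (X (m + 1)).2.1) (hdiff (m + 1))).1 m
      (Nat.lt_succ_self m)
    have h2 := (X (m + 1)).2.2.1 m (Nat.lt_succ_self m)
    convert sub_mem h2 h1 using 1
    simp only [map_sub, Pi.sub_apply]; abel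
  · have h1 := (hlow (m + 1) _ (sub_mem hZC (X (m + 1)).2.1) (hdiff (m + 1))).2 m
      (Nat.lt_succ_self m)
    have h2 := (X (m + 1)).2.2.2 m (Nat.lt_succ_self m)
    have e3 : e' (y - φ Z) m = e' (y - φ (X (m + 1)).1) m := by
      rw [map_sub, map_sub, Pi.sub_apply] at h1
      simp only [map_sub, Pi.sub_apply, sub_eq_zero.1 h1]
    rwa [e3]

end QuasiIsoCriterion

/-! ### Derivations which permute jet coordinates -/

section LetterOps

variable {R ι A : Type} [CommRing R] [Algebra ℂ R] {deg : A → ℤ} {δ : ι → R →ₗ[ℂ] R}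

theorem letter_eq_consL (j : A × (ι →₀ ℕ)) : letter R j = consL j (Finsupp.single [] 1) := by
  simp [letter]

theorem letter_mem_homog (j : A × (ι →₀ ℕ)) : letter R j ∈ homog R deg 1 (deg j.1) :=
  single_mem_homog rfl (by simp)

theorem CommDer.map_one (hδ : CommDer δ) (i : ι) : δ i 1 = 0 := by
  have h := hδ.leibniz i 1 1
  rw [one_mul, mul_one, one_mul] at h
  exact left_eq_add.1 h

theorem totalD_letter (hδ : CommDer δ) (i : ι) (j : A × (ι →₀ ℕ)) :
    totalD δ i (letter R j) = letter R (j.1, j.2 + Finsupp.single i 1) := by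
  rw [letter_eq_consL, totalD_consL, totalD_nil, hδ.map_one, letter_eq_consL]
  simp

/-- Values `j ↦ c j • g j` on the jet coordinates. -/
def mono (R : Type) {ι A : Type} [CommRing R] [Algebra ℂ R] (c : A × (ι →₀ ℕ) → ℂ)
    (g : A × (ι →₀ ℕ) → A × (ι →₀ ℕ)) (j : A × (ι →₀ ℕ)) : JetPoly R ι A := c j • letter R (g j)

variable {c c' : A × (ι →₀ ℕ) → ℂ} {g g' : A × (ι →₀ ℕ) → A × (ι →₀ ℕ)} {p p' : ℤ}

theorem isHomogFamily_mono (h : ∀ j, c j ≠ 0 → deg (g j).1 = deg j.1 - p) :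
    IsHomogFamily deg p 1 (mono R c g) := fun j => by
  by_cases hc : c j = 0
  · simp [mono, hc]
  · rw [← h j hc]
    exact Submodule.smul_mem _ _ (letter_mem_homog _)

theorem isEvolutionary_mono (hδ : CommDer δ)
    (hc : ∀ j i, c (j.1, j.2 + Finsupp.single i 1) = c j)
    (hg : ∀ j i, c j ≠ 0 → g (j.1, j.2 + Finsupp.single i 1) =
      ((g j).1, (g j).2 + Finsupp.single i 1)) :
    IsEvolutionary δ (mono R c g) := fun j i => by
  rw [mono, mono, map_smul, totalD_letter hδ, hc]
  by_cases h : c j = 0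
  · simp [h]
  · rw [hg j i h]

theorem der_mono_mono (j : A × (ι →₀ ℕ)) :
    der deg p (mono R c g) (mono R c' g' j) = (c' j * c (g' j)) • letter R (g (g' j)) := by
  rw [mono, map_smul, der_letter, mono, smul_smul]

/-- For two odd derivations the graded commutator is the anticommutator; the operator identities
below thereby reduce to comparing values on one letter. -/
theorem der_anticomm {m m' : ℕ} {q q' r : A × (ι →₀ ℕ) → JetPoly R ι A}
    (hq : IsHomogFamily deg p m q) (hq' : IsHomogFamily deg p' m' q')
    (hp : sgn (p * p') = -1) (h : ∀ j, der deg p q (q' j) + der deg p' q' (q j) = r j)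
    (x : JetPoly R ι A) :
    der deg p q (der deg p' q' x) + der deg p' q' (der deg p q x) = der deg (p + p') r x := by
  have := der_comm hq hq' x
  rw [hp] at this
  simp only [neg_smul, one_smul, sub_neg_eq_add, h] at this
  exact this

theorem linAdj_letter [Fintype ι] [DecidableEq A] (a a' : A) (y : JetPoly R ι A) :
    linAdj δ deg a (letter R (a', 0)) y = if a' = a then y else 0 := by
  rw [linAdj, letter_eq_consL, pdAll_consL, pdAll_nil, map_zero, smul_zero, add_zero]
  split_ifs
  · simp
  · simp

theorem fieldD_eq_der_mono (deg : A → ℤ) (i : ι) : fieldD R i = der deg 0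
    (mono R (fun _ => 1) fun j : A × (ι →₀ ℕ) => (j.1, j.2 + Finsupp.single i 1)) := by
  rw [fieldD_eq_der deg]
  congr 1
  funext j
  rw [mono, one_smul]

theorem isHomogFamily_fieldD (i : ι) : IsHomogFamily deg 0 1
    (mono R (fun _ => 1) fun j : A × (ι →₀ ℕ) => (j.1, j.2 + Finsupp.single i 1)) :=
  isHomogFamily_mono fun j _ => by simp

end LetterOps

/-! ### Contractions and the Dolbeault operator -/

section Dolbeault

variable {R : Type} [CommRing R] [Algebra ℂ R] {d : ℕ} {B : Type} {degB : B → ℤ}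
  {δ : Fin d ⊕ Fin d → R →ₗ[ℂ] R}

/-- Degree of `d z̄_S ⊗ e b`. -/
def formDeg (degB : B → ℤ) (a : Finset (Fin d) × B) : ℤ := a.1.card + degB a.2

/-- Jet coordinates of the fields. -/
abbrev FieldJet (d : ℕ) (B : Type) : Type := (Finset (Fin d) × B) × (Fin d ⊕ Fin d →₀ ℕ)

/-- Polynomials in the jet coordinates of the fields. -/
abbrev FieldPoly (R : Type) [CommRing R] (d : ℕ) (B : Type) : Type :=
  JetPoly R (Fin d ⊕ Fin d) (Finset (Fin d) × B)

/-- Sign of exterior multiplication by `d z̄_i`. -/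
def extSign (i : Fin d) (S : Finset (Fin d)) : ℂ := if i ∈ S then 0 else wedgeSign {i} S

/-- Sign of contraction with `∂/∂z̄_i`. -/
def intSign (i : Fin d) (S : Finset (Fin d)) : ℂ := if i ∈ S then wedgeSign {i} (S.erase i) else 0

theorem extSign_mem {i : Fin d} {S : Finset (Fin d)} (h : i ∈ S) : extSign i S = 0 := if_pos h

theorem extSign_notMem {i : Fin d} {S : Finset (Fin d)} (h : i ∉ S) :
    extSign i S = wedgeSign {i} S := if_neg h

theorem intSign_mem {i : Fin d} {S : Finset (Fin d)} (h : i ∈ S) :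
    intSign i S = wedgeSign {i} (S.erase i) := if_pos h

theorem intSign_notMem {i : Fin d} {S : Finset (Fin d)} (h : i ∉ S) : intSign i S = 0 := if_neg h

theorem intSign_insert {i : Fin d} {S : Finset (Fin d)} (h : i ∉ S) :
    intSign i (insert i S) = wedgeSign {i} S := by
  rw [intSign_mem (Finset.mem_insert_self i S), Finset.erase_insert h]

/-- This lemma and the next four are the canonical anticommutation relations of exterior
multiplication and contraction, written for matrix coefficients. Impossible insertions and removals
have coefficient zero, so they need no separate treatment. -/
theorem extSign_anticomm {i l : Fin d} (h : i ≠ l) (S : Finset (Fin d)) :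
    extSign i S * extSign l (insert i S) + extSign l S * extSign i (insert l S) = 0 := by
  by_cases hi : i ∈ S
  · simp [extSign, hi]
  by_cases hl : l ∈ S
  · simp [extSign, hl]
  rw [extSign_notMem hi, extSign_notMem hl, extSign_notMem (by simp [hl, Ne.symm h]),
    extSign_notMem (by simp [hi, h]), wedgeSign_comm_insert h hi hl, neg_add_cancel]

theorem intSign_anticomm {i l : Fin d} (h : i ≠ l) (S : Finset (Fin d)) :
    intSign i S * intSign l (S.erase i) + intSign l S * intSign i (S.erase l) = 0 := by
  by_cases hi : i ∈ S
  swap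
  · simp [intSign, hi]
  by_cases hl : l ∈ S
  swap
  · simp [intSign, hl]
  obtain ⟨T, hi', hl', rfl⟩ : ∃ T : Finset (Fin d), i ∉ T ∧ l ∉ T ∧ S = insert i (insert l T) :=
    ⟨(S.erase i).erase l, by simp, by simp, by
      rw [Finset.insert_erase (Finset.mem_erase.2 ⟨Ne.symm h, hl⟩), Finset.insert_erase hi]⟩
  have h1 : i ∉ insert l T := by simp [h, hi']
  have h2 : l ∉ insert i T := by simp [Ne.symm h, hl']
  rw [intSign_insert h1, Finset.erase_insert h1, intSign_insert hl', Finset.insert_comm,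
    intSign_insert h2, Finset.erase_insert h2, intSign_insert hi']
  have := wedgeSign_comm_insert h hi' hl'
  linear_combination this

theorem extSign_intSign_anticomm {i l : Fin d} (h : i ≠ l) (S : Finset (Fin d)) :
    extSign i S * intSign l (insert i S) + intSign l S * extSign i (S.erase l) = 0 := by
  by_cases hi : i ∈ S
  · simp [extSign, hi, h]
  by_cases hl : l ∈ S
  swap
  · simp [intSign, hl, Ne.symm h]
  obtain ⟨T, hl', rfl⟩ : ∃ T : Finset (Fin d), l ∉ T ∧ S = insert l T :=
    ⟨S.erase l, by simp, (Finset.insert_erase hl).symm⟩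
  have hi' : i ∉ T := fun h => hi (by simp [h])
  have h2 : l ∉ insert i T := by simp [Ne.symm h, hl']
  rw [extSign_notMem hi, Finset.insert_comm, intSign_insert h2, intSign_insert hl',
    Finset.erase_insert hl', extSign_notMem hi', wedgeSign_insert_right hl' {i},
    wedgeSign_insert_right hi' {l}, wedgeSign_swap_singleton h]
  linear_combination (-(wedgeSign {i} T * wedgeSign {l} T)) * wedgeSign_mul_self {i} {l}

theorem extSign_intSign_self (i : Fin d) (S : Finset (Fin d)) :
    extSign i S * intSign i (insert i S) = if i ∈ S then 0 else 1 := by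
  by_cases hi : i ∈ S
  · simp [extSign, hi]
  · rw [intSign_insert hi, extSign_notMem hi, wedgeSign_mul_self, if_neg hi]

theorem intSign_extSign_self (i : Fin d) (S : Finset (Fin d)) :
    intSign i S * extSign i (S.erase i) = if i ∈ S then 1 else 0 := by
  by_cases hi : i ∈ S
  · rw [intSign_mem hi, extSign_notMem (by simp), wedgeSign_mul_self, if_pos hi]
  · simp [intSign, hi]

/-- Values of the derivation induced by contraction with `∂/∂z̄_i`. -/
def etaQ (R : Type) [CommRing R] [Algebra ℂ R] (i : Fin d) : FieldJet d B → FieldPoly R d B :=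
  mono R (fun j => extSign i j.1.1) fun j => ((insert i j.1.1, j.1.2), j.2)

/-- Values of the derivation induced by multiplication with `d z̄_i`. -/
def kapQ (R : Type) [CommRing R] [Algebra ℂ R] (i : Fin d) : FieldJet d B → FieldPoly R d B :=
  mono R (fun j => intSign i j.1.1) fun j => ((j.1.1.erase i, j.1.2), j.2)

/-- Values of the derivation induced by `d z̄_i ∂/∂z̄_i`. -/
def dbarQ (R : Type) [CommRing R] [Algebra ℂ R] (i : Fin d) : FieldJet d B → FieldPoly R d B :=
  mono R (fun j => intSign i j.1.1) fun j =>
    ((j.1.1.erase i, j.1.2), j.2 + Finsupp.single (Sum.inr i) 1)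

/-- Values of the derivation induced by the contraction of `∂/∂z̄_i` after division by `z̄_i`. -/
def htpQ (R : Type) [CommRing R] [Algebra ℂ R] (i : Fin d) : FieldJet d B → FieldPoly R d B :=
  mono R (fun j => extSign i j.1.1 * j.2 (Sum.inr i)) fun j =>
    ((insert i j.1.1, j.1.2), j.2 - Finsupp.single (Sum.inr i) 1)

theorem formDeg_insert {i : Fin d} {a : Finset (Fin d) × B} (h : i ∉ a.1) :
    formDeg degB (insert i a.1, a.2) = formDeg degB a - (-1) := by
  simp only [formDeg, Finset.card_insert_of_notMem h]
  push_cast; ring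

theorem formDeg_erase {i : Fin d} {a : Finset (Fin d) × B} (h : i ∈ a.1) :
    formDeg degB (a.1.erase i, a.2) = formDeg degB a - 1 := by
  simp only [formDeg, Finset.card_erase_of_mem h]
  rw [Nat.cast_sub (Finset.card_pos.2 ⟨i, h⟩)]
  push_cast; ring

theorem isHomogFamily_etaQ (i : Fin d) : IsHomogFamily (formDeg degB) (-1) 1 (etaQ R i) :=
  isHomogFamily_mono fun j hj => formDeg_insert (a := j.1) fun h => hj (extSign_mem h)

theorem isHomogFamily_kapQ (i : Fin d) : IsHomogFamily (formDeg degB) 1 1 (kapQ R i) :=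
  isHomogFamily_mono fun j hj => formDeg_erase (a := j.1)
    (by by_contra h; exact hj (intSign_notMem h))

theorem isHomogFamily_dbarQ (i : Fin d) : IsHomogFamily (formDeg degB) 1 1 (dbarQ R i) :=
  isHomogFamily_mono fun j hj => formDeg_erase (a := j.1)
    (by by_contra h; exact hj (intSign_notMem h))

theorem isHomogFamily_htpQ (i : Fin d) : IsHomogFamily (formDeg degB) (-1) 1 (htpQ R i) :=
  isHomogFamily_mono fun j hj => formDeg_insert (a := j.1) fun h => hj (by simp [extSign_mem h])

theorem isEvolutionary_etaQ (hδ : CommDer δ) (i : Fin d) :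
    IsEvolutionary δ (etaQ (B := B) R i) :=
  isEvolutionary_mono hδ (fun _ _ => rfl) fun _ _ _ => rfl

theorem isEvolutionary_kapQ (hδ : CommDer δ) (i : Fin d) :
    IsEvolutionary δ (kapQ (B := B) R i) :=
  isEvolutionary_mono hδ (fun _ _ => rfl) fun _ _ _ => rfl

theorem isEvolutionary_dbarQ (hδ : CommDer δ) (i : Fin d) :
    IsEvolutionary δ (dbarQ (B := B) R i) :=
  isEvolutionary_mono hδ (fun _ _ => rfl) fun _ _ _ => Prod.ext rfl (add_right_comm _ _ _)

/-- The derivation induced by contraction with `∂/∂z̄_i`. -/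
def etaD (R : Type) [CommRing R] [Algebra ℂ R] (degB : B → ℤ) (i : Fin d) :
    FieldPoly R d B →ₗ[ℂ] FieldPoly R d B := der (formDeg degB) (-1) (etaQ R i)

/-- The derivation induced by multiplication with `d z̄_i`. -/
def kapD (R : Type) [CommRing R] [Algebra ℂ R] (degB : B → ℤ) (i : Fin d) :
    FieldPoly R d B →ₗ[ℂ] FieldPoly R d B := der (formDeg degB) 1 (kapQ R i)

/-- The derivation induced by the Dolbeault operator. -/
def dbarD (R : Type) [CommRing R] [Algebra ℂ R] (degB : B → ℤ) :
    FieldPoly R d B →ₗ[ℂ] FieldPoly R d B := ∑ i, der (formDeg degB) 1 (dbarQ R i)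

/-- A homotopy for the Dolbeault operator on formal power series. -/
def htpD (R : Type) [CommRing R] [Algebra ℂ R] (degB : B → ℤ) :
    FieldPoly R d B →ₗ[ℂ] FieldPoly R d B := ∑ i, der (formDeg degB) (-1) (htpQ R i)

theorem dbarD_eq_der : dbarD (d := d) R degB = der (formDeg degB) 1 (∑ i, dbarQ R i) :=
  (der_sum_left _ _).symm

theorem isHomogFamily_sum {A ι κ : Type} {deg : A → ℤ} {p : ℤ} {m : ℕ} {s : Finset κ}
    {q : κ → A × (ι →₀ ℕ) → JetPoly R ι A} (h : ∀ i ∈ s, IsHomogFamily deg p m (q i)) :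
    IsHomogFamily deg p m (∑ i ∈ s, q i) := fun j => by
  rw [Finset.sum_apply]
  exact Submodule.sum_mem _ fun i hi => h i hi j

theorem isEvolutionary_sum {A ι κ : Type} {δ : ι → R →ₗ[ℂ] R} {s : Finset κ}
    {q : κ → A × (ι →₀ ℕ) → JetPoly R ι A} (h : ∀ i ∈ s, IsEvolutionary δ (q i)) :
    IsEvolutionary δ (∑ i ∈ s, q i) := fun j i => by
  rw [Finset.sum_apply, Finset.sum_apply, map_sum]
  exact Finset.sum_congr rfl fun l hl => h l hl j i

theorem isHomogFamily_dbar : IsHomogFamily (formDeg degB) 1 1 (∑ i : Fin d, dbarQ R i) :=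
  isHomogFamily_sum fun i _ => isHomogFamily_dbarQ i

theorem isEvolutionary_dbar (hδ : CommDer δ) : IsEvolutionary (A := Finset (Fin d) × B) δ (∑ i : Fin d, dbarQ R i) :=
  isEvolutionary_sum fun i _ => isEvolutionary_dbarQ hδ i

variable {n : ℕ} {k : ℤ} {x : FieldPoly R d B}

theorem etaD_mem_homog (i : Fin d) (hx : x ∈ homog R (formDeg degB) n k) :
    etaD R degB i x ∈ homog R (formDeg degB) n (k + 1) := by
  have := der_mem_homog_of_one (isHomogFamily_etaQ i) hx
  rwa [sub_neg_eq_add] at this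

theorem kapD_mem_homog (i : Fin d) (hx : x ∈ homog R (formDeg degB) n k) :
    kapD R degB i x ∈ homog R (formDeg degB) n (k - 1) :=
  der_mem_homog_of_one (isHomogFamily_kapQ i) hx

theorem dbarD_mem_homog (hx : x ∈ homog R (formDeg degB) n k) :
    dbarD R degB x ∈ homog R (formDeg degB) n (k - 1) := by
  rw [dbarD_eq_der]
  exact der_mem_homog_of_one isHomogFamily_dbar hx

theorem htpD_mem_homog (hx : x ∈ homog R (formDeg degB) n k) :
    htpD R degB x ∈ homog R (formDeg degB) n (k + 1) := by
  rw [htpD, LinearMap.sum_apply]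
  refine Submodule.sum_mem _ fun i _ => ?_
  have := der_mem_homog_of_one (isHomogFamily_htpQ i) hx
  rwa [sub_neg_eq_add] at this

theorem etaD_mem_koszul (i : Fin d) (hx : x ∈ koszulRel R (formDeg degB)) :
    etaD R degB i x ∈ koszulRel R (formDeg degB) := der_mem_koszul (isHomogFamily_etaQ i) hx

theorem htpD_mem_koszul (hx : x ∈ koszulRel R (formDeg degB)) :
    htpD R degB x ∈ koszulRel R (formDeg degB) := by
  rw [htpD, LinearMap.sum_apply]
  exact Submodule.sum_mem _ fun i _ => der_mem_koszul (isHomogFamily_htpQ i) hx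

theorem etaD_totalD (hδ : CommDer δ) (i : Fin d) (l : Fin d ⊕ Fin d) (x : FieldPoly R d B) :
    etaD R degB i (totalD δ l x) = totalD δ l (etaD R degB i x) :=
  der_totalD hδ (isEvolutionary_etaQ hδ i) l x

theorem dbarD_totalD (hδ : CommDer δ) (l : Fin d ⊕ Fin d) (x : FieldPoly R d B) :
    dbarD R degB (totalD δ l x) = totalD δ l (dbarD R degB x) := by
  rw [dbarD_eq_der]
  exact der_totalD hδ (isEvolutionary_dbar hδ) l x

theorem etaD_mem_locSub (hδ : CommDer δ) (i : Fin d) (hx : x ∈ locSub δ (formDeg degB)) :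
    etaD R degB i x ∈ locSub δ (formDeg degB) :=
  der_mem_locSub hδ (isHomogFamily_etaQ i) (isEvolutionary_etaQ hδ i) hx

theorem kapD_mem_locSub (hδ : CommDer δ) (i : Fin d) (hx : x ∈ locSub δ (formDeg degB)) :
    kapD R degB i x ∈ locSub δ (formDeg degB) :=
  der_mem_locSub hδ (isHomogFamily_kapQ i) (isEvolutionary_kapQ hδ i) hx

theorem dbarD_mem_locSub (hδ : CommDer δ) (hx : x ∈ locSub δ (formDeg degB)) :
    dbarD R degB x ∈ locSub δ (formDeg degB) := by
  rw [dbarD_eq_der]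
  exact der_mem_locSub hδ isHomogFamily_dbar (isEvolutionary_dbar hδ) hx

theorem sgn_neg_one : sgn (-1) = -1 := by simp [sgn]

theorem etaD_anticomm (i l : Fin d) (x : FieldPoly R d B) :
    etaD R degB i (etaD R degB l x) + etaD R degB l (etaD R degB i x) = 0 := by
  rw [etaD, etaD, der_anticomm (r := 0) (isHomogFamily_etaQ i) (isHomogFamily_etaQ l)
    (by simp), der_zero_left, LinearMap.zero_apply]
  rintro ⟨⟨S, b⟩, K⟩
  rw [etaQ, etaQ, der_mono_mono, der_mono_mono]
  simp only [Pi.zero_apply]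
  by_cases h : i = l
  · subst h; simp [extSign]
  · rw [Finset.insert_comm l i, ← add_smul, add_comm, extSign_anticomm h, zero_smul]

theorem etaD_sq (i : Fin d) (x : FieldPoly R d B) : etaD R degB i (etaD R degB i x) = 0 := by
  have h := etaD_anticomm (degB := degB) i i x
  rw [← two_smul ℂ] at h
  exact (smul_eq_zero.1 h).resolve_left two_ne_zero

theorem kapD_etaD_of_ne {i l : Fin d} (h : i ≠ l) (x : FieldPoly R d B) :
    etaD R degB i (kapD R degB l x) + kapD R degB l (etaD R degB i x) = 0 := by
  rw [etaD, kapD, der_anticomm (r := 0) (isHomogFamily_etaQ i) (isHomogFamily_kapQ l)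
    (by simp [sgn_neg_one]), der_zero_left, LinearMap.zero_apply]
  rintro ⟨⟨S, b⟩, K⟩
  rw [etaQ, kapQ, der_mono_mono, der_mono_mono]
  simp only [Pi.zero_apply]
  rw [Finset.erase_insert_of_ne h, ← add_smul, add_comm, extSign_intSign_anticomm h, zero_smul]

/-- Contraction with `∂/∂z̄_i` and multiplication by `d z̄_i` anticommute to the identity on fields,
hence to the letter count on functionals. For `n ≠ 0` this makes `η_i`-closed elements `η_i`-exact.
-/
theorem kapD_etaD_self (i : Fin d) (hx : x ∈ homog R (formDeg degB) n k) :
    etaD R degB i (kapD R degB i x) + kapD R degB i (etaD R degB i x) = (n : ℂ) • x := by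
  rw [← der_letter_eq hx, etaD, kapD, der_anticomm (r := letter R) (isHomogFamily_etaQ i)
    (isHomogFamily_kapQ i) (by simp [sgn_neg_one]), neg_add_cancel]
  rintro ⟨⟨S, b⟩, K⟩
  rw [etaQ, kapQ, der_mono_mono, der_mono_mono]
  simp only [intSign_extSign_self, extSign_intSign_self]
  split_ifs with h
  · simp [Finset.insert_erase h]
  · simp [Finset.erase_insert h]

theorem kapD_dbarD (i : Fin d) (x : FieldPoly R d B) :
    kapD R degB i (dbarD R degB x) + dbarD R degB (kapD R degB i x) = 0 := by
  simp only [dbarD, LinearMap.sum_apply, map_sum, ← Finset.sum_add_distrib]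
  refine Finset.sum_eq_zero fun l _ => ?_
  rw [kapD, der_anticomm (r := 0) (isHomogFamily_kapQ i) (isHomogFamily_dbarQ l)
    (by simp), der_zero_left, LinearMap.zero_apply]
  rintro ⟨⟨S, b⟩, K⟩
  rw [kapQ, dbarQ, der_mono_mono, der_mono_mono]
  simp only [Pi.zero_apply]
  by_cases h : i = l
  · subst h; simp [intSign]
  · rw [Finset.erase_right_comm (a := l), ← add_smul, add_comm, intSign_anticomm h, zero_smul]

theorem dbarD_sq (x : FieldPoly R d B) : dbarD R degB (dbarD R degB x) = 0 := by
  have h : dbarD R degB (dbarD R degB x) + dbarD R degB (dbarD R degB x) = 0 := by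
    simp only [dbarD, LinearMap.sum_apply, map_sum]
    nth_rewrite 2 [Finset.sum_comm]
    simp only [← Finset.sum_add_distrib]
    refine Finset.sum_eq_zero fun l _ => Finset.sum_eq_zero fun i _ => ?_
    rw [der_anticomm (r := 0) (isHomogFamily_dbarQ i) (isHomogFamily_dbarQ l)
      (by simp), der_zero_left, LinearMap.zero_apply]
    rintro ⟨⟨S, b⟩, K⟩
    rw [dbarQ, dbarQ, der_mono_mono, der_mono_mono]
    simp only [Pi.zero_apply]
    by_cases h : i = l
    · subst h; simp [intSign]
    · rw [Finset.erase_right_comm (a := l), add_right_comm K, ← add_smul, add_comm,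
        intSign_anticomm h, zero_smul]
  rw [← two_smul ℂ] at h
  exact (smul_eq_zero.1 h).resolve_left two_ne_zero

/-- Cartan's formula for the contraction of `∂/∂z̄_i` with `∂̄`. -/
theorem etaD_dbarD (i : Fin d) (x : FieldPoly R d B) :
    etaD R degB i (dbarD R degB x) + dbarD R degB (etaD R degB i x) = fieldD R (Sum.inr i) x := by
  simp only [dbarD, LinearMap.sum_apply, map_sum, ← Finset.sum_add_distrib]
  rw [Finset.sum_eq_single i]
  · rw [fieldD_eq_der (formDeg degB), etaD, der_anticomm (isHomogFamily_etaQ i)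
      (isHomogFamily_dbarQ i) (by simp [sgn_neg_one]) fun j => rfl, neg_add_cancel]
    congr 2
    funext ⟨⟨S, b⟩, K⟩
    rw [etaQ, dbarQ, der_mono_mono, der_mono_mono]
    simp only [intSign_extSign_self, extSign_intSign_self]
    split_ifs with h
    · simp [Finset.insert_erase h]
    · simp [Finset.erase_insert h]
  · intro l _ hl
    rw [etaD, der_anticomm (r := 0) (isHomogFamily_etaQ i) (isHomogFamily_dbarQ l)
      (by simp [sgn_neg_one]), der_zero_left, LinearMap.zero_apply]
    rintro ⟨⟨S, b⟩, K⟩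
    rw [etaQ, dbarQ, der_mono_mono, der_mono_mono]
    simp only [Pi.zero_apply]
    rw [Finset.erase_insert_of_ne (Ne.symm hl), ← add_smul, add_comm,
      extSign_intSign_anticomm (Ne.symm hl), zero_smul]
  · simp

/-- The weight of a jet coordinate: the form degree plus the number of antiholomorphic
derivatives. -/
def jetWeight (j : FieldJet d B) : ℕ := ∑ i, ((if i ∈ j.1.1 then 1 else 0) + j.2 (Sum.inr i))

/-- The `∂̄`-Poincaré lemma for formal power series in dual form. The factor `K_i` with lowered
index is dual to multiplication by `z̄_i`, so `htpD` comes from contraction with `∑ z̄_i ∂/∂z̄_i`,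
whose Lie derivative acts on a jet coordinate by its weight. -/
theorem htpD_dbarD (x : FieldPoly R d B) :
    htpD R degB (dbarD R degB x) + dbarD R degB (htpD R degB x) =
      der (formDeg degB) 0 (fun j => (jetWeight j : ℂ) • letter R j) x := by
  have h1 : ∀ i l, der (formDeg degB) (-1) (htpQ R i) (der (formDeg degB) 1 (dbarQ R l) x) +
      der (formDeg degB) 1 (dbarQ R l) (der (formDeg degB) (-1) (htpQ R i) x) =
      if i = l then der (formDeg degB) 0 (fun j : FieldJet d B =>
        (((if i ∈ j.1.1 then 1 else 0) + j.2 (Sum.inr i) : ℕ) : ℂ) • letter R j) x else 0 := by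
    intro i l
    split_ifs with h
    · subst h
      rw [der_anticomm (isHomogFamily_htpQ i) (isHomogFamily_dbarQ i)
        (by simp [sgn_neg_one]) fun j => rfl, neg_add_cancel]
      congr 2
      funext ⟨⟨S, b⟩, K⟩
      rw [htpQ, dbarQ, der_mono_mono, der_mono_mono]
      simp only [Finsupp.add_apply, Finsupp.single_eq_same, add_tsub_cancel_right, ← mul_assoc,
        intSign_extSign_self]
      rw [mul_right_comm, extSign_intSign_self]
      split_ifs with h
      · simp [Finset.insert_erase h, add_comm]
      · by_cases hK : K (Sum.inr i) = 0
        · simp [hK]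
        · rw [tsub_add_cancel_of_le (Finsupp.single_le_iff.2 (Nat.one_le_iff_ne_zero.2 hK))]
          simp [Finset.erase_insert h]
    · rw [der_anticomm (r := 0) (isHomogFamily_htpQ i) (isHomogFamily_dbarQ l)
        (by simp [sgn_neg_one]), der_zero_left, LinearMap.zero_apply]
      rintro ⟨⟨S, b⟩, K⟩
      rw [htpQ, dbarQ, der_mono_mono, der_mono_mono]
      simp only [Pi.zero_apply]
      have h0 : (Finsupp.single (Sum.inr l) 1 : Fin d ⊕ Fin d →₀ ℕ) (Sum.inr i) = 0 :=
        Finsupp.single_eq_of_ne (by simpa using h)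
      by_cases hK : K (Sum.inr i) = 0
      · simp [hK, h0]
      · have hK' : K + Finsupp.single (Sum.inr l) 1 - Finsupp.single (Sum.inr i) 1 =
            K - Finsupp.single (Sum.inr i) 1 + Finsupp.single (Sum.inr l) 1 :=
          tsub_add_eq_add_tsub (Finsupp.single_le_iff.2 (Nat.one_le_iff_ne_zero.2 hK)) |>.symm
        rw [hK', Finset.erase_insert_of_ne h, ← add_smul, Finsupp.add_apply, h0, add_zero]
        have := extSign_intSign_anticomm h S
        have e : intSign l S * (extSign i (S.erase l) * (K (Sum.inr i) : ℂ)) +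
            extSign i S * (K (Sum.inr i) : ℂ) * intSign l (insert i S) = 0 := by
          linear_combination (K (Sum.inr i) : ℂ) * this
        rw [e, zero_smul]
  have h2 : (fun j : FieldJet d B => (jetWeight j : ℂ) • letter R j) = ∑ i, fun j : FieldJet d B =>
      (((if i ∈ j.1.1 then 1 else 0) + j.2 (Sum.inr i) : ℕ) : ℂ) • letter R j := by
    funext j
    rw [Finset.sum_apply, jetWeight, Nat.cast_sum, Finset.sum_smul]
  rw [h2, der_sum_left, LinearMap.sum_apply]
  simp only [dbarD, htpD, LinearMap.sum_apply, map_sum]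
  nth_rewrite 2 [Finset.sum_comm]
  simp only [← Finset.sum_add_distrib, h1]
  simp

theorem htpQ_fieldD_of_ne {i : Fin d} {l : Fin d ⊕ Fin d} (h : Sum.inr i ≠ l)
    (x : FieldPoly R d B) : der (formDeg degB) (-1) (htpQ R i) (fieldD R l x) =
      fieldD R l (der (formDeg degB) (-1) (htpQ R i) x) := by
  rw [fieldD_eq_der_mono (formDeg degB), ← sub_eq_zero]
  have := der_comm (isHomogFamily_htpQ i) (isHomogFamily_fieldD (R := R) (deg := formDeg degB) l) x
  rw [mul_zero, sgn_zero, one_smul] at this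
  rw [this]
  have e : (fun j : FieldJet d B => der (formDeg degB) (-1) (htpQ R i)
      (mono R (fun _ => 1) (fun j => (j.1, j.2 + Finsupp.single l 1)) j) -
      (1 : ℂ) • der (formDeg degB) 0 (mono R (fun _ => 1) fun j => (j.1, j.2 + Finsupp.single l 1))
        (htpQ R i j)) = 0 := by
    funext ⟨⟨S, b⟩, K⟩
    rw [htpQ, der_mono_mono, der_mono_mono]
    have h0 : (Finsupp.single l 1 : Fin d ⊕ Fin d →₀ ℕ) (Sum.inr i) = 0 :=
      Finsupp.single_eq_of_ne h
    by_cases hK : K (Sum.inr i) = 0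
    · simp [hK, h0]
    · have hK' : K + Finsupp.single l 1 - Finsupp.single (Sum.inr i) 1 =
          K - Finsupp.single (Sum.inr i) 1 + Finsupp.single l 1 :=
        tsub_add_eq_add_tsub (Finsupp.single_le_iff.2 (Nat.one_le_iff_ne_zero.2 hK)) |>.symm
      simp [hK', h0]
  rw [e, der_zero_left, LinearMap.zero_apply]

theorem htpD_fieldD_inl (i : Fin d) (x : FieldPoly R d B) :
    htpD R degB (fieldD R (Sum.inl i) x) = fieldD R (Sum.inl i) (htpD R degB x) := by
  simp only [htpD, LinearMap.sum_apply, map_sum]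
  exact Finset.sum_congr rfl fun l _ => htpQ_fieldD_of_ne (by simp) x

theorem htpQ_fieldD_self (i : Fin d) (x : FieldPoly R d B) :
    der (formDeg degB) (-1) (htpQ R i) (fieldD R (Sum.inr i) x) =
      fieldD R (Sum.inr i) (der (formDeg degB) (-1) (htpQ R i) x) + etaD R degB i x := by
  rw [fieldD_eq_der_mono (formDeg degB), ← sub_eq_iff_eq_add']
  have := der_comm (isHomogFamily_htpQ i)
    (isHomogFamily_fieldD (R := R) (deg := formDeg degB) (Sum.inr i)) x
  rw [mul_zero, sgn_zero, one_smul] at this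
  rw [this, etaD]
  congr 2
  funext ⟨⟨S, b⟩, K⟩
  rw [htpQ, der_mono_mono, der_mono_mono, etaQ, mono]
  simp only [Finsupp.add_apply, Finsupp.single_eq_same, add_tsub_cancel_right, one_mul, mul_one,
    one_smul]
  by_cases hK : K (Sum.inr i) = 0
  · simp [hK]
  · rw [tsub_add_cancel_of_le (Finsupp.single_le_iff.2 (Nat.one_le_iff_ne_zero.2 hK)), ← sub_smul]
    congr 1
    push_cast
    ring

/-- The Euler field is not translation invariant: the homotopy fails to commute with `∂/∂z̄_i`, but
only by the contraction `η_i`. Hence it does not descend to local functionals by itself, yet does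
after applying all contractions. -/
theorem htpD_fieldD_inr (i : Fin d) (x : FieldPoly R d B) :
    htpD R degB (fieldD R (Sum.inr i) x) = fieldD R (Sum.inr i) (htpD R degB x) +
      etaD R degB i x := by
  simp only [htpD, LinearMap.sum_apply, map_sum]
  rw [← Finset.add_sum_erase _ _ (Finset.mem_univ i), htpQ_fieldD_self,
    ← Finset.add_sum_erase _ (fun l => fieldD R (Sum.inr i)
      (der (formDeg degB) (-1) (htpQ R l) x)) (Finset.mem_univ i), add_right_comm]
  congr 1
  congr 1
  exact Finset.sum_congr rfl fun l hl => htpQ_fieldD_of_ne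
    (by simpa using Finset.ne_of_mem_erase hl) x

end Dolbeault

/-! ### Iterated contractions -/

section Contractions

variable {R : Type} [CommRing R] [Algebra ℂ R] {d : ℕ} {B : Type} {degB : B → ℤ}
  {δ : Fin d ⊕ Fin d → R →ₗ[ℂ] R}

/-- Composition of the contractions along a list of indices. -/
def etaL (R : Type) [CommRing R] [Algebra ℂ R] (degB : B → ℤ) :
    List (Fin d) → FieldPoly R d B →ₗ[ℂ] FieldPoly R d B
  | [] => LinearMap.id
  | i :: L => etaD R degB i ∘ₗ etaL R degB L

@[simp] theorem etaL_nil (x : FieldPoly R d B) : etaL R degB [] x = x := rfl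

theorem etaL_cons (i : Fin d) (L : List (Fin d)) (x : FieldPoly R d B) :
    etaL R degB (i :: L) x = etaD R degB i (etaL R degB L x) := rfl

theorem etaL_mem {P : Submodule ℂ (FieldPoly R d B)} (hP : ∀ i, ∀ x ∈ P, etaD R degB i x ∈ P)
    (L : List (Fin d)) {x : FieldPoly R d B} (hx : x ∈ P) : etaL R degB L x ∈ P := by
  induction L with
  | nil => exact hx
  | cons i L ih => exact hP i _ ih

theorem etaL_mem_locSub (hδ : CommDer δ) (L : List (Fin d)) {x : FieldPoly R d B}
    (hx : x ∈ locSub δ (formDeg degB)) : etaL R degB L x ∈ locSub δ (formDeg degB) :=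
  etaL_mem (fun i _ => etaD_mem_locSub hδ i) L hx

theorem etaL_mem_homog (L : List (Fin d)) {n : ℕ} {k : ℤ} {x : FieldPoly R d B}
    (hx : x ∈ homog R (formDeg degB) n k) :
    etaL R degB L x ∈ homog R (formDeg degB) n (k + L.length) := by
  induction L with
  | nil => simpa using hx
  | cons i L ih =>
    have := etaD_mem_homog i ih
    rw [etaL_cons]
    convert this using 2
    push_cast [List.length_cons]
    ring

/-- An operator which anticommutes with contractions up to relations. -/
theorem anticomm_etaL {P : Submodule ℂ (FieldPoly R d B)} (hP : ∀ i, ∀ x ∈ P, etaD R degB i x ∈ P)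
    {Y : FieldPoly R d B →ₗ[ℂ] FieldPoly R d B}
    (hY : ∀ i x, Y (etaD R degB i x) + etaD R degB i (Y x) ∈ P) (L : List (Fin d))
    (x : FieldPoly R d B) :
    Y (etaL R degB L x) ≡ sgn L.length • etaL R degB L (Y x) [SMOD P] := by
  induction L with
  | nil => simp
  | cons i L ih =>
    rw [etaL_cons, etaL_cons, List.length_cons]
    have h1 : Y (etaD R degB i (etaL R degB L x)) ≡ -etaD R degB i (Y (etaL R degB L x)) [SMOD P] := by
      rw [SModEq.sub_mem, sub_neg_eq_add]
      exact hY i _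
    refine h1.trans ?_
    have h2 := SModEq.neg' (SModEq.map_of_le (etaD R degB i) (hP i) ih)
    refine h2.trans (SModEq.of_eq ?_)
    push_cast
    rw [map_smul, sgn_add, sgn_one]
    module

theorem etaD_etaL (i : Fin d) (L : List (Fin d)) (x : FieldPoly R d B) :
    etaD R degB i (etaL R degB L x) = sgn L.length • etaL R degB L (etaD R degB i x) := by
  have := anticomm_etaL (R := R) (P := ⊥) (degB := degB) (Y := etaD R degB i)
    (by simp) (fun l x => by simpa using etaD_anticomm i l x) L x
  rwa [SModEq.bot] at this

theorem etaD_etaL_of_mem {i : Fin d} {L : List (Fin d)} (h : i ∈ L) (x : FieldPoly R d B) :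
    etaD R degB i (etaL R degB L x) = 0 := by
  induction L with
  | nil => simp at h
  | cons l L ih =>
    rw [etaL_cons]
    rcases List.mem_cons.1 h with rfl | h
    · exact etaD_sq i _
    · have := etaD_anticomm (degB := degB) i l (etaL R degB L x)
      rwa [ih h, map_zero, add_zero] at this

/-- Up to sign `η_i` moves through the other contractions until it meets its own copy, and `η_i² =
0`. This removes the defect of `htpD_fieldD_inr`. -/
theorem etaL_etaD_of_mem {i : Fin d} {L : List (Fin d)} (h : i ∈ L) (x : FieldPoly R d B) :
    etaL R degB L (etaD R degB i x) = 0 := by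
  have := etaD_etaL (degB := degB) i L x
  rw [etaD_etaL_of_mem h] at this
  exact (smul_eq_zero.1 this.symm).resolve_left (sgn_ne_zero _)

/-- Local functionals annihilated by contractions are iterated contractions. -/
theorem exists_eq_etaL (hδ : CommDer δ) {n : ℕ} (hn : n ≠ 0) {L : List (Fin d)} (hL : L.Nodup)
    {k : ℤ} {x : FieldPoly R d B} (hx : x ∈ homog R (formDeg degB) n k)
    (h : ∀ i ∈ L, etaD R degB i x ∈ locSub δ (formDeg degB)) :
    ∃ y ∈ homog R (formDeg degB) n (k - L.length),
      x ≡ etaL R degB L y [SMOD locSub δ (formDeg degB)] ∧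
      (dbarD R degB x ∈ locSub δ (formDeg degB) → dbarD R degB y ∈ locSub δ (formDeg degB)) := by
  induction L generalizing k x with
  | nil => exact ⟨x, by simpa using hx, SModEq.rfl, id⟩
  | cons i L ih =>
    have hn' : (n : ℂ) ≠ 0 := by exact_mod_cast hn
    obtain ⟨hiL, hL⟩ := List.nodup_cons.1 hL
    -- By `kapD_etaD_self`, `z` is an `η_i`-primitive of `x` modulo relations. Multiplication by `d
    -- z̄_i` anticommutes with the remaining contractions and with `∂̄`, so `z` inherits all
    -- hypotheses for the shorter list.
    set z := (n : ℂ)⁻¹ • kapD R degB i x with hz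
    have hzh : z ∈ homog R (formDeg degB) n (k - 1) := Submodule.smul_mem _ _ (kapD_mem_homog i hx)
    obtain ⟨y, hy, h1, h2⟩ := ih hL hzh fun l hl => by
      have hli : l ≠ i := fun e => hiL (e ▸ hl)
      rw [hz, map_smul]
      refine Submodule.smul_mem _ _ ?_
      rw [eq_neg_of_add_eq_zero_left (kapD_etaD_of_ne hli x)]
      exact neg_mem (kapD_mem_locSub hδ i (h l (List.mem_cons_of_mem _ hl)))
    refine ⟨y, ?_, ?_, fun hd => h2 ?_⟩
    · convert hy using 2
      push_cast [List.length_cons]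
      ring
    · have h3 : x ≡ etaD R degB i z [SMOD locSub δ (formDeg degB)] := by
        have e : x - etaD R degB i z = (n : ℂ)⁻¹ • kapD R degB i (etaD R degB i x) := by
          have := kapD_etaD_self i hx
          rw [hz, map_smul, eq_sub_of_add_eq' this, smul_sub, smul_smul, inv_mul_cancel₀ hn',
            one_smul]
        rw [SModEq.sub_mem, e]
        exact Submodule.smul_mem _ _ (kapD_mem_locSub hδ i (h i List.mem_cons_self))
      exact h3.trans (SModEq.map_of_le (etaD R degB i) (fun _ => etaD_mem_locSub hδ i) h1)
    · rw [hz, map_smul, eq_neg_of_add_eq_zero_right (kapD_dbarD i x)]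
      exact Submodule.smul_mem _ _ (neg_mem (kapD_mem_locSub hδ i hd))

end Contractions

/-! ### Weights -/

section Weights

variable {d : ℕ} {B : Type} {degB : B → ℤ}

/-- Weight of a word. -/
def wordWeight (w : List (FieldJet d B)) : ℕ := (w.map jetWeight).sum

/-- Multiplication of the words by a function of their weight. -/
def wtMap (f : ℕ → ℂ) : FieldPoly ℂ d B →ₗ[ℂ] FieldPoly ℂ d B :=
  Finsupp.lsum ℂ fun w => f (wordWeight w) • Finsupp.lsingle w

theorem wtMap_single (f : ℕ → ℂ) (w : List (FieldJet d B)) (r : ℂ) :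
    wtMap f (Finsupp.single w r) = f (wordWeight w) • Finsupp.single w r := by
  simp [wtMap]

theorem wtMap_consL (f : ℕ → ℂ) (j : FieldJet d B) (x : FieldPoly ℂ d B) :
    wtMap f (consL j x) = consL j (wtMap (fun m => f (jetWeight j + m)) x) := by
  induction x using Finsupp.induction_linear with
  | zero => simp
  | add x y hx hy => simp only [map_add, hx, hy]
  | single w r => rw [consL_single, wtMap_single, wtMap_single, map_smul, consL_single]; rfl

theorem wtMap_wtMap (f g : ℕ → ℂ) (x : FieldPoly ℂ d B) :
    wtMap f (wtMap g x) = wtMap (fun m => f m * g m) x := by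
  induction x using Finsupp.induction_linear with
  | zero => simp
  | add x y hx hy => simp only [map_add, hx, hy]
  | single w r => rw [wtMap_single, map_smul, wtMap_single, wtMap_single, smul_smul, mul_comm]

theorem wtMap_add (f g : ℕ → ℂ) (x : FieldPoly ℂ d B) :
    wtMap (fun m => f m + g m) x = wtMap f x + wtMap g x := by
  induction x using Finsupp.induction_linear with
  | zero => simp
  | add x y hx hy => simp only [map_add, hx, hy]; abel
  | single w r => simp only [wtMap_single, add_smul]

theorem wtMap_one (x : FieldPoly ℂ d B) : wtMap (fun _ => 1) x = x := by
  induction x using Finsupp.induction_linear with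
  | zero => simp
  | add x y hx hy => simp only [map_add, hx, hy]
  | single w r => rw [wtMap_single, one_smul]

@[simp] theorem wtMap_zero : wtMap (fun _ => 0) = (0 : FieldPoly ℂ d B →ₗ[ℂ] FieldPoly ℂ d B) := by
  refine Finsupp.lhom_ext fun w r => ?_
  rw [wtMap_single, zero_smul, LinearMap.zero_apply]

theorem wtMap_id (x : FieldPoly ℂ d B) :
    wtMap (fun m => (m : ℂ)) x = der (formDeg degB) 0 (fun j => (jetWeight j : ℂ) • letter ℂ j) x := by
  induction x using Finsupp.induction_linear with
  | zero => simp
  | add x y hx hy => simp only [map_add, hx, hy]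
  | single w r =>
    induction w with
    | nil => simp [wtMap_single, wordWeight]
    | cons j w ih =>
      rw [wtMap_single] at ih
      rw [wtMap_single, ← consL_single, der_consL, ← ih, zero_mul, sgn_zero, one_smul, map_smul,
        map_smul, LinearMap.smul_apply, letter_mul, ← add_smul]
      simp [wordWeight]

theorem wtMap_mem_homog (f : ℕ → ℂ) {deg : Finset (Fin d) × B → ℤ} {n : ℕ} {k : ℤ}
    {x : FieldPoly ℂ d B} (hx : x ∈ homog ℂ deg n k) : wtMap f x ∈ homog ℂ deg n k :=
  homog_le_comap (wtMap f) (fun w r h h' => by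
    rw [wtMap_single]; exact Submodule.smul_mem _ _ (single_mem_homog h h')) hx

theorem wtMap_mem_koszul (f : ℕ → ℂ) {deg : Finset (Fin d) × B → ℤ}
    {x : FieldPoly ℂ d B} (hx : x ∈ koszulRel ℂ deg) : wtMap f x ∈ koszulRel ℂ deg := by
  revert x
  change koszulRel ℂ deg ≤ (koszulRel ℂ deg).comap (wtMap f)
  refine Submodule.span_le.2 ?_
  rintro _ ⟨u, v, x, y, r, rfl⟩
  change wtMap f _ ∈ koszulRel ℂ deg
  have h : wordWeight (u ++ y :: x :: v) = wordWeight (u ++ x :: y :: v) := by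
    simp [wordWeight]; ring
  rw [map_sub, map_smul, wtMap_single, wtMap_single, h, smul_comm, ← smul_sub]
  exact Submodule.smul_mem _ _ (Submodule.subset_span ⟨u, v, x, y, r, rfl⟩)

/-- A derivation which shifts weights. -/
theorem wtMap_der_mono {deg : Finset (Fin d) × B → ℤ} {p : ℤ} {c : FieldJet d B → ℂ}
    {g : FieldJet d B → FieldJet d B} (s : ℕ)
    (h : ∀ j, c j ≠ 0 → jetWeight (g j) = jetWeight j + s) (f : ℕ → ℂ) (x : FieldPoly ℂ d B) :
    wtMap f (der deg p (mono ℂ c g) x) = der deg p (mono ℂ c g) (wtMap (fun m => f (m + s)) x) := by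
  induction x using word_induction generalizing f with
  | hnil r => rw [der_nil, map_zero, wtMap_single, map_smul, der_nil, smul_zero]
  | hcons j x ih =>
    rw [der_consL, map_add, map_smul, wtMap_consL, ih, wtMap_consL, der_consL]
    simp only [add_assoc]
    congr 1
    rw [mono, map_smul, LinearMap.smul_apply, letter_mul, map_smul, wtMap_consL,
      LinearMap.smul_apply, letter_mul]
    by_cases hc : c j = 0
    · rw [hc, zero_smul, zero_smul]
    · simp only [h j hc]
      congr 4
      funext m
      congr 1
      ring
  | hadd x y hx hy => simp only [map_add, hx, hy]

theorem jetWeight_eq {j j' : FieldJet d B} (h : ∀ l, (if l ∈ j.1.1 then 1 else 0) + j.2 (Sum.inr l) =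
    (if l ∈ j'.1.1 then 1 else 0) + j'.2 (Sum.inr l)) : jetWeight j = jetWeight j' :=
  Finset.sum_congr rfl fun l _ => h l

/-- On jet coordinates `∂̄` trades a factor `d z̄_i` for a derivative `∂/∂z̄_i`; both count one in
the weight. -/
theorem wtMap_dbarD (f : ℕ → ℂ) (x : FieldPoly ℂ d B) :
    wtMap f (dbarD ℂ degB x) = dbarD ℂ degB (wtMap f x) := by
  simp only [dbarD, LinearMap.sum_apply, map_sum]
  refine Finset.sum_congr rfl fun i _ => wtMap_der_mono 0 (fun j hj => jetWeight_eq fun l => ?_) f x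
  have hi : i ∈ j.1.1 := by by_contra h; exact hj (intSign_notMem h)
  by_cases hl : l = i
  · subst hl; simp [hi, add_comm]
  · simp [hl]

theorem wtMap_htpD (f : ℕ → ℂ) (x : FieldPoly ℂ d B) :
    wtMap f (htpD ℂ degB x) = htpD ℂ degB (wtMap f x) := by
  simp only [htpD, LinearMap.sum_apply, map_sum]
  refine Finset.sum_congr rfl fun i _ => wtMap_der_mono 0 (fun j hj => jetWeight_eq fun l => ?_) f x
  have hi : i ∉ j.1.1 := fun h => hj (by simp [extSign_mem h])
  have hK : j.2 (Sum.inr i) ≠ 0 := fun h => hj (by simp [h])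
  by_cases hl : l = i
  · subst hl
    simp [hi]
    omega
  · simp [hl]

theorem jetWeight_fieldD_inr (i : Fin d) (j : FieldJet d B) :
    jetWeight (j.1, j.2 + Finsupp.single (Sum.inr i) 1) = jetWeight j + 1 := by
  simp only [jetWeight, Finsupp.add_apply, ← add_assoc]
  rw [Finset.sum_add_distrib]
  congr 1
  simp [Finsupp.single_apply]

theorem jetWeight_fieldD_inl (i : Fin d) (j : FieldJet d B) :
    jetWeight (j.1, j.2 + Finsupp.single (Sum.inl i) 1) = jetWeight j :=
  jetWeight_eq fun l => by simp

theorem wtMap_fieldD_inr (f : ℕ → ℂ) (i : Fin d) (x : FieldPoly ℂ d B) :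
    wtMap f (fieldD ℂ (Sum.inr i) x) = fieldD ℂ (Sum.inr i) (wtMap (fun m => f (m + 1)) x) := by
  rw [fieldD_eq_der_mono 0]
  exact wtMap_der_mono 1 (fun j _ => jetWeight_fieldD_inr i j) f x

theorem wtMap_fieldD_inl (f : ℕ → ℂ) (i : Fin d) (x : FieldPoly ℂ d B) :
    wtMap f (fieldD ℂ (Sum.inl i) x) = fieldD ℂ (Sum.inl i) (wtMap f x) := by
  rw [fieldD_eq_der_mono 0]
  exact wtMap_der_mono 0 (fun j _ => jetWeight_fieldD_inl i j) f x

/-- Relations of local functionals with constant coefficients. -/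
abbrev constSub {ι A : Type} (deg : A → ℤ) : Submodule ℂ (JetPoly ℂ ι A) := locSub (fun _ => 0) deg

theorem fieldD_mem_constSub {ι A : Type} {deg : A → ℤ} (i : ι) (x : JetPoly ℂ ι A) :
    fieldD ℂ i x ∈ constSub deg := by
  rw [← constD_eq_fieldD]
  exact totalD_mem_locSub i x

theorem constSub_induction {ι A M : Type} [AddCommGroup M] [Module ℂ M] {deg : A → ℤ}
    (T : JetPoly ℂ ι A →ₗ[ℂ] M) {N : Submodule ℂ M} (h1 : ∀ x ∈ koszulRel ℂ deg, T x ∈ N)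
    (h2 : ∀ i x, T (fieldD ℂ i x) ∈ N) {x : JetPoly ℂ ι A} (hx : x ∈ constSub deg) : T x ∈ N :=
  locSub_induction T h1 (fun i x => by rw [← constD, constD_eq_fieldD]; exact h2 i x) hx

theorem wtMap_mem_constSub (f : ℕ → ℂ) {x : FieldPoly ℂ d B} (hx : x ∈ constSub (formDeg degB)) :
    wtMap f x ∈ constSub (formDeg degB) := by
  refine constSub_induction _ (fun x hx => koszul_le_locSub (wtMap_mem_koszul f hx)) ?_ hx
  rintro (i | i) x
  · rw [wtMap_fieldD_inl]; exact fieldD_mem_constSub _ _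
  · rw [wtMap_fieldD_inr]; exact fieldD_mem_constSub _ _

/-! ### Holomorphic jets -/

/-- Restriction of a polynomial with constant coefficients to holomorphic jets. -/
def projHol : FieldPoly ℂ d B →ₗ[ℂ] JetPoly ℂ (Fin d) B :=
  Finsupp.lsum ℂ fun w => (w.mapM holLetter).elim 0 Finsupp.lsingle

/-- The jet coordinate of the fields which restricts to a given holomorphic jet coordinate. -/
def liftLetter (d : ℕ) {B : Type} (j : B × (Fin d →₀ ℕ)) : FieldJet d B := ((∅, j.1), j.2.mapDomain Sum.inl)

/-- Extension of a polynomial by the projection to holomorphic jets. -/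
def inclHol : JetPoly ℂ (Fin d) B →ₗ[ℂ] FieldPoly ℂ d B :=
  Finsupp.lmapDomain ℂ ℂ (List.map (liftLetter d))

theorem projHol_single (w : List (FieldJet d B)) (r : ℂ) :
    projHol (Finsupp.single w r) = (w.mapM holLetter).elim 0 fun v => Finsupp.single v r := by
  rw [projHol, Finsupp.lsum_single]
  cases w.mapM holLetter <;> rfl

@[simp] theorem projHol_nil (r : ℂ) :
    projHol (Finsupp.single ([] : List (FieldJet d B)) r) = Finsupp.single [] r := by
  rw [projHol_single]; rfl

theorem projHol_consL (j : FieldJet d B) (x : FieldPoly ℂ d B) :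
    projHol (consL j x) = (holLetter j).elim 0 fun v => consL v (projHol x) := by
  induction x using Finsupp.induction_linear with
  | zero => cases holLetter j <;> simp
  | add x y hx hy =>
    simp only [map_add, hx, hy]
    cases holLetter j <;> simp
  | single w r =>
    rw [consL_single, projHol_single, projHol_single, List.mapM_cons]
    cases holLetter j with
    | none => rfl
    | some v =>
      cases w.mapM holLetter with
      | none => simp
      | some u => simp

@[simp] theorem inclHol_nil (r : ℂ) : inclHol (d := d) (B := B) (Finsupp.single [] r) =
    Finsupp.single [] r := by
  simp [inclHol, Finsupp.lmapDomain_apply]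

theorem inclHol_consL (j : B × (Fin d →₀ ℕ)) (x : JetPoly ℂ (Fin d) B) :
    inclHol (consL j x) = consL (liftLetter d j) (inclHol x) := by
  induction x using Finsupp.induction_linear with
  | zero => simp
  | add x y hx hy => simp only [map_add, hx, hy]
  | single w r => simp [inclHol, Finsupp.lmapDomain_apply]

theorem holLetter_liftLetter (j : B × (Fin d →₀ ℕ)) : holLetter (liftLetter d j) = some j := by
  rw [holLetter, if_pos]
  · congr 1
    refine Prod.ext rfl ?_
    exact Finsupp.comapDomain_mapDomain Sum.inl Sum.inl_injective j.2
  · refine ⟨rfl, fun i => ?_⟩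
    exact Finsupp.mapDomain_of_notMem_range _ _ (by simp)

theorem jetWeight_eq_zero_iff {j : FieldJet d B} :
    jetWeight j = 0 ↔ j.1.1 = ∅ ∧ ∀ i, j.2 (Sum.inr i) = 0 := by
  rw [jetWeight, Finset.sum_eq_zero_iff]
  simp only [Finset.mem_univ, true_implies, Nat.add_eq_zero_iff, Finset.eq_empty_iff_forall_notMem,
    forall_and]
  simp

theorem holLetter_eq_none {j : FieldJet d B} (h : jetWeight j ≠ 0) : holLetter j = none :=
  if_neg (jetWeight_eq_zero_iff.not.1 h)

theorem holLetter_eq_some {j : FieldJet d B} (h : jetWeight j = 0) :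
    ∃ v, holLetter j = some v ∧ j = liftLetter d v := by
  have h' := jetWeight_eq_zero_iff.1 h
  refine ⟨_, if_pos h', Prod.ext (Prod.ext h'.1 rfl) ?_⟩
  refine (Finsupp.mapDomain_comapDomain Sum.inl Sum.inl_injective j.2 ?_).symm
  rintro (i | i) hi
  · exact ⟨i, rfl⟩
  · exact absurd (h'.2 i) (Finsupp.mem_support_iff.1 hi)

@[simp] theorem projHol_inclHol (x : JetPoly ℂ (Fin d) B) : projHol (inclHol x) = x := by
  induction x using word_induction with
  | hnil r => simp
  | hcons j x ih => rw [inclHol_consL, projHol_consL, holLetter_liftLetter, ih]; rfl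
  | hadd x y hx hy => simp only [map_add, hx, hy]

/-- The letters surviving on holomorphic jets are precisely those of weight zero, so the composite
is the projection onto weight zero. -/
theorem inclHol_projHol (x : FieldPoly ℂ d B) :
    inclHol (projHol x) = wtMap (fun m => if m = 0 then 1 else 0) x := by
  induction x using word_induction with
  | hnil r => simp [wtMap_single, wordWeight]
  | hcons j x ih =>
    rw [projHol_consL, wtMap_consL]
    by_cases h : jetWeight j = 0
    · obtain ⟨v, hv, hj⟩ := holLetter_eq_some h
      rw [hv, Option.elim_some, inclHol_consL, ← hj, ih]
      simp [h]
    · rw [holLetter_eq_none h, Option.elim_none, map_zero]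
      have : (fun m => if jetWeight j + m = 0 then (1 : ℂ) else 0) = fun _ => 0 := by
        funext m; simp [h]
      rw [this]
      simp
  | hadd x y hx hy => simp only [map_add, hx, hy]

/-- A derivation whose values have no holomorphic part. -/
theorem projHol_der_mono {deg : Finset (Fin d) × B → ℤ} {p : ℤ} {c : FieldJet d B → ℂ}
    {g : FieldJet d B → FieldJet d B} (h : ∀ j, c j ≠ 0 → jetWeight (g j) ≠ 0)
    (x : FieldPoly ℂ d B) : projHol (der deg p (mono ℂ c g) x) = 0 := by
  induction x using word_induction with
  | hnil r => simp
  | hcons j x ih =>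
    rw [der_consL, map_add, map_smul, projHol_consL j, ih, mono, map_smul, LinearMap.smul_apply,
      letter_mul, map_smul, projHol_consL]
    have h1 : (holLetter j).elim 0 (fun v => consL v (0 : JetPoly ℂ (Fin d) B)) = 0 := by
      cases holLetter j <;> simp
    rw [h1, smul_zero, add_zero]
    by_cases hc : c j = 0
    · rw [hc, zero_smul]
    · rw [holLetter_eq_none (h j hc), Option.elim_none, smul_zero]
  | hadd x y hx hy => rw [map_add, map_add, hx, hy, add_zero]

theorem projHol_etaD (i : Fin d) (x : FieldPoly ℂ d B) : projHol (etaD ℂ degB i x) = 0 :=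
  projHol_der_mono (fun j _ h => by simpa using (jetWeight_eq_zero_iff.1 h).1) x

theorem projHol_dbarD (x : FieldPoly ℂ d B) : projHol (dbarD ℂ degB x) = 0 := by
  rw [dbarD, LinearMap.sum_apply, map_sum]
  exact Finset.sum_eq_zero fun i _ => projHol_der_mono
    (fun j _ h => by simpa using (jetWeight_eq_zero_iff.1 h).2 i) x

theorem projHol_fieldD_inr (i : Fin d) (x : FieldPoly ℂ d B) :
    projHol (fieldD ℂ (Sum.inr i) x) = 0 := by
  rw [fieldD_eq_der_mono 0]
  exact projHol_der_mono (fun j _ h => by simp [jetWeight_fieldD_inr] at h) x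

theorem liftLetter_fieldD (i : Fin d) (v : B × (Fin d →₀ ℕ)) :
    ((liftLetter d v).1, (liftLetter d v).2 + Finsupp.single (Sum.inl i) 1) =
      liftLetter d (v.1, v.2 + Finsupp.single i 1) := by
  simp [liftLetter, Finsupp.mapDomain_add]

theorem projHol_fieldD_inl (i : Fin d) (x : FieldPoly ℂ d B) :
    projHol (fieldD ℂ (Sum.inl i) x) = fieldD ℂ i (projHol x) := by
  induction x using word_induction with
  | hnil r => simp
  | hcons j x ih =>
    rw [fieldD_consL, map_add, projHol_consL, projHol_consL, projHol_consL, ih]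
    by_cases h : jetWeight j = 0
    · obtain ⟨v, hv, hj⟩ := holLetter_eq_some h
      rw [hv]
      subst hj
      rw [liftLetter_fieldD, holLetter_liftLetter]
      simp [fieldD_consL]
    · rw [holLetter_eq_none h, holLetter_eq_none (by rwa [jetWeight_fieldD_inl])]
      simp
  | hadd x y hx hy => simp only [map_add, hx, hy]

theorem inclHol_fieldD (i : Fin d) (x : JetPoly ℂ (Fin d) B) :
    inclHol (fieldD ℂ i x) = fieldD ℂ (Sum.inl i) (inclHol x) := by
  induction x using word_induction with
  | hnil r => simp
  | hcons j x ih =>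
    rw [fieldD_consL, map_add, inclHol_consL, inclHol_consL, inclHol_consL, ih, fieldD_consL,
      liftLetter_fieldD]
  | hadd x y hx hy => simp only [map_add, hx, hy]

theorem formDeg_liftLetter (v : B × (Fin d →₀ ℕ)) : formDeg degB (liftLetter d v).1 = degB v.1 := by
  simp [formDeg, liftLetter]

theorem projHol_mem_koszul {x : FieldPoly ℂ d B} (hx : x ∈ koszulRel ℂ (formDeg degB)) :
    projHol x ∈ koszulRel ℂ degB := by
  have h0 : ∀ j : FieldJet d B, (holLetter j).elim 0 (fun v => consL v (0 : JetPoly ℂ (Fin d) B)) = 0 :=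
    fun j => by cases holLetter j <;> simp
  refine koszul_induction projHol (fun j l z => ?_) (fun j z hz h => ?_) hx
  · rw [map_sub, map_smul, projHol_consL, projHol_consL, projHol_consL, projHol_consL]
    by_cases hj : jetWeight j = 0
    · obtain ⟨v, hv, rfl⟩ := holLetter_eq_some hj
      by_cases hl : jetWeight l = 0
      · obtain ⟨u, hu, rfl⟩ := holLetter_eq_some hl
        rw [hv, hu, formDeg_liftLetter, formDeg_liftLetter]
        exact consL_consL_mem_koszul v u (projHol z)
      · rw [holLetter_eq_none hl]; simp [hv]
    · rw [holLetter_eq_none hj]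
      simp only [Option.elim_none]
      rw [h0]; simp
  · rw [projHol_consL]
    cases holLetter j with
    | none => exact zero_mem _
    | some v => exact consL_mem_koszul v h

theorem inclHol_mem_koszul {x : JetPoly ℂ (Fin d) B} (hx : x ∈ koszulRel ℂ degB) :
    inclHol x ∈ koszulRel ℂ (formDeg degB) := by
  refine koszul_induction inclHol (fun j l z => ?_) (fun j z hz h => ?_) hx
  · have := consL_consL_mem_koszul (deg := formDeg degB) (liftLetter d j) (liftLetter d l)
      (inclHol z)
    rw [formDeg_liftLetter, formDeg_liftLetter] at this
    rw [map_sub, map_smul, inclHol_consL, inclHol_consL, inclHol_consL, inclHol_consL]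
    exact this
  · rw [inclHol_consL]
    exact consL_mem_koszul _ h

theorem projHol_mem_homog {n : ℕ} {k : ℤ} {x : FieldPoly ℂ d B}
    (hx : x ∈ homog ℂ (formDeg degB) n k) : projHol x ∈ homog ℂ degB n k := by
  refine homog_le_comap projHol (fun w r h h' => ?_) hx
  clear hx
  induction w generalizing n k with
  | nil => rw [projHol_nil]; exact single_mem_homog (by simpa using h) (by simpa using h')
  | cons j w ih =>
    rw [← consL_single, projHol_consL]
    subst h h'
    by_cases hj : jetWeight j = 0
    · obtain ⟨v, hv, rfl⟩ := holLetter_eq_some hj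
      rw [hv, wordDeg_cons, formDeg_liftLetter]
      exact consL_mem_homog v (ih rfl rfl)
    · rw [holLetter_eq_none hj]; exact zero_mem _

theorem inclHol_mem_homog {n : ℕ} {k : ℤ} {x : JetPoly ℂ (Fin d) B}
    (hx : x ∈ homog ℂ degB n k) : inclHol x ∈ homog ℂ (formDeg degB) n k := by
  refine homog_le_comap inclHol (fun w r h h' => ?_) hx
  clear hx
  induction w generalizing n k with
  | nil => rw [inclHol_nil]; exact single_mem_homog (by simpa using h) (by simpa using h')
  | cons j w ih =>
    rw [← consL_single, inclHol_consL]
    subst h h'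
    rw [wordDeg_cons, ← formDeg_liftLetter (d := d) (degB := degB) j]
    exact consL_mem_homog _ (ih rfl rfl)

theorem inclHol_mem_constSub {x : JetPoly ℂ (Fin d) B} (hx : x ∈ constSub degB) :
    inclHol x ∈ constSub (formDeg degB) :=
  constSub_induction _ (fun x hx => koszul_le_locSub (inclHol_mem_koszul hx))
    (fun i x => by rw [inclHol_fieldD]; exact fieldD_mem_constSub _ _) hx

/-- On jet coordinates `∂̄` removes a factor `d z̄_i`, and lifted letters have none. -/
theorem dbarD_inclHol (x : JetPoly ℂ (Fin d) B) : dbarD ℂ degB (inclHol x) = 0 := by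
  rw [dbarD, LinearMap.sum_apply]
  refine Finset.sum_eq_zero fun i _ => ?_
  induction x using word_induction with
  | hnil r => simp
  | hcons j x ih =>
    rw [inclHol_consL, der_consL, ih, dbarQ, mono, intSign_notMem (by simp [liftLetter])]
    simp
  | hadd x y hx hy => rw [map_add, map_add, hx, hy, add_zero]

/-- Reduction of an iterated contraction of a cocycle to its holomorphic part. -/
theorem exists_etaL_eq {L : List (Fin d)} (hL : ∀ i, i ∈ L) {n : ℕ} {k : ℤ} {y : FieldPoly ℂ d B}
    (hy : y ∈ homog ℂ (formDeg degB) n k)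
    (hd : dbarD ℂ degB y ∈ constSub (formDeg degB)) :
    ∃ z ∈ homog ℂ (formDeg degB) n (k + 1), projHol z = 0 ∧
      etaL ℂ degB L y ≡ etaL ℂ degB L (inclHol (projHol y)) + etaL ℂ degB L (dbarD ℂ degB z)
        [SMOD constSub (formDeg degB)] := by
  -- The inverse weight. The convention `0⁻¹ = 0` discards weight zero, where the homotopy formula
  -- gives nothing.
  let f : ℕ → ℂ := fun m => (m : ℂ)⁻¹
  -- Applying the homotopy to a total derivative leaves an extra `η_i`; the contractions along `L`
  -- kill it because `L` contains every index.
  have hh : ∀ x ∈ constSub (formDeg degB), etaL ℂ degB L (htpD ℂ degB x) ∈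
      constSub (formDeg degB) := fun x hx => by
    refine constSub_induction (etaL ℂ degB L ∘ₗ htpD ℂ degB) (fun x hx => ?_) ?_ hx
    · exact etaL_mem_locSub commDer_zero L (koszul_le_locSub (htpD_mem_koszul hx))
    · rintro (i | i) x
      · rw [LinearMap.comp_apply, htpD_fieldD_inl]
        exact etaL_mem_locSub commDer_zero L (fieldD_mem_constSub _ _)
      · rw [LinearMap.comp_apply, htpD_fieldD_inr, map_add, etaL_etaD_of_mem (hL i), add_zero]
        exact etaL_mem_locSub commDer_zero L (fieldD_mem_constSub _ _)
  refine ⟨htpD ℂ degB (wtMap f y), htpD_mem_homog (wtMap_mem_homog f hy), ?_, ?_⟩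
  · have h1 : inclHol (projHol (htpD ℂ degB (wtMap f y))) = 0 := by
      rw [inclHol_projHol, wtMap_htpD, wtMap_wtMap]
      have : (fun m => (if m = 0 then (1 : ℂ) else 0) * f m) = fun _ => 0 := by
        funext m; by_cases hm : m = 0 <;> simp [f, hm]
      rw [this]
      simp
    have := congrArg projHol h1
    rwa [projHol_inclHol, map_zero] at this
  -- Weight zero is the holomorphic part; on positive weight `h∂̄ + ∂̄h` divided by the weight is
  -- the identity. The term containing `∂̄ y` is a relation after contraction.
  · have h1 : y = inclHol (projHol y) + (htpD ℂ degB (wtMap f (dbarD ℂ degB y)) +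
        dbarD ℂ degB (htpD ℂ degB (wtMap f y))) := by
      rw [wtMap_dbarD, htpD_dbarD, ← wtMap_id, wtMap_wtMap, inclHol_projHol, ← wtMap_add]
      nth_rewrite 1 [← wtMap_one y]
      congr 1
      congr 1
      funext m
      by_cases hm : m = 0 <;> simp [f, hm]
    nth_rewrite 1 [h1]
    rw [map_add, map_add, SModEq.sub_mem]
    convert hh _ (wtMap_mem_constSub f hd) using 1
    abel

end Weights

/-! ### Variational derivatives and the Dolbeault complex -/

section EulerDolbeault

variable {R : Type} [CommRing R] [Algebra ℂ R] {d : ℕ} {B : Type} [Fintype B] [DecidableEq B]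
  {degB : B → ℤ} {δ : Fin d ⊕ Fin d → R →ₗ[ℂ] R}

/-- The values `etaQ` are linear and involve no derivatives of the fields, so the correction term of
`euler_der` merely changes the component, removing `i` from it. -/
theorem euler_etaD (hδ : CommDer δ) (i : Fin d) (a : Finset (Fin d) × B) (x : FieldPoly R d B) :
    euler δ (formDeg degB) a (etaD R degB i x) ≡
      sgn (formDeg degB a) • etaD R degB i (euler δ (formDeg degB) a x) +
      intSign i a.1 • euler δ (formDeg degB) (a.1.erase i, a.2) x
      [SMOD koszulRel R (formDeg degB)] := by
  refine (euler_der hδ (isHomogFamily_etaQ i) (isEvolutionary_etaQ hδ i) a x).trans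
    (SModEq.of_eq ?_)
  rw [etaD, sgn_eq_of_even (a := -1 * formDeg degB a) ⟨-formDeg degB a, by ring⟩]
  congr 1
  simp only [etaQ, mono, linAdj_smul_left, linAdj_letter]
  rw [Finset.sum_eq_single (a.1.erase i, a.2)]
  · by_cases hi : i ∈ a.1
    · rw [if_pos (by rw [Finset.insert_erase hi]), extSign_notMem (by simp), intSign_mem hi]
    · have : insert i (a.1.erase i) ≠ a.1 := fun h => hi (h ▸ Finset.mem_insert_self _ _)
      rw [if_neg fun h => this (congrArg Prod.fst h), intSign_notMem hi, smul_zero, zero_smul]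
  · intro c _ hc
    by_cases hi : i ∈ c.1
    · rw [extSign_mem hi, zero_smul]
    · rw [if_neg, smul_zero]
      rintro rfl
      simp [Finset.erase_insert hi] at hc
  · simp

/-- As for contractions, except that the linear values contain one derivative `∂/∂z̄_i`, whose
adjoint is minus the total derivative. -/
theorem euler_dbarD (hδ : CommDer δ) (a : Finset (Fin d) × B) (x : FieldPoly R d B) :
    euler δ (formDeg degB) a (dbarD R degB x) ≡
      sgn (formDeg degB a) • dbarD R degB (euler δ (formDeg degB) a x) -
      ∑ i, extSign i a.1 • totalD δ (Sum.inr i) (euler δ (formDeg degB) (insert i a.1, a.2) x)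
      [SMOD koszulRel R (formDeg degB)] := by
  rw [dbarD_eq_der]
  refine (euler_der hδ isHomogFamily_dbar (isEvolutionary_dbar hδ) a x).trans
    (SModEq.of_eq ?_)
  rw [one_mul, sub_eq_add_neg]
  congr 1
  simp only [Finset.sum_apply, linAdj_sum_left]
  rw [Finset.sum_comm, ← Finset.sum_neg_distrib]
  refine Finset.sum_congr rfl fun i _ => ?_
  have hl : ∀ c : Finset (Fin d) × B, linAdj δ (formDeg degB) a (dbarQ R i (c, 0))
      (euler δ (formDeg degB) c x) = -(intSign i c.1 • if (c.1.erase i, c.2) = a then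
        totalD δ (Sum.inr i) (euler δ (formDeg degB) c x) else 0) := fun c => by
    rw [dbarQ, mono, ← totalD_letter hδ (Sum.inr i) ((c.1.erase i, c.2), 0), linAdj_smul_left,
      linAdj_totalD hδ, linAdj_letter, smul_neg]
  rw [Finset.sum_congr rfl fun c _ => hl c, Finset.sum_neg_distrib]
  congr 1
  rw [Finset.sum_eq_single (insert i a.1, a.2)]
  · by_cases hi : i ∈ a.1
    · have : (insert i a.1).erase i ≠ a.1 := fun h => by
        have := Finset.notMem_erase i (insert i a.1)
        rw [h] at this
        exact this hi
      rw [if_neg fun h => this (congrArg Prod.fst h), extSign_mem hi, smul_zero, zero_smul]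
    · rw [if_pos (by rw [Finset.erase_insert hi]), extSign_notMem hi, intSign_insert hi]
  · intro c _ hc
    by_cases hi : i ∈ c.1
    · rw [if_neg, smul_zero]
      rintro rfl
      simp [Finset.insert_erase hi] at hc
    · rw [intSign_notMem hi, zero_smul]
  · simp

/-! ### Variational derivatives and holomorphic jets -/

/-- Restriction of families to holomorphic jets. -/
def projHolE : EPoly ℂ (Fin d ⊕ Fin d) (Finset (Fin d) × B) →ₗ[ℂ] EPoly ℂ (Fin d) B :=
  Finsupp.lsum ℂ fun K => if ∀ i, K (Sum.inr i) = 0 then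
    Finsupp.lsingle (K.comapDomain Sum.inl Sum.inl_injective.injOn) ∘ₗ projHol else 0

theorem projHolE_single (K : Fin d ⊕ Fin d →₀ ℕ) (x : FieldPoly ℂ d B) :
    projHolE (Finsupp.single K x) = if ∀ i, K (Sum.inr i) = 0 then
      Finsupp.single (K.comapDomain Sum.inl Sum.inl_injective.injOn) (projHol x) else 0 := by
  rw [projHolE, Finsupp.lsum_single]
  split_ifs <;> simp

theorem projHolE_mapE_consL (j : FieldJet d B)
    (e : EPoly ℂ (Fin d ⊕ Fin d) (Finset (Fin d) × B)) :
    projHolE (mapE (consL j) e) = (holLetter j).elim 0 fun v => mapE (consL v) (projHolE e) := by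
  induction e using Finsupp.induction_linear with
  | zero => cases holLetter j <;> simp
  | add e e' h h' =>
    rw [map_add, map_add, h, h', map_add]
    cases holLetter j <;> simp
  | single K x =>
    rw [mapE_single, projHolE_single, projHolE_single, projHol_consL]
    cases holLetter j <;> simp only [Option.elim_none, Option.elim_some] <;> split_ifs <;> simp

theorem projHolE_pdAll (b : B) (x : FieldPoly ℂ d B) :
    projHolE (pdAll (formDeg degB) (∅, b) x) = pdAll degB b (projHol x) := by
  induction x using word_induction with
  | hnil r => rw [pdAll_nil, projHol_nil, pdAll_nil, map_zero]
  | hcons j x ih =>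
    rw [pdAll_consL, map_add, map_smul, projHolE_mapE_consL, ih, projHol_consL]
    have hb : formDeg degB ((∅ : Finset (Fin d)), b) = degB b := by simp [formDeg]
    by_cases hj : jetWeight j = 0
    · obtain ⟨v, hv, rfl⟩ := holLetter_eq_some hj
      rw [hv, Option.elim_some, Option.elim_some, pdAll_consL, formDeg_liftLetter, hb]
      congr 1
      have e1 : (liftLetter d v).1 = (∅, b) ↔ v.1 = b := by simp [liftLetter]
      have e2 : ∀ i, (liftLetter d v).2 (Sum.inr i) = 0 := (jetWeight_eq_zero_iff.1 hj).2
      have e3 : (liftLetter d v).2.comapDomain Sum.inl Sum.inl_injective.injOn = v.2 :=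
        Finsupp.comapDomain_mapDomain Sum.inl Sum.inl_injective v.2
      by_cases h : v.1 = b
      · rw [if_pos h, if_pos (e1.2 h), projHolE_single, if_pos e2, e3]
      · rw [if_neg h, if_neg (e1.not.2 h), map_zero]
    · rw [holLetter_eq_none hj, Option.elim_none, Option.elim_none, smul_zero, add_zero, map_zero]
      split_ifs with h
      · rw [projHolE_single, if_neg]
        exact fun h' => hj (jetWeight_eq_zero_iff.2 ⟨by rw [h], h'⟩)
      · rw [map_zero]
  | hadd x y hx hy => rw [map_add, map_add, map_add, hx, hy, map_add]

theorem projHol_totalDPow (K : Fin d ⊕ Fin d →₀ ℕ) (x : FieldPoly ℂ d B) :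
    projHol (totalDPow (fun _ => 0) K x) = if ∀ i, K (Sum.inr i) = 0 then
      totalDPow (fun _ => 0) (K.comapDomain Sum.inl Sum.inl_injective.injOn) (projHol x) else 0 := by
  induction K using multiindex_induction with
  | h0 => simp
  | h1 K i ih =>
    rw [totalDPow_add_single commDer_zero, Module.End.mul_apply, ← constD, constD_eq_fieldD]
    cases i with
    | inl i =>
      rw [projHol_fieldD_inl, ih]
      have e : (K + Finsupp.single (Sum.inl i) 1).comapDomain Sum.inl Sum.inl_injective.injOn =
          K.comapDomain Sum.inl Sum.inl_injective.injOn + Finsupp.single i 1 := by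
        ext l
        simp [Finsupp.comapDomain_apply, Finsupp.single_apply]
      rw [e, totalDPow_add_single commDer_zero, Module.End.mul_apply, ← constD, constD_eq_fieldD]
      simp only [Finsupp.add_apply, Finsupp.single_apply, reduceCtorEq, if_false, add_zero]
      split_ifs
      · rfl
      · exact map_zero _
    | inr i =>
      rw [projHol_fieldD_inr, if_neg]
      intro h
      simpa using h i

theorem Sig_projHolE (e : EPoly ℂ (Fin d ⊕ Fin d) (Finset (Fin d) × B)) :
    Sig (fun _ => 0) (projHolE e) = projHol (Sig (fun _ => 0) e) := by
  induction e using Finsupp.induction_linear with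
  | zero => simp
  | add e e' h h' => rw [map_add, map_add, h, h', map_add, map_add]
  | single K x =>
    rw [projHolE_single, Sig_single, map_smul, projHol_totalDPow]
    split_ifs with h
    · rw [Sig_single]
      congr 1
      rw [signK, signK, Finsupp.sum_fintype _ _ (by simp), Finsupp.sum_fintype _ _ (by simp),
        Fintype.sum_sum_type]
      simp [h, Finsupp.comapDomain_apply]
    · rw [map_zero, smul_zero]

/-- On holomorphic jets every term with an antiholomorphic derivative disappears, both among the
partial derivatives and among the total derivatives applied afterwards. What is left is the
variational calculus of holomorphic jets. -/
theorem projHol_euler (b : B) (x : FieldPoly ℂ d B) :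
    projHol (euler (fun _ => 0) (formDeg degB) (∅, b) x) =
      euler (fun _ => 0) degB b (projHol x) := by
  rw [euler_eq, euler_eq, ← Sig_projHolE, projHolE_pdAll]

/-- The sign of the iterated contraction. -/
def listSign : List (Fin d) → ℂ
  | [] => 1
  | i :: L => wedgeSign {i} L.toFinset * listSign L

theorem listSign_mul_self (L : List (Fin d)) : listSign L * listSign L = 1 := by
  induction L with
  | nil => simp [listSign]
  | cons i L ih =>
    rw [listSign]
    linear_combination (listSign L * listSign L) * wedgeSign_mul_self {i} L.toFinset + ih

/-- Passing the variational derivative through `η_i` gives two terms. The one in the image of `η_i`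
vanishes on holomorphic jets; the other removes `i` from the component. Starting from the top
component one ends at `∅`, which is why the holomorphic part is defined through the top component.
-/
theorem projHol_euler_etaL {L : List (Fin d)} (hL : L.Nodup) (b : B) (x : FieldPoly ℂ d B) :
    projHol (euler (fun _ => 0) (formDeg degB) (L.toFinset, b) (etaL ℂ degB L x)) ≡
      listSign L • euler (fun _ => 0) degB b (projHol x) [SMOD koszulRel ℂ degB] := by
  induction L with
  | nil => simp [listSign, projHol_euler]
  | cons i L ih =>
    obtain ⟨hi, hL⟩ := List.nodup_cons.1 hL
    have hi' : i ∉ L.toFinset := by simpa using hi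
    have h1 := SModEq.map_of_le projHol (fun _ => projHol_mem_koszul)
      (euler_etaD (degB := degB) commDer_zero i ((i :: L).toFinset, b) (etaL ℂ degB L x))
    rw [etaL_cons]
    refine h1.trans ?_
    rw [map_add, map_smul, map_smul, projHol_etaD, smul_zero, zero_add, listSign, mul_smul]
    simp only [List.toFinset_cons]
    rw [intSign_insert hi', Finset.erase_insert hi']
    exact (ih hL).smul _

/-- The holomorphic part of a Lagrangian with constant coefficients. -/
def holPartC (degB : B → ℤ) (n : ℕ) : FieldPoly ℂ d B →ₗ[ℂ] JetPoly ℂ (Fin d) B :=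
  (n : ℂ)⁻¹ • ∑ b, consL (b, 0) ∘ₗ projHol ∘ₗ euler (fun _ => 0) (formDeg degB) (Finset.univ, b)

theorem holPartC_apply (n : ℕ) (x : FieldPoly ℂ d B) : holPartC degB n x = (n : ℂ)⁻¹ •
    ∑ b, consL (b, 0) (projHol (euler (fun _ => 0) (formDeg degB) (Finset.univ, b) x)) := by
  simp [holPartC, LinearMap.sum_apply]

theorem holPartC_mem_koszul (n : ℕ) {x : FieldPoly ℂ d B} (hx : x ∈ constSub (formDeg degB)) :
    holPartC degB n x ∈ koszulRel ℂ degB := by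
  rw [holPartC_apply]
  exact Submodule.smul_mem _ _ (Submodule.sum_mem _ fun b _ => consL_mem_koszul _
    (projHol_mem_koszul (euler_mem_koszul_of_locSub commDer_zero _ hx)))

theorem holPartC_mem_homog {n : ℕ} {k : ℤ} {x : FieldPoly ℂ d B}
    (hx : x ∈ homog ℂ (formDeg degB) n k) : holPartC degB n x ∈ homog ℂ degB n (k - d) := by
  cases n with
  | zero => simp [holPartC_apply]
  | succ n =>
    rw [holPartC_apply]
    refine Submodule.smul_mem _ _ (Submodule.sum_mem _ fun b _ => ?_)
    have := consL_mem_homog (b, 0) (projHol_mem_homog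
      (euler_mem_homog commDer_zero (Finset.univ, b) hx))
    convert this using 2
    · simp
    · simp [formDeg]
      ring

/-- All indices in increasing order. -/
abbrev allIdx (d : ℕ) : List (Fin d) := List.finRange d

/-- By `projHol_euler_etaL` the sum defining the holomorphic part is the one in Euler's identity for
`projHol x`, and the factor `n⁻¹` cancels the `n` found there. -/
theorem holPartC_etaL {n : ℕ} (hn : n ≠ 0) {k : ℤ} {x : FieldPoly ℂ d B}
    (hx : x ∈ homog ℂ (formDeg degB) n k) :
    holPartC degB n (etaL ℂ degB (allIdx d) x) ≡ listSign (allIdx d) • projHol x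
      [SMOD constSub degB] := by
  have hn' : (n : ℂ) ≠ 0 := by exact_mod_cast hn
  have h1 : ∀ b, projHol (euler (fun _ => 0) (formDeg degB) (Finset.univ, b)
      (etaL ℂ degB (allIdx d) x)) ≡
      listSign (allIdx d) • euler (fun _ => 0) degB b (projHol x) [SMOD koszulRel ℂ degB] := by
    intro b
    have := projHol_euler_etaL (degB := degB) (List.nodup_finRange d) b x
    rwa [List.toFinset_finRange] at this
  rw [holPartC_apply]
  have h2 := SModEq.of_le (V := constSub degB) koszul_le_locSub
    (SModEq.sum' (s := Finset.univ) fun b _ => consL_congr (b, 0) (h1 b))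
  refine (h2.smul _).trans ?_
  have h3 := sum_consL_euler (δ := fun _ => 0) commDer_zero (projHol_mem_homog hx)
  simp only [map_smul]
  rw [← Finset.smul_sum, smul_comm]
  refine (((h3.symm.smul (n : ℂ)⁻¹)).smul _).trans (SModEq.of_eq ?_)
  rw [smul_smul (n : ℂ)⁻¹, inv_mul_cancel₀ hn', one_smul]

end EulerDolbeault

/-! ### Derivatives of smooth functions -/

section Smooth

variable {d : ℕ}

theorem wirtinger_apply (c : ℂ) (i : Fin d) (f : smoothFun d) (x : Fin d → ℂ) :
    (wirtinger c i f).1 x = (1 / 2) * (fderiv ℝ f.1 x (Pi.single i 1)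
      + c * fderiv ℝ f.1 x (Pi.single i Complex.I)) := rfl

theorem wirtinger_mul (c : ℂ) (i : Fin d) (f g : smoothFun d) :
    wirtinger c i (f * g) = wirtinger c i f * g + f * wirtinger c i g := by
  have hf (x) : DifferentiableAt ℝ f.1 x := (smoothFun_contDiff f).differentiable (by simp) x
  have hg (x) : DifferentiableAt ℝ g.1 x := (smoothFun_contDiff g).differentiable (by simp) x
  refine Subtype.ext (funext fun x => ?_)
  have h : fderiv ℝ (f * g).1 x = f.1 x • fderiv ℝ g.1 x + g.1 x • fderiv ℝ f.1 x :=
    fderiv_mul (hf x) (hg x)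
  have e : (wirtinger c i f * g + f * wirtinger c i g).1 x =
      (wirtinger c i f).1 x * g.1 x + f.1 x * (wirtinger c i g).1 x := rfl
  rw [e, wirtinger_apply, wirtinger_apply, wirtinger_apply, h]
  simp only [add_apply, smul_apply, smul_eq_mul]
  ring

theorem fderiv_wirtinger (c : ℂ) (i : Fin d) (f : smoothFun d) (x v : Fin d → ℂ) :
    fderiv ℝ (wirtinger c i f).1 x v = (1 / 2) * (fderiv ℝ (fderiv ℝ f.1) x v (Pi.single i 1)
      + c * fderiv ℝ (fderiv ℝ f.1) x v (Pi.single i Complex.I)) := by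
  have hf : DifferentiableAt ℝ (fderiv ℝ f.1) x :=
    ((smoothFun_contDiff f).fderiv_right (m := ∞) (by simp)).differentiable (by simp) x
  have h (w : Fin d → ℂ) : HasFDerivAt (fun x => fderiv ℝ f.1 x w)
      ((fderiv ℝ (fderiv ℝ f.1) x).flip w) x := by
    have := hf.hasFDerivAt.clm_apply (hasFDerivAt_const w x)
    simpa using this
  have h' : HasFDerivAt (wirtinger c i f).1 ((1 / 2 : ℂ) •
      ((fderiv ℝ (fderiv ℝ f.1) x).flip (Pi.single i 1) +
        c • (fderiv ℝ (fderiv ℝ f.1) x).flip (Pi.single i Complex.I))) x :=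
    ((h _).add ((h _).const_mul c)).const_mul (1 / 2 : ℂ)
  rw [h'.fderiv]
  simp
  ring

theorem wirtinger_comm (c c' : ℂ) (i i' : Fin d) (f : smoothFun d) :
    wirtinger c i (wirtinger c' i' f) = wirtinger c' i' (wirtinger c i f) := by
  refine Subtype.ext (funext fun x => ?_)
  have hs : IsSymmSndFDerivAt ℝ f.1 x :=
    (smoothFun_contDiff f).contDiffAt.isSymmSndFDerivAt (by
      rw [minSmoothness_of_isRCLikeNormedField]; exact WithTop.coe_le_coe.2 (le_top : (2 : ℕ∞) ≤ ⊤))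
  rw [wirtinger_apply, wirtinger_apply, fderiv_wirtinger, fderiv_wirtinger, fderiv_wirtinger,
    fderiv_wirtinger, hs.eq (Pi.single i 1) (Pi.single i' 1),
    hs.eq (Pi.single i 1) (Pi.single i' Complex.I), hs.eq (Pi.single i Complex.I) (Pi.single i' 1),
    hs.eq (Pi.single i Complex.I) (Pi.single i' Complex.I)]
  ring

theorem commDer_coefD (d : ℕ) : CommDer (coefD d) where
  leibniz i f g := by
    rcases i with i | i
    · exact wirtinger_mul _ i f g
    · exact wirtinger_mul _ i f g
  comm i i' f := by
    rcases i with i | i <;> rcases i' with i' | i' <;> exact wirtinger_comm _ _ i i' f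

/-- Evaluation at the origin. -/
def evalZero (d : ℕ) : smoothFun d →ₐ[ℂ] ℂ :=
  (Pi.evalAlgHom ℂ (fun _ : Fin d → ℂ => ℂ) 0).comp (smoothFun d).val

theorem evalZero_apply (f : smoothFun d) : evalZero d f = f.1 0 := rfl

theorem eq_const_of_coefD (f : smoothFun d) (h : ∀ i, coefD d i f = 0) :
    algebraMap ℂ (smoothFun d) (evalZero d f) = f := by
  have hd : ∀ x, fderiv ℝ f.1 x = 0 := fun x => by
    have h1 : ∀ i, fderiv ℝ f.1 x (Pi.single i 1) = 0 ∧
        fderiv ℝ f.1 x (Pi.single i Complex.I) = 0 := fun i => by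
      have ha : (wirtinger (-Complex.I) i f).1 x = 0 := by
        have := congrArg (fun g => g.1 x) (h (Sum.inl i)); exact this
      have hb : (wirtinger Complex.I i f).1 x = 0 := by
        have := congrArg (fun g => g.1 x) (h (Sum.inr i)); exact this
      rw [wirtinger_apply] at ha hb
      refine ⟨by linear_combination ha + hb, ?_⟩
      linear_combination Complex.I * ha - Complex.I * hb +
        (fderiv ℝ f.1 x (Pi.single i Complex.I)) * Complex.I_sq
    refine ContinuousLinearMap.ext fun v => ?_
    have hv : v = ∑ i, ((v i).re • (Pi.single i 1 : Fin d → ℂ) +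
        (v i).im • (Pi.single i Complex.I : Fin d → ℂ)) := by
      ext i
      rw [Finset.sum_apply, Finset.sum_eq_single i]
      · simp
      · intro j _ hj
        simp [Pi.single_eq_of_ne (Ne.symm hj)]
      · simp
    rw [hv, map_sum]
    refine Finset.sum_eq_zero fun i _ => ?_
    rw [map_add, map_smul, map_smul, (h1 i).1, (h1 i).2, smul_zero, smul_zero, add_zero]
  refine Subtype.ext (funext fun x => ?_)
  exact is_const_of_fderiv_eq_zero ((smoothFun_contDiff f).differentiable (by simp)) hd 0 x

end Smooth

/-! ### Polynomials with constant coefficients -/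

section Const

variable {R ι A : Type} [CommRing R] [Algebra ℂ R] {deg : A → ℤ} {δ : ι → R →ₗ[ℂ] R}

/-- The inclusion of the polynomials with constant coefficients. -/
def cMap (R : Type) {ι A : Type} [CommRing R] [Algebra ℂ R] : JetPoly ℂ ι A →ₗ[ℂ] JetPoly R ι A :=
  Finsupp.mapRange.linearMap (Algebra.linearMap ℂ R)

@[simp] theorem cMap_single (w : List (A × (ι →₀ ℕ))) (r : ℂ) :
    cMap R (Finsupp.single w r) = Finsupp.single w (algebraMap ℂ R r) := by
  simp [cMap]

theorem cMap_consL (j : A × (ι →₀ ℕ)) (x : JetPoly ℂ ι A) :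
    cMap R (consL j x) = consL j (cMap R x) := by
  induction x using Finsupp.induction_linear with
  | zero => simp
  | add x y hx hy => simp only [map_add, hx, hy]
  | single w r => simp

theorem cMap_letter (j : A × (ι →₀ ℕ)) : cMap R (letter ℂ j) = letter R j := by
  simp [letter]

theorem cMap_smul (r : ℂ) (x : JetPoly ℂ ι A) : cMap R (r • x) = algebraMap ℂ R r • cMap R x := by
  rw [map_smul, algebraMap_smul]

theorem cMap_mul (x y : JetPoly ℂ ι A) : cMap R (x ⋆ y) = cMap R x ⋆ cMap R y := by
  induction x using word_induction with
  | hnil r => rw [nil_mul, cMap_smul, cMap_single, nil_mul]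
  | hcons j x ih => rw [consL_mul, cMap_consL, cMap_consL, consL_mul, ih]
  | hadd x x' hx hx' => simp only [map_add, LinearMap.add_apply, hx, hx']

theorem cMap_der {p : ℤ} {q : A × (ι →₀ ℕ) → JetPoly ℂ ι A} {q' : A × (ι →₀ ℕ) → JetPoly R ι A}
    (h : ∀ j, q' j = cMap R (q j)) (x : JetPoly ℂ ι A) :
    cMap R (der deg p q x) = der deg p q' (cMap R x) := by
  induction x using word_induction with
  | hnil r => simp
  | hcons j x ih =>
    rw [der_consL, map_add, map_smul, cMap_mul, cMap_consL, cMap_consL, ih, der_consL, h]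
  | hadd x y hx hy => simp only [map_add, hx, hy]

theorem cMap_fieldD (i : ι) (x : JetPoly ℂ ι A) : cMap R (fieldD ℂ i x) = fieldD R i (cMap R x) := by
  rw [fieldD_eq_der 0, fieldD_eq_der 0]
  exact cMap_der (fun j => (cMap_letter _).symm) x

theorem CommDer.map_algebraMap (hδ : CommDer δ) (i : ι) (c : ℂ) : δ i (algebraMap ℂ R c) = 0 := by
  rw [Algebra.algebraMap_eq_smul_one, map_smul, hδ.map_one, smul_zero]

theorem cMap_totalD (hδ : CommDer δ) (i : ι) (x : JetPoly ℂ ι A) :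
    cMap R (constD i x) = totalD δ i (cMap R x) := by
  rw [constD_eq_fieldD, cMap_fieldD, totalD_eq]
  have : coefMap (δ i) (cMap R x) = 0 := by
    induction x using Finsupp.induction_linear with
    | zero => simp
    | add x y hx hy => rw [map_add, map_add, hx, hy, add_zero]
    | single w r => rw [cMap_single, coefMap_single, hδ.map_algebraMap, Finsupp.single_zero]
  rw [this, zero_add]

theorem cMap_mem_koszul {x : JetPoly ℂ ι A} (hx : x ∈ koszulRel ℂ deg) :
    cMap R x ∈ koszulRel R deg := by
  refine koszul_induction (cMap R) (fun x y z => ?_) (fun j z _ h => ?_) hx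
  · rw [map_sub, map_smul]
    simp only [cMap_consL]
    exact consL_consL_mem_koszul x y (cMap R z)
  · rw [cMap_consL]
    exact consL_mem_koszul j h

theorem cMap_mem_homog {n : ℕ} {k : ℤ} {x : JetPoly ℂ ι A} (hx : x ∈ homog ℂ deg n k) :
    cMap R x ∈ homog R deg n k :=
  homog_le_comap (cMap R) (fun w r h h' => by rw [cMap_single]; exact single_mem_homog h h') hx

theorem cMap_mem_locSub (hδ : CommDer δ) {x : JetPoly ℂ ι A} (hx : x ∈ constSub deg) :
    cMap R x ∈ locSub δ deg :=
  locSub_induction (cMap R) (fun _ hx => koszul_le_locSub (cMap_mem_koszul hx))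
    (fun i x => by rw [← constD, cMap_totalD hδ]; exact totalD_mem_locSub i _) hx

theorem cMap_projHomog {n : ℕ} {k : ℤ} (x : JetPoly ℂ ι A) :
    cMap R (projHomog deg n k x) = projHomog deg n k (cMap R x) := by
  induction x using Finsupp.induction_linear with
  | zero => simp
  | add x y hx hy => simp only [map_add, hx, hy]
  | single w r =>
    rw [cMap_single, projHomog_single, projHomog_single]
    split_ifs <;> simp

/-- Evaluation of the coefficients. -/
def evMap (φ : R →ₐ[ℂ] ℂ) : JetPoly R ι A →ₗ[ℂ] JetPoly ℂ ι A :=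
  Finsupp.mapRange.linearMap φ.toLinearMap

@[simp] theorem evMap_single (φ : R →ₐ[ℂ] ℂ) (w : List (A × (ι →₀ ℕ))) (r : R) :
    evMap φ (Finsupp.single w r) = Finsupp.single w (φ r) := by
  simp [evMap]

theorem evMap_cMap (φ : R →ₐ[ℂ] ℂ) (x : JetPoly ℂ ι A) : evMap φ (cMap R x) = x := by
  induction x using Finsupp.induction_linear with
  | zero => simp
  | add x y hx hy => simp only [map_add, hx, hy]
  | single w r => simp

theorem evMap_consL (φ : R →ₐ[ℂ] ℂ) (j : A × (ι →₀ ℕ)) (x : JetPoly R ι A) :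
    evMap φ (consL j x) = consL j (evMap φ x) := by
  induction x using Finsupp.induction_linear with
  | zero => simp
  | add x y hx hy => simp only [map_add, hx, hy]
  | single w r => simp

theorem evMap_mem_koszul (φ : R →ₐ[ℂ] ℂ) {x : JetPoly R ι A} (hx : x ∈ koszulRel R deg) :
    evMap φ x ∈ koszulRel ℂ deg := by
  refine koszul_induction (evMap φ) (fun x y z => ?_) (fun j z _ h => ?_) hx
  · rw [map_sub, map_smul]
    simp only [evMap_consL]
    exact consL_consL_mem_koszul x y (evMap φ z)
  · rw [evMap_consL]
    exact consL_mem_koszul j h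

/-- Polynomials whose derivatives vanish modulo Koszul relations have constant coefficients. -/
theorem exists_cMap_of_coefMap {φ : R →ₐ[ℂ] ℂ}
    (hφ : ∀ r, (∀ i, δ i r = 0) → algebraMap ℂ R (φ r) = r) {x : JetPoly R ι A}
    (hx : ∀ i, coefMap (δ i) x ∈ koszulRel R deg) :
    ∃ y : JetPoly ℂ ι A, x ≡ cMap R y [SMOD koszulRel R deg] := by
  -- The relations are already defined over `ℂ`. A linear section of the quotient gives a projection
  -- `P` modulo relations, whose `R`-linear extension `PR` kills the relations and commutes with
  -- operators on coefficients.
  obtain ⟨g, hg⟩ := (koszulRel ℂ (ι := ι) deg).mkQ.exists_rightInverse_of_surjective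
    (Submodule.range_mkQ _)
  let P : JetPoly ℂ ι A →ₗ[ℂ] JetPoly ℂ ι A := g ∘ₗ (koszulRel ℂ deg).mkQ
  have hP0 : ∀ x ∈ koszulRel ℂ deg, P x = 0 := fun x hx => by
    rw [LinearMap.comp_apply, Submodule.mkQ_apply, (Submodule.Quotient.mk_eq_zero _).2 hx, map_zero]
  have hP1 : ∀ x, P x ≡ x [SMOD koszulRel ℂ deg] := fun x => by
    have := LinearMap.congr_fun hg (Submodule.Quotient.mk x)
    exact this
  let PR : JetPoly R ι A →ₗ[ℂ] JetPoly R ι A := Finsupp.lsum ℂ fun w =>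
    (LinearMap.toSpanSingleton R (JetPoly R ι A) (cMap R (P (Finsupp.single w 1)))).restrictScalars ℂ
  have hPR : ∀ w r, PR (Finsupp.single w r) = r • cMap R (P (Finsupp.single w 1)) := fun w r => by
    simp [PR]
  have h1 : ∀ x, PR x ≡ x [SMOD koszulRel R deg] := fun x => by
    induction x using Finsupp.induction_linear with
    | zero => simp
    | add x y hx hy => rw [map_add]; exact hx.add hy
    | single w r =>
      have h2 := smul_mem_koszul r (cMap_mem_koszul (R := R)
        (SModEq.sub_mem.1 (hP1 (Finsupp.single w 1))))
      rw [SModEq.sub_mem, hPR]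
      rw [map_sub, smul_sub, cMap_single] at h2
      simpa using h2
  have h2 : ∀ x ∈ koszulRel R deg, PR x = 0 := fun x hx => by
    have : koszulRel R deg ≤ LinearMap.ker PR := by
      refine Submodule.span_le.2 ?_
      rintro _ ⟨u, v, x, y, r, rfl⟩
      change PR _ = 0
      rw [map_sub, map_smul, hPR, hPR, smul_comm, ← smul_sub, ← map_smul, ← map_smul, ← map_sub,
        ← map_sub, hP0, map_zero, smul_zero]
      exact Submodule.subset_span ⟨u, v, x, y, 1, rfl⟩
    exact this hx
  have h3 : ∀ (f : R →ₗ[ℂ] R) x, coefMap f (PR x) = PR (coefMap f x) := fun f x => by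
    induction x using Finsupp.induction_linear with
    | zero => simp
    | add x y hx hy => simp only [map_add, hx, hy]
    | single w r =>
      rw [coefMap_single, hPR, hPR]
      generalize P (Finsupp.single w 1) = z
      induction z using Finsupp.induction_linear with
      | zero => simp
      | add x y hx hy => simp only [map_add, smul_add, hx, hy]
      | single w s =>
        rw [cMap_single, Finsupp.smul_single, Finsupp.smul_single, coefMap_single, smul_eq_mul,
          smul_eq_mul, mul_comm, ← Algebra.smul_def, map_smul, mul_comm, ← Algebra.smul_def]
  -- Derivatives of the coefficients of `x` vanish only modulo relations, but for `PR x` they vanish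
  -- exactly. Its coefficients are therefore constants.
  refine ⟨evMap φ (PR x), (h1 x).symm.trans (SModEq.of_eq ?_)⟩
  ext w
  have h4 : ∀ i, δ i (PR x w) = 0 := fun i => by
    have := DFunLike.congr_fun ((h3 (δ i) x).trans (h2 _ (hx i))) w
    exact this
  exact (hφ _ h4).symm

variable [Fintype ι] [DecidableEq A]

theorem cMap_totalDPow (hδ : CommDer δ) (K : ι →₀ ℕ) (x : JetPoly ℂ ι A) :
    cMap R (totalDPow (fun _ => 0) K x) = totalDPow δ K (cMap R x) := by
  have := comm_totalDPow commDer_zero hδ (cMap R) id (fun i x => cMap_totalD hδ i x) K x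
  rwa [Finsupp.mapDomain_id] at this

theorem euler_single (a : A) (w : List (A × (ι →₀ ℕ))) (r : R) :
    euler δ deg a (Finsupp.single w r) = ∑ k : Fin w.length, if (w.get k).1 = a then
      ((-1 : ℂ) ^ (deg a * wordDeg deg (w.take k)) * (-1) ^ ((w.get k).2.sum fun _ e => e)) •
        totalDPow δ (w.get k).2 (Finsupp.single (w.eraseIdx k) r) else 0 := by
  rw [euler, Finsupp.lsum_single, LinearMap.sum_apply]
  refine Finset.sum_congr rfl fun k _ => ?_
  split_ifs <;> rfl

theorem cMap_euler (hδ : CommDer δ) (a : A) (x : JetPoly ℂ ι A) :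
    cMap R (euler (fun _ => 0) deg a x) = euler δ deg a (cMap R x) := by
  induction x using Finsupp.induction_linear with
  | zero => simp
  | add x y hx hy => simp only [map_add, hx, hy]
  | single w r =>
    rw [cMap_single, euler_single, euler_single, map_sum]
    refine Finset.sum_congr rfl fun k _ => ?_
    split_ifs
    · rw [map_smul, cMap_totalDPow hδ, cMap_single]
    · exact map_zero _

theorem coefMap_euler (hδ : CommDer δ) (i : ι) (a : A) (x : JetPoly R ι A) :
    coefMap (δ i) (euler δ deg a x) = euler δ deg a (coefMap (δ i) x) := by
  induction x using Finsupp.induction_linear with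
  | zero => simp
  | add x y hx hy => simp only [map_add, hx, hy]
  | single w r =>
    rw [coefMap_single, euler_single, euler_single, map_sum]
    refine Finset.sum_congr rfl fun k _ => ?_
    split_ifs
    · rw [map_smul, comm_totalDPow' hδ (coefMap (δ i)) (coefMap_comm_totalD hδ i), coefMap_single]
    · exact map_zero _

variable [Fintype A]

/-- A larger coefficient ring offers more primitives, but in positive degree it creates no new total
derivatives: variational derivatives detect them, commute with the inclusion of constants, and
evaluation by `φ` returns to `ℂ`. -/
theorem cMap_mem_locSub_iff (hδ : CommDer δ) (φ : R →ₐ[ℂ] ℂ) {n : ℕ} (hn : n ≠ 0) {k : ℤ}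
    {x : JetPoly ℂ ι A} (hx : x ∈ homog ℂ deg n k) :
    cMap R x ∈ locSub δ deg ↔ x ∈ constSub deg := by
  refine ⟨fun h => mem_locSub_of_euler commDer_zero hn hx fun a => ?_, cMap_mem_locSub hδ⟩
  have h1 := evMap_mem_koszul φ (euler_mem_koszul_of_locSub hδ a h)
  rwa [← cMap_euler hδ, evMap_cMap] at h1

/-- Translation-invariant local functionals have constant coefficients. -/
theorem exists_cMap_of_fieldD (hδ : CommDer δ) {φ : R →ₐ[ℂ] ℂ}
    (hφ : ∀ r, (∀ i, δ i r = 0) → algebraMap ℂ R (φ r) = r) {n : ℕ} (hn : n ≠ 0) {k : ℤ}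
    {x : JetPoly R ι A} (hx : x ∈ homog R deg n k)
    (h : ∀ i, fieldD R i x ∈ locSub δ deg) :
    ∃ y ∈ homog ℂ deg n k, x ≡ cMap R y [SMOD locSub δ deg] := by
  have h1 : ∀ a, ∃ y : JetPoly ℂ ι A, y ∈ homog ℂ deg (n - 1) (k - deg a) ∧
      euler δ deg a x ≡ cMap R y [SMOD koszulRel R deg] := fun a => by
    -- Differentiating coefficients is `D_i - fieldD i`. The variational derivative kills `D_i x`,
    -- and `fieldD i x` is a relation by hypothesis, so the coefficients of the variational
    -- derivative are constant modulo relations.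
    obtain ⟨y, hy⟩ := exists_cMap_of_coefMap (x := euler δ deg a x) (deg := deg) hφ fun i => by
      rw [coefMap_euler hδ, eq_sub_of_add_eq (totalD_eq (δ := δ) i x).symm, map_sub,
        euler_totalD hδ, zero_sub]
      exact neg_mem (euler_mem_koszul_of_locSub hδ a (h i))
    refine ⟨projHomog deg (n - 1) (k - deg a) y, projHomog_mem _, ?_⟩
    rw [cMap_projHomog, ← projHomog_of_mem (euler_mem_homog hδ a hx)]
    exact SModEq.map_of_le _ (fun _ => projHomog_mem_koszul) hy
  choose y hyh hy using h1
  have hn' : (n : ℂ) ≠ 0 := by exact_mod_cast hn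
  -- Euler's identity rebuilds the functional from its variational derivatives, now with constant
  -- coefficients.
  refine ⟨(n : ℂ)⁻¹ • ∑ a, consL (a, 0) (y a), Submodule.smul_mem _ _ (Submodule.sum_mem _
    fun a _ => ?_), ?_⟩
  · have := consL_mem_homog (a, 0) (hyh a)
    convert this using 2
    · omega
    · simp
  · have h2 := (sum_consL_euler hδ hx).trans (SModEq.of_le koszul_le_locSub
      (SModEq.sum' (s := Finset.univ) fun a _ => consL_congr (a, 0) (hy a)))
    have h3 := h2.smul (n : ℂ)⁻¹
    rw [smul_smul, inv_mul_cancel₀ hn', one_smul] at h3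
    refine h3.trans (SModEq.of_eq ?_)
    rw [map_smul, map_sum]
    simp only [cMap_consL]

end Const

/-! ### The pairing on Dolbeault forms -/

section FormPairing

variable {d : ℕ} {B : Type} [DecidableEq B] {degB : B → ℤ} {κ : Matrix B B ℂ}

theorem wedgeSign_swap {S T : Finset (Fin d)} (h : Disjoint S T) :
    wedgeSign S T = sgn (S.card * T.card) * wedgeSign T S := by
  induction S using Finset.induction with
  | empty => simp
  | insert i S hi ih =>
    obtain ⟨h1, h2⟩ := Finset.disjoint_insert_left.1 h
    rw [wedgeSign_insert_left hi, wedgeSign_insert_right hi, wedgeSign_swap_left h1, ih h2,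
      Finset.card_insert_of_notMem hi]
    push_cast
    rw [add_mul, one_mul, sgn_add]
    linear_combination (-(sgn (S.card * T.card : ℤ) * wedgeSign T S * wedgeSign {i} T)) *
      sgn_mul_self (T.card : ℤ)

/-- The inverse of the pairing on Dolbeault forms with values in a space with inverse
pairing `κ`. -/
def formPairing (d : ℕ) (degB : B → ℤ) (κ : Matrix B B ℂ) :
    Matrix (Finset (Fin d) × B) (Finset (Fin d) × B) ℂ := fun a b =>
  if b.1 = a.1ᶜ then sgn (degB b.2 * a.1.card) * wedgeSign a.1ᶜ a.1 * κ a.2 b.2 else 0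

theorem formPairing_ne_zero {a b : Finset (Fin d) × B} (h : formPairing d degB κ a b ≠ 0) :
    b.1 = a.1ᶜ ∧ κ a.2 b.2 ≠ 0 := by
  unfold formPairing at h
  split_ifs at h with h1
  · exact ⟨h1, right_ne_zero_of_mul h⟩
  · exact absurd rfl h

theorem card_add_card_compl' (S : Finset (Fin d)) : (S.card : ℤ) + (Sᶜ.card : ℤ) = d := by
  have := Finset.card_add_card_compl S
  rw [Fintype.card_fin] at this
  exact_mod_cast this

theorem formPairing_apply {a b : Finset (Fin d) × B} (h : b.1 = a.1ᶜ) :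
    formPairing d degB κ a b = sgn (degB b.2 * a.1.card) * wedgeSign a.1ᶜ a.1 * κ a.2 b.2 :=
  if_pos h

/-- Complementary form degrees add up to `d`, which moves the degree parameter from `d` to `0`. The
symmetry sign combines that of `κ` with the one for exchanging the complementary wedge factors. -/
theorem isPairing_formPairing (hκ : IsPairing degB d κ) :
    IsPairing (formDeg degB) 0 (formPairing d degB κ) where
  deg_add a b h := by
    obtain ⟨h1, h2⟩ := formPairing_ne_zero h
    have := hκ.deg_add _ _ h2
    have := card_add_card_compl' a.1
    rw [formDeg, formDeg, h1]
    omega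
  symm a b := by
    by_cases h : b.1 = a.1ᶜ
    · have h' : a.1 = b.1ᶜ := by rw [h, compl_compl]
      by_cases h0 : κ a.2 b.2 = 0
      · have h1 := hκ.symm a.2 b.2
        rw [h0, mul_zero] at h1
        rw [formPairing_apply h, formPairing_apply h', h0, (mul_eq_zero.1 h1).resolve_left (sgn_ne_zero _)]
        simp
      · have h1 := hκ.symm a.2 b.2
        have h2 : κ b.2 a.2 = sgn (degB b.2) * (sgn (degB b.2) * κ b.2 a.2) := by
          rw [← mul_assoc, sgn_mul_self, one_mul]
        have h3 := card_add_card_compl' a.1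
        rw [formPairing_apply h, formPairing_apply h', h2, h1, ← h', h,
          wedgeSign_swap (disjoint_compl_right (a := a.1)), formDeg, formDeg, h]
        have hd := hκ.deg_add _ _ h0
        have hb : degB b.2 = 1 - a.1.card - a.1ᶜ.card - degB a.2 := by omega
        have e : sgn (a.1ᶜ.card + degB b.2) * sgn (degB a.2 * a.1ᶜ.card) *
            sgn (a.1.card * a.1ᶜ.card) * sgn (degB b.2) *
            sgn ((degB a.2 - 1) * (d + degB a.2) + degB a.2) =
            sgn ((a.1.card + degB a.2 - 1) * (0 + (a.1.card + degB a.2)) +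
              (a.1.card + degB a.2)) * sgn (degB b.2 * a.1.card) := by
          simp only [← sgn_add]
          refine sgn_eq_of_even ⟨degB b.2 + degB a.2 * a.1ᶜ.card + a.1.card * a.1ᶜ.card -
            a.1.card, ?_⟩
          rw [hb, ← h3]
          ring
        linear_combination (wedgeSign a.1ᶜ a.1 * κ a.2 b.2) * e
    · have h' : ¬ a.1 = b.1ᶜ := fun h' => h (by rw [h', compl_compl])
      rw [formPairing, formPairing, if_neg h, if_neg h', mul_zero, mul_zero]

/-- Up to sign contraction is self-adjoint for the wedge pairing. This compatibility lets `{I, -}`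
anticommute with `η_i` when `I` is `η_i`-invariant, and with `∂̄` up to the bracket with `∂̄ I`. -/
theorem extSign_mul_formPairing (hκ : IsPairing degB d κ) (i : Fin d) (a b : Finset (Fin d) × B) :
    extSign i b.1 * formPairing d degB κ a (insert i b.1, b.2) =
      sgn (formDeg degB a) * extSign i a.1 * formPairing d degB κ (insert i a.1, a.2) b := by
  by_cases hb : i ∈ b.1
  · by_cases ha : i ∈ a.1
    · rw [extSign_mem hb, extSign_mem ha]; ring
    · rw [extSign_mem hb, formPairing, formPairing, if_neg (c := b.1 = _)]
      · ring
      · intro h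
        rw [h] at hb
        simp at hb
  · by_cases ha : i ∈ a.1
    · rw [extSign_mem ha, formPairing, if_neg]
      · ring
      · intro h
        have : i ∈ a.1ᶜ := h ▸ Finset.mem_insert_self i b.1
        simp [ha] at this
    · by_cases h : b.1 = (insert i a.1)ᶜ
      · have hc : a.1ᶜ = insert i b.1 := by
          rw [h, Finset.compl_insert, Finset.insert_erase (by simpa using ha)]
        rw [formPairing_apply hc.symm, formPairing_apply h, extSign_notMem ha, extSign_notMem hb,
          ← h, hc, wedgeSign_insert_left hb, wedgeSign_insert_right ha, wedgeSign_swap_left hb,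
          Finset.card_insert_of_notMem ha]
        by_cases h0 : κ a.2 b.2 = 0
        · simp [h0]
        have e : sgn (degB b.2 * a.1.card) = sgn (formDeg degB a) *
            sgn (degB b.2 * (a.1.card + 1 : ℕ)) * sgn b.1.card := by
          have h1 := card_add_card_compl' a.1
          rw [hc, Finset.card_insert_of_notMem hb] at h1
          have h2 := hκ.deg_add _ _ h0
          simp only [← sgn_add]
          refine sgn_eq_of_even ⟨0, ?_⟩
          rw [formDeg]
          push_cast at h1 ⊢
          linear_combination -h1 - h2
        simp only
        linear_combination (wedgeSign {i} b.1 * wedgeSign {i} a.1 * wedgeSign b.1 a.1 * κ a.2 b.2) * e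
      · rw [formPairing, formPairing, if_neg h, if_neg]
        · ring
        · intro h'
          apply h
          change insert i b.1 = _ at h'
          rw [Finset.compl_insert, ← h', Finset.erase_insert hb]

theorem sum_insert_eq [Fintype B] {M : Type*} [AddCommMonoid M] (i : Fin d)
    {f : Finset (Fin d) × B → M} (h : ∀ b, i ∉ b.1 → f b = 0) :
    ∑ b, f b = ∑ b : Finset (Fin d) × B, if i ∈ b.1 then 0 else f (insert i b.1, b.2) := by
  have h1 : ∑ b, f b = ∑ b with i ∈ b.1, f b := by
    rw [Finset.sum_filter]
    refine Finset.sum_congr rfl fun b _ => ?_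
    split_ifs with hb
    · rfl
    · exact h b hb
  have h2 : ∑ b : Finset (Fin d) × B, (if i ∈ b.1 then 0 else f (insert i b.1, b.2)) =
      ∑ b : Finset (Fin d) × B with i ∉ b.1, f (insert i b.1, b.2) := by
    rw [Finset.sum_filter]
    refine Finset.sum_congr rfl fun b _ => ?_
    split_ifs <;> simp_all
  rw [h1, h2]
  refine Finset.sum_nbij' (fun b => (b.1.erase i, b.2)) (fun b => (insert i b.1, b.2)) ?_ ?_ ?_ ?_ ?_
  · simp
  · simp
  · rintro b hb
    simp only [Finset.mem_filter, Finset.mem_univ, true_and] at hb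
    exact Prod.ext (Finset.insert_erase hb) rfl
  · rintro b hb
    simp only [Finset.mem_filter, Finset.mem_univ, true_and] at hb
    exact Prod.ext (Finset.erase_insert hb) rfl
  · rintro b hb
    simp only [Finset.mem_filter, Finset.mem_univ, true_and] at hb
    simp only
    rw [Finset.insert_erase hb]

end FormPairing

/-! ### The inverses of the pairings on the fibre and on the fields. -/

namespace FreeTheory

variable {d : ℕ} {V₀ : Type*} [AddCommGroup V₀] [Module ℂ V₀] {B : Type}
  (𝓥 : FreeTheory d V₀ B) [Fintype B] [DecidableEq B]

theorem fibrePairing_skew (b c : B) :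
    𝓥.fibrePairing b c = -(sgn (𝓥.deg b * 𝓥.deg c) * 𝓥.fibrePairing c b) :=
  𝓥.pairing_skew b c

theorem isUnit_det_fibrePairing : IsUnit 𝓥.fibrePairing.det := by
  have h : 𝓥.fibrePairing = LinearMap.BilinForm.toMatrix 𝓥.e 𝓥.pairing := by
    ext b c
    rw [LinearMap.BilinForm.toMatrix_apply]; rfl
  rw [h]
  exact isUnit_iff_ne_zero.2 ((LinearMap.BilinForm.nondegenerate_iff_det_ne_zero 𝓥.e).1
    𝓥.nondegenerate)

theorem fibrePairing_mul_inv : 𝓥.fibrePairing * 𝓥.fibrePairing⁻¹ = 1 :=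
  Matrix.mul_nonsing_inv _ 𝓥.isUnit_det_fibrePairing

theorem inv_fibrePairing_deg (b c : B) (h : 𝓥.fibrePairing⁻¹ b c ≠ 0) :
    𝓥.deg b + 𝓥.deg c = 1 - d := by
  -- Erasing the entries of the inverse in wrong degrees still leaves a right inverse, because the
  -- pairing has no entries there either; uniqueness shows that nothing was erased.
  let κ : Matrix B B ℂ := fun b c => if 𝓥.deg b + 𝓥.deg c = 1 - d then 𝓥.fibrePairing⁻¹ b c else 0
  have h1 : 𝓥.fibrePairing * κ = 1 := by
    ext b c
    have h0 := congrFun (congrFun 𝓥.fibrePairing_mul_inv b) c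
    rw [Matrix.mul_apply] at h0 ⊢
    by_cases hbc : 𝓥.deg b = 𝓥.deg c
    · rw [← h0]
      refine Finset.sum_congr rfl fun e _ => ?_
      by_cases he : 𝓥.fibrePairing b e = 0
      · rw [he, zero_mul, zero_mul]
      · have := 𝓥.pairing_deg b e he
        rw [show κ e c = 𝓥.fibrePairing⁻¹ e c from if_pos (by omega)]
    · rw [Matrix.one_apply_ne (fun h => hbc (by rw [h]))]
      refine Finset.sum_eq_zero fun e _ => ?_
      by_cases he : 𝓥.fibrePairing b e = 0
      · rw [he, zero_mul]
      · have := 𝓥.pairing_deg b e he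
        rw [show κ e c = 0 from if_neg (by omega), mul_zero]
  have h2 := Matrix.inv_eq_right_inv h1
  by_contra h3
  rw [h2] at h
  exact h (if_neg h3)

/-- The negative graded transpose of the inverse is again a right inverse, since the pairing is
graded skew; inverses are unique. -/
theorem inv_fibrePairing_skew (b c : B) :
    𝓥.fibrePairing⁻¹ b c = -(sgn (𝓥.deg b * 𝓥.deg c) * 𝓥.fibrePairing⁻¹ c b) := by
  have h1 : 𝓥.fibrePairing * (Matrix.of fun b c =>
      -(sgn (𝓥.deg b * 𝓥.deg c) * 𝓥.fibrePairing⁻¹ c b)) = 1 := by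
    ext b c
    have h0 : (𝓥.fibrePairing⁻¹ * 𝓥.fibrePairing) c b = (1 : Matrix B B ℂ) c b := by
      rw [Matrix.nonsing_inv_mul _ 𝓥.isUnit_det_fibrePairing]
    rw [Matrix.mul_apply] at h0 ⊢
    simp only [Matrix.of_apply]
    have h2 : ∀ e, 𝓥.fibrePairing b e * -(sgn (𝓥.deg e * 𝓥.deg c) * 𝓥.fibrePairing⁻¹ c e) =
        sgn ((1 - d - 𝓥.deg b) * (𝓥.deg b + 𝓥.deg c)) *
          (𝓥.fibrePairing⁻¹ c e * 𝓥.fibrePairing e b) := fun e => by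
      by_cases he : 𝓥.fibrePairing b e = 0
      · have := 𝓥.fibrePairing_skew e b
        rw [he, mul_zero, neg_zero] at this
        rw [he, this]; ring
      · have h3 : 1 - d - 𝓥.deg b = 𝓥.deg e := by have := 𝓥.pairing_deg b e he; omega
        rw [𝓥.fibrePairing_skew b e, h3, mul_add, sgn_add, mul_comm (𝓥.deg b)]
        ring
    rw [Finset.sum_congr rfl fun e _ => h2 e, ← Finset.mul_sum, h0]
    by_cases hbc : b = c
    · subst hbc
      rw [Matrix.one_apply_eq, mul_one, sgn_eq_of_even (b := 0), sgn_zero]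
      exact ⟨(1 - d - 𝓥.deg b) * 𝓥.deg b, by ring⟩
    · rw [Matrix.one_apply_ne hbc, Matrix.one_apply_ne (Ne.symm hbc), mul_zero]
  have h2 := Matrix.inv_eq_right_inv h1
  exact congrFun (congrFun h2 b) c

theorem isPairing_inv_fibrePairing : IsPairing 𝓥.deg d 𝓥.fibrePairing⁻¹ where
  deg_add := 𝓥.inv_fibrePairing_deg
  symm a b := by
    by_cases h : 𝓥.fibrePairing⁻¹ a b = 0
    · rw [𝓥.inv_fibrePairing_skew b a, h]; ring
    · rw [𝓥.inv_fibrePairing_skew b a]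
      have h1 : (d : ℤ) + 𝓥.deg a = 1 - 𝓥.deg b := by
        have := 𝓥.inv_fibrePairing_deg a b h; omega
      rw [h1, mul_neg, ← mul_assoc, ← sgn_add, ← neg_mul, ← sgn_eq_neg_of_odd]
      refine ⟨𝓥.deg a - 𝓥.deg a * 𝓥.deg b - 1, by ring⟩

theorem inv_fieldPairing : 𝓥.fieldPairing⁻¹ = formPairing d 𝓥.deg 𝓥.fibrePairing⁻¹ := by
  refine Matrix.inv_eq_right_inv ?_
  ext a b
  rw [Matrix.mul_apply, Fintype.sum_prod_type, Finset.sum_eq_single a.1ᶜ]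
  · by_cases h : a.1 = b.1
    · have h1 : ∀ c, 𝓥.fieldPairing a (a.1ᶜ, c) * formPairing d 𝓥.deg 𝓥.fibrePairing⁻¹ (a.1ᶜ, c) b =
          sgn (𝓥.deg a.2 * a.1ᶜ.card) * sgn (𝓥.deg b.2 * a.1ᶜ.card) *
            (𝓥.fibrePairing a.2 c * 𝓥.fibrePairing⁻¹ c b.2) := fun c => by
        have e1 : 𝓥.fieldPairing a (a.1ᶜ, c) = sgn (𝓥.deg a.2 * a.1ᶜ.card) * wedgeSign a.1 a.1ᶜ *
          𝓥.fibrePairing a.2 c := if_pos rfl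
        rw [e1, formPairing_apply (by simp [h])]
        simp only [compl_compl]
        linear_combination (sgn (𝓥.deg a.2 * a.1ᶜ.card) * sgn (𝓥.deg b.2 * a.1ᶜ.card) *
            (𝓥.fibrePairing a.2 c * 𝓥.fibrePairing⁻¹ c b.2)) * wedgeSign_mul_self a.1 a.1ᶜ
      rw [Finset.sum_congr rfl fun c _ => h1 c, ← Finset.mul_sum, ← Matrix.mul_apply,
        𝓥.fibrePairing_mul_inv]
      by_cases h2 : a.2 = b.2
      · rw [Prod.ext h h2, Matrix.one_apply_eq, Matrix.one_apply_eq, sgn_mul_self, one_mul]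
      · rw [Matrix.one_apply_ne h2, Matrix.one_apply_ne fun h => h2 (congrArg Prod.snd h), mul_zero]
    · rw [Matrix.one_apply_ne fun h' => h (congrArg Prod.fst h')]
      refine Finset.sum_eq_zero fun c _ => ?_
      rw [formPairing, if_neg, mul_zero]
      simpa using Ne.symm h
  · intro T _ hT
    refine Finset.sum_eq_zero fun c _ => ?_
    rw [fieldPairing, if_neg hT, zero_mul]
  · simp

end FreeTheory

/-! ### Hamiltonian derivations with constant coefficients -/

section ConstHamiltonian

variable {d : ℕ} {B : Type} [Fintype B] [DecidableEq B] {degB : B → ℤ} {κ : Matrix B B ℂ}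
  {J : JetSeries ℂ (Fin d ⊕ Fin d) (Finset (Fin d) × B)}

theorem formPairing_mul_sgn (hκ : IsPairing degB d κ) (a b : Finset (Fin d) × B) :
    sgn (formDeg degB a) * formPairing d degB κ a b * sgn (formDeg degB b) =
      -formPairing d degB κ a b := by
  by_cases h : formPairing d degB κ a b = 0
  · simp [h]
  · have h1 := (isPairing_formPairing hκ).deg_add a b h
    have h2 : sgn (formDeg degB a) * sgn (formDeg degB b) = -1 := by
      rw [← sgn_add, h1, sub_zero, sgn_one]
    linear_combination (formPairing d degB κ a b) * h2

/-- Components of the Hamiltonian derivation of a Lagrangian with constant coefficients. -/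
def hamC (degB : B → ℤ) (κ : Matrix B B ℂ)
    (J : JetSeries ℂ (Fin d ⊕ Fin d) (Finset (Fin d) × B)) :
    ℕ → FieldJet d B → FieldPoly ℂ d B :=
  hamiltonian (fun _ => 0) (formDeg degB) (formPairing d degB κ) J

theorem hamC_eq (m : ℕ) (j : FieldJet d B) : hamC degB κ J m j =
    totalDPow (fun _ => 0) j.2 (∑ b, (sgn (formDeg degB j.1) * formPairing d degB κ j.1 b) •
      euler (fun _ => 0) (formDeg degB) b (J (m + 1))) := rfl

theorem isHomogFamily_hamC (hκ : IsPairing degB d κ) (hJ : J ∈ lagrangians ℂ (formDeg degB) 0)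
    (m : ℕ) : IsHomogFamily (formDeg degB) 1 m (hamC degB κ J m) :=
  isHomogFamily_hamiltonian commDer_zero (isPairing_formPairing hκ) hJ m

theorem isEvolutionary_hamC (m : ℕ) : IsEvolutionary (fun _ => 0) (hamC degB κ J m) :=
  isEvolutionary_hamiltonian commDer_zero m

theorem etaD_euler_add_mem_koszul {i : Fin d} {x : FieldPoly ℂ d B}
    (hx : etaD ℂ degB i x ∈ constSub (formDeg degB)) (b : Finset (Fin d) × B) :
    sgn (formDeg degB b) • etaD ℂ degB i (euler (fun _ => 0) (formDeg degB) b x) +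
      intSign i b.1 • euler (fun _ => 0) (formDeg degB) (b.1.erase i, b.2) x ∈
      koszulRel ℂ (formDeg degB) := by
  have h1 := euler_mem_koszul_of_locSub commDer_zero b hx
  rw [← SModEq.zero] at h1 ⊢
  exact (euler_etaD commDer_zero i b x).symm.trans h1

/-- The anticommutator of `η_i` and `{J, -}` on a letter is governed by the variational derivatives
of `η_i J`; these vanish because `η_i J` is a total derivative. -/
theorem hamC_etaQ (hκ : IsPairing degB d κ) {m : ℕ} {i : Fin d}
    (hη : etaD ℂ degB i (J (m + 1)) ∈ constSub (formDeg degB)) (j : FieldJet d B) :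
    etaD ℂ degB i (hamC degB κ J m j) + der (formDeg degB) 1 (hamC degB κ J m) (etaQ ℂ i j) ∈
      koszulRel ℂ (formDeg degB) := by
  obtain ⟨a, K⟩ := j
  set E := fun b => euler (fun _ => 0) (formDeg degB) b (J (m + 1)) with hE
  have e1 : der (formDeg degB) 1 (hamC degB κ J m) (etaQ ℂ i (a, K)) =
      totalDPow (fun _ => 0) K (∑ b, (extSign i a.1 * (sgn (formDeg degB (insert i a.1, a.2)) *
        formPairing d degB κ (insert i a.1, a.2) b)) • E b) := by
    rw [etaQ, mono, map_smul, der_letter, hamC_eq, ← map_smul, Finset.smul_sum]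
    simp only [smul_smul, hE]
  have e2 : etaD ℂ degB i (hamC degB κ J m (a, K)) = totalDPow (fun _ => 0) K
      (∑ b, (sgn (formDeg degB a) * formPairing d degB κ a b) • etaD ℂ degB i (E b)) := by
    rw [hamC_eq, comm_totalDPow' commDer_zero _ (etaD_totalD commDer_zero i), map_sum]
    simp only [map_smul, hE]
  rw [e1, e2, ← map_add]
  refine totalDPow_mem_koszul commDer_zero _ ?_
  have e3 : ∀ b, (sgn (formDeg degB a) * formPairing d degB κ a b) • etaD ℂ degB i (E b) ≡
      (formPairing d degB κ a b * intSign i b.1) • E (b.1.erase i, b.2)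
      [SMOD koszulRel ℂ (formDeg degB)] := fun b => by
    have := Submodule.smul_mem _ (sgn (formDeg degB a) * formPairing d degB κ a b *
      sgn (formDeg degB b)) (etaD_euler_add_mem_koszul hη b)
    rw [SModEq.sub_mem]
    convert this using 1
    rw [smul_add, smul_smul, smul_smul, mul_assoc _ (sgn _) (sgn _), sgn_mul_self, mul_one,
      formPairing_mul_sgn hκ, neg_mul, neg_smul, sub_eq_add_neg]
  -- Reindexing `b` as `insert i b` puts all terms on the same variational derivative, where
  -- adjointness of the contraction applies.
  have e4 : ∑ b, (formPairing d degB κ a b * intSign i b.1) • E (b.1.erase i, b.2) =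
      ∑ b, (sgn (formDeg degB a) * extSign i a.1 * formPairing d degB κ (insert i a.1, a.2) b) •
        E b := by
    rw [sum_insert_eq i fun b hb => by rw [intSign_notMem hb, mul_zero, zero_smul]]
    refine Finset.sum_congr rfl fun b _ => ?_
    rw [← extSign_mul_formPairing hκ]
    split_ifs with hb
    · rw [extSign_mem hb, zero_mul, zero_smul]
    · simp only
      rw [Finset.erase_insert hb, intSign_insert hb, extSign_notMem hb, mul_comm]
  rw [← SModEq.zero]
  refine (((SModEq.sum' fun b _ => e3 b).trans (SModEq.of_eq e4)).add SModEq.rfl).trans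
    (SModEq.of_eq ?_)
  rw [← Finset.sum_add_distrib]
  refine Finset.sum_eq_zero fun b _ => ?_
  rw [← add_smul]
  by_cases ha : i ∈ a.1
  · rw [extSign_mem ha]; simp
  · have : sgn (formDeg degB (insert i a.1, a.2)) = -sgn (formDeg degB a) := by
      rw [formDeg_insert ha]
      exact sgn_eq_neg_of_odd ⟨0, by ring⟩
    rw [this]
    convert zero_smul ℂ _
    ring

theorem etaD_der_hamC (hκ : IsPairing degB d κ) (hJ : J ∈ lagrangians ℂ (formDeg degB) 0) {m : ℕ}
    {i : Fin d} (hη : etaD ℂ degB i (J (m + 1)) ∈ constSub (formDeg degB)) (x : FieldPoly ℂ d B) :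
    der (formDeg degB) 1 (hamC degB κ J m) (etaD ℂ degB i x) +
      etaD ℂ degB i (der (formDeg degB) 1 (hamC degB κ J m) x) ∈ koszulRel ℂ (formDeg degB) := by
  rw [add_comm, etaD, der_anticomm (isHomogFamily_etaQ i) (isHomogFamily_hamC hκ hJ m)
    (by simp [sgn_neg_one]) (fun j => rfl), ← SModEq.zero]
  refine (der_congr_left (q' := 0) (fun j => SModEq.zero.2 ?_) x).trans (by rw [der_zero_left]; rfl)
  exact hamC_etaQ hκ hη j

/-- The derivative of a Hamiltonian derivation along the Dolbeault operator. -/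
theorem dbarD_hamC (hκ : IsPairing degB d κ) (m : ℕ) (j : FieldJet d B) :
    dbarD ℂ degB (hamC degB κ J m j) +
      der (formDeg degB) 1 (hamC degB κ J m) ((∑ i, dbarQ ℂ i) j) ≡
    totalDPow (fun _ => 0) j.2 (∑ b, (sgn (formDeg degB j.1) * formPairing d degB κ j.1 b *
      sgn (formDeg degB b)) • euler (fun _ => 0) (formDeg degB) b (dbarD ℂ degB (J (m + 1))))
      [SMOD koszulRel ℂ (formDeg degB)] := by
  obtain ⟨a, K⟩ := j
  set E := fun b => euler (fun _ => 0) (formDeg degB) b (J (m + 1)) with hE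
  have e1 : der (formDeg degB) 1 (hamC degB κ J m) ((∑ i, dbarQ ℂ i) (a, K)) =
      totalDPow (fun _ => 0) K (∑ i : Fin d, totalD (fun _ => 0) (Sum.inr i) (∑ b,
        (intSign i a.1 * (sgn (formDeg degB (a.1.erase i, a.2)) *
          formPairing d degB κ (a.1.erase i, a.2) b)) • E b)) := by
    rw [Finset.sum_apply, map_sum, map_sum]
    refine Finset.sum_congr rfl fun i _ => ?_
    rw [dbarQ, mono, map_smul, der_letter, hamC_eq, totalDPow_add_single commDer_zero,
      Module.End.mul_apply, ← comm_totalDPow' commDer_zero (totalD (fun _ => 0) (Sum.inr i))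
        (fun l x => totalD_comm commDer_zero _ _ _), ← map_smul, ← map_smul, Finset.smul_sum]
    simp only [smul_smul, hE]
  have e2 : dbarD ℂ degB (hamC degB κ J m (a, K)) = totalDPow (fun _ => 0) K
      (∑ b, (sgn (formDeg degB a) * formPairing d degB κ a b) • dbarD ℂ degB (E b)) := by
    rw [hamC_eq, comm_totalDPow' commDer_zero _ (dbarD_totalD commDer_zero), map_sum]
    simp only [map_smul, hE]
  -- Adjointness of exterior multiplication, obtained from `extSign_mul_formPairing` at `a.1.erase
  -- i`. If `i ∉ a.1`, both sides vanish, since the pairing forces `b.1` to be the complement of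
  -- `a.1`.
  have e3 : ∀ i, ∑ b, (intSign i a.1 * (sgn (formDeg degB (a.1.erase i, a.2)) *
      formPairing d degB κ (a.1.erase i, a.2) b)) • E b =
      ∑ b, (formPairing d degB κ a b * extSign i b.1) • E (insert i b.1, b.2) := fun i => by
    by_cases ha : i ∈ a.1
    · rw [sum_insert_eq i]
      · refine Finset.sum_congr rfl fun b _ => ?_
        have := extSign_mul_formPairing hκ i (a.1.erase i, a.2) b
        simp only [Finset.insert_erase ha] at this
        split_ifs with hb
        · rw [extSign_mem hb, mul_zero, zero_smul]
        · rw [intSign_mem ha]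
          congr 1
          rw [extSign_notMem hb, extSign_notMem (Finset.notMem_erase i _)] at *
          have hs := sgn_mul_self (formDeg degB (a.1.erase i, a.2))
          have hv := wedgeSign_mul_self {i} (a.1.erase i)
          have hw := wedgeSign_mul_self {i} b.1
          generalize sgn (formDeg degB (a.1.erase i, a.2)) = s at *
          generalize wedgeSign {i} (a.1.erase i) = v at *
          generalize wedgeSign {i} b.1 = w at *
          linear_combination s * v * w * this + w * formPairing d degB κ a b * (s * s * hv + hs) -
            s * v * formPairing d degB κ (a.1.erase i, a.2) (insert i b.1, b.2) * hw
      · intro b hb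
        by_cases h : formPairing d degB κ (a.1.erase i, a.2) b = 0
        · rw [h, mul_zero, mul_zero, zero_smul]
        · rw [(formPairing_ne_zero h).1] at hb
          simp at hb
    · rw [intSign_notMem ha]
      simp only [zero_mul, zero_smul, Finset.sum_const_zero]
      refine (Finset.sum_eq_zero fun b _ => ?_).symm
      by_cases h : formPairing d degB κ a b = 0
      · rw [h, zero_mul, zero_smul]
      · rw [extSign_mem, mul_zero, zero_smul]
        rw [(formPairing_ne_zero h).1]
        simpa using ha
  rw [e1, e2, ← map_add]
  refine SModEq.map_of_le _ (fun _ => totalDPow_mem_koszul commDer_zero _) (SModEq.symm ?_)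
  refine (SModEq.sum' fun b _ => (euler_dbarD (degB := degB) commDer_zero b (J (m + 1))).smul
    (sgn (formDeg degB a) * formPairing d degB κ a b * sgn (formDeg degB b))).trans
    (SModEq.of_eq ?_)
  simp only [e3, map_sum, map_smul]
  rw [Finset.sum_comm (s := Finset.univ (α := Fin d)), ← Finset.sum_add_distrib]
  refine Finset.sum_congr rfl fun b _ => ?_
  rw [smul_sub, smul_smul, mul_assoc _ (sgn _) (sgn _), sgn_mul_self, mul_one,
    formPairing_mul_sgn hκ, neg_smul, sub_neg_eq_add, Finset.smul_sum]
  simp only [smul_smul, hE]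

/-! ### The differential of the deformation complex -/

/-- Components of the differential of the deformation complex. -/
def defQ (degB : B → ℤ) (κ : Matrix B B ℂ)
    (J : JetSeries ℂ (Fin d ⊕ Fin d) (Finset (Fin d) × B)) (m : ℕ) :
    FieldJet d B → FieldPoly ℂ d B :=
  hamC degB κ J m + if m = 1 then ∑ i, dbarQ ℂ i else 0

theorem isHomogFamily_defQ (hκ : IsPairing degB d κ) (hJ : J ∈ lagrangians ℂ (formDeg degB) 0)
    (m : ℕ) : IsHomogFamily (formDeg degB) 1 m (defQ degB κ J m) := fun j => by
  refine Submodule.add_mem _ (isHomogFamily_hamC hκ hJ m j) ?_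
  split_ifs with h
  · subst h
    exact isHomogFamily_dbar j
  · exact zero_mem _

theorem defQ_zero (hJ1 : J 1 = 0) : defQ degB κ J 0 = 0 := by
  rw [defQ, if_neg (by simp), add_zero]
  exact hamiltonian_eq_zero hJ1

theorem sum_antidiagonal_dbar {M : Type*} [AddCommMonoid M] (n : ℕ) (f : ℕ → M) :
    ∑ p ∈ Finset.HasAntidiagonal.antidiagonal (n + 1), (if p.1 = 1 then f p.2 else 0) = f n := by
  rw [Finset.sum_eq_single (1, n)]
  · simp
  · rintro ⟨a, b⟩ h1 h2
    rw [Finset.HasAntidiagonal.mem_antidiagonal] at h1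
    rw [if_neg]
    rintro rfl
    exact h2 (Prod.ext rfl (by simp at h1 ⊢; omega))
  · intro h
    exact absurd (Finset.HasAntidiagonal.mem_antidiagonal.2 (by simp; omega)) h

theorem der_defQ (m : ℕ) (x : FieldPoly ℂ d B) : der (formDeg degB) 1 (defQ degB κ J m) x =
    der (formDeg degB) 1 (hamC degB κ J m) x + if m = 1 then dbarD ℂ degB x else 0 := by
  rw [defQ, der_add_left, LinearMap.add_apply, dbarD_eq_der]
  congr 1
  split_ifs
  · rfl
  · rw [der_zero_left]; rfl

theorem ceDiff_defQ (F : JetSeries ℂ (Fin d ⊕ Fin d) (Finset (Fin d) × B)) (n : ℕ) :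
    ceDiff (formDeg degB) (defQ degB κ J) F n =
      dbarD ℂ degB (F n) + ceDiff (formDeg degB) (hamC degB κ J) F n := by
  rw [ceDiff_apply, ceDiff_apply, Finset.sum_congr rfl fun p _ => der_defQ p.1 (F p.2),
    Finset.sum_add_distrib, sum_antidiagonal_dbar n fun l => dbarD ℂ degB (F l), add_comm]

/-- The master equation for Lagrangians with constant coefficients. -/
def IsMaster (degB : B → ℤ) (κ : Matrix B B ℂ)
    (J : JetSeries ℂ (Fin d ⊕ Fin d) (Finset (Fin d) × B)) : Prop :=
  ∀ n, dbarD ℂ degB (J n) + ((1 / 2 : ℂ) • ceDiff (formDeg degB) (hamC degB κ J) J) n ∈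
    constSub (formDeg degB)

/-- Expanding `(∂̄ + {J, -})²` on a letter, `∂̄²` drops out, the cross terms give the Hamiltonian
field of `∂̄J` and the rest that of `½{J, J}`. Together they involve only variational derivatives of
the left side of the master equation, a total derivative. -/
theorem sum_der_defQ (hκ : IsPairing degB d κ) (hJ : J ∈ lagrangians ℂ (formDeg degB) 0)
    (hJ1 : J 1 = 0) (hm : IsMaster degB κ J) (M : ℕ) (j : FieldJet d B) :
    ∑ p ∈ Finset.HasAntidiagonal.antidiagonal M,
      der (formDeg degB) 1 (defQ degB κ J p.1) (defQ degB κ J p.2 j) ∈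
      koszulRel ℂ (formDeg degB) := by
  cases M with
  | zero => simp [defQ_zero hJ1, der_zero_left]
  | succ M =>
    set q := (∑ i, dbarQ ℂ i : FieldJet d B → FieldPoly ℂ d B) with hq
    have h1 : ∀ p ∈ Finset.HasAntidiagonal.antidiagonal (M + 1),
        der (formDeg degB) 1 (defQ degB κ J p.1) (defQ degB κ J p.2 j) =
        der (formDeg degB) 1 (hamC degB κ J p.1) (hamC degB κ J p.2 j) +
        ((if p.1 = 1 then dbarD ℂ degB (hamC degB κ J p.2 j) else 0) +
        if p.2 = 1 then der (formDeg degB) 1 (hamC degB κ J p.1) (q j) else 0) := fun p _ => by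
      have h2 : dbarD ℂ degB (q j) = 0 := by
        have := dbarD_sq (degB := degB) (letter ℂ j)
        rwa [dbarD_eq_der, der_letter, ← dbarD_eq_der] at this
      have h3 : defQ degB κ J p.2 j = hamC degB κ J p.2 j + if p.2 = 1 then q j else 0 := by
        rw [defQ, Pi.add_apply]
        split_ifs <;> rfl
      rw [der_defQ, h3, map_add, map_add]
      split_ifs with h4 h5 h5 <;> simp only [h2, map_zero, add_zero, zero_add]
      rw [add_assoc, add_comm (dbarD ℂ degB _)]
    have h3 : ∑ p ∈ Finset.HasAntidiagonal.antidiagonal (M + 1),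
        (if p.2 = 1 then der (formDeg degB) 1 (hamC degB κ J p.1) (q j) else 0) =
        der (formDeg degB) 1 (hamC degB κ J M) (q j) := by
      rw [← Finset.Nat.sum_antidiagonal_swap]
      exact sum_antidiagonal_dbar M fun l => der (formDeg degB) 1 (hamC degB κ J l) (q j)
    rw [Finset.sum_congr rfl h1, Finset.sum_add_distrib, Finset.sum_add_distrib, h3,
      sum_antidiagonal_dbar M fun l => dbarD ℂ degB (hamC degB κ J l j), ← SModEq.zero]
    refine ((sum_der_hamiltonian commDer_zero (isPairing_formPairing hκ) hJ (M + 1) j).add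
      (dbarD_hamC hκ M j)).trans ?_
    rw [← map_add, ← Finset.sum_add_distrib, SModEq.zero]
    refine totalDPow_mem_koszul commDer_zero _ (Submodule.sum_mem _ fun b _ => ?_)
    rw [← smul_add, ← map_add, add_comm]
    exact Submodule.smul_mem _ _ (euler_mem_koszul_of_locSub commDer_zero b (hm (M + 1)))

theorem ceDiff_defQ_sq (hκ : IsPairing degB d κ) (hJ : J ∈ lagrangians ℂ (formDeg degB) 0)
    (hJ1 : J 1 = 0) (hm : IsMaster degB κ J)
    (F : JetSeries ℂ (Fin d ⊕ Fin d) (Finset (Fin d) × B)) :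
    ceDiff (formDeg degB) (defQ degB κ J) (ceDiff (formDeg degB) (defQ degB κ J) F) ∈
      symRel ℂ (Fin d ⊕ Fin d) (formDeg degB) :=
  ceDiff_sq (defQ_zero hJ1) (isHomogFamily_defQ hκ hJ) (sum_der_defQ hκ hJ hJ1 hm) F

end ConstHamiltonian

/-! ### The holomorphic part of a Hamiltonian derivation -/

section HolHamiltonian

variable {d : ℕ} {B : Type} [Fintype B] [DecidableEq B] {degB : B → ℤ} {κ : Matrix B B ℂ}
  {J : JetSeries ℂ (Fin d ⊕ Fin d) (Finset (Fin d) × B)}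

/-- The holomorphic part of a Lagrangian with constant coefficients, in all degrees. -/
def holSeries (degB : B → ℤ) (J : JetSeries ℂ (Fin d ⊕ Fin d) (Finset (Fin d) × B)) :
    JetSeries ℂ (Fin d) B := fun n => holPartC degB n (J n)

/-- Components of the Hamiltonian derivation of the holomorphic part. -/
def hamH (degB : B → ℤ) (κ : Matrix B B ℂ) (I : JetSeries ℂ (Fin d) B) :
    ℕ → B × (Fin d →₀ ℕ) → JetPoly ℂ (Fin d) B :=
  hamiltonian (fun _ => 0) degB κ I

theorem etaL_allIdx_of_invariant {n : ℕ} (hn : n ≠ 0) {k : ℤ} {x : FieldPoly ℂ d B}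
    (hx : x ∈ homog ℂ (formDeg degB) n k)
    (hη : ∀ i, etaD ℂ degB i x ∈ constSub (formDeg degB)) :
    ∃ y ∈ homog ℂ (formDeg degB) n (k - d),
      x ≡ etaL ℂ degB (allIdx d) y [SMOD constSub (formDeg degB)] ∧
      (dbarD ℂ degB x ∈ constSub (formDeg degB) → dbarD ℂ degB y ∈ constSub (formDeg degB)) := by
  have := exists_eq_etaL commDer_zero hn (List.nodup_finRange d) hx fun i _ => hη i
  rwa [List.length_finRange] at this

theorem holPartC_congr (n : ℕ) {x y : FieldPoly ℂ d B}
    (h : x ≡ y [SMOD constSub (formDeg degB)]) :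
    holPartC degB n x ≡ holPartC degB n y [SMOD constSub degB] :=
  SModEq.map_of_le _ (fun _ hx => koszul_le_locSub (holPartC_mem_koszul n hx)) h

/-- Variational derivatives of the holomorphic part. -/
theorem projHol_euler_univ {n : ℕ} (hn : n ≠ 0) {k : ℤ} {x : FieldPoly ℂ d B}
    (hx : x ∈ homog ℂ (formDeg degB) n k)
    (hη : ∀ i, etaD ℂ degB i x ∈ constSub (formDeg degB)) (b : B) :
    projHol (euler (fun _ => 0) (formDeg degB) (Finset.univ, b) x) ≡
      euler (fun _ => 0) degB b (holPartC degB n x) [SMOD koszulRel ℂ degB] := by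
  obtain ⟨y, hy, hxy, -⟩ := etaL_allIdx_of_invariant hn hx hη
  have h1 := SModEq.map_of_le projHol (fun _ => projHol_mem_koszul)
    (SModEq.map_of_le _ (fun _ => euler_mem_koszul_of_locSub commDer_zero (Finset.univ, b)) hxy)
  have h2 := projHol_euler_etaL (degB := degB) (List.nodup_finRange d) b y
  rw [List.toFinset_finRange] at h2
  have h3 := SModEq.map_of_le _ (fun _ => euler_mem_koszul_of_locSub commDer_zero b)
    ((holPartC_congr n hxy).trans (holPartC_etaL hn hy))
  rw [map_smul] at h3
  exact h1.trans (h2.trans h3.symm)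

/-- For `i ∉ b.1`, the variational derivative in component `b` occurs in that of `η_i x` in
component `insert i b.1`, which is zero. The other term there lies in the image of `η_i` and
disappears on holomorphic jets. -/
theorem projHol_euler_mem_koszul {x : FieldPoly ℂ d B}
    (hη : ∀ i, etaD ℂ degB i x ∈ constSub (formDeg degB)) {b : Finset (Fin d) × B}
    (hb : b.1 ≠ Finset.univ) :
    projHol (euler (fun _ => 0) (formDeg degB) b x) ∈ koszulRel ℂ degB := by
  obtain ⟨i, hi⟩ : ∃ i, i ∉ b.1 := by
    by_contra h
    push Not at h
    exact hb (Finset.eq_univ_iff_forall.2 h)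
  have h1 := projHol_mem_koszul (etaD_euler_add_mem_koszul (hη i) (insert i b.1, b.2))
  rw [map_add, map_smul, projHol_etaD, smul_zero, zero_add, map_smul, intSign_insert hi] at h1
  simp only [Finset.erase_insert hi] at h1
  have h2 := Submodule.smul_mem _ (wedgeSign {i} b.1) h1
  rwa [smul_smul, wedgeSign_mul_self, one_smul] at h2

/-- On holomorphic jets only the top variational derivative of `J` survives, and the pairing matches
it with components having no `d z̄`. So `{J, -}` preserves the equations cutting out holomorphic
jets and restricts there to the bracket with the holomorphic part. -/
theorem projHol_hamC {k : ℤ} {m : ℕ} (hJ : J (m + 1) ∈ homog ℂ (formDeg degB) (m + 1) k)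
    (hη : ∀ i, etaD ℂ degB i (J (m + 1)) ∈ constSub (formDeg degB)) (j : FieldJet d B) :
    projHol (hamC degB κ J m j) ≡
      (holLetter j).elim 0 (hamH degB κ (holSeries degB J) m) [SMOD koszulRel ℂ degB] := by
  obtain ⟨⟨S, b⟩, K⟩ := j
  rw [hamC_eq, projHol_totalDPow, map_sum]
  simp only [map_smul]
  by_cases hK : ∀ i, K (Sum.inr i) = 0
  · rw [if_pos hK]
    by_cases hS : S = ∅
    · subst hS
      rw [holLetter, if_pos ⟨rfl, hK⟩, Option.elim_some, hamH, hamiltonian_eq]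
      refine SModEq.map_of_le _ (fun _ => totalDPow_mem_koszul commDer_zero _) ?_
      rw [Fintype.sum_prod_type, Finset.sum_eq_single Finset.univ]
      · refine SModEq.sum' fun c _ => ?_
        have e : sgn (formDeg degB ((∅ : Finset (Fin d)), b)) *
            formPairing d degB κ (∅, b) (Finset.univ, c) = sgn (degB b) * κ b c := by
          rw [formPairing_apply (by simp)]
          simp [formDeg]
        rw [e]
        exact (projHol_euler_univ (Nat.succ_ne_zero m) hJ hη c).smul _
      · intro T _ hT
        refine Finset.sum_eq_zero fun c _ => ?_
        rw [formPairing, if_neg (by simpa using hT), mul_zero, zero_smul]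
      · simp
    · rw [holLetter, if_neg fun h => hS h.1, Option.elim_none, SModEq.zero]
      refine totalDPow_mem_koszul commDer_zero _ (Submodule.sum_mem _ fun c _ => ?_)
      by_cases h0 : formPairing d degB κ (S, b) c = 0
      · rw [h0, mul_zero, zero_smul]; exact zero_mem _
      · refine Submodule.smul_mem _ _ (projHol_euler_mem_koszul hη ?_)
        rw [(formPairing_ne_zero h0).1]
        simpa using hS
  · rw [if_neg hK, holLetter, if_neg fun h => hK h.2]
    rfl

theorem projHol_mul (x y : FieldPoly ℂ d B) : projHol (x ⋆ y) = projHol x ⋆ projHol y := by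
  induction x using word_induction with
  | hnil r => rw [nil_mul, map_smul, projHol_nil, nil_mul]
  | hcons j x ih =>
    rw [consL_mul, projHol_consL, projHol_consL, ih]
    cases holLetter j <;> simp [consL_mul]
  | hadd x x' hx hx' => simp only [map_add, LinearMap.add_apply, hx, hx']

theorem projHol_der {deg' : Finset (Fin d) × B → ℤ} {p : ℤ} {q : FieldJet d B → FieldPoly ℂ d B}
    {q' : B × (Fin d →₀ ℕ) → JetPoly ℂ (Fin d) B}
    (hdeg : ∀ b, deg' (∅, b) = degB b)
    (h : ∀ j, projHol (q j) ≡ (holLetter j).elim 0 q' [SMOD koszulRel ℂ degB])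
    (x : FieldPoly ℂ d B) :
    projHol (der deg' p q x) ≡ der degB p q' (projHol x) [SMOD koszulRel ℂ degB] := by
  induction x using word_induction with
  | hnil r => simp
  | hcons j x ih =>
    rw [der_consL, map_add, map_smul, projHol_mul, projHol_consL, projHol_consL]
    by_cases hj : jetWeight j = 0
    · obtain ⟨v, hv, rfl⟩ := holLetter_eq_some hj
      have hv' := h (liftLetter d v)
      rw [hv, Option.elim_some] at hv'
      simp only [hv, Option.elim_some]
      rw [der_consL]
      refine (mulL_congr hv' SModEq.rfl).add ?_
      have : deg' (liftLetter d v).1 = degB v.1 := hdeg v.1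
      rw [this]
      exact (consL_congr _ ih).smul _
    · have hv' := h j
      rw [holLetter_eq_none hj, Option.elim_none] at hv'
      simp only [holLetter_eq_none hj, Option.elim_none, smul_zero, add_zero, map_zero]
      refine (mulL_congr hv' SModEq.rfl).trans ?_
      simp
  | hadd x y hx hy => simp only [map_add]; exact hx.add hy

/-- Write `x` as an iterated contraction of some `y`. Up to total derivatives `∂̄` passes through to
`y`, and `∂̄ y` vanishes on holomorphic jets. -/
theorem holPartC_dbarD {n : ℕ} (hn : n ≠ 0) {k : ℤ} {x : FieldPoly ℂ d B}
    (hx : x ∈ homog ℂ (formDeg degB) n k)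
    (hη : ∀ i, etaD ℂ degB i x ∈ constSub (formDeg degB)) :
    holPartC degB n (dbarD ℂ degB x) ∈ constSub degB := by
  obtain ⟨y, hy, hxy, -⟩ := etaL_allIdx_of_invariant hn hx hη
  have h1 : dbarD ℂ degB (etaL ℂ degB (allIdx d) y) ≡
      sgn (allIdx d).length • etaL ℂ degB (allIdx d) (dbarD ℂ degB y)
      [SMOD constSub (formDeg degB)] :=
    anticomm_etaL (fun i x => etaD_mem_locSub commDer_zero i) (fun i x => by
      rw [add_comm, etaD_dbarD]; exact fieldD_mem_constSub _ _) _ _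
  rw [← SModEq.zero]
  have h2 := (SModEq.map_of_le _ (fun _ => dbarD_mem_locSub commDer_zero) hxy).trans h1
  refine (holPartC_congr n h2).trans ?_
  rw [map_smul]
  refine ((holPartC_etaL hn (dbarD_mem_homog hy)).smul _).trans ?_
  rw [projHol_dbarD, smul_zero, smul_zero]

/-- Again `x` is an iterated contraction; moving the odd derivation past `d` contractions gives `sgn
d`, after which `projHol_hamC` identifies its restriction. One letter is replaced by `m`, hence the
degree `n + m`. -/
theorem holPartC_der_hamC (hκ : IsPairing degB d κ) (hJ : J ∈ lagrangians ℂ (formDeg degB) 0)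
    (hη : ∀ n i, etaD ℂ degB i (J n) ∈ constSub (formDeg degB)) {m n : ℕ} (hm : m ≠ 0) {k : ℤ}
    {x : FieldPoly ℂ d B} (hx : x ∈ homog ℂ (formDeg degB) (n + 1) k)
    (hx' : ∀ i, etaD ℂ degB i x ∈ constSub (formDeg degB)) :
    holPartC degB (n + m) (der (formDeg degB) 1 (hamC degB κ J m) x) ≡
      sgn d • der degB 1 (hamH degB κ (holSeries degB J) m) (holPartC degB (n + 1) x)
      [SMOD constSub degB] := by
  obtain ⟨y, hy, hxy, -⟩ := etaL_allIdx_of_invariant (Nat.succ_ne_zero n) hx hx'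
  have hh := isHomogFamily_hamC hκ hJ m
  have h1 : der (formDeg degB) 1 (hamC degB κ J m) (etaL ℂ degB (allIdx d) y) ≡
      sgn (allIdx d).length • etaL ℂ degB (allIdx d) (der (formDeg degB) 1 (hamC degB κ J m) y)
      [SMOD koszulRel ℂ (formDeg degB)] :=
    anticomm_etaL (fun i x => etaD_mem_koszul i) (fun i x => etaD_der_hamC hκ hJ (hη _ i) x) _ _
  have h2 := (SModEq.map_of_le _
    (fun _ => der_mem_locSub commDer_zero hh (isEvolutionary_hamC m)) hxy).trans
    (SModEq.of_le koszul_le_locSub h1)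
  refine (holPartC_congr (n + m) h2).trans ?_
  rw [map_smul, List.length_finRange]
  refine SModEq.smul ?_ _
  refine (holPartC_etaL (by omega) (der_mem_homog hh hy)).trans ?_
  have h3 : projHol (der (formDeg degB) 1 (hamC degB κ J m) y) ≡
      der degB 1 (hamH degB κ (holSeries degB J) m) (projHol y) [SMOD koszulRel ℂ degB] :=
    projHol_der (fun b => by simp [formDeg])
      (projHol_hamC ((mem_lagrangians.1 hJ).2 (m + 1)) (hη (m + 1))) y
  have h4 := (holPartC_congr (n + 1) hxy).trans (holPartC_etaL (Nat.succ_ne_zero n) hy)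
  have h5 : IsHomogFamily degB 1 m (hamH degB κ (holSeries degB J) m) := by
    refine isHomogFamily_hamiltonian commDer_zero hκ (mem_lagrangians.2 ⟨?_, fun l => ?_⟩) m
    · simp [holSeries, (mem_lagrangians.1 hJ).1]
    · have := holPartC_mem_homog ((mem_lagrangians.1 hJ).2 l)
      rwa [neg_zero, zero_sub] at this
  have h6 := SModEq.map_of_le _ (fun _ => der_mem_locSub commDer_zero h5
    (isEvolutionary_hamiltonian commDer_zero m)) h4
  rw [map_smul] at h6
  exact ((SModEq.of_le koszul_le_locSub h3).smul _).trans h6.symm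

/-- Taking the holomorphic part intertwines brackets. -/
theorem holSeries_ceDiff_hamC (hκ : IsPairing degB d κ) (hJ : J ∈ lagrangians ℂ (formDeg degB) 0)
    (hJ1 : J 1 = 0) (hη : ∀ n i, etaD ℂ degB i (J n) ∈ constSub (formDeg degB)) {k : ℤ}
    {F : JetSeries ℂ (Fin d ⊕ Fin d) (Finset (Fin d) × B)}
    (hF : F ∈ lagrangians ℂ (formDeg degB) k)
    (hF' : ∀ n i, etaD ℂ degB i (F n) ∈ constSub (formDeg degB)) (n : ℕ) :
    holPartC degB n (ceDiff (formDeg degB) (hamC degB κ J) F n) ≡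
      sgn d • ceDiff degB (hamH degB κ (holSeries degB J)) (holSeries degB F) n
      [SMOD constSub degB] := by
  rw [ceDiff_apply, ceDiff_apply, map_sum, Finset.smul_sum]
  refine SModEq.sum' fun p hp => ?_
  obtain ⟨m, l⟩ := p
  rw [Finset.HasAntidiagonal.mem_antidiagonal] at hp
  simp only at hp ⊢
  have hF0 := (mem_lagrangians.1 hF).1
  by_cases hm : m = 0
  · subst hm
    have h1 : hamC degB κ J 0 = 0 := hamiltonian_eq_zero hJ1
    have h2 : hamH degB κ (holSeries degB J) 0 = 0 :=
      hamiltonian_eq_zero (by simp [holSeries, hJ1])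
    rw [h1, h2, der_zero_left, der_zero_left]
    simp
  · cases l with
    | zero => simp [holSeries, hF0]
    | succ l =>
      obtain rfl : n = l + m := by omega
      exact holPartC_der_hamC hκ hJ hη hm ((mem_lagrangians.1 hF).2 (l + 1)) (hF' (l + 1))

/-- The holomorphic part of the master equation: `∂̄J` contributes nothing and the bracket becomes a
nonzero multiple of the holomorphic bracket. -/
theorem holSeries_master (hκ : IsPairing degB d κ) (hJ : J ∈ lagrangians ℂ (formDeg degB) 0)
    (hJ1 : J 1 = 0) (hη : ∀ n i, etaD ℂ degB i (J n) ∈ constSub (formDeg degB))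
    (hm : IsMaster degB κ J) (n : ℕ) :
    ceDiff degB (hamH degB κ (holSeries degB J)) (holSeries degB J) n ∈ constSub degB := by
  have hJ0 := (mem_lagrangians.1 hJ).1
  rcases Nat.eq_zero_or_pos n with rfl | hn
  · have h2 : hamH degB κ (holSeries degB J) 0 = 0 :=
      hamiltonian_eq_zero (by simp [holSeries, hJ1])
    rw [ceDiff_apply]
    simp [holSeries, hJ0, h2, der_zero_left, Finset.Nat.antidiagonal_succ]
  · have h1 := holPartC_mem_koszul n (hm n)
    rw [map_add, Pi.smul_apply, map_smul] at h1
    have h2 := holPartC_dbarD hn.ne' ((mem_lagrangians.1 hJ).2 n) (hη n)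
    have h3 := (Submodule.add_mem_iff_right _ h2).1 (koszul_le_locSub h1)
    have h4 := ((holSeries_ceDiff_hamC hκ hJ hJ1 hη hJ hη n).smul (1 / 2 : ℂ)).symm.trans
      (SModEq.zero.2 h3)
    rw [smul_smul, SModEq.zero] at h4
    exact (Submodule.smul_mem_iff _ (mul_ne_zero (by norm_num) (sgn_ne_zero _))).1 h4

theorem holSeries_ceDiff_defQ (hκ : IsPairing degB d κ) (hJ : J ∈ lagrangians ℂ (formDeg degB) 0)
    (hJ1 : J 1 = 0) (hη : ∀ n i, etaD ℂ degB i (J n) ∈ constSub (formDeg degB)) {k : ℤ}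
    {F : JetSeries ℂ (Fin d ⊕ Fin d) (Finset (Fin d) × B)}
    (hF : F ∈ lagrangians ℂ (formDeg degB) k)
    (hF' : ∀ n i, etaD ℂ degB i (F n) ∈ constSub (formDeg degB)) (n : ℕ) :
    holPartC degB n (ceDiff (formDeg degB) (defQ degB κ J) F n) ≡
      sgn d • ceDiff degB (hamH degB κ (holSeries degB J)) (holSeries degB F) n
      [SMOD constSub degB] := by
  have h1 := holSeries_ceDiff_hamC hκ hJ hJ1 hη hF hF' n
  rw [ceDiff_defQ, map_add]
  rcases Nat.eq_zero_or_pos n with rfl | hn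
  · simpa [(mem_lagrangians.1 hF).1] using h1
  · have h2 := SModEq.zero.2 (holPartC_dbarD hn.ne' ((mem_lagrangians.1 hF).2 n) (hF' n))
    have := h2.add h1
    rwa [zero_add] at this

end HolHamiltonian

/-! ### Constant coefficients and smooth coefficients -/

section Compare

variable {R : Type} [CommRing R] [Algebra ℂ R] {d : ℕ} {B : Type} {degB : B → ℤ}
  {δ : Fin d ⊕ Fin d → R →ₗ[ℂ] R}

/-- Only the parity of `p` enters a derivation. Contractions are defined with `oddDer`, that is `p =
1`, whereas their degree bookkeeping requires `p = -1`. -/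
theorem der_eq_of_even {ι A : Type} {deg : A → ℤ} {p p' : ℤ} (h : Even (p - p'))
    (q : A × (ι →₀ ℕ) → JetPoly R ι A) : der deg p q = der deg p' q := by
  refine LinearMap.ext fun x => ?_
  induction x using word_induction with
  | hnil r => simp
  | hcons j x ih =>
    rw [der_consL, der_consL, ih, sgn_eq_of_even]
    rw [← sub_mul]
    exact h.mul_right _
  | hadd x y hx hy => simp only [map_add, hx, hy]

theorem cMap_mono {ι A : Type} (c : A × (ι →₀ ℕ) → ℂ) (g : A × (ι →₀ ℕ) → A × (ι →₀ ℕ))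
    (j : A × (ι →₀ ℕ)) : cMap R (mono ℂ c g j) = mono R c g j := by
  rw [mono, mono, map_smul, cMap_letter]

theorem cMap_etaD (i : Fin d) (x : FieldPoly ℂ d B) :
    cMap R (etaD ℂ degB i x) = etaD R degB i (cMap R x) :=
  cMap_der (fun j => (cMap_mono _ _ j).symm) x

theorem cMap_dbarD (x : FieldPoly ℂ d B) :
    cMap R (dbarD ℂ degB x) = dbarD R degB (cMap R x) := by
  rw [dbarD_eq_der, dbarD_eq_der]
  refine cMap_der (fun j => ?_) x
  rw [Finset.sum_apply, Finset.sum_apply, map_sum]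
  exact Finset.sum_congr rfl fun i _ => (cMap_mono _ _ j).symm

theorem cMap_etaL (L : List (Fin d)) (x : FieldPoly ℂ d B) :
    cMap R (etaL ℂ degB L x) = etaL R degB L (cMap R x) := by
  induction L with
  | nil => rfl
  | cons i L ih => rw [etaL_cons, etaL_cons, cMap_etaD, ih]

theorem fieldD_mem_locSub {ι A : Type} {deg : A → ℤ} {δ : ι → R →ₗ[ℂ] R} (hδ : CommDer δ) (i : ι)
    {x : JetPoly R ι A} (hx : x ∈ locSub δ deg) : fieldD R i x ∈ locSub δ deg := by
  rw [fieldD_eq_der_mono deg]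
  exact der_mem_locSub hδ (isHomogFamily_fieldD i)
    (isEvolutionary_mono hδ (fun _ _ => rfl) fun _ _ _ => Prod.ext rfl (add_right_comm _ _ _)) hx

/-- Series with constant coefficients. -/
def cSeries (R : Type) {ι A : Type} [CommRing R] [Algebra ℂ R] (F : JetSeries ℂ ι A) :
    JetSeries R ι A := fun n => cMap R (F n)

theorem cMap_ceDiff {ι A : Type} {deg : A → ℤ} (q : ℕ → A × (ι →₀ ℕ) → JetPoly ℂ ι A)
    (F : JetSeries ℂ ι A) :
    ceDiff deg (fun m j => cMap R (q m j)) (cSeries R F) = cSeries R (ceDiff deg q F) := by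
  funext n
  rw [ceDiff_apply, cSeries, ceDiff_apply, map_sum]
  exact Finset.sum_congr rfl fun p _ => (cMap_der (fun j => rfl) _).symm

theorem cMap_hamiltonian {ι A : Type} [Fintype ι] [Fintype A] [DecidableEq A] {deg : A → ℤ}
    {δ : ι → R →ₗ[ℂ] R} (hδ : CommDer δ) (π : Matrix A A ℂ) (J : JetSeries ℂ ι A) (m : ℕ)
    (j : A × (ι →₀ ℕ)) : hamiltonian δ deg π (cSeries R J) m j =
      cMap R (hamiltonian (fun _ => 0) deg π J m j) := by
  rw [hamiltonian_eq, hamiltonian_eq, cMap_totalDPow hδ]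
  congr 1
  rw [map_sum]
  simp only [map_smul, cSeries, cMap_euler hδ]

end Compare

/-! ### Invariant local functionals and the deformation differential through constant-coefficient
representatives. -/

namespace FreeTheory

variable {d : ℕ} {V₀ : Type*} [AddCommGroup V₀] [Module ℂ V₀] {B : Type}
  (𝓥 : FreeTheory d V₀ B)

theorem fieldDeg_eq : 𝓥.fieldDeg = formDeg 𝓥.deg := rfl

theorem contract_apply (i : Fin d) (F : BVLag d B) (n : ℕ) :
    𝓥.contract i F n = etaD (smoothFun d) 𝓥.deg i (F n) := by
  rw [contract, LinearMap.compLeft_apply, Function.comp_apply, oddDer_eq_der, fieldDeg_eq, etaD, der_eq_of_even (p := -1) (p' := 1) ⟨-1, rfl⟩]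
  congr 2
  funext j
  rw [etaQ, mono, letter]
  split_ifs with h
  · rw [extSign_mem h, zero_smul]
  · rw [extSign_notMem h, Finsupp.smul_single, Algebra.algebraMap_eq_smul_one]

theorem dbar_apply (F : BVLag d B) (n : ℕ) :
    𝓥.dbar F n = dbarD (smoothFun d) 𝓥.deg (F n) := by
  rw [dbar, LinearMap.compLeft_apply, Function.comp_apply, oddDer_eq_der, fieldDeg_eq, dbarD_eq_der]
  congr 2
  funext j
  rw [Finset.sum_apply]
  refine Finset.sum_subset_zero_on_sdiff (Finset.subset_univ _) (fun i hi => ?_) (fun i hi => ?_)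
  · rw [dbarQ, mono, intSign_notMem (Finset.mem_sdiff.1 hi).2, zero_smul]
  · rw [dbarQ, mono, intSign_mem hi, letter, Finsupp.smul_single, Algebra.algebraMap_eq_smul_one]

theorem mem_bvRel {F : BVLag d B} :
    F ∈ 𝓥.bvRel ↔ ∀ n, F n ∈ locSub (coefD d) (formDeg 𝓥.deg) := mem_locRel

theorem mem_invariants {k : ℤ} {F : BVLag d B} : F ∈ 𝓥.invariants k ↔
    F ∈ lagrangians (smoothFun d) (formDeg 𝓥.deg) k ∧
    (∀ n i, fieldD (smoothFun d) i (F n) ∈ locSub (coefD d) (formDeg 𝓥.deg)) ∧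
    ∀ n i, etaD (smoothFun d) 𝓥.deg i (F n) ∈ locSub (coefD d) (formDeg 𝓥.deg) := by
  simp only [invariants, Submodule.mem_inf, Submodule.mem_iInf, Submodule.mem_comap, mem_bvRel,
    contract_apply]
  refine and_congr Iff.rfl (and_congr ?_ ?_)
  · exact forall_comm
  · exact forall_comm

variable [Fintype B] [DecidableEq B]

theorem cMap_mem_iff {n : ℕ} {k : ℤ} {x : FieldPoly ℂ d B} (hn : n ≠ 0)
    (hx : x ∈ homog ℂ (formDeg 𝓥.deg) n k) :
    cMap (smoothFun d) x ∈ locSub (coefD d) (formDeg 𝓥.deg) ↔ x ∈ constSub (formDeg 𝓥.deg) :=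
  cMap_mem_locSub_iff (commDer_coefD d) (evalZero d) hn hx

/-- Invariant local functionals are represented by Lagrangians with constant coefficients. -/
theorem exists_const {k : ℤ} {F : BVLag d B} (hF : F ∈ 𝓥.invariants k) :
    ∃ G ∈ lagrangians ℂ (formDeg 𝓥.deg) k, F ≡ cSeries (smoothFun d) G [SMOD 𝓥.bvRel] ∧
      (∀ n i, etaD ℂ 𝓥.deg i (G n) ∈ constSub (formDeg 𝓥.deg)) ∧ ∀ n, F n = 0 → G n = 0 := by
  obtain ⟨h1, h2, h3⟩ := 𝓥.mem_invariants.1 hF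
  rw [mem_lagrangians] at h1
  -- The clause `F n = 0 → y = 0` keeps the vanishing of low degrees, so that a representative of an
  -- interaction has no linear term.
  have h4 : ∀ n, ∃ y ∈ homog ℂ (formDeg 𝓥.deg) n (-k),
      F n ≡ cMap (smoothFun d) y [SMOD locSub (coefD d) (formDeg 𝓥.deg)] ∧ (F n = 0 → y = 0) := by
    intro n
    by_cases h0 : F n = 0
    · exact ⟨0, zero_mem _, by rw [h0, map_zero], fun _ => rfl⟩
    · have hn : n ≠ 0 := fun hn => h0 (hn ▸ h1.1)
      obtain ⟨y, hy, hy'⟩ := exists_cMap_of_fieldD (commDer_coefD d) (φ := evalZero d)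
        eq_const_of_coefD hn (h1.2 n) (h2 n)
      exact ⟨y, hy, hy', fun h => absurd h h0⟩
  choose G hG hG' hG0 using h4
  refine ⟨G, mem_lagrangians.2 ⟨hG0 0 h1.1, hG⟩, smodEq_locRel.2 hG', fun n i => ?_, hG0⟩
  rcases Nat.eq_zero_or_pos n with rfl | hn
  · rw [hG0 0 h1.1, map_zero]; exact zero_mem _
  · rw [← 𝓥.cMap_mem_iff hn.ne' (etaD_mem_homog i (hG n)), cMap_etaD]
    have : etaD (smoothFun d) 𝓥.deg i (F n) ≡ etaD (smoothFun d) 𝓥.deg i (cMap _ (G n))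
        [SMOD locSub (coefD d) (formDeg 𝓥.deg)] := SModEq.map_of_le _ (fun _ => etaD_mem_locSub (commDer_coefD d) i) (hG' n)
    exact (this.mem_iff).1 (h3 n i)

theorem mem_invariants_of_const {k : ℤ} {F : BVLag d B}
    {G : JetSeries ℂ (Fin d ⊕ Fin d) (Finset (Fin d) × B)}
    (hF : F ∈ lagrangians (smoothFun d) (formDeg 𝓥.deg) k)
    (hG : F ≡ cSeries (smoothFun d) G [SMOD 𝓥.bvRel])
    (hη : ∀ n i, etaD ℂ 𝓥.deg i (G n) ∈ constSub (formDeg 𝓥.deg)) : F ∈ 𝓥.invariants k := by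
  have hG' : ∀ n, F n ≡ cSeries (smoothFun d) G n [SMOD locSub (coefD d) (formDeg 𝓥.deg)] :=
    smodEq_locRel.1 hG
  refine 𝓥.mem_invariants.2 ⟨hF, fun n i => ?_, fun n i => ?_⟩
  · have : fieldD (smoothFun d) i (F n) ≡ fieldD (smoothFun d) i (cSeries _ G n)
        [SMOD locSub (coefD d) (formDeg 𝓥.deg)] := SModEq.map_of_le _ (fun _ => fieldD_mem_locSub (commDer_coefD d) i) (hG' n)
    refine this.mem_iff.2 ?_
    rw [cSeries, ← cMap_fieldD]
    exact cMap_mem_locSub (commDer_coefD d) (fieldD_mem_constSub _ _)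
  · have : etaD (smoothFun d) 𝓥.deg i (F n) ≡ etaD (smoothFun d) 𝓥.deg i (cSeries _ G n)
        [SMOD locSub (coefD d) (formDeg 𝓥.deg)] := SModEq.map_of_le _ (fun _ => etaD_mem_locSub (commDer_coefD d) i) (hG' n)
    refine this.mem_iff.2 ?_
    rw [cSeries, ← cMap_etaD]
    exact cMap_mem_locSub (commDer_coefD d) (hη n i)

theorem cSeries_mem_bvRel {G : JetSeries ℂ (Fin d ⊕ Fin d) (Finset (Fin d) × B)} {k : ℤ}
    (hG : G ∈ lagrangians ℂ (formDeg 𝓥.deg) k) :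
    cSeries (smoothFun d) G ∈ 𝓥.bvRel ↔ ∀ n, G n ∈ constSub (formDeg 𝓥.deg) := by
  rw [mem_bvRel]
  refine forall_congr' fun n => ?_
  rw [mem_lagrangians] at hG
  rcases Nat.eq_zero_or_pos n with rfl | hn
  · simp [cSeries, hG.1]
  · exact 𝓥.cMap_mem_iff hn.ne' (hG.2 n)

theorem cSeries_mem_lagrangians {ι A : Type} {deg : A → ℤ} {R : Type} [CommRing R] [Algebra ℂ R]
    {G : JetSeries ℂ ι A} {k : ℤ} (hG : G ∈ lagrangians ℂ deg k) :
    cSeries R G ∈ lagrangians R deg k := by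
  rw [mem_lagrangians] at *
  exact ⟨by simp [cSeries, hG.1], fun n => cMap_mem_homog (hG.2 n)⟩

/-! ### Holomorphic parts -/

theorem restrictHol_eq (x : FieldPoly (smoothFun d) d B) :
    restrictHol d B x = projHol (evMap (evalZero d) x) := by
  induction x using Finsupp.induction_linear with
  | zero => simp
  | add x y hx hy => simp only [map_add, hx, hy]
  | single w r =>
    rw [evMap_single, projHol_single, restrictHol, Finsupp.lsum_single]
    cases w.mapM holLetter with
    | none => rfl
    | some v => rfl

theorem holPart_apply (F : BVLag d B) (n : ℕ) : 𝓥.holPart F n = (n : ℂ)⁻¹ • ∑ b, consL (b, 0)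
    (projHol (evMap (evalZero d) (euler (coefD d) (formDeg 𝓥.deg) (Finset.univ, b) (F n)))) := by
  simp only [← restrictHol_eq]
  simp only [holPart, LinearMap.pi_apply, LinearMap.comp_apply, LinearMap.smul_apply,
    LinearMap.sum_apply]
  rfl

theorem holPart_mem_symRel {F : BVLag d B} (hF : F ∈ 𝓥.bvRel) :
    𝓥.holPart F ∈ symRel ℂ (Fin d) 𝓥.deg := by
  rw [mem_symRel]
  rw [mem_bvRel] at hF
  intro n
  rw [holPart_apply]
  exact Submodule.smul_mem _ _ (Submodule.sum_mem _ fun b _ => consL_mem_koszul _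
    (projHol_mem_koszul (evMap_mem_koszul _
      (euler_mem_koszul_of_locSub (commDer_coefD d) _ (hF n)))))

theorem holPart_cSeries (G : JetSeries ℂ (Fin d ⊕ Fin d) (Finset (Fin d) × B)) :
    𝓥.holPart (cSeries (smoothFun d) G) = holSeries 𝓥.deg G := by
  funext n
  rw [holPart_apply, holSeries, holPartC_apply]
  simp only [cSeries, ← cMap_euler (commDer_coefD d), evMap_cMap]

theorem holPart_congr {F : BVLag d B} {G : JetSeries ℂ (Fin d ⊕ Fin d) (Finset (Fin d) × B)}
    (hG : F ≡ cSeries (smoothFun d) G [SMOD 𝓥.bvRel]) :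
    𝓥.holPart F ≡ holSeries 𝓥.deg G [SMOD symRel ℂ (Fin d) 𝓥.deg] := by
  rw [← holPart_cSeries]
  exact SModEq.map_of_le 𝓥.holPart (fun _ => 𝓥.holPart_mem_symRel) hG

theorem holPart_mem_lagrangians {k : ℤ} {F : BVLag d B}
    (hF : F ∈ lagrangians (smoothFun d) (formDeg 𝓥.deg) k) :
    𝓥.holPart F ∈ lagrangians ℂ 𝓥.deg (k + d) := by
  rw [mem_lagrangians] at *
  refine ⟨by rw [holPart_apply]; simp, fun n => ?_⟩
  rw [holPart_apply]
  cases n with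
  | zero => simp
  | succ n =>
    refine Submodule.smul_mem _ _ (Submodule.sum_mem _ fun b _ => ?_)
    have h1 := euler_mem_homog (commDer_coefD d) (Finset.univ, b) (hF.2 (n + 1))
    have h2 : evMap (evalZero d) (euler (coefD d) (formDeg 𝓥.deg) (Finset.univ, b) (F (n + 1))) ∈
        homog ℂ (formDeg 𝓥.deg) (n + 1 - 1) (-k - formDeg 𝓥.deg (Finset.univ, b)) :=
      homog_le_comap (evMap (evalZero d))
        (fun w r h h' => by rw [evMap_single]; exact single_mem_homog h h') h1
    have := consL_mem_homog (b, 0) (projHol_mem_homog h2)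
    convert this using 2
    · simp
    · simp [formDeg]
      ring

/-! ### The deformation complex -/

theorem bvBracket_eq (I : BVLag d B) : 𝓥.bvBracket I = ceDiff (formDeg 𝓥.deg)
    (hamiltonian (coefD d) (formDeg 𝓥.deg) (formPairing d 𝓥.deg 𝓥.fibrePairing⁻¹) I) := by
  rw [bvBracket, bracket, inv_fieldPairing]
  rfl

variable {𝓥} {I : BVLag d B} {J : JetSeries ℂ (Fin d ⊕ Fin d) (Finset (Fin d) × B)}

/-- `{I, -}` depends on `I` only through variational derivatives, which annihilate total
derivatives. Replacing `I` by a constant-coefficient representative changes the operator only by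
Koszul relations. -/
theorem bvBracket_congr (hI : I ≡ cSeries (smoothFun d) J [SMOD 𝓥.bvRel]) (F : BVLag d B) :
    𝓥.bvBracket I F ≡ ceDiff (formDeg 𝓥.deg)
      (fun m j => cMap (smoothFun d) (hamC 𝓥.deg 𝓥.fibrePairing⁻¹ J m j)) F
      [SMOD symRel (smoothFun d) (Fin d ⊕ Fin d) (formDeg 𝓥.deg)] := by
  rw [bvBracket_eq]
  refine ceDiff_congr (fun m j => ?_) F
  refine (hamiltonian_congr (commDer_coefD d) hI m j).trans (SModEq.of_eq ?_)
  rw [cMap_hamiltonian (commDer_coefD d)]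
  rfl

theorem bvBracket_mem_lagrangians (hI : I ∈ lagrangians (smoothFun d) (formDeg 𝓥.deg) 0)
    (hI1 : I 1 = 0) {k : ℤ} {F : BVLag d B}
    (hF : F ∈ lagrangians (smoothFun d) (formDeg 𝓥.deg) k) :
    𝓥.bvBracket I F ∈ lagrangians (smoothFun d) (formDeg 𝓥.deg) (k + 1) := by
  rw [bvBracket_eq]
  exact ceDiff_mem_lagrangians (hamiltonian_eq_zero hI1) (isHomogFamily_hamiltonian
    (commDer_coefD d) (isPairing_formPairing 𝓥.isPairing_inv_fibrePairing) hI) hF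

theorem bvBracket_mem_bvRel (hI : I ∈ lagrangians (smoothFun d) (formDeg 𝓥.deg) 0)
    {F : BVLag d B} (hF : F ∈ 𝓥.bvRel) : 𝓥.bvBracket I F ∈ 𝓥.bvRel := by
  rw [bvBracket_eq]
  exact ceDiff_mem_locRel (commDer_coefD d) (isHomogFamily_hamiltonian
    (commDer_coefD d) (isPairing_formPairing 𝓥.isPairing_inv_fibrePairing) hI)
    (isEvolutionary_hamiltonian (commDer_coefD d)) hF

theorem dbar_mem_bvRel {F : BVLag d B} (hF : F ∈ 𝓥.bvRel) : 𝓥.dbar F ∈ 𝓥.bvRel := by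
  rw [mem_bvRel] at *
  intro n
  rw [dbar_apply]
  exact dbarD_mem_locSub (commDer_coefD d) (hF n)

theorem dbar_mem_lagrangians {k : ℤ} {F : BVLag d B}
    (hF : F ∈ lagrangians (smoothFun d) (formDeg 𝓥.deg) k) :
    𝓥.dbar F ∈ lagrangians (smoothFun d) (formDeg 𝓥.deg) (k + 1) := by
  rw [mem_lagrangians] at *
  refine ⟨by rw [dbar_apply, hF.1, map_zero], fun n => ?_⟩
  rw [dbar_apply, neg_add, ← sub_eq_add_neg]
  exact dbarD_mem_homog (hF.2 n)

theorem defDiff_mem_bvRel (hI : I ∈ lagrangians (smoothFun d) (formDeg 𝓥.deg) 0)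
    {F : BVLag d B} (hF : F ∈ 𝓥.bvRel) : 𝓥.defDiff I F ∈ 𝓥.bvRel :=
  Submodule.add_mem _ (dbar_mem_bvRel hF) (bvBracket_mem_bvRel hI hF)

theorem defDiff_mem_lagrangians (hI : I ∈ lagrangians (smoothFun d) (formDeg 𝓥.deg) 0)
    (hI1 : I 1 = 0) {k : ℤ} {F : BVLag d B}
    (hF : F ∈ lagrangians (smoothFun d) (formDeg 𝓥.deg) k) :
    𝓥.defDiff I F ∈ lagrangians (smoothFun d) (formDeg 𝓥.deg) (k + 1) :=
  Submodule.add_mem _ (dbar_mem_lagrangians hF) (bvBracket_mem_lagrangians hI hI1 hF)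

theorem bvBracket_cSeries (hI : I ≡ cSeries (smoothFun d) J [SMOD 𝓥.bvRel])
    (G : JetSeries ℂ (Fin d ⊕ Fin d) (Finset (Fin d) × B)) :
    𝓥.bvBracket I (cSeries (smoothFun d) G) ≡
      cSeries (smoothFun d) (ceDiff (formDeg 𝓥.deg) (hamC 𝓥.deg 𝓥.fibrePairing⁻¹ J) G)
      [SMOD 𝓥.bvRel] := by
  rw [← cMap_ceDiff]
  exact SModEq.of_le symRel_le_locRel (bvBracket_congr hI _)

theorem dbar_cSeries (G : JetSeries ℂ (Fin d ⊕ Fin d) (Finset (Fin d) × B)) :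
    𝓥.dbar (cSeries (smoothFun d) G) = cSeries (smoothFun d) fun n => dbarD ℂ 𝓥.deg (G n) := by
  funext n
  rw [dbar_apply, cSeries, cSeries, cMap_dbarD]

theorem defDiff_congr (hI0 : I ∈ lagrangians (smoothFun d) (formDeg 𝓥.deg) 0)
    (hI : I ≡ cSeries (smoothFun d) J [SMOD 𝓥.bvRel]) {F : BVLag d B}
    {G : JetSeries ℂ (Fin d ⊕ Fin d) (Finset (Fin d) × B)}
    (hG : F ≡ cSeries (smoothFun d) G [SMOD 𝓥.bvRel]) :
    𝓥.defDiff I F ≡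
      cSeries (smoothFun d) (ceDiff (formDeg 𝓥.deg) (defQ 𝓥.deg 𝓥.fibrePairing⁻¹ J) G)
      [SMOD 𝓥.bvRel] := by
  have h1 : 𝓥.defDiff I F ≡ 𝓥.defDiff I (cSeries _ G) [SMOD 𝓥.bvRel] :=
    SModEq.map_of_le _ (fun _ => defDiff_mem_bvRel hI0) hG
  refine h1.trans ?_
  have e : cSeries (smoothFun d) (ceDiff (formDeg 𝓥.deg) (defQ 𝓥.deg 𝓥.fibrePairing⁻¹ J) G) =
      𝓥.dbar (cSeries (smoothFun d) G) + cSeries (smoothFun d)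
        (ceDiff (formDeg 𝓥.deg) (hamC 𝓥.deg 𝓥.fibrePairing⁻¹ J) G) := by
    rw [dbar_cSeries]
    funext n
    rw [Pi.add_apply, cSeries, cSeries, cSeries, ceDiff_defQ, map_add]
  rw [e]
  exact SModEq.add SModEq.rfl (bvBracket_cSeries hI G)

theorem isMaster_of_const (hI0 : I ∈ lagrangians (smoothFun d) (formDeg 𝓥.deg) 0)
    (hI : I ≡ cSeries (smoothFun d) J [SMOD 𝓥.bvRel])
    (hJ : J ∈ lagrangians ℂ (formDeg 𝓥.deg) 0) (hJ1 : J 1 = 0)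
    (hm : 𝓥.dbar I + (1 / 2 : ℂ) • 𝓥.bvBracket I I ∈ 𝓥.bvRel) :
    IsMaster 𝓥.deg 𝓥.fibrePairing⁻¹ J := by
  set X := ceDiff (formDeg 𝓥.deg) (hamC 𝓥.deg 𝓥.fibrePairing⁻¹ J) J with hX
  have h1 : 𝓥.dbar I + (1 / 2 : ℂ) • 𝓥.bvBracket I I ≡
      cSeries (smoothFun d) fun n => dbarD ℂ 𝓥.deg (J n) + ((1 / 2 : ℂ) • X) n [SMOD 𝓥.bvRel] := by
    have h2 : 𝓥.dbar I ≡ 𝓥.dbar (cSeries (smoothFun d) J) [SMOD 𝓥.bvRel] :=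
      SModEq.map_of_le _ (fun F hF => dbar_mem_bvRel (𝓥 := 𝓥) (F := F) hF) hI
    have h3' : 𝓥.bvBracket I I ≡ 𝓥.bvBracket I (cSeries (smoothFun d) J) [SMOD 𝓥.bvRel] :=
      SModEq.map_of_le _ (fun _ => bvBracket_mem_bvRel hI0) hI
    have h3 := h3'.trans
      (bvBracket_cSeries hI J)
    refine (h2.add (h3.smul (1 / 2 : ℂ))).trans (SModEq.of_eq ?_)
    rw [dbar_cSeries]
    funext n
    simp only [Pi.add_apply, Pi.smul_apply, cSeries, map_add, map_smul, hX]
  refine (𝓥.cSeries_mem_bvRel (k := 1) ?_).1 (h1.mem_iff.1 hm)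
  have h4 : X ∈ lagrangians ℂ (formDeg 𝓥.deg) (0 + 1) := ceDiff_mem_lagrangians
    (hamiltonian_eq_zero hJ1) (isHomogFamily_hamC 𝓥.isPairing_inv_fibrePairing hJ) hJ
  rw [zero_add] at h4
  have h5 : (fun n => dbarD ℂ 𝓥.deg (J n)) ∈ lagrangians ℂ (formDeg 𝓥.deg) 1 := by
    refine mem_lagrangians.2 ⟨by rw [(mem_lagrangians.1 hJ).1, map_zero], fun n => ?_⟩
    have := dbarD_mem_homog ((mem_lagrangians.1 hJ).2 n)
    rwa [neg_zero, zero_sub] at this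
  exact Submodule.add_mem _ h5 (Submodule.smul_mem _ _ h4)

/-! ### The inclusion of holomorphic Lagrangians -/

variable (𝓥)

theorem dolbeaultExt_cons (j : B × (Fin d →₀ ℕ)) (w : List (B × (Fin d →₀ ℕ)))
    (T : Finset (Fin d)) : 𝓥.dolbeaultExt (j :: w) T = ∑ S ∈ T.powerset,
      (wedgeSign S (T \ S) * sgn (𝓥.deg j.1 * (T \ S).card)) •
        consL ((S, j.1), j.2.mapDomain Sum.inl) (𝓥.dolbeaultExt w (T \ S)) := rfl

/-- The extra factor `d z̄_i` sits either on the first letter or on the remaining ones, matching the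
two Leibniz terms of `η_i`. Iterating from `T = ∅` identifies the extension to Dolbeault forms with
the iterated contraction, up to `listSign`. -/
theorem dolbeaultExt_insert {i : Fin d} {T : Finset (Fin d)} (hi : i ∉ T)
    (w : List (B × (Fin d →₀ ℕ))) : 𝓥.dolbeaultExt w (insert i T) =
      wedgeSign {i} T • etaD (smoothFun d) 𝓥.deg i (𝓥.dolbeaultExt w T) := by
  induction w generalizing T with
  | nil =>
    have h1 : 𝓥.dolbeaultExt [] (insert i T) = 0 := if_neg (Finset.insert_ne_empty i T)
    rw [h1, dolbeaultExt]
    split_ifs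
    · rw [etaD, der_nil, smul_zero]
    · simp
  | cons j w ih =>
    rw [dolbeaultExt_cons, dolbeaultExt_cons, Finset.sum_powerset_insert hi, map_sum,
      Finset.smul_sum, ← Finset.sum_add_distrib]
    refine Finset.sum_congr rfl fun S hS => ?_
    have hST := Finset.mem_powerset.1 hS
    have hiS : i ∉ S := fun h => hi (hST h)
    have hiT : i ∉ T \ S := fun h => hi (Finset.mem_sdiff.1 h).1
    have e1 : insert i T \ S = insert i (T \ S) := Finset.insert_sdiff_of_notMem T hiS
    have e2 : insert i T \ insert i S = T \ S := by
      rw [Finset.insert_sdiff_insert, Finset.sdiff_insert_of_notMem hi]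
    have e3 : wedgeSign {i} T = wedgeSign {i} S * wedgeSign {i} (T \ S) := by
      rw [← wedgeSign_union_right Finset.disjoint_sdiff, Finset.union_sdiff_of_subset hST]
    have e4 : etaD (smoothFun d) 𝓥.deg i (consL ((S, j.1), j.2.mapDomain Sum.inl)
        (𝓥.dolbeaultExt w (T \ S))) = wedgeSign {i} S • consL ((insert i S, j.1),
        j.2.mapDomain Sum.inl) (𝓥.dolbeaultExt w (T \ S)) + sgn (S.card + 𝓥.deg j.1) •
        consL ((S, j.1), j.2.mapDomain Sum.inl)
          (etaD (smoothFun d) 𝓥.deg i (𝓥.dolbeaultExt w (T \ S))) := by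
      rw [etaD, der_consL, etaQ, mono, map_smul, LinearMap.smul_apply, letter_mul,
        extSign_notMem hiS]
      congr 2
      exact sgn_eq_of_even ⟨-(S.card + 𝓥.deg j.1), by simp only [formDeg]; ring⟩
    rw [e1, e2, ih hiT, map_smul, map_smul (etaD (smoothFun d) 𝓥.deg i), e4, e3,
      wedgeSign_insert_right hiT, wedgeSign_swap_left hiS, wedgeSign_insert_left hiS,
      Finset.card_insert_of_notMem hiT]
    push_cast
    rw [mul_add, mul_one, sgn_add, sgn_add]
    match_scalars
    · ring
    · linear_combination (-(wedgeSign S (T \ S) * wedgeSign {i} (T \ S) *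
        sgn (𝓥.deg j.1 * (T \ S).card))) * wedgeSign_mul_self {i} S

end FreeTheory

/-! ### Extension of holomorphic Lagrangians and primitives for the Dolbeault differential. -/

section ConstPrimitive

variable {d : ℕ} {B : Type} [Fintype B] [DecidableEq B] {degB : B → ℤ}

/-- The extension of a holomorphic Lagrangian to Dolbeault forms. -/
def inclC (degB : B → ℤ) : JetPoly ℂ (Fin d) B →ₗ[ℂ] FieldPoly ℂ d B :=
  listSign (allIdx d) • (etaL ℂ degB (allIdx d) ∘ₗ inclHol)

theorem inclC_apply (x : JetPoly ℂ (Fin d) B) :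
    inclC degB x = listSign (allIdx d) • etaL ℂ degB (allIdx d) (inclHol x) := rfl

theorem etaD_inclC (i : Fin d) (x : JetPoly ℂ (Fin d) B) :
    etaD ℂ degB i (inclC degB x) = 0 := by
  rw [inclC_apply, map_smul, etaD_etaL_of_mem (List.mem_finRange i), smul_zero]

theorem inclC_mem_homog {n : ℕ} {k : ℤ} {x : JetPoly ℂ (Fin d) B} (hx : x ∈ homog ℂ degB n k) :
    inclC degB x ∈ homog ℂ (formDeg degB) n (k + d) := by
  have := etaL_mem_homog (allIdx d) (inclHol_mem_homog hx)
  rw [List.length_finRange] at this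
  exact Submodule.smul_mem _ _ this

theorem holPartC_inclC {n : ℕ} (hn : n ≠ 0) {k : ℤ} {x : JetPoly ℂ (Fin d) B}
    (hx : x ∈ homog ℂ degB n k) : holPartC degB n (inclC degB x) ≡ x [SMOD constSub degB] := by
  rw [inclC_apply, map_smul]
  refine ((holPartC_etaL hn (inclHol_mem_homog hx)).smul _).trans (SModEq.of_eq ?_)
  rw [smul_smul, listSign_mul_self, one_smul, projHol_inclHol]

theorem dbarD_etaL (y : FieldPoly ℂ d B) : dbarD ℂ degB (etaL ℂ degB (allIdx d) y) ≡
    sgn d • etaL ℂ degB (allIdx d) (dbarD ℂ degB y) [SMOD constSub (formDeg degB)] := by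
  have h1 := anticomm_etaL (degB := degB) (Y := dbarD ℂ degB) (P := constSub (formDeg degB))
    (fun i x => etaD_mem_locSub commDer_zero i) (fun i x => by
      rw [add_comm, etaD_dbarD]; exact fieldD_mem_constSub _ _) (allIdx d) y
  rwa [List.length_finRange] at h1

theorem dbarD_inclC (x : JetPoly ℂ (Fin d) B) :
    dbarD ℂ degB (inclC degB x) ∈ constSub (formDeg degB) := by
  rw [inclC_apply, map_smul]
  refine Submodule.smul_mem _ _ ?_
  rw [← SModEq.zero]
  refine (dbarD_etaL _).trans ?_
  rw [dbarD_inclHol, map_zero, smul_zero]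

/-- The holomorphic part is a quasi-isomorphism for the Dolbeault differential. -/
theorem exists_dolbeault_primitive {n : ℕ} (hn : n ≠ 0) {k : ℤ} {x : FieldPoly ℂ d B}
    (hx : x ∈ homog ℂ (formDeg degB) n (k - 1))
    (hη : ∀ i, etaD ℂ degB i x ∈ constSub (formDeg degB))
    (hd : dbarD ℂ degB x ∈ constSub (formDeg degB)) (hp : holPartC degB n x ∈ constSub degB)
    {y : JetPoly ℂ (Fin d) B} (hy : y ∈ homog ℂ degB n (k - d)) :
    ∃ c ∈ homog ℂ (formDeg degB) n k, (∀ i, etaD ℂ degB i c = 0) ∧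
      x - dbarD ℂ degB c ∈ constSub (formDeg degB) ∧ y - holPartC degB n c ∈ constSub degB := by
  obtain ⟨u, hu, hxu, hdu⟩ := etaL_allIdx_of_invariant hn hx hη
  obtain ⟨z, hz, hz0, hz1⟩ := exists_etaL_eq (List.mem_finRange) hu (hdu hd)
  -- The holomorphic part of `x` is `± projHol u` modulo relations, so its triviality removes the
  -- holomorphic term in the reduction of `u`.
  have h1 : projHol u ∈ constSub degB := by
    have h2 := (((holPartC_congr n hxu).trans (holPartC_etaL hn hu)).mem_iff).1 hp
    have h3 := Submodule.smul_mem _ (listSign (allIdx d)) h2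
    rwa [smul_smul, listSign_mul_self, one_smul] at h3
  have hz' := etaL_mem_homog (allIdx d) hz
  rw [List.length_finRange] at hz'
  have hy' := inclC_mem_homog hy
  -- The first summand is a `∂̄`-primitive of `x` with trivial holomorphic part; the second has
  -- holomorphic part `y` and is `∂̄`-closed, so the two requirements do not interfere.
  refine ⟨sgn d • etaL ℂ degB (allIdx d) z + inclC degB y, Submodule.add_mem _
    (Submodule.smul_mem _ _ ?_) ?_, fun i => ?_, ?_, ?_⟩
  · convert hz' using 1; ring_nf
  · convert hy' using 1; ring_nf
  · rw [map_add, etaD_inclC, map_smul, etaD_etaL_of_mem (List.mem_finRange i), smul_zero, add_zero]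
  · rw [map_add, map_smul]
    have h4 := (dbarD_etaL (degB := degB) z).smul (sgn d)
    rw [smul_smul, sgn_mul_self, one_smul] at h4
    have h5 : etaL ℂ degB (allIdx d) (inclHol (projHol u)) ∈ constSub (formDeg degB) :=
      etaL_mem_locSub commDer_zero _ (inclHol_mem_constSub h1)
    have h6 := h4.add (SModEq.zero.2 (dbarD_inclC (degB := degB) y))
    have h7 := hxu.trans (hz1.trans ((SModEq.zero.2 h5).add SModEq.rfl))
    rw [← SModEq.sub_mem]
    refine h7.trans (SModEq.trans (SModEq.of_eq ?_) h6.symm)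
    rw [zero_add, add_zero]
  · rw [← SModEq.sub_mem, map_add, map_smul]
    have h4 := (holPartC_etaL (degB := degB) hn hz).smul (sgn d)
    rw [hz0, smul_zero, smul_zero] at h4
    refine (((h4.add (holPartC_inclC hn hy))).trans (SModEq.of_eq ?_)).symm
    rw [zero_add]

end ConstPrimitive

namespace FreeTheory

variable {d : ℕ} {V₀ : Type*} [AddCommGroup V₀] [Module ℂ V₀] {B : Type}
  (𝓥 : FreeTheory d V₀ B) [Fintype B] [DecidableEq B]

theorem dolbeaultExt_empty (w : List (B × (Fin d →₀ ℕ))) :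
    𝓥.dolbeaultExt w ∅ = cMap (smoothFun d) (inclHol (Finsupp.single w 1)) := by
  induction w with
  | nil => simp [dolbeaultExt]
  | cons j w ih =>
    rw [← consL_single, inclHol_consL, cMap_consL, ← ih, dolbeaultExt_cons]
    simp [liftLetter]

theorem dolbeaultExt_toFinset {L : List (Fin d)} (hL : L.Nodup) (w : List (B × (Fin d →₀ ℕ))) :
    𝓥.dolbeaultExt w L.toFinset =
      listSign L • etaL (smoothFun d) 𝓥.deg L (𝓥.dolbeaultExt w ∅) := by
  induction L with
  | nil => simp [listSign]
  | cons i L ih =>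
    obtain ⟨hi, hL⟩ := List.nodup_cons.1 hL
    rw [List.toFinset_cons, dolbeaultExt_insert _ (by simpa using hi), ih hL, listSign, etaL_cons,
      map_smul, smul_smul]

theorem inclusion_eq (G : HolLag d B) :
    𝓥.inclusion G = cSeries (smoothFun d) fun n => inclC 𝓥.deg (G n) := by
  funext n
  rw [inclusion, LinearMap.compLeft_apply, Function.comp_apply, cSeries]
  induction G n using Finsupp.induction_linear with
  | zero => simp
  | add x y hx hy => simp only [map_add, hx, hy]
  | single w r =>
    have h1 := 𝓥.dolbeaultExt_toFinset (List.nodup_finRange d) w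
    rw [List.toFinset_finRange] at h1
    rw [Finsupp.lsum_single, LinearMap.toSpanSingleton_apply, h1, dolbeaultExt_empty, ← cMap_etaL,
      inclC_apply, ← map_smul, ← map_smul]
    congr 1
    have h2 : Finsupp.single w r = r • Finsupp.single w (1 : ℂ) := by simp
    rw [h2, map_smul, map_smul, smul_comm]

theorem inclusion_mem_invariants {k : ℤ} {G : HolLag d B} (hG : G ∈ lagrangians ℂ 𝓥.deg k) :
    𝓥.inclusion G ∈ 𝓥.invariants (k - d) := by
  have h1 : (fun n => inclC 𝓥.deg (G n)) ∈ lagrangians ℂ (formDeg 𝓥.deg) (k - d) := by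
    refine mem_lagrangians.2 ⟨by rw [(mem_lagrangians.1 hG).1, map_zero], fun n => ?_⟩
    have := inclC_mem_homog ((mem_lagrangians.1 hG).2 n)
    convert this using 1
    ring_nf
  rw [inclusion_eq]
  exact 𝓥.mem_invariants_of_const (cSeries_mem_lagrangians h1) SModEq.rfl
    fun n i => by rw [etaD_inclC]; exact zero_mem _

theorem holPart_inclusion {k : ℤ} {G : HolLag d B} (hG : G ∈ lagrangians ℂ 𝓥.deg k) :
    𝓥.holPart (𝓥.inclusion G) - G ∈ 𝓥.holRel := by
  rw [inclusion_eq, holPart_cSeries]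
  refine mem_locRel.2 fun n => ?_
  rcases Nat.eq_zero_or_pos n with rfl | hn
  · simp [holSeries, (mem_lagrangians.1 hG).1]
  · exact SModEq.sub_mem.1 (holPartC_inclC hn.ne' ((mem_lagrangians.1 hG).2 n))

end FreeTheory

/-! ### Leading terms -/

section Leading

variable {R ι A : Type} [CommRing R] [Algebra ℂ R] {deg : A → ℤ} {δ : ι → R →ₗ[ℂ] R}
  {q : ℕ → A × (ι →₀ ℕ) → JetPoly R ι A} {F : JetSeries R ι A} {m : ℕ}

/-- When all brackets have arity at least two, replacing a letter lengthens the word, so degree `m`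
of the result sees only degrees of `F` below `m`. For Hamiltonian derivations this is what cubicity
of the interaction provides. -/
theorem ceDiff_apply_mem_of_lt {P : Submodule ℂ (JetPoly R ι A)}
    (hP : ∀ l, ∀ x ∈ P, der deg 1 (q l) x ∈ P) (hq0 : q 0 = 0) (hq1 : q 1 = 0)
    (hF : ∀ l < m, F l ∈ P) : ceDiff deg q F m ∈ P := by
  rw [ceDiff_apply]
  refine Submodule.sum_mem _ fun p hp => ?_
  obtain ⟨a, b⟩ := p
  rw [Finset.HasAntidiagonal.mem_antidiagonal] at hp
  match a, hp with
  | 0, _ => simp [hq0, der_zero_left]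
  | 1, _ => simp [hq1, der_zero_left]
  | a + 2, hp => exact hP _ _ (hF _ (by simp only at hp; omega))

end Leading

theorem negOnePow_smul {M : Type*} [AddCommGroup M] [Module ℂ M] (k : ℤ) (x : M) :
    k.negOnePow • x = sgn k • x := by
  rcases Int.even_or_odd k with h | h
  · rw [Int.negOnePow_even k h, sgn_eq_of_even (b := 0) (by simpa using h), sgn_zero, one_smul,
      one_smul]
  · rw [Int.negOnePow_odd k h, sgn_eq_neg_of_odd (b := 0) (by simpa using h), sgn_zero, neg_smul,
      one_smul, Units.neg_smul, one_smul]

/-! ### Interactions: constant-coefficient representatives, the complexes and the comparison maps.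
-/

namespace FreeTheory

variable {d : ℕ} {V₀ : Type*} [AddCommGroup V₀] [Module ℂ V₀] {B : Type}
  {𝓥 : FreeTheory d V₀ B} [Fintype B] [DecidableEq B] (S : 𝓥.Interaction)

theorem Interaction.mem_lagrangians : S.I ∈ lagrangians (smoothFun d) (formDeg 𝓥.deg) 0 :=
  (𝓥.mem_invariants.1 S.invariant).1

theorem Interaction.exists_const : ∃ J ∈ lagrangians ℂ (formDeg 𝓥.deg) 0,
    S.I ≡ cSeries (smoothFun d) J [SMOD 𝓥.bvRel] ∧
    (∀ n i, etaD ℂ 𝓥.deg i (J n) ∈ constSub (formDeg 𝓥.deg)) ∧ J 1 = 0 ∧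
    IsMaster 𝓥.deg 𝓥.fibrePairing⁻¹ J := by
  obtain ⟨J, hJ, hI, hη, h0⟩ := 𝓥.exists_const S.invariant
  have hJ1 := h0 1 (S.cubic 1 (by norm_num))
  exact ⟨J, hJ, hI, hη, hJ1, isMaster_of_const S.mem_lagrangians hI hJ hJ1 S.master⟩

/-! ### The holomorphic interaction -/

theorem Interaction.holPart_mem : 𝓥.holPart S.I ∈ lagrangians ℂ 𝓥.deg (d : ℤ) := by
  have := 𝓥.holPart_mem_lagrangians S.mem_lagrangians
  rwa [zero_add] at this

theorem Interaction.holPart_eq_zero {n : ℕ} (hn : n < 3) : 𝓥.holPart S.I n = 0 := by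
  rw [holPart_apply, S.cubic n hn]
  simp

theorem Interaction.holBrackets_eq_zero {m : ℕ} (hm : m < 2) :
    𝓥.holBrackets (𝓥.holPart S.I) m = 0 :=
  hamiltonian_eq_zero (S.holPart_eq_zero (by omega))

theorem Interaction.isHomogFamily_holBrackets (m : ℕ) :
    IsHomogFamily 𝓥.deg 1 m (𝓥.holBrackets (𝓥.holPart S.I) m) :=
  isHomogFamily_hamiltonian commDer_zero 𝓥.isPairing_inv_fibrePairing S.holPart_mem m

theorem Interaction.isEvolutionary_holBrackets (m : ℕ) :
    IsEvolutionary (fun _ => 0) (𝓥.holBrackets (𝓥.holPart S.I) m) :=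
  isEvolutionary_hamiltonian commDer_zero m

variable {S} in
theorem Interaction.holBracket_congr {J : JetSeries ℂ (Fin d ⊕ Fin d) (Finset (Fin d) × B)}
    (hI : S.I ≡ cSeries (smoothFun d) J [SMOD 𝓥.bvRel]) (F : HolLag d B) :
    𝓥.holBracket (𝓥.holPart S.I) F ≡ ceDiff 𝓥.deg
      (hamH 𝓥.deg 𝓥.fibrePairing⁻¹ (holSeries 𝓥.deg J)) F [SMOD symRel ℂ (Fin d) 𝓥.deg] :=
  ceDiff_congr (fun m j => hamiltonian_congr commDer_zero
    (SModEq.of_le symRel_le_locRel (𝓥.holPart_congr hI)) m j) F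

theorem Interaction.holBracket_mem_holRel {F : HolLag d B} (hF : F ∈ 𝓥.holRel) :
    𝓥.holBracket (𝓥.holPart S.I) F ∈ 𝓥.holRel :=
  ceDiff_mem_locRel commDer_zero S.isHomogFamily_holBrackets S.isEvolutionary_holBrackets hF

theorem Interaction.holBracket_mem_symRel {F : HolLag d B} (hF : F ∈ symRel ℂ (Fin d) 𝓥.deg) :
    𝓥.holBracket (𝓥.holPart S.I) F ∈ symRel ℂ (Fin d) 𝓥.deg :=
  ceDiff_mem_symRel S.isHomogFamily_holBrackets hF

theorem Interaction.holBracket_mem_lagrangians {k : ℤ} {F : HolLag d B}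
    (hF : F ∈ lagrangians ℂ 𝓥.deg k) :
    𝓥.holBracket (𝓥.holPart S.I) F ∈ lagrangians ℂ 𝓥.deg (k + 1) :=
  ceDiff_mem_lagrangians (S.holBrackets_eq_zero (by norm_num)) S.isHomogFamily_holBrackets hF

theorem Interaction.holBracket_self_mem :
    𝓥.holBracket (𝓥.holPart S.I) (𝓥.holPart S.I) ∈ 𝓥.holRel := by
  obtain ⟨J, hJ, hI, hη, hJ1, hm⟩ := S.exists_const
  have h1 : 𝓥.holBracket (𝓥.holPart S.I) (𝓥.holPart S.I) ≡
      𝓥.holBracket (𝓥.holPart S.I) (holSeries 𝓥.deg J) [SMOD symRel ℂ (Fin d) 𝓥.deg] :=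
    SModEq.map_of_le _ (fun F hF => S.holBracket_mem_symRel hF) (𝓥.holPart_congr hI)
  have h2 : 𝓥.holBracket (𝓥.holPart S.I) (𝓥.holPart S.I) ≡ _ [SMOD 𝓥.holRel] :=
    SModEq.of_le symRel_le_locRel (h1.trans (Interaction.holBracket_congr hI _))
  exact h2.mem_iff.2 (mem_locRel.2
    (holSeries_master 𝓥.isPairing_inv_fibrePairing hJ hJ1 hη hm))

/-- `{I^hol, I^hol}` is only a total derivative, but its variational derivatives then vanish, so the
operator squares to zero on `O_red` itself and not merely modulo total derivatives. -/
theorem Interaction.holBracket_sq (F : HolLag d B) :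
    𝓥.holBracket (𝓥.holPart S.I) (𝓥.holBracket (𝓥.holPart S.I) F) ∈
      symRel ℂ (Fin d) 𝓥.deg := by
  refine ceDiff_sq (S.holBrackets_eq_zero (by norm_num)) S.isHomogFamily_holBrackets
    (fun M j => ?_) F
  rw [← SModEq.zero]
  refine (sum_der_hamiltonian commDer_zero 𝓥.isPairing_inv_fibrePairing S.holPart_mem M j).trans
    (SModEq.zero.2 ?_)
  refine totalDPow_mem_koszul commDer_zero _ (Submodule.sum_mem _ fun b _ =>
    Submodule.smul_mem _ _ (euler_mem_koszul_of_locSub commDer_zero b ?_))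
  exact Submodule.smul_mem _ _ (mem_locRel.1 S.holBracket_self_mem M)

theorem Interaction.isLInfinity : IsLInfinity 𝓥.deg (𝓥.holBrackets (𝓥.holPart S.I)) where
  zero := S.holBrackets_eq_zero (by norm_num)
  homogeneous m j w := mem_homog.1 (S.isHomogFamily_holBrackets m j) w
  sq _ F _ := S.holBracket_sq F

theorem Interaction.holBracket_holD (i : Fin d) (G : HolLag d B) :
    𝓥.holBracket (𝓥.holPart S.I) (holD d B i G) = holD d B i (𝓥.holBracket (𝓥.holPart S.I) G) :=
  ceDiff_totalD commDer_zero S.isEvolutionary_holBrackets i G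

/-! ### The three complexes -/

theorem Interaction.isSubqComplex_def :
    IsSubqComplex (M := BVLag d B) 𝓥.invariants 𝓥.bvRel (𝓥.defDiff S.I) where
  map_deg k F hF := by
    obtain ⟨J, hJ, hI, hη, hJ1, hm⟩ := S.exists_const
    obtain ⟨G, hG, hFG, hGη, -⟩ := 𝓥.exists_const hF
    refine 𝓥.mem_invariants_of_const (defDiff_mem_lagrangians S.mem_lagrangians
      (S.cubic 1 (by norm_num)) (𝓥.mem_invariants.1 hF).1)
      (defDiff_congr S.mem_lagrangians hI hFG) fun n i => ?_
    rw [ceDiff_defQ, map_add]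
    refine Submodule.add_mem _ ?_ ?_
    -- By Cartan's formula `η_i ∂̄ = ∂/∂z̄_i - ∂̄ η_i`, and both terms are relations on an invariant
    -- constant-coefficient functional.
    · rw [eq_sub_of_add_eq (etaD_dbarD i (G n))]
      exact Submodule.sub_mem _ (fieldD_mem_constSub _ _)
        (dbarD_mem_locSub commDer_zero (hGη n i))
    · rw [ceDiff_apply, map_sum]
      refine Submodule.sum_mem _ fun p _ => ?_
      have h1 := koszul_le_locSub (δ := fun _ => 0) (etaD_der_hamC 𝓥.isPairing_inv_fibrePairing hJ
        (hη (p.1 + 1) i) (G p.2))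
      exact (Submodule.add_mem_iff_right _ (der_mem_locSub commDer_zero
        (isHomogFamily_hamC 𝓥.isPairing_inv_fibrePairing hJ p.1) (isEvolutionary_hamC p.1)
        (hGη p.2 i))).1 h1
  map_rel k F _ hF := defDiff_mem_bvRel S.mem_lagrangians hF
  sq k F hF := by
    obtain ⟨J, hJ, hI, hη, hJ1, hm⟩ := S.exists_const
    obtain ⟨G, hG, hFG, hGη, -⟩ := 𝓥.exists_const hF
    refine (defDiff_congr S.mem_lagrangians hI
      (defDiff_congr S.mem_lagrangians hI hFG)).mem_iff.2 (𝓥.mem_bvRel.2 fun n => ?_)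
    exact koszul_le_locSub (cMap_mem_koszul (mem_symRel.1
      (ceDiff_defQ_sq 𝓥.isPairing_inv_fibrePairing hJ hJ1 hm G) n))

theorem Interaction.isSubqComplex_hol : IsSubqComplex (M := HolLag d B) (lagrangians ℂ 𝓥.deg)
    𝓥.holRel (𝓥.holBracket (𝓥.holPart S.I)) where
  map_deg _ _ hF := S.holBracket_mem_lagrangians hF
  map_rel _ _ _ hF := S.holBracket_mem_holRel hF
  sq _ F _ := symRel_le_locRel (S.holBracket_sq F)

theorem holD_apply (i : Fin d) (F : HolLag d B) (n : ℕ) : holD d B i F n = constD i (F n) := by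
  rw [holD, LinearMap.compLeft_apply, Function.comp_apply]

theorem holD_mem_lagrangians {k : ℤ} {F : HolLag d B} (i : Fin d)
    (hF : F ∈ lagrangians ℂ 𝓥.deg k) : holD d B i F ∈ lagrangians ℂ 𝓥.deg k := by
  rw [HolBV.mem_lagrangians] at *
  exact ⟨by rw [holD_apply, hF.1, map_zero],
    fun n => by rw [holD_apply]; exact totalD_mem_homog _ (hF.2 n)⟩

theorem holD_mem_symRel {F : HolLag d B} (i : Fin d)
    (hF : F ∈ symRel ℂ (Fin d) 𝓥.deg) : holD d B i F ∈ symRel ℂ (Fin d) 𝓥.deg := by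
  rw [mem_symRel] at *
  intro n
  rw [holD_apply]
  exact totalD_mem_koszul i (hF n)

theorem holD_mem_holRel (i : Fin d) (F : HolLag d B) : holD d B i F ∈ 𝓥.holRel :=
  mem_locRel.2 fun n => by rw [holD_apply]; exact totalD_mem_locSub i (F n)

theorem koszulDiff_apply (H : HolLag d B) (G : Finset (Fin d) → HolLag d B) (T : Finset (Fin d)) :
    𝓥.koszulDiff H G T = ∑ i ∈ Tᶜ, wedgeSign {i} T • holD d B i (G (insert i T)) +
      (-1 : ℂ) ^ T.card • 𝓥.holBracket H (G T) := by
  simp [koszulDiff, LinearMap.sum_apply]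

theorem koszulDiff_apply_apply (H : HolLag d B) (G : Finset (Fin d) → HolLag d B)
    (T : Finset (Fin d)) (n : ℕ) : 𝓥.koszulDiff H G T n = koszulD d B (fun T => G T n) T +
      (-1 : ℂ) ^ T.card • 𝓥.holBracket H (G T) n := by
  rw [koszulDiff_apply, Pi.add_apply, Finset.sum_apply, koszulD_apply]
  rfl

theorem mem_koszulDeg {k : ℤ} {G : Finset (Fin d) → HolLag d B} :
    G ∈ 𝓥.koszulDeg k ↔ ∀ T, G T ∈ lagrangians ℂ 𝓥.deg (k + T.card) := by
  simp [koszulDeg, Submodule.mem_pi]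

theorem mem_koszulComplexRel {G : Finset (Fin d) → HolLag d B} :
    G ∈ 𝓥.koszulComplexRel ↔ ∀ T, G T ∈ symRel ℂ (Fin d) 𝓥.deg := by
  simp [koszulComplexRel, Submodule.mem_pi]

theorem Interaction.isSubqComplex_koszul : IsSubqComplex (M := Finset (Fin d) → HolLag d B)
    𝓥.koszulDeg 𝓥.koszulComplexRel (𝓥.koszulDiff (𝓥.holPart S.I)) where
  map_deg k G hG := by
    rw [mem_koszulDeg] at *
    intro T
    rw [koszulDiff_apply]
    refine Submodule.add_mem _ (Submodule.sum_mem _ fun i hi => Submodule.smul_mem _ _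
      (holD_mem_lagrangians i ?_)) (Submodule.smul_mem _ _ ?_)
    · have := hG (insert i T)
      rw [Finset.card_insert_of_notMem (Finset.mem_compl.1 hi)] at this
      convert this using 1
      push_cast
      ring_nf
    · have := S.holBracket_mem_lagrangians (hG T)
      convert this using 1
      ring_nf
  map_rel k G _ hG := by
    rw [mem_koszulComplexRel] at *
    intro T
    rw [koszulDiff_apply]
    exact Submodule.add_mem _ (Submodule.sum_mem _ fun i _ => Submodule.smul_mem _ _
      (holD_mem_symRel i (hG _))) (Submodule.smul_mem _ _ (S.holBracket_mem_symRel (hG T)))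
  sq k G _ := by
    rw [mem_koszulComplexRel]
    intro T
    set X := 𝓥.holBracket (𝓥.holPart S.I) with hX
    have h1 : ∑ i ∈ Tᶜ, wedgeSign {i} T • holD d B i (∑ l ∈ (insert i T)ᶜ,
        wedgeSign {l} (insert i T) • holD d B l (G (insert l (insert i T)))) = 0 := by
      funext n
      have := congrFun (koszulD_sq fun T => G T n) T
      rw [koszulD_apply] at this
      simp only [koszulD_apply] at this
      rw [Finset.sum_apply]
      refine Eq.trans (Finset.sum_congr rfl fun i _ => ?_) this
      rw [Pi.smul_apply, holD_apply, Finset.sum_apply]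
      rfl
    -- The additional generator in `insert i T` flips the sign `(-1)^|T|`; this makes the commuting
    -- operators `∂_i` and `{I^hol, -}` anticommute in the total complex.
    have h2 : ∀ i ∈ Tᶜ, wedgeSign {i} T • holD d B i ((-1 : ℂ) ^ (insert i T).card •
        X (G (insert i T))) = -((-1 : ℂ) ^ T.card • wedgeSign {i} T •
        holD d B i (X (G (insert i T)))) := fun i hi => by
      rw [Finset.card_insert_of_notMem (Finset.mem_compl.1 hi), map_smul, pow_succ]
      module
    have h3 : 𝓥.koszulDiff (𝓥.holPart S.I) (𝓥.koszulDiff (𝓥.holPart S.I) G) T = X (X (G T)) := by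
      rw [koszulDiff_apply]
      simp only [koszulDiff_apply, map_add, smul_add, Finset.sum_add_distrib]
      rw [h1, zero_add, Finset.sum_congr rfl h2, map_sum, map_smul, smul_smul, ← pow_add,
        Even.neg_one_pow ⟨_, rfl⟩, one_smul]
      simp only [map_smul, hX, S.holBracket_holD]
      rw [Finset.sum_neg_distrib, Finset.smul_sum, neg_add_cancel_left]
    rw [h3]
    exact S.holBracket_sq _

/-! ### The comparison maps -/

/-- The sign `(-1)^d` picked up in passing `d` contractions is exactly the sign of the differential
on the `d`-fold shift, so no correction of the map is needed. -/
theorem Interaction.isSubqMap_holPart : IsSubqMap (M := BVLag d B) (M' := HolLag d B)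
    𝓥.invariants 𝓥.bvRel (𝓥.defDiff S.I)
    (lagrangians ℂ 𝓥.deg) 𝓥.holRel (𝓥.holBracket (𝓥.holPart S.I)) (d : ℤ) 𝓥.holPart where
  map_deg k F hF := 𝓥.holPart_mem_lagrangians (𝓥.mem_invariants.1 hF).1
  map_rel k F _ hF := symRel_le_locRel (𝓥.holPart_mem_symRel hF)
  comm k F hF := by
    obtain ⟨J, hJ, hI, hη, hJ1, hm⟩ := S.exists_const
    obtain ⟨G, hG, hFG, hGη, -⟩ := 𝓥.exists_const hF
    have h1 : 𝓥.holPart (𝓥.defDiff S.I F) ≡ holSeries 𝓥.deg _ [SMOD 𝓥.holRel] :=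
      SModEq.of_le symRel_le_locRel (𝓥.holPart_congr (defDiff_congr S.mem_lagrangians hI hFG))
    have h2 : holSeries 𝓥.deg (ceDiff (formDeg 𝓥.deg) (defQ 𝓥.deg 𝓥.fibrePairing⁻¹ J) G) ≡
        sgn d • ceDiff 𝓥.deg (hamH 𝓥.deg 𝓥.fibrePairing⁻¹ (holSeries 𝓥.deg J))
          (holSeries 𝓥.deg G) [SMOD 𝓥.holRel] :=
      smodEq_locRel.2 (holSeries_ceDiff_defQ 𝓥.isPairing_inv_fibrePairing hJ hJ1 hη hG hGη)
    have h3 : 𝓥.holBracket (𝓥.holPart S.I) (𝓥.holPart F) ≡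
        𝓥.holBracket (𝓥.holPart S.I) (holSeries 𝓥.deg G) [SMOD symRel ℂ (Fin d) 𝓥.deg] :=
      SModEq.map_of_le _ (fun F hF => S.holBracket_mem_symRel hF) (𝓥.holPart_congr hFG)
    have h4 : 𝓥.holBracket (𝓥.holPart S.I) (𝓥.holPart F) ≡ _ [SMOD 𝓥.holRel] :=
      SModEq.of_le symRel_le_locRel (h3.trans (Interaction.holBracket_congr hI _))
    rw [negOnePow_smul]
    exact SModEq.sub_mem.1 (h1.trans (h2.trans (h4.smul (sgn d)).symm))

theorem Interaction.isSubqMap_augmentation :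
    IsSubqMap (M := Finset (Fin d) → HolLag d B) (M' := HolLag d B)
      𝓥.koszulDeg 𝓥.koszulComplexRel (𝓥.koszulDiff (𝓥.holPart S.I))
      (lagrangians ℂ 𝓥.deg) 𝓥.holRel (𝓥.holBracket (𝓥.holPart S.I)) 0 (augmentation d B) where
  map_deg k G hG := by
    have := mem_koszulDeg.1 hG ∅
    rwa [Finset.card_empty] at this
  map_rel k G _ hG := symRel_le_locRel (mem_koszulComplexRel.1 hG ∅)
  comm k G _ := by
    change 𝓥.koszulDiff (𝓥.holPart S.I) G ∅ - (0 : ℤ).negOnePow • _ ∈ _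
    rw [koszulDiff_apply, Int.negOnePow_zero, one_smul, Finset.card_empty, pow_zero, one_smul]
    change _ + 𝓥.holBracket (𝓥.holPart S.I) (G ∅) - 𝓥.holBracket (𝓥.holPart S.I) (G ∅) ∈ _
    rw [add_sub_cancel_right]
    exact Submodule.sum_mem _ fun i _ => Submodule.smul_mem _ _ (holD_mem_holRel i _)

end FreeTheory

/-! ### Leading terms in a fixed polynomial degree and the two quasi-isomorphisms. -/

namespace FreeTheory

variable {d : ℕ} {V₀ : Type*} [AddCommGroup V₀] [Module ℂ V₀] {B : Type}
  {𝓥 : FreeTheory d V₀ B} [Fintype B] [DecidableEq B] (S : 𝓥.Interaction)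

/-- The part of polynomial degree `m` of the Lagrangians of degree `k`. -/
def homogPart {R ι A : Type} [CommRing R] [Algebra ℂ R] (deg : A → ℤ) (m : ℕ) (k : ℤ) :
    Submodule ℂ (JetPoly R ι A) := if m = 0 then ⊥ else homog R deg m (-k)

theorem mem_homogPart_of_ne {R ι A : Type} [CommRing R] [Algebra ℂ R] {deg : A → ℤ} {m : ℕ}
    (hm : m ≠ 0) {k : ℤ} {x : JetPoly R ι A} :
    x ∈ homogPart deg m k ↔ x ∈ homog R deg m (-k) := by
  rw [homogPart, if_neg hm]

theorem eq_zero_of_mem_homogPart {R ι A : Type} [CommRing R] [Algebra ℂ R] {deg : A → ℤ}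
    {k : ℤ} {x : JetPoly R ι A} (hx : x ∈ homogPart deg 0 k) : x = 0 := by
  rwa [homogPart, if_pos rfl, Submodule.mem_bot] at hx

theorem mem_lagrangians_iff {R ι A : Type} [CommRing R] [Algebra ℂ R] {deg : A → ℤ} {k : ℤ}
    {F : JetSeries R ι A} : F ∈ lagrangians R deg k ↔ ∀ m, F m ∈ homogPart deg m k := by
  rw [mem_lagrangians]
  constructor
  · rintro ⟨h0, h⟩ m
    by_cases hm : m = 0
    · subst hm; rw [h0]; exact zero_mem _
    · exact (mem_homogPart_of_ne hm).2 (h m)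
  · intro h
    have h0 := eq_zero_of_mem_homogPart (h 0)
    refine ⟨h0, fun m => ?_⟩
    by_cases hm : m = 0
    · subst hm; rw [h0]; exact zero_mem _
    · exact (mem_homogPart_of_ne hm).1 (h m)

variable (𝓥) in
/-- The part of polynomial degree `m` of the invariants. -/
def invariantPart (m : ℕ) (k : ℤ) : Submodule ℂ (FieldPoly (smoothFun d) d B) :=
  homogPart (formDeg 𝓥.deg) m k ⊓
    ((⨅ i, (locSub (coefD d) (formDeg 𝓥.deg)).comap (fieldD (smoothFun d) i)) ⊓
      ⨅ i, (locSub (coefD d) (formDeg 𝓥.deg)).comap (etaD (smoothFun d) 𝓥.deg i))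

theorem mem_invariantPart {m : ℕ} {k : ℤ} {x : FieldPoly (smoothFun d) d B} :
    x ∈ 𝓥.invariantPart m k ↔ x ∈ homogPart (formDeg 𝓥.deg) m k ∧
      (∀ i, fieldD (smoothFun d) i x ∈ locSub (coefD d) (formDeg 𝓥.deg)) ∧
      ∀ i, etaD (smoothFun d) 𝓥.deg i x ∈ locSub (coefD d) (formDeg 𝓥.deg) := by
  simp only [invariantPart, Submodule.mem_inf, Submodule.mem_iInf, Submodule.mem_comap]

theorem mem_invariants_iff {k : ℤ} {F : BVLag d B} :
    F ∈ 𝓥.invariants k ↔ ∀ m, F m ∈ 𝓥.invariantPart m k := by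
  simp only [mem_invariants, mem_invariantPart, forall_and]
  rw [mem_lagrangians_iff]

variable (𝓥) in
/-- The holomorphic part in polynomial degree `m`. -/
def holPartAt (m : ℕ) : FieldPoly (smoothFun d) d B →ₗ[ℂ] JetPoly ℂ (Fin d) B :=
  LinearMap.proj m ∘ₗ 𝓥.holPart ∘ₗ LinearMap.pi fun _ => LinearMap.id

theorem holPart_apply_eq (F : BVLag d B) (m : ℕ) : 𝓥.holPart F m = 𝓥.holPartAt m (F m) := by
  change _ = 𝓥.holPart (fun _ => F m) m
  rw [holPart_apply, holPart_apply]

theorem holPartAt_cMap (m : ℕ) (x : FieldPoly ℂ d B) :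
    𝓥.holPartAt m (cMap (smoothFun d) x) = holPartC 𝓥.deg m x :=
  congrFun (𝓥.holPart_cSeries fun _ => x) m

theorem holPartAt_mem {m : ℕ} {x : FieldPoly (smoothFun d) d B}
    (hx : x ∈ locSub (coefD d) (formDeg 𝓥.deg)) : 𝓥.holPartAt m x ∈ constSub 𝓥.deg :=
  koszul_le_locSub (mem_symRel.1 (𝓥.holPart_mem_symRel (F := fun _ => x)
    (𝓥.mem_bvRel.2 fun _ => hx)) m)

/-- The holomorphic part is a quasi-isomorphism in each polynomial degree. -/
theorem exists_invariantPart_primitive {m : ℕ} {k : ℤ} {a : FieldPoly (smoothFun d) d B}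
    (ha : a ∈ 𝓥.invariantPart m (k + 1)) {b : JetPoly ℂ (Fin d) B}
    (hb : b ∈ homogPart 𝓥.deg m (k + d))
    (hd : dbarD (smoothFun d) 𝓥.deg a ∈ locSub (coefD d) (formDeg 𝓥.deg))
    (hp : 𝓥.holPartAt m a ∈ constSub 𝓥.deg) : ∃ c ∈ 𝓥.invariantPart m k,
      a - dbarD (smoothFun d) 𝓥.deg c ∈ locSub (coefD d) (formDeg 𝓥.deg) ∧
      b - 𝓥.holPartAt m c ∈ constSub 𝓥.deg := by
  obtain ⟨h1, h2, h3⟩ := mem_invariantPart.1 ha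
  by_cases hm : m = 0
  · subst hm
    refine ⟨0, zero_mem _, ?_, ?_⟩
    · rw [eq_zero_of_mem_homogPart h1, map_zero]
      have h0 : (0 : FieldPoly (smoothFun d) d B) - 0 = 0 :=
        Finsupp.ext fun _ => sub_zero (G := smoothFun d) _
      rw [h0]
      exact zero_mem _
    · rw [eq_zero_of_mem_homogPart hb, map_zero, sub_zero]; exact zero_mem _
  rw [mem_homogPart_of_ne hm] at h1 hb
  -- In positive degree a constant-coefficient representative inherits every hypothesis over `ℂ`
  -- through `cMap_mem_iff`, and the primitive found there is mapped back.
  obtain ⟨x, hx, hax⟩ := exists_cMap_of_fieldD (commDer_coefD d) (φ := evalZero d)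
    eq_const_of_coefD hm h1 h2
  have hx' : x ∈ homog ℂ (formDeg 𝓥.deg) m (-k - 1) := by convert hx using 1; ring_nf
  have hη : ∀ i, etaD ℂ 𝓥.deg i x ∈ constSub (formDeg 𝓥.deg) := fun i => by
    rw [← 𝓥.cMap_mem_iff hm (etaD_mem_homog i hx), cMap_etaD]
    have : etaD (smoothFun d) 𝓥.deg i a ≡ etaD (smoothFun d) 𝓥.deg i (cMap (smoothFun d) x)
        [SMOD locSub (coefD d) (formDeg 𝓥.deg)] :=
      SModEq.map_of_le _ (fun _ => etaD_mem_locSub (commDer_coefD d) i) hax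
    exact this.mem_iff.1 (h3 i)
  have hdx : dbarD ℂ 𝓥.deg x ∈ constSub (formDeg 𝓥.deg) := by
    rw [← 𝓥.cMap_mem_iff hm (dbarD_mem_homog hx), cMap_dbarD]
    have : dbarD (smoothFun d) 𝓥.deg a ≡ dbarD (smoothFun d) 𝓥.deg (cMap (smoothFun d) x)
        [SMOD locSub (coefD d) (formDeg 𝓥.deg)] :=
      SModEq.map_of_le _ (fun _ => dbarD_mem_locSub (commDer_coefD d)) hax
    exact this.mem_iff.1 hd
  have hpx : holPartC 𝓥.deg m x ∈ constSub 𝓥.deg := by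
    rw [← holPartAt_cMap]
    have : 𝓥.holPartAt m a ≡ 𝓥.holPartAt m (cMap (smoothFun d) x) [SMOD constSub 𝓥.deg] :=
      SModEq.map_of_le _ (fun u hu => holPartAt_mem (𝓥 := 𝓥) (m := m) (x := u) hu) hax
    exact this.mem_iff.1 hp
  have hb' : b ∈ homog ℂ 𝓥.deg m (-k - d) := by convert hb using 1; ring_nf
  obtain ⟨c, hc, hcη, hc1, hc2⟩ := exists_dolbeault_primitive hm hx' hη hdx hpx hb'
  refine ⟨cMap (smoothFun d) c, mem_invariantPart.2 ⟨?_, fun i => ?_, fun i => ?_⟩, ?_, ?_⟩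
  · exact (mem_homogPart_of_ne hm).2 (cMap_mem_homog hc)
  · rw [← cMap_fieldD]
    exact cMap_mem_locSub (commDer_coefD d) (fieldD_mem_constSub _ _)
  · rw [← cMap_etaD, hcη, map_zero]; exact zero_mem _
  · have h4 := cMap_mem_locSub (commDer_coefD d) hc1
    rw [map_sub, cMap_dbarD] at h4
    exact SModEq.sub_mem.1 (hax.trans (SModEq.sub_mem.2 h4))
  · rwa [holPartAt_cMap]

/-- The Koszul resolution computes the underived tensor product in each polynomial degree. -/
theorem exists_koszul_primitive {degB : B → ℤ} {m : ℕ} {k : ℤ}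
    {a : Finset (Fin d) → JetPoly ℂ (Fin d) B}
    (ha : ∀ T, a T ∈ homogPart degB m (k + 1 + T.card)) {b : JetPoly ℂ (Fin d) B}
    (hb : b ∈ homogPart degB m k) (hd : ∀ T, koszulD d B a T ∈ koszulRel ℂ degB)
    (hp : a ∅ ∈ constSub degB) : ∃ c : Finset (Fin d) → JetPoly ℂ (Fin d) B,
      (∀ T, c T ∈ homogPart degB m (k + T.card)) ∧
      (∀ T, (a - koszulD d B c) T ∈ koszulRel ℂ degB) ∧ b - c ∅ ∈ constSub degB := by
  classical
  by_cases hm : m = 0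
  · subst hm
    have h0 : a = 0 := funext fun T => eq_zero_of_mem_homogPart (ha T)
    refine ⟨0, fun T => zero_mem _, fun T => ?_, ?_⟩
    · rw [h0, map_zero, sub_zero]; exact zero_mem _
    · rw [eq_zero_of_mem_homogPart hb]
      simp
  simp only [mem_homogPart_of_ne hm] at *
  obtain ⟨H, hH, hH'⟩ := koszulD_exact hm (k := -k - 1) a
    (fun T => by convert ha T using 1; ring_nf) hd hp
  -- The Koszul differential never uses the component at `∅`, so it can be set to `b` without
  -- changing the boundary.
  refine ⟨Function.update H ∅ b, fun T => ?_, fun T => ?_, ?_⟩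
  · by_cases hT : T = ∅
    · subst hT
      rw [Function.update_self, Finset.card_empty, Nat.cast_zero, add_zero]
      exact hb
    · rw [Function.update_of_ne hT]
      convert hH T using 1
      ring_nf
  · have : koszulD d B (Function.update H ∅ b) T = koszulD d B H T := by
      rw [koszulD_apply, koszulD_apply]
      refine Finset.sum_congr rfl fun i _ => ?_
      rw [Function.update_of_ne (Finset.insert_ne_empty i T)]
    rw [Pi.sub_apply, this]
    exact hH' T
  · rw [Function.update_self, sub_self]
    exact zero_mem _

/-- In leading order the source carries `∂̄` and the target the zero differential, because `I` is at
least cubic; that case is `exists_invariantPart_primitive`. -/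
theorem Interaction.quasiIso_holPart :
    QuasiIso (subqHom S.isSubqComplex_def S.isSubqComplex_hol S.isSubqMap_holPart) := by
  refine quasiIso_subqHom _ _ _ fun k x hx y hy hDx hxy => ?_
  refine exists_of_leading (LinearEquiv.refl ℂ (BVLag d B)) (LinearEquiv.refl ℂ (HolLag d B))
    (Cc := 𝓥.invariantPart) (Nc := fun _ => locSub (coefD d) (formDeg 𝓥.deg))
    (Cc' := homogPart 𝓥.deg) (Nc' := fun _ => constSub 𝓥.deg)
    (fun k x => mem_invariants_iff (𝓥 := 𝓥) (k := k) (F := x))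
    (fun x => mem_bvRel 𝓥 (F := x)) (fun k x => mem_lagrangians_iff)
    (fun x => mem_locRel) (fun _ => dbarD (smoothFun d) 𝓥.deg) 𝓥.holPartAt ?_ ?_
    (fun x m => holPart_apply_eq (𝓥 := 𝓥) x m) S.isSubqComplex_def S.isSubqMap_holPart
    (fun m k a ha b hb => exists_invariantPart_primitive (𝓥 := 𝓥) (m := m) (k := k) (a := a) ha hb) k x hx y hy hDx hxy
  · intro k m F _ hF
    have e : 𝓥.defDiff S.I F m - dbarD (smoothFun d) 𝓥.deg (F m) = 𝓥.bvBracket S.I F m := by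
      change 𝓥.dbar F m + 𝓥.bvBracket S.I F m - _ = _
      rw [dbar_apply]
      exact Finsupp.ext fun _ => add_sub_cancel_left (G := smoothFun d) _ _
    change 𝓥.defDiff S.I F m - dbarD (smoothFun d) 𝓥.deg (F m) ∈ _
    rw [e, bvBracket_eq]
    exact ceDiff_apply_mem_of_lt (fun l x => der_mem_locSub (commDer_coefD d)
      (isHomogFamily_hamiltonian (commDer_coefD d)
        (isPairing_formPairing 𝓥.isPairing_inv_fibrePairing) S.mem_lagrangians l)
      (isEvolutionary_hamiltonian (commDer_coefD d) l))
      (hamiltonian_eq_zero (S.cubic 1 (by norm_num)))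
      (hamiltonian_eq_zero (S.cubic 2 (by norm_num))) hF
  · intro k m F _ hF
    exact ceDiff_apply_mem_of_lt (fun l x => der_mem_locSub commDer_zero
      (S.isHomogFamily_holBrackets l) (S.isEvolutionary_holBrackets l))
      (S.holBrackets_eq_zero (by norm_num)) (S.holBrackets_eq_zero (by norm_num)) hF

/-- Families of series are series of families. -/
def seriesEquiv (d : ℕ) (B : Type) :
    (Finset (Fin d) → HolLag d B) ≃ₗ[ℂ] (ℕ → Finset (Fin d) → JetPoly ℂ (Fin d) B) where
  toFun G n T := G T n
  invFun G T n := G n T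
  map_add' _ _ := rfl
  map_smul' _ _ := rfl
  left_inv _ := rfl
  right_inv _ := rfl

/-- In leading order only the Koszul differential remains, and `exists_koszul_primitive` applies.
`seriesEquiv` views a family of series as a series of families, so that the degree filtration is
visible. -/
theorem Interaction.quasiIso_augmentation : QuasiIso (subqHomZero S.isSubqComplex_koszul
    S.isSubqComplex_hol S.isSubqMap_augmentation) := by
  refine quasiIso_subqHomZero _ _ _ fun k x hx y hy hDx hxy => ?_
  refine exists_of_leading (seriesEquiv d B) (LinearEquiv.refl ℂ (HolLag d B))
    (Cc := fun m k => Submodule.pi Set.univ fun T => homogPart 𝓥.deg m (k + T.card))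
    (Nc := fun _ => Submodule.pi Set.univ fun _ => koszulRel ℂ 𝓥.deg)
    (Cc' := homogPart 𝓥.deg) (Nc' := fun _ => constSub 𝓥.deg)
    (fun k x => ?_) (fun x => ?_) (fun k x => mem_lagrangians_iff)
    (fun x => mem_locRel) (fun _ => koszulD d B) (fun _ => LinearMap.proj ∅) ?_ ?_
    (fun x m => rfl) S.isSubqComplex_koszul S.isSubqMap_augmentation
    ?_ k x hx y hy hDx hxy
  · rw [mem_koszulDeg]
    simp only [mem_lagrangians_iff, Submodule.mem_pi, Set.mem_univ, true_implies]
    exact forall_comm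
  · rw [mem_koszulComplexRel]
    simp only [mem_symRel, Submodule.mem_pi, Set.mem_univ, true_implies]
    exact forall_comm
  · intro k m G _ hG
    simp only [Submodule.mem_pi, Set.mem_univ, true_implies] at hG ⊢
    intro T
    change 𝓥.koszulDiff (𝓥.holPart S.I) G T m - koszulD d B (fun T => G T m) T ∈ _
    rw [koszulDiff_apply_apply, add_sub_cancel_left]
    exact Submodule.smul_mem _ _ (ceDiff_apply_mem_of_lt (fun l x => der_mem_koszul
      (S.isHomogFamily_holBrackets l)) (S.holBrackets_eq_zero (by norm_num))
      (S.holBrackets_eq_zero (by norm_num)) fun l hl => hG l hl T)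
  · intro k m F _ hF
    exact ceDiff_apply_mem_of_lt (fun l x => der_mem_locSub commDer_zero
      (S.isHomogFamily_holBrackets l) (S.isEvolutionary_holBrackets l))
      (S.holBrackets_eq_zero (by norm_num)) (S.holBrackets_eq_zero (by norm_num)) hF
  · intro m k a ha b hb hda hpa
    simp only [Submodule.mem_pi, Set.mem_univ, true_implies] at ha hda ⊢
    rw [add_zero] at hb
    exact exists_koszul_primitive ha hb hda hpa

end FreeTheory

end HolBV

end

theorem mainTheorem4 {d : ℕ} {V₀ : Type*} [AddCommGroup V₀] [Module ℂ V₀] {B : Type} [Fintype B]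
    [DecidableEq B] (𝓥 : HolBV.FreeTheory d V₀ B) (S : 𝓥.Interaction) :
    -- `I^hol`, the holomorphic part of `I`, is a holomorphic interaction
    (𝓥.holPart S.I ∈ HolBV.lagrangians ℂ 𝓥.deg (d : ℤ) ∧
      (∀ n < 3, 𝓥.holPart S.I n = 0) ∧
      𝓥.holBracket (𝓥.holPart S.I) (𝓥.holPart S.I) ∈ 𝓥.holRel) ∧
    -- it makes `V₀[[z]][-1]` an `L_∞`-algebra over `ℂ[∂]`, with `C_red^* = (O_red, {I^hol, -})`
    (HolBV.IsLInfinity 𝓥.deg (𝓥.holBrackets (𝓥.holPart S.I)) ∧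
      ∀ i G, 𝓥.holBracket (𝓥.holPart S.I) (HolBV.FreeTheory.holD d B i G) =
        HolBV.FreeTheory.holD d B i (𝓥.holBracket (𝓥.holPart S.I) G)) ∧
    -- the holomorphic part is a left inverse of `G ↦ ∫ d^d z G^{Ω^{0,*}}`
    (∀ (k : ℤ), ∀ G ∈ HolBV.lagrangians ℂ 𝓥.deg k,
      𝓥.inclusion G ∈ 𝓥.invariants (k - d) ∧ 𝓥.holPart (𝓥.inclusion G) - G ∈ 𝓥.holRel) ∧
    -- quasi-isomorphisms
    -- `(Def)^{ℂ^{2d|d}} → (ℂ d^d z ⊗ O_red(V₀[[z]]))[d] ← (ℂ d^d z ⊗^L O_red(V₀[[z]]))[d]`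
    ∃ (hDef : HolBV.IsSubqComplex (M := HolBV.BVLag d B) 𝓥.invariants 𝓥.bvRel (𝓥.defDiff S.I))
      (hHol : HolBV.IsSubqComplex (M := HolBV.HolLag d B) (HolBV.lagrangians ℂ 𝓥.deg) 𝓥.holRel
        (𝓥.holBracket (𝓥.holPart S.I)))
      (hKos : HolBV.IsSubqComplex (M := Finset (Fin d) → HolBV.HolLag d B) 𝓥.koszulDeg 𝓥.koszulComplexRel
        (𝓥.koszulDiff (𝓥.holPart S.I)))
      (hρ : HolBV.IsSubqMap (M := HolBV.BVLag d B) (M' := HolBV.HolLag d B)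
        𝓥.invariants 𝓥.bvRel (𝓥.defDiff S.I)
        (HolBV.lagrangians ℂ 𝓥.deg) 𝓥.holRel (𝓥.holBracket (𝓥.holPart S.I)) (d : ℤ) 𝓥.holPart)
      (hε : HolBV.IsSubqMap (M := Finset (Fin d) → HolBV.HolLag d B) (M' := HolBV.HolLag d B)
        𝓥.koszulDeg 𝓥.koszulComplexRel (𝓥.koszulDiff (𝓥.holPart S.I))
        (HolBV.lagrangians ℂ 𝓥.deg) 𝓥.holRel (𝓥.holBracket (𝓥.holPart S.I)) 0
        (HolBV.FreeTheory.augmentation d B)),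
      QuasiIso (HolBV.subqHom hDef hHol hρ) ∧
      QuasiIso ((HolBV.subqHomZero hKos hHol hε)⟦(d : ℤ)⟧') := by
  refine ⟨⟨S.holPart_mem, fun n hn => S.holPart_eq_zero hn, S.holBracket_self_mem⟩,
    ⟨S.isLInfinity, S.holBracket_holD⟩,
    fun k G hG => ⟨𝓥.inclusion_mem_invariants hG, 𝓥.holPart_inclusion hG⟩,
    S.isSubqComplex_def, S.isSubqComplex_hol, S.isSubqComplex_koszul, S.isSubqMap_holPart,
    S.isSubqMap_augmentation, S.quasiIso_holPart, ?_⟩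
  have := S.quasiIso_augmentation
  infer_instance
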